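/- Let $\Sigma$ be a second countable locally compact Hausdorff groupoid with unit space $X$, and let $\mathcal A\subset\Sigma$ be a closed normal abelian wide subgroup bundle (a closed bundle of abelian subgroups $A(u)$ of the isotropy groups, $u\in X$, containing all units, with $\sigma A(s(\sigma))\sigma^{-1}=A(r(\sigma))$ for $\sigma\in\Sigma$) which has a Haar system $\beta=\{\beta^u\}$. Let $\mathcal G=\Sigma/\mathcal A$, write $\dot\sigma$ for the class of $\sigma$, and let $\alpha=\{\alpha^u\}$ be a Haar system on $\mathcal G$, with $\alpha_u$ the image of $\alpha^u$ under inversion. Let $\hat{\mathcal A}$ be the set of pairs $(u,\chi)$ with $u\in X$ and $\chi\in\hat A(u)=A(u)^\wedge$, written $\chi$ with $\hat p(\chi)=u$, with the Gelfand topology, i.e. the coarsest one making $\chi\mapsto\int f(a)\overline{\chi(a)}\,d\beta^{\hat p(\chi)}(a)$ continuous for every $f\in C_c(\mathcal A)$. Then $\Sigma$ and $\mathcal G$ act on the right of $\hat{\mathcal A}$ by $(\chi\cdot\sigma)(a)=\chi(\sigma a\sigma^{-1})$; equip the transformation groupoid $\hat{\mathcal A}\rtimes\mathcal G$ with the Haar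 system $\delta_\chi\times\alpha^{\hat p(\chi)}$. Let $\hat\Sigma$ be the quotient of the groupoid $\mathcal D=(\hat{\mathcal A}\rtimes\Sigma)\times\mathbf T$ of triples $(\chi,z,\sigma)$, $\hat p(\chi)=r(\sigma)$, by the normal subgroup bundle of all $(\chi,\overline{\chi(a)},a)$, $a\in A(\hat p(\chi))$; it is a $\mathbf T$-groupoid over $\hat{\mathcal A}\rtimes\mathcal G$, and $[\chi,z,a\sigma]=[\chi,\chi(a)z,\sigma]$. Let $C_c(\hat{\mathcal A}\rtimes\mathcal G;\hat\Sigma)$ be the space of $f\in C_c(\hat\Sigma)$ with $f(z\cdot e)=zf(e)$ for $z\in\mathbf T$, $e\in\hat\Sigma$, and write $f(\chi,\sigma)=f([\chi,1,\sigma])$; its operations are $$f*g(\chi,\sigma)=\int_{\mathcal G}f(\chi,\tau)\,g(\chi\cdot\tau,\tau^{-1}\sigma)\,d\alpha^{r(\sigma)}(\dot\tau),\qquad f^*(\chi,\sigma)=\overline{f(\chi\cdot\sigma,\sigma^{-1})}.$$ Let $\hat{\mathcal E}=\coprod_{u}C_0(\hat A(u))$ be the $C^*$-bundle over $X$ whose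 $C_0$-sections are $u\mapsto h|_{\hat A(u)}$, $h\in C_0(\hat{\mathcal A})$; let $\hat\vartheta_\sigma(h)(\chi)=h(\chi\cdot\sigma)$ for $h\in C_0(\hat A(s(\sigma)))$, and $\hat\kappa(a)h(\chi)=\overline{\chi(a)}h(\chi)$. Let $C_c(\mathcal G,\Sigma,\hat{\mathcal E},\hat\kappa)$ be the space of continuous $F:\Sigma\to\hat{\mathcal E}$ with $F(\sigma)\in C_0(\hat A(r(\sigma)))$ and $F(a\sigma)=F(\sigma)\hat\kappa(a)^*$ (that is, $F(a\sigma)(\chi)=\chi(a)F(\sigma)(\chi)$), whose support has compact image in $\mathcal G$ (the compactly supported sections of the Fell bundle of the twisted system), with $$F*G(\sigma)=\int_{\mathcal G}F(\tau)\,\hat\vartheta_\tau\bigl(G(\tau^{-1}\sigma)\bigr)\,d\alpha^{r(\sigma)}(\dot\tau),\qquad F^*(\sigma)=\hat\vartheta_\sigma\bigl(F(\sigma^{-1})^*\bigr).$$ In both cases the full $C^*$-algebra is the completion universal for $I$-norm decreasing $*$-representations on Hilbert spaces, where $\|F\|_I$ is the larger of the suprema over the units of the integrals of the fibrewise norm of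 $F$ against $\alpha^u$ and against $\alpha_u$ in the second case, and in the first case the same expression for $|f|$ on $\hat{\mathcal A}\rtimes\mathcal G$. The reduced $C^*$-algebra is the completion in the norm of the left convolution operators on the Hilbert module obtained by completing the sections in the inner product $\langle f,g\rangle=(f^**g)|_{\text{units}}$. Then both spaces are closed under the linear operations, convolution and involution, with finite $I$-norm and reduced norm. The formula $$F_f(\sigma)(\chi)=f(\chi,\sigma)$$ defines an injective $*$-homomorphism $f\mapsto F_f$ (a $*$-isomorphism onto its range) of $C_c(\hat{\mathcal A}\rtimes\mathcal G;\hat\Sigma)$ into $C_c(\mathcal G,\Sigma,\hat{\mathcal E},\hat\kappa)$, whose range is dense in the $I$-norm and which is isometric for the reduced norms, and it extends to isomorphisms of $C^*$-algebras $$C^*(\hat{\mathcal A}\rtimes\mathcal G;\hat\Sigma)\cong C^*(\mathcal G,\Sigma,\hat{\mathcal E},\hat\vartheta,\hat\kappa)\quad\text{and}\quad C^*_r(\hat{\mathcal A}\rtimes\mathcal G;\hat\Sigma)\cong C^*_r(\mathcal G,\Sigma,\hat{\mathcal E},\hat\vartheta,\hat\kappa).$$ -/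

import Mathlib

open MeasureTheory Topology
open scoped ENNReal ZeroAtInfty CompactlySupported

universe u

noncomputable section

/-! ### Groupoids, wide normal subgroup bundles, quotients -/

/-- A groupoid with arrow space `S` and unit space `X`. The product `mul a b` is meaningful only
when `s a = r b`; every axiom is restricted to composable arrows. -/
structure GroupoidStr (S X : Type u) where
  r : S → X
  s : S → X
  one : X → S
  mul : S → S → S
  inv : S → S
  r_one : ∀ x, r (one x) = x
  s_one : ∀ x, s (one x) = x
  r_mul : ∀ a b, s a = r b → r (mul a b) = r a
  s_mul : ∀ a b, s a = r b → s (mul a b) = s b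
  assoc : ∀ a b c, s a = r b → s b = r c → mul (mul a b) c = mul a (mul b c)
  one_mul : ∀ a, mul (one (r a)) a = a
  mul_one : ∀ a, mul a (one (s a)) = a
  r_inv : ∀ a, r (inv a) = s a
  s_inv : ∀ a, s (inv a) = r a
  inv_mul : ∀ a, mul (inv a) a = one (s a)
  mul_inv : ∀ a, mul a (inv a) = one (r a)

namespace GroupoidStr

variable {S X : Type u} (G : GroupoidStr S X)

theorem inv_mul_cancel_left (a b : S) (h : G.s a = G.r b) :
    G.mul (G.inv a) (G.mul a b) = b := by
  rw [← G.assoc _ _ _ (G.s_inv a) h, G.inv_mul, h, G.one_mul]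

theorem mul_inv_cancel_left (a b : S) (h : G.r a = G.r b) :
    G.mul a (G.mul (G.inv a) b) = b := by
  rw [← G.assoc _ _ _ (G.r_inv a).symm ((G.s_inv a).trans h), G.mul_inv, h, G.one_mul]

theorem mul_inv_cancel_right (a b : S) (h : G.s a = G.r b) :
    G.mul (G.mul a b) (G.inv b) = a := by
  rw [G.assoc _ _ _ h (G.r_inv b).symm, G.mul_inv, ← h, G.mul_one]

theorem inv_mul_cancel_right (a b : S) (h : G.s a = G.s b) :
    G.mul (G.mul a (G.inv b)) b = a := by
  rw [G.assoc _ _ _ (h.trans (G.r_inv b).symm) (G.s_inv b), G.inv_mul, ← h, G.mul_one]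

theorem eq_inv_of_mul (a b : S) (h : G.s a = G.r b) (hab : G.mul a b = G.one (G.r a)) :
    b = G.inv a := by
  have := G.inv_mul_cancel_left a b h
  rw [hab, ← G.s_inv a, G.mul_one] at this
  exact this.symm

theorem inv_inv (a : S) : G.inv (G.inv a) = a := by
  refine (G.eq_inv_of_mul (G.inv a) a (G.s_inv a) ?_).symm
  rw [G.inv_mul, G.r_inv]

theorem inv_one (x : X) : G.inv (G.one x) = G.one x := by
  refine (G.eq_inv_of_mul _ _ (by rw [G.s_one, G.r_one]) ?_).symm
  have := G.one_mul (G.one x)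
  rwa [G.r_one] at this ⊢

theorem mul_inv_rev (a b : S) (h : G.s a = G.r b) :
    G.inv (G.mul a b) = G.mul (G.inv b) (G.inv a) := by
  have h' : G.s (G.inv b) = G.r (G.inv a) := by rw [G.s_inv, G.r_inv, h]
  refine (G.eq_inv_of_mul _ _ ?_ ?_).symm
  · rw [G.s_mul _ _ h, G.r_mul _ _ h', G.r_inv]
  · rw [← G.assoc _ _ _ ((G.s_mul _ _ h).trans (G.r_inv b).symm) h',
      G.mul_inv_cancel_right _ _ h, G.mul_inv, G.r_mul _ _ h]

/-- Continuity of the structure maps. -/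
structure IsTopological [TopologicalSpace S] [TopologicalSpace X] : Prop where
  continuous_r : Continuous G.r
  continuous_s : Continuous G.s
  continuous_one : Continuous G.one
  continuous_inv : Continuous G.inv
  continuousOn_mul : ContinuousOn (fun p : S × S => G.mul p.1 p.2) {p | G.s p.1 = G.r p.2}

/-- A (left) Haar system on a groupoid whose arrow space is (as in all uses here) locally compact,
Hausdorff and second countable; there Borel measures that are finite on compact sets are Radon. -/
structure HaarSystem [TopologicalSpace S] [MeasurableSpace S] [TopologicalSpace X] where
  meas : X → Measure S
  finite_compact : ∀ x, IsFiniteMeasureOnCompacts (meas x)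
  null_compl : ∀ x, meas x {a | G.r a ≠ x} = 0
  pos_of_isOpen : ∀ x (U : Set S), IsOpen U → (∃ a ∈ U, G.r a = x) → 0 < meas x U
  continuous_integral : ∀ f : C_c(S, ℂ), Continuous fun x => ∫ a, f a ∂(meas x)
  left_inv : ∀ (f : C_c(S, ℂ)) (a : S),
    ∫ b, f (G.mul a b) ∂(meas (G.s a)) = ∫ b, f b ∂(meas (G.r a))

/-- A wide normal subgroup bundle of a groupoid. -/
structure NormalBundle where
  carrier : Set S
  isotropy : ∀ a ∈ carrier, G.s a = G.r a
  one_mem : ∀ x, G.one x ∈ carrier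
  mul_mem : ∀ a ∈ carrier, ∀ b ∈ carrier, G.s a = G.r b → G.mul a b ∈ carrier
  inv_mem : ∀ a ∈ carrier, G.inv a ∈ carrier
  conj_mem : ∀ c, ∀ a ∈ carrier, G.s c = G.r a → G.mul (G.mul c a) (G.inv c) ∈ carrier

namespace NormalBundle

variable {G} (N : G.NormalBundle)

open Classical in
/-- A subgroup bundle, as a groupoid in its own right. -/
def toGroupoid : GroupoidStr N.carrier X where
  r a := G.r a
  s a := G.s a
  one x := ⟨G.one x, N.one_mem x⟩
  mul a b := if h : G.s a = G.r b then ⟨G.mul a b, N.mul_mem a a.2 b b.2 h⟩ else a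
  inv a := ⟨G.inv a, N.inv_mem a a.2⟩
  r_one x := G.r_one x
  s_one x := G.s_one x
  r_mul a b h := by rw [dif_pos h]; exact G.r_mul _ _ h
  s_mul a b h := by rw [dif_pos h]; exact G.s_mul _ _ h
  assoc a b c h h' := by
    have h1 : G.s (G.mul a b) = G.r c := (G.s_mul _ _ h).trans h'
    have h2 : G.s a = G.r (G.mul b c) := h.trans (G.r_mul _ _ h').symm
    simp only [dif_pos h, dif_pos h', dif_pos h1, dif_pos h2]
    exact Subtype.ext (G.assoc _ _ _ h h')
  one_mul a := by
    rw [dif_pos (G.s_one _)]; exact Subtype.ext (G.one_mul _)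
  mul_one a := by
    rw [dif_pos (G.r_one _).symm]; exact Subtype.ext (G.mul_one _)
  r_inv a := G.r_inv a
  s_inv a := G.s_inv a
  inv_mul a := by
    rw [dif_pos (G.s_inv _)]; exact Subtype.ext (G.inv_mul _)
  mul_inv a := by
    rw [dif_pos (G.r_inv _).symm]; exact Subtype.ext (G.mul_inv _)

/-- `a ∼ b` iff `a ∈ N b`. -/
def setoid : Setoid S where
  r a b := G.r a = G.r b ∧ G.s a = G.s b ∧ G.mul a (G.inv b) ∈ N.carrier
  iseqv :=
    { refl := fun a => ⟨rfl, rfl, by rw [G.mul_inv]; exact N.one_mem _⟩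
      symm := by
        rintro a b ⟨h1, h2, h3⟩
        refine ⟨h1.symm, h2.symm, ?_⟩
        have := N.inv_mem _ h3
        rwa [G.mul_inv_rev _ _ (h2.trans (G.r_inv b).symm), G.inv_inv] at this
      trans := by
        rintro a b c ⟨h1, h2, h3⟩ ⟨h4, h5, h6⟩
        refine ⟨h1.trans h4, h2.trans h5, ?_⟩
        have hab : G.s a = G.r (G.inv b) := h2.trans (G.r_inv b).symm
        have hbc : G.s b = G.r (G.inv c) := h5.trans (G.r_inv c).symm
        have hc : G.s (G.mul a (G.inv b)) = G.r (G.mul b (G.inv c)) := by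
          rw [G.s_mul _ _ hab, G.s_inv, G.r_mul _ _ hbc]
        have := N.mul_mem _ h3 _ h6 hc
        rwa [← G.assoc _ _ _ ((G.s_mul _ _ hab).trans (G.s_inv b)) hbc,
          G.inv_mul_cancel_right _ _ h2] at this }

/-- The orbit space `N \ S`. -/
def Quot : Type u := Quotient N.setoid

/-- The orbit map. -/
def proj (a : S) : N.Quot := Quotient.mk N.setoid a

/-- A representative of an orbit. -/
def out (q : N.Quot) : S := Quotient.out q

theorem proj_out (q : N.Quot) : N.proj (N.out q) = q := Quotient.out_eq q

theorem out_proj (a : S) : N.setoid.r (N.out (N.proj a)) a := Quotient.mk_out (s := N.setoid) a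

theorem proj_eq {a b : S} (h : N.setoid.r a b) : N.proj a = N.proj b := Quotient.sound h

theorem r_out_proj (a : S) : G.r (N.out (N.proj a)) = G.r a := (N.out_proj a).1

theorem s_out_proj (a : S) : G.s (N.out (N.proj a)) = G.s a := (N.out_proj a).2.1

theorem mul_rel {a a' b b' : S} (ha : N.setoid.r a a') (hb : N.setoid.r b b')
    (h : G.s a = G.r b) : N.setoid.r (G.mul a b) (G.mul a' b') := by
  obtain ⟨h1, h2, h3⟩ := ha
  obtain ⟨h4, h5, h6⟩ := hb
  have h' : G.s a' = G.r b' := h2.symm.trans (h.trans h4)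
  refine ⟨?_, ?_, ?_⟩
  · rw [G.r_mul _ _ h, G.r_mul _ _ h', h1]
  · rw [G.s_mul _ _ h, G.s_mul _ _ h', h5]
  · have hbb : G.s b = G.r (G.inv b') := h5.trans (G.r_inv b').symm
    have haa : G.s a = G.r (G.inv a') := h2.trans (G.r_inv a').symm
    have hn : G.s a = G.r (G.mul b (G.inv b')) := h.trans (G.r_mul _ _ hbb).symm
    have hns : G.s (G.mul b (G.inv b')) = G.s a := by
      rw [G.s_mul _ _ hbb, G.s_inv, ← h', h2]
    have hc := N.conj_mem a _ h6 hn
    have hsan : G.s (G.mul a (G.mul b (G.inv b'))) = G.s a := (G.s_mul _ _ hn).trans hns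
    have hsc : G.s (G.mul (G.mul a (G.mul b (G.inv b'))) (G.inv a)) = G.r a := by
      rw [G.s_mul _ _ (hsan.trans (G.r_inv a).symm), G.s_inv]
    have hm := N.mul_mem _ hc _ h3 (hsc.trans (G.r_mul _ _ haa).symm)
    have hb'a' : G.s (G.inv b') = G.r (G.inv a') := by rw [G.s_inv, G.r_inv, h']
    rw [← G.assoc _ _ _ hsc haa, G.inv_mul_cancel_right _ _ hsan,
      G.assoc _ _ _ hn (hns.trans haa), G.assoc _ _ _ hbb hb'a',
      ← G.mul_inv_rev _ _ h'] at hm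
    have hr : G.s b = G.r (G.inv (G.mul a' b')) := by
      rw [G.r_inv, G.s_mul _ _ h', h5]
    rwa [← G.assoc _ _ _ h hr] at hm

theorem inv_rel {a a' : S} (ha : N.setoid.r a a') : N.setoid.r (G.inv a) (G.inv a') := by
  obtain ⟨h1, h2, h3⟩ := ha
  have haa : G.s a = G.r (G.inv a') := h2.trans (G.r_inv a').symm
  refine ⟨by rw [G.r_inv, G.r_inv, h2], by rw [G.s_inv, G.s_inv, h1], ?_⟩
  have hr : G.s (G.inv a) = G.r (G.mul a (G.inv a')) := by rw [G.s_inv, G.r_mul _ _ haa]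
  have := N.inv_mem _ (N.conj_mem (G.inv a) _ h3 hr)
  rw [G.inv_inv, G.inv_mul_cancel_left _ _ haa,
    G.mul_inv_rev _ _ (by rw [G.s_inv, h1]), G.inv_inv] at this
  rwa [G.inv_inv]

/-- The quotient groupoid; on composable orbits the product is `(N a)(N b) = N (a b)`. -/
def quotGroupoid : GroupoidStr N.Quot X where
  r q := G.r (N.out q)
  s q := G.s (N.out q)
  one x := N.proj (G.one x)
  mul p q := N.proj (G.mul (N.out p) (N.out q))
  inv q := N.proj (G.inv (N.out q))
  r_one x := by rw [N.r_out_proj, G.r_one]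
  s_one x := by rw [N.s_out_proj, G.s_one]
  r_mul p q h := by rw [N.r_out_proj, G.r_mul _ _ h]
  s_mul p q h := by rw [N.s_out_proj, G.s_mul _ _ h]
  assoc p q t h h' := by
    have h1 := N.proj_eq (N.mul_rel (N.out_proj (G.mul (N.out p) (N.out q)))
      (N.setoid.refl (N.out t)) (by rw [N.s_out_proj, G.s_mul _ _ h, h']))
    have h2 := N.proj_eq (N.mul_rel (N.setoid.refl (N.out p))
      (N.out_proj (G.mul (N.out q) (N.out t))) (by rw [N.r_out_proj, G.r_mul _ _ h', h]))
    rw [h1, h2, G.assoc _ _ _ h h']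
  one_mul q := by
    have h1 := N.proj_eq (N.mul_rel (N.out_proj (G.one (G.r (N.out q))))
      (N.setoid.refl (N.out q)) (by rw [N.s_out_proj, G.s_one]))
    rw [h1, G.one_mul, N.proj_out]
  mul_one q := by
    have h1 := N.proj_eq (N.mul_rel (N.setoid.refl (N.out q))
      (N.out_proj (G.one (G.s (N.out q)))) (by rw [N.r_out_proj, G.r_one]))
    rw [h1, G.mul_one, N.proj_out]
  r_inv q := by rw [N.r_out_proj, G.r_inv]
  s_inv q := by rw [N.s_out_proj, G.s_inv]
  inv_mul q := by
    have h1 := N.proj_eq (N.mul_rel (N.out_proj (G.inv (N.out q)))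
      (N.setoid.refl (N.out q)) (by rw [N.s_out_proj, G.s_inv]))
    rw [h1, G.inv_mul]
  mul_inv q := by
    have h1 := N.proj_eq (N.mul_rel (N.setoid.refl (N.out q))
      (N.out_proj (G.inv (N.out q))) (by rw [N.r_out_proj, G.r_inv]))
    rw [h1, G.mul_inv]

instance [TopologicalSpace S] : TopologicalSpace N.Quot :=
  inferInstanceAs (TopologicalSpace (Quotient N.setoid))

instance [TopologicalSpace S] : MeasurableSpace N.Quot := borel _

instance [TopologicalSpace S] : BorelSpace N.Quot := ⟨rfl⟩

/-- The fibre of a subgroup bundle over a unit. -/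
def Fiber (x : X) : Type u := {a : S // a ∈ N.carrier ∧ G.r a = x}

instance [TopologicalSpace S] (x : X) : TopologicalSpace (N.Fiber x) :=
  inferInstanceAs (TopologicalSpace {a : S // a ∈ N.carrier ∧ G.r a = x})

theorem Fiber.s_eq {x : X} (a : N.Fiber x) : G.s a.1 = x :=
  (N.isotropy _ a.2.1).trans a.2.2

theorem Fiber.comp {x : X} (a b : N.Fiber x) : G.s a.1 = G.r b.1 :=
  (Fiber.s_eq N a).trans b.2.2.symm

/-- The group structure of a fibre. -/
instance (x : X) : Group (N.Fiber x) where
  mul a b := ⟨G.mul a.1 b.1, N.mul_mem _ a.2.1 _ b.2.1 (Fiber.comp N a b),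
    (G.r_mul _ _ (Fiber.comp N a b)).trans a.2.2⟩
  one := ⟨G.one x, N.one_mem x, G.r_one x⟩
  inv a := ⟨G.inv a.1, N.inv_mem _ a.2.1, (G.r_inv _).trans (Fiber.s_eq N a)⟩
  mul_assoc a b c := Subtype.ext (G.assoc _ _ _ (Fiber.comp N a b) (Fiber.comp N b c))
  one_mul a := Subtype.ext (by
    have := G.one_mul a.1
    rwa [a.2.2] at this)
  mul_one a := Subtype.ext (by
    have := G.mul_one a.1
    rwa [Fiber.s_eq N a] at this)
  inv_mul_cancel a := Subtype.ext (by
    have := G.inv_mul a.1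
    rwa [Fiber.s_eq N a] at this)

end NormalBundle

/-- A right action of a groupoid on a set `Y` fibred over the unit space;
`act y a` is meaningful only when `p y = r a`. -/
structure RightAction (Y : Type u) where
  p : Y → X
  act : Y → S → Y
  p_act : ∀ y a, p y = G.r a → p (act y a) = G.s a
  act_one : ∀ y, act y (G.one (p y)) = y
  act_mul : ∀ y a b, p y = G.r a → G.s a = G.r b → act y (G.mul a b) = act (act y a) b

namespace RightAction

variable {G} {Y : Type u} (A : G.RightAction Y)

/-- The arrows of the transformation groupoid `Y ⋊ G`. -/
abbrev Space : Type u := {q : Y × S // A.p q.1 = G.r q.2}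

open Classical in
/-- The transformation groupoid `Y ⋊ G`, with unit space `Y`. -/
def groupoid : GroupoidStr A.Space Y where
  r q := q.1.1
  s q := A.act q.1.1 q.1.2
  one y := ⟨(y, G.one (A.p y)), (G.r_one _).symm⟩
  mul q t := if h : G.s q.1.2 = G.r t.1.2 then
    ⟨(q.1.1, G.mul q.1.2 t.1.2), q.2.trans (G.r_mul _ _ h).symm⟩ else q
  inv q := ⟨(A.act q.1.1 q.1.2, G.inv q.1.2), (A.p_act _ _ q.2).trans (G.r_inv _).symm⟩
  r_one y := rfl
  s_one y := A.act_one y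
  r_mul q t h := by split_ifs <;> rfl
  s_mul q t h := by
    have h' : G.s q.1.2 = G.r t.1.2 := by rw [← t.2, ← A.p_act _ _ q.2, h]
    rw [dif_pos h']
    exact (A.act_mul _ _ _ q.2 h').trans (by rw [h])
  assoc q t w h h' := by
    have h1 : G.s q.1.2 = G.r t.1.2 := by rw [← t.2, ← A.p_act _ _ q.2, h]
    have h2 : G.s t.1.2 = G.r w.1.2 := by rw [← w.2, ← A.p_act _ _ t.2, h']
    have h3 : G.s (G.mul q.1.2 t.1.2) = G.r w.1.2 := (G.s_mul _ _ h1).trans h2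
    have h4 : G.s q.1.2 = G.r (G.mul t.1.2 w.1.2) := h1.trans (G.r_mul _ _ h2).symm
    simp only [dif_pos h1, dif_pos h2, dif_pos h3, dif_pos h4, G.assoc _ _ _ h1 h2]
  one_mul q := by
    have h : G.s (G.one (A.p q.1.1)) = G.r q.1.2 := (G.s_one _).trans q.2
    rw [dif_pos h]
    refine Subtype.ext (Prod.ext rfl ?_)
    change G.mul (G.one (A.p q.1.1)) q.1.2 = q.1.2
    rw [q.2, G.one_mul]
  mul_one q := by
    have h : G.s q.1.2 = G.r (G.one (A.p (A.act q.1.1 q.1.2))) := by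
      rw [G.r_one, A.p_act _ _ q.2]
    rw [dif_pos h]
    refine Subtype.ext (Prod.ext rfl ?_)
    change G.mul q.1.2 (G.one (A.p (A.act q.1.1 q.1.2))) = q.1.2
    rw [A.p_act _ _ q.2, G.mul_one]
  r_inv q := rfl
  s_inv q := by
    change A.act (A.act q.1.1 q.1.2) (G.inv q.1.2) = q.1.1
    rw [← A.act_mul _ _ _ q.2 (G.r_inv _).symm, G.mul_inv, ← q.2, A.act_one]
  inv_mul q := by
    rw [dif_pos (G.s_inv _)]
    refine Subtype.ext (Prod.ext rfl ?_)
    change G.mul (G.inv q.1.2) q.1.2 = G.one (A.p (A.act q.1.1 q.1.2))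
    rw [G.inv_mul, A.p_act _ _ q.2]
  mul_inv q := by
    rw [dif_pos (G.r_inv _).symm]
    refine Subtype.ext (Prod.ext rfl ?_)
    change G.mul q.1.2 (G.inv q.1.2) = G.one (A.p q.1.1)
    rw [G.mul_inv, q.2]

end RightAction

/-- The product of a groupoid with a group. -/
def prodGroup (T : Type) [Group T] : GroupoidStr (S × T) X where
  r q := G.r q.1
  s q := G.s q.1
  one x := (G.one x, 1)
  mul q t := (G.mul q.1 t.1, q.2 * t.2)
  inv q := (G.inv q.1, q.2⁻¹)
  r_one x := G.r_one x
  s_one x := G.s_one x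
  r_mul _ _ h := G.r_mul _ _ h
  s_mul _ _ h := G.s_mul _ _ h
  assoc _ _ _ h h' := Prod.ext (G.assoc _ _ _ h h') (_root_.mul_assoc _ _ _)
  one_mul _ := Prod.ext (G.one_mul _) (_root_.one_mul _)
  mul_one _ := Prod.ext (G.mul_one _) (_root_.mul_one _)
  r_inv _ := G.r_inv _
  s_inv _ := G.s_inv _
  inv_mul _ := Prod.ext (G.inv_mul _) (inv_mul_cancel _)
  mul_inv _ := Prod.ext (G.mul_inv _) (mul_inv_cancel _)

end GroupoidStr


/-! ### Section algebras and their C*-algebras -/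

/-- The data from which full and reduced C*-algebras are completed: a space `carrier` of sections
inside an ambient vector space, with convolution, involution, the `I`-norm, and the supremum norm
of the restriction of a section to the unit space. -/
structure SectionAlgebra (F : Type u) [AddCommGroup F] [Module ℂ F] where
  carrier : Set F
  conv : F → F → F
  invol : F → F
  iNorm : F → ℝ≥0∞
  unitNorm : F → ℝ≥0∞

namespace SectionAlgebra

variable {F : Type u} [AddCommGroup F] [Module ℂ F] (A : SectionAlgebra F)

/-- The norm of the Hilbert module that is the completion of the space of sections in the inner
product `⟨f, g⟩ = (f^* * g)|_{units}`. -/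
def moduleNorm (f : F) : ℝ≥0∞ := (A.unitNorm (A.conv (A.invol f) f)) ^ (1 / 2 : ℝ)

/-- The reduced norm: the operator norm of left convolution on the Hilbert module, that is, on its
dense subspace of sections. -/
def redNorm (f : F) : ℝ≥0∞ :=
  sInf {C | ∀ g ∈ A.carrier, A.moduleNorm (A.conv f g) ≤ C * A.moduleNorm g}

/-- The sections form a vector space closed under convolution and involution, on which the
`I`-norm and the reduced norm are finite. -/
structure IsWellDefined : Prop where
  zero_mem : 0 ∈ A.carrier
  add_mem : ∀ f ∈ A.carrier, ∀ g ∈ A.carrier, f + g ∈ A.carrier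
  smul_mem : ∀ (c : ℂ), ∀ f ∈ A.carrier, c • f ∈ A.carrier
  conv_mem : ∀ f ∈ A.carrier, ∀ g ∈ A.carrier, A.conv f g ∈ A.carrier
  invol_mem : ∀ f ∈ A.carrier, A.invol f ∈ A.carrier
  iNorm_ne_top : ∀ f ∈ A.carrier, A.iNorm f ≠ ∞
  redNorm_ne_top : ∀ f ∈ A.carrier, A.redNorm f ≠ ∞

/-- A `*`-representation of the sections by bounded operators on a Hilbert space which is norm
decreasing for `n`. -/
structure Rep (n : F → ℝ≥0∞) where
  H : Type u
  [normed : NormedAddCommGroup H]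
  [inner : InnerProductSpace ℂ H]
  [complete : CompleteSpace H]
  toFun : A.carrier → (H →L[ℂ] H)
  map_add : ∀ f g h : A.carrier, (h : F) = f + g → toFun h = toFun f + toFun g
  map_smul : ∀ (c : ℂ) (f h : A.carrier), (h : F) = c • (f : F) → toFun h = c • toFun f
  map_conv : ∀ f g h : A.carrier, (h : F) = A.conv f g → toFun h = toFun f * toFun g
  map_invol : ∀ f h : A.carrier, (h : F) = A.invol f → toFun h = star (toFun f)
  norm_le : ∀ f : A.carrier, ‖toFun f‖ ≤ (n f).toReal

attribute [instance] Rep.normed Rep.inner Rep.complete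

/-- The C*-algebra of bounded families of operators indexed by the representations. -/
abbrev Ambient (n : F → ℝ≥0∞) : Type (u + 1) :=
  lp (fun L : A.Rep n => L.H →L[ℂ] L.H) ∞

/-- The direct sum of all `n`-decreasing representations. -/
def univRep (n : F → ℝ≥0∞) (f : A.carrier) : A.Ambient n :=
  ⟨fun L => L.toFun f, memℓp_infty ⟨(n f).toReal, by
    rintro _ ⟨L, rfl⟩
    exact L.norm_le f⟩⟩

/-- The C*-subalgebra generated by the image of the direct sum of all `n`-decreasing
representations. -/
def envelope (n : F → ℝ≥0∞) : NonUnitalStarSubalgebra ℂ (A.Ambient n) :=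
  (NonUnitalStarAlgebra.adjoin ℂ (Set.range (A.univRep n))).topologicalClosure

/-- The completion of the sections that is universal for `n`-decreasing representations. If `n` is
itself a C*-seminorm, then by the Gelfand-Naimark theorem this is the Hausdorff completion
for `n`. -/
def Completion (n : F → ℝ≥0∞) : Type (u + 1) := A.envelope n

instance (n : F → ℝ≥0∞) : NonUnitalCStarAlgebra (A.Completion n) :=
  haveI : IsClosed (A.envelope n : Set (A.Ambient n)) :=
    NonUnitalStarSubalgebra.isClosed_topologicalClosure _
  inferInstanceAs (NonUnitalCStarAlgebra (A.envelope n))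

/-- The canonical map from the sections to the completion. -/
def toCompletion (n : F → ℝ≥0∞) (f : A.carrier) : A.Completion n :=
  ⟨A.univRep n f, NonUnitalStarSubalgebra.le_topologicalClosure _
    (NonUnitalStarAlgebra.subset_adjoin ℂ _ ⟨f, rfl⟩)⟩

/-- The full C*-algebra: the completion that is universal for `I`-norm decreasing
representations. -/
abbrev FullCStar : Type (u + 1) := A.Completion A.iNorm

/-- The reduced C*-algebra: the completion for the reduced norm. -/
abbrev RedCStar : Type (u + 1) := A.Completion A.redNorm

/-- A map between section spaces that respects the linear structure, convolution and
involution. -/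
structure IsStarHom {F' : Type u} [AddCommGroup F'] [Module ℂ F'] (B : SectionAlgebra F')
    (T : A.carrier → B.carrier) : Prop where
  map_add : ∀ f g h : A.carrier, (h : F) = f + g → (T h : F') = T f + T g
  map_smul : ∀ (c : ℂ) (f h : A.carrier), (h : F) = c • (f : F) → (T h : F') = c • (T f : F')
  map_conv : ∀ f g h : A.carrier, (h : F) = A.conv f g → (T h : F') = B.conv (T f) (T g)
  map_invol : ∀ f h : A.carrier, (h : F) = A.invol f → (T h : F') = B.invol (T f)

end SectionAlgebra

/-! ### Abelian extensions -/

/-- A topological groupoid with a closed normal abelian wide subgroup bundle `A` that has a Haar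
system `β`. -/
structure AbelianExtension (S X : Type u) [TopologicalSpace S] [MeasurableSpace S]
    [TopologicalSpace X] where
  gpd : GroupoidStr S X
  isTop : gpd.IsTopological
  A : gpd.NormalBundle
  isClosed_A : IsClosed A.carrier
  comm : ∀ a ∈ A.carrier, ∀ b ∈ A.carrier, gpd.s a = gpd.r b → gpd.mul a b = gpd.mul b a
  β : A.toGroupoid.HaarSystem

namespace AbelianExtension

variable {S X : Type u} [TopologicalSpace S] [MeasurableSpace S] [TopologicalSpace X]
  (E : AbelianExtension S X)

/-- The quotient groupoid `𝒢 = Σ / A`. -/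
abbrev quot : GroupoidStr E.A.Quot X := E.A.quotGroupoid

/-- The Pontryagin dual of the fibre `A(x)`. -/
abbrev DualFiber (x : X) : Type u := E.A.Fiber x →ₜ* Circle

/-- The set underlying the dual bundle: a unit `x` together with a character of `A(x)`. -/
structure Dual where
  base : X
  char : E.DualFiber base

variable {E} in
open Classical in
/-- `χ(a)`, for `a` in the fibre of `A` over the base point of `χ`. -/
def Dual.eval (χ : E.Dual) (a : S) : Circle :=
  if h : a ∈ E.A.carrier ∧ E.gpd.r a = χ.base then χ.char ⟨a, h⟩ else 1

theorem Dual.eval_of {χ : E.Dual} {a : S} (ha : a ∈ E.A.carrier) (hr : E.gpd.r a = χ.base) :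
    χ.eval a = χ.char ⟨a, ha, hr⟩ := dif_pos ⟨ha, hr⟩

theorem Dual.ext' {χ ψ : E.Dual} (hb : χ.base = ψ.base)
    (h : ∀ a ∈ E.A.carrier, E.gpd.r a = χ.base → χ.eval a = ψ.eval a) : χ = ψ := by
  obtain ⟨x, c⟩ := χ
  obtain ⟨y, d⟩ := ψ
  obtain rfl : x = y := hb
  congr 1
  ext ⟨a, ha⟩
  have := h a ha.1 ha.2
  rw [Dual.eval_of E ha.1 ha.2, Dual.eval_of E ha.1 ha.2] at this
  exact congrArg _ this

theorem Dual.eval_mul {χ : E.Dual} {a b : S} (ha : a ∈ E.A.carrier) (hb : b ∈ E.A.carrier)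
    (hra : E.gpd.r a = χ.base) (hrb : E.gpd.r b = χ.base) :
    χ.eval (E.gpd.mul a b) = χ.eval a * χ.eval b := by
  have hs : E.gpd.s a = E.gpd.r b := by rw [E.A.isotropy a ha, hra, hrb]
  rw [Dual.eval_of E (E.A.mul_mem _ ha _ hb hs) ((E.gpd.r_mul _ _ hs).trans hra),
    Dual.eval_of E ha hra, Dual.eval_of E hb hrb]
  have h : ∀ p q : E.A.Fiber χ.base, χ.char (p * q) = χ.char p * χ.char q := map_mul χ.char
  exact h ⟨a, ha, hra⟩ ⟨b, hb, hrb⟩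

theorem Dual.eval_one (χ : E.Dual) : χ.eval (E.gpd.one χ.base) = 1 := by
  rw [Dual.eval_of E (E.A.one_mem _) (E.gpd.r_one _)]
  exact map_one χ.char

theorem Dual.eval_inv {χ : E.Dual} {a : S} (ha : a ∈ E.A.carrier) (hra : E.gpd.r a = χ.base) :
    χ.eval (E.gpd.inv a) = (χ.eval a)⁻¹ := by
  rw [Dual.eval_of E (E.A.inv_mem _ ha) (by rw [E.gpd.r_inv, E.A.isotropy a ha, hra]),
    Dual.eval_of E ha hra]
  have h : ∀ p : E.A.Fiber χ.base, χ.char p⁻¹ = (χ.char p)⁻¹ := map_inv χ.char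
  exact h ⟨a, ha, hra⟩

/-- The Gelfand topology on the dual bundle: the coarsest topology for which
`χ ↦ ∫ f(a) conj(χ(a)) dβ(a)` is continuous for all `f ∈ C_c(A)`. -/
instance : TopologicalSpace E.Dual :=
  TopologicalSpace.induced
    (fun χ (f : C_c(E.A.carrier, ℂ)) =>
      ∫ a, f a * star (χ.eval (a : S) : ℂ) ∂(E.β.meas χ.base))
    inferInstance

instance : MeasurableSpace E.Dual := borel _

instance : BorelSpace E.Dual := ⟨rfl⟩

/-- Conjugation `a ↦ σ a σ⁻¹`, as a map `A(s(σ)) → A(r(σ))`. -/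
def conjHom (σ : S) {x y : X} (hs : E.gpd.s σ = x) (hr : E.gpd.r σ = y) :
    E.A.Fiber x →ₜ* E.A.Fiber y where
  toFun a := ⟨E.gpd.mul (E.gpd.mul σ a.1) (E.gpd.inv σ),
    E.A.conj_mem _ _ a.2.1 (hs.trans a.2.2.symm), by
      have h : E.gpd.s σ = E.gpd.r a.1 := hs.trans a.2.2.symm
      rw [E.gpd.r_mul, E.gpd.r_mul _ _ h, hr]
      rw [E.gpd.s_mul _ _ h, E.gpd.r_inv, E.A.isotropy _ a.2.1, h]⟩
  map_one' := by
    refine Subtype.ext ?_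
    change E.gpd.mul (E.gpd.mul σ (E.gpd.one x)) (E.gpd.inv σ) = E.gpd.one y
    rw [← hs, E.gpd.mul_one, E.gpd.mul_inv, hr]
  map_mul' a b := by
    refine Subtype.ext ?_
    have h : ∀ c : E.A.Fiber x, E.gpd.s σ = E.gpd.r c.1 := fun c => hs.trans c.2.2.symm
    have h' : ∀ c : E.A.Fiber x, E.gpd.s c.1 = E.gpd.r (E.gpd.inv σ) := fun c => by
      rw [E.gpd.r_inv, hs, GroupoidStr.NormalBundle.Fiber.s_eq]
    have hab := GroupoidStr.NormalBundle.Fiber.comp E.A a b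
    have hσb : E.gpd.s (E.gpd.inv σ) = E.gpd.r (E.gpd.mul σ b.1) := by
      rw [E.gpd.s_inv, E.gpd.r_mul _ _ (h b)]
    have hsb : E.gpd.s (E.gpd.mul σ b.1) = E.gpd.r (E.gpd.inv σ) :=
      (E.gpd.s_mul _ _ (h b)).trans (h' b)
    change E.gpd.mul (E.gpd.mul σ (E.gpd.mul a.1 b.1)) (E.gpd.inv σ) =
      E.gpd.mul (E.gpd.mul (E.gpd.mul σ a.1) (E.gpd.inv σ))
        (E.gpd.mul (E.gpd.mul σ b.1) (E.gpd.inv σ))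
    rw [E.gpd.assoc _ (E.gpd.inv σ) _ ((E.gpd.s_mul _ _ (h a)).trans (h' a))
        (hσb.trans (E.gpd.r_mul _ _ hsb).symm),
      ← E.gpd.assoc (E.gpd.inv σ) _ _ hσb hsb, E.gpd.inv_mul_cancel_left _ _ (h b),
      ← E.gpd.assoc _ _ _ ((E.gpd.s_mul _ _ (h a)).trans hab) (h' b),
      E.gpd.assoc _ _ _ (h a) hab]
  continuous_toFun := by
    have h : ∀ c : E.A.Fiber x, E.gpd.s σ = E.gpd.r c.1 := fun c => hs.trans c.2.2.symm
    have h1 : Continuous fun c : E.A.Fiber x => E.gpd.mul σ c.1 :=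
      E.isTop.continuousOn_mul.comp_continuous
        (f := fun c : E.A.Fiber x => (σ, c.1))
        (Continuous.prodMk continuous_const continuous_subtype_val) h
    have h2 : Continuous fun c : E.A.Fiber x => E.gpd.mul (E.gpd.mul σ c.1) (E.gpd.inv σ) :=
      E.isTop.continuousOn_mul.comp_continuous
        (f := fun c : E.A.Fiber x => (E.gpd.mul σ c.1, E.gpd.inv σ))
        (Continuous.prodMk h1 continuous_const) fun c => by
          change E.gpd.s (E.gpd.mul σ c.1) = E.gpd.r (E.gpd.inv σ)
          rw [E.gpd.s_mul _ _ (h c), E.gpd.r_inv, hs, GroupoidStr.NormalBundle.Fiber.s_eq]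
    exact h2.subtype_mk _

theorem conj_conj_inv (σ : S) {x y : X} (hs : E.gpd.s σ = x) (hr : E.gpd.r σ = y)
    (a : E.A.Fiber y) :
    E.conjHom σ hs hr (E.conjHom (E.gpd.inv σ) (by rw [E.gpd.s_inv, hr]) (by rw [E.gpd.r_inv, hs]) a)
      = a := by
  refine Subtype.ext ?_
  have h : E.gpd.s (E.gpd.inv σ) = E.gpd.r a.1 := by rw [E.gpd.s_inv, hr, a.2.2]
  have h' : E.gpd.s a.1 = E.gpd.r σ := by rw [GroupoidStr.NormalBundle.Fiber.s_eq, hr]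
  change E.gpd.mul (E.gpd.mul σ (E.gpd.mul (E.gpd.mul (E.gpd.inv σ) a.1)
    (E.gpd.inv (E.gpd.inv σ)))) (E.gpd.inv σ) = a.1
  have hm : E.gpd.s (E.gpd.mul (E.gpd.inv σ) a.1) = E.gpd.r σ := by rw [E.gpd.s_mul _ _ h, h']
  rw [E.gpd.inv_inv, E.gpd.assoc _ _ _ h h', E.gpd.mul_inv_cancel_left,
    E.gpd.mul_inv_cancel_right _ _ h']
  rw [E.gpd.r_mul _ _ h', hr, a.2.2]

theorem conj_inv_conj (σ : S) {x y : X} (hs : E.gpd.s σ = x) (hr : E.gpd.r σ = y)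
    (a : E.A.Fiber x) :
    E.conjHom (E.gpd.inv σ) (by rw [E.gpd.s_inv, hr]) (by rw [E.gpd.r_inv, hs]) (E.conjHom σ hs hr a)
      = a := by
  have h := E.conj_conj_inv (E.gpd.inv σ) (by rw [E.gpd.s_inv, hr]) (by rw [E.gpd.r_inv, hs]) a
  refine Eq.trans ?_ h
  congr 1
  refine Subtype.ext ?_
  change E.gpd.mul (E.gpd.mul σ a.1) (E.gpd.inv σ) =
    E.gpd.mul (E.gpd.mul (E.gpd.inv (E.gpd.inv σ)) a.1) (E.gpd.inv (E.gpd.inv (E.gpd.inv σ)))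
  rw [E.gpd.inv_inv]

/-- `χ ↦ χ · σ`, with `(χ · σ)(a) = χ(σ a σ⁻¹)`, as a homeomorphism from the dual of `A(r(σ))`
to the dual of `A(s(σ))`. -/
def dualHomeo (σ : S) {x y : X} (hs : E.gpd.s σ = x) (hr : E.gpd.r σ = y) :
    E.DualFiber y ≃ₜ E.DualFiber x where
  toFun χ := χ.comp (E.conjHom σ hs hr)
  invFun χ := χ.comp
    (E.conjHom (E.gpd.inv σ) (by rw [E.gpd.s_inv, hr]) (by rw [E.gpd.r_inv, hs]))
  left_inv χ := by
    ext a
    exact congrArg (fun b => ((χ b : Circle) : ℂ)) (E.conj_conj_inv σ hs hr a)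
  right_inv χ := by
    ext a
    exact congrArg (fun b => ((χ b : Circle) : ℂ)) (E.conj_inv_conj σ hs hr a)
  continuous_toFun := ContinuousMonoidHom.continuous_comp_left _
  continuous_invFun := ContinuousMonoidHom.continuous_comp_left _

theorem r_conj {σ a : S} (ha : a ∈ E.A.carrier) (h : E.gpd.s σ = E.gpd.r a) :
    E.gpd.r (E.gpd.mul (E.gpd.mul σ a) (E.gpd.inv σ)) = E.gpd.r σ := by
  rw [E.gpd.r_mul, E.gpd.r_mul _ _ h]
  rw [E.gpd.s_mul _ _ h, E.gpd.r_inv, E.A.isotropy _ ha, h]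

open Classical in
/-- The right action of `Σ` on the dual bundle. -/
def sact (χ : E.Dual) (σ : S) : E.Dual :=
  if h : χ.base = E.gpd.r σ then ⟨E.gpd.s σ, E.dualHomeo σ rfl h.symm χ.char⟩ else χ

theorem base_sact {χ : E.Dual} {σ : S} (h : χ.base = E.gpd.r σ) :
    (E.sact χ σ).base = E.gpd.s σ := by
  rw [sact, dif_pos h]

theorem eval_sact {χ : E.Dual} {σ a : S} (h : χ.base = E.gpd.r σ) (ha : a ∈ E.A.carrier)
    (hr : E.gpd.r a = E.gpd.s σ) :
    (E.sact χ σ).eval a = χ.eval (E.gpd.mul (E.gpd.mul σ a) (E.gpd.inv σ)) := by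
  rw [sact, dif_pos h, Dual.eval_of E ha hr, Dual.eval_of E (E.A.conj_mem _ _ ha hr.symm)
    ((E.r_conj ha hr.symm).trans h.symm)]
  rfl

theorem conj_mul {σ τ a : S} (hστ : E.gpd.s σ = E.gpd.r τ) (hτa : E.gpd.s τ = E.gpd.r a)
    (ha : a ∈ E.A.carrier) :
    E.gpd.mul (E.gpd.mul (E.gpd.mul σ τ) a) (E.gpd.inv (E.gpd.mul σ τ)) =
      E.gpd.mul (E.gpd.mul σ (E.gpd.mul (E.gpd.mul τ a) (E.gpd.inv τ))) (E.gpd.inv σ) := by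
  have hsa : E.gpd.s a = E.gpd.r (E.gpd.inv τ) := by
    rw [E.gpd.r_inv, E.A.isotropy _ ha, hτa]
  have h1 : E.gpd.s (E.gpd.mul τ a) = E.gpd.r (E.gpd.inv τ) := (E.gpd.s_mul _ _ hτa).trans hsa
  have h2 : E.gpd.s (E.gpd.inv τ) = E.gpd.r (E.gpd.inv σ) := by
    rw [E.gpd.s_inv, E.gpd.r_inv, hστ]
  have h3 : E.gpd.s σ = E.gpd.r (E.gpd.mul τ a) := hστ.trans (E.gpd.r_mul _ _ hτa).symm
  rw [E.gpd.mul_inv_rev _ _ hστ, E.gpd.assoc _ _ _ hστ hτa, ← E.gpd.assoc σ _ _ h3 h1,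
    E.gpd.assoc _ _ _ ((E.gpd.s_mul _ _ h3).trans h1) h2]

theorem sact_of_mem {χ : E.Dual} {a : S} (ha : a ∈ E.A.carrier) (h : χ.base = E.gpd.r a) :
    E.sact χ a = χ := by
  have hb : (E.sact χ a).base = χ.base := by rw [E.base_sact h, E.A.isotropy _ ha, h]
  refine Dual.ext' E hb fun b hbm hbr => ?_
  rw [E.base_sact h] at hbr
  rw [E.eval_sact h hbm hbr, E.comm a ha b hbm hbr.symm, E.gpd.mul_inv_cancel_right]
  rw [E.A.isotropy _ hbm, hbr, E.A.isotropy _ ha]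

theorem sact_mul {χ : E.Dual} {σ τ : S} (h : χ.base = E.gpd.r σ) (hστ : E.gpd.s σ = E.gpd.r τ) :
    E.sact χ (E.gpd.mul σ τ) = E.sact (E.sact χ σ) τ := by
  have h' : χ.base = E.gpd.r (E.gpd.mul σ τ) := h.trans (E.gpd.r_mul _ _ hστ).symm
  have h'' : (E.sact χ σ).base = E.gpd.r τ := (E.base_sact h).trans hστ
  refine Dual.ext' E ?_ fun a ha hr => ?_
  · rw [E.base_sact h', E.base_sact h'', E.gpd.s_mul _ _ hστ]
  · rw [E.base_sact h'] at hr
    have hr' : E.gpd.r a = E.gpd.s τ := hr.trans (E.gpd.s_mul _ _ hστ)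
    rw [E.eval_sact h' ha hr, E.eval_sact h'' ha hr',
      E.eval_sact h (E.A.conj_mem _ _ ha hr'.symm) ((E.r_conj ha hr'.symm).trans hστ.symm),
      E.conj_mul hστ hr'.symm ha]

theorem sact_rel {χ : E.Dual} {σ τ : S} (h : χ.base = E.gpd.r τ) (hστ : E.A.setoid.r σ τ) :
    E.sact χ σ = E.sact χ τ := by
  obtain ⟨h1, h2, h3⟩ := hστ
  have hc : E.gpd.s σ = E.gpd.r (E.gpd.inv τ) := h2.trans (E.gpd.r_inv _).symm
  have hb : χ.base = E.gpd.r (E.gpd.mul σ (E.gpd.inv τ)) := by rw [E.gpd.r_mul _ _ hc, h1, h]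
  have := E.sact_mul (τ := τ) hb (by rw [E.gpd.s_mul _ _ hc, E.gpd.s_inv])
  rwa [E.gpd.inv_mul_cancel_right _ _ h2, E.sact_of_mem h3 hb] at this

/-- The right action of `Σ` on the dual bundle. -/
def sigmaAction : E.gpd.RightAction E.Dual where
  p := Dual.base
  act := E.sact
  p_act _ _ h := E.base_sact h
  act_one _ := E.sact_of_mem (E.A.one_mem _) (E.gpd.r_one _).symm
  act_mul _ _ _ h h' := E.sact_mul h h'

/-- The right action of `𝒢` on the dual bundle. -/
def quotAction : E.quot.RightAction E.Dual where
  p := Dual.base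
  act χ γ := E.sact χ (E.A.out γ)
  p_act _ _ h := E.base_sact h
  act_one χ := by
    have h : χ.base = E.gpd.r (E.gpd.one χ.base) := (E.gpd.r_one _).symm
    exact (E.sact_rel h (E.A.out_proj _)).trans (E.sact_of_mem (E.A.one_mem _) h)
  act_mul χ a b h h' :=
    (E.sact_rel (h.trans (E.gpd.r_mul _ _ h').symm) (E.A.out_proj _)).trans (E.sact_mul h h')

/-! ### The `𝕋`-groupoid and its section algebra -/

/-- The transformation groupoid of the dual bundle by `𝒢`. -/
abbrev transGroupoid : GroupoidStr E.quotAction.Space E.Dual := E.quotAction.groupoid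

/-- The groupoid `𝒟` of triples `((χ, σ), z)`. -/
abbrev dGroupoid : GroupoidStr (E.sigmaAction.Space × Circle) E.Dual :=
  E.sigmaAction.groupoid.prodGroup Circle

/-- The subgroup bundle of `𝒟` of all `((χ, a), conj(χ(a)))` with `a ∈ A`. -/
def hBundle : E.dGroupoid.NormalBundle where
  carrier := {d | d.1.1.2 ∈ E.A.carrier ∧ d.2 = (d.1.1.1.eval d.1.1.2)⁻¹}
  isotropy := by
    rintro ⟨⟨⟨χ, a⟩, h⟩, z⟩ ⟨ha, -⟩
    exact E.sact_of_mem ha h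
  one_mem χ := ⟨E.A.one_mem _, by
    change (1 : Circle) = (χ.eval (E.gpd.one χ.base))⁻¹
    rw [Dual.eval_one, inv_one]⟩
  mul_mem := by
    rintro ⟨⟨⟨χ, a⟩, h⟩, z⟩ ⟨ha, hz⟩ ⟨⟨⟨ψ, b⟩, k⟩, w⟩ ⟨hb, hw⟩ hc
    change E.sact χ a = ψ at hc
    change χ.base = E.gpd.r a at h
    change ψ.base = E.gpd.r b at k
    dsimp only at ha hz hb hw
    rw [E.sact_of_mem ha h] at hc
    subst hc
    have hs : E.gpd.s a = E.gpd.r b := by rw [E.A.isotropy _ ha, ← h, k]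
    have hm : E.sigmaAction.groupoid.mul ⟨(χ, a), h⟩ ⟨(χ, b), k⟩ =
        ⟨(χ, E.gpd.mul a b), h.trans (E.gpd.r_mul _ _ hs).symm⟩ := dif_pos hs
    change (E.sigmaAction.groupoid.mul ⟨(χ, a), h⟩ ⟨(χ, b), k⟩, z * w) ∈ _
    rw [hm]
    refine ⟨E.A.mul_mem _ ha _ hb hs, ?_⟩
    change z * w = (χ.eval (E.gpd.mul a b))⁻¹
    rw [Dual.eval_mul E ha hb h.symm k.symm, hz, hw, _root_.mul_inv]
  inv_mem := by
    rintro ⟨⟨⟨χ, a⟩, h⟩, z⟩ ⟨ha, hz⟩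
    change χ.base = E.gpd.r a at h
    dsimp only at ha hz
    refine ⟨E.A.inv_mem _ ha, ?_⟩
    change z⁻¹ = ((E.sact χ a).eval (E.gpd.inv a))⁻¹
    rw [E.sact_of_mem ha h, Dual.eval_inv E ha h.symm, hz]
  conj_mem := by
    rintro ⟨⟨⟨χ, σ⟩, h⟩, z⟩ ⟨⟨⟨ψ, a⟩, k⟩, w⟩ ⟨ha, hw⟩ hc
    change E.sact χ σ = ψ at hc
    change χ.base = E.gpd.r σ at h
    change ψ.base = E.gpd.r a at k
    dsimp only at ha hw
    subst hc
    have hs : E.gpd.s σ = E.gpd.r a := (E.base_sact h).symm.trans k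
    have hs' : E.gpd.s (E.gpd.mul σ a) = E.gpd.r (E.gpd.inv σ) := by
      rw [E.gpd.s_mul _ _ hs, E.gpd.r_inv, E.A.isotropy _ ha, hs]
    have hm : E.sigmaAction.groupoid.mul ⟨(χ, σ), h⟩ ⟨(E.sact χ σ, a), k⟩ =
        ⟨(χ, E.gpd.mul σ a), h.trans (E.gpd.r_mul _ _ hs).symm⟩ := dif_pos hs
    have hm' : E.sigmaAction.groupoid.mul
          ⟨(χ, E.gpd.mul σ a), h.trans (E.gpd.r_mul _ _ hs).symm⟩
          (E.sigmaAction.groupoid.inv ⟨(χ, σ), h⟩) =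
        ⟨(χ, E.gpd.mul (E.gpd.mul σ a) (E.gpd.inv σ)),
          h.trans (E.r_conj ha hs).symm⟩ := dif_pos hs'
    change (E.sigmaAction.groupoid.mul
      (E.sigmaAction.groupoid.mul ⟨(χ, σ), h⟩ ⟨(E.sact χ σ, a), k⟩)
      (E.sigmaAction.groupoid.inv ⟨(χ, σ), h⟩), z * w * z⁻¹) ∈ _
    rw [hm, hm']
    refine ⟨E.A.conj_mem _ _ ha hs, ?_⟩
    change z * w * z⁻¹ = (χ.eval (E.gpd.mul (E.gpd.mul σ a) (E.gpd.inv σ)))⁻¹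
    rw [← E.eval_sact h ha hs.symm, hw, mul_comm z, mul_inv_cancel_right]

/-- The `𝕋`-groupoid `Σ̂ = 𝒟 / H`, with unit space the dual bundle. -/
abbrev SigmaHat : Type u := E.hBundle.Quot

/-- The groupoid structure of `Σ̂`. -/
abbrev sigmaHat : GroupoidStr E.SigmaHat E.Dual := E.hBundle.quotGroupoid

/-- The class `[χ, z, σ]`. -/
def cls (χ : E.Dual) (z : Circle) (σ : S) (h : χ.base = E.gpd.r σ) : E.SigmaHat :=
  E.hBundle.proj (⟨(χ, σ), h⟩, z)

/-- The inclusion `i(χ, z) = [χ, z, x]` of the trivial circle bundle, `x` the base point of `χ`. -/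
def incl (χ : E.Dual) (z : Circle) : E.SigmaHat :=
  E.cls χ z (E.gpd.one χ.base) (E.gpd.r_one _).symm

/-- The projection `j([χ, z, σ]) = (χ, σA)` of `Σ̂` onto the transformation groupoid. -/
def jMap (e : E.SigmaHat) : E.quotAction.Space :=
  ⟨((E.hBundle.out e).1.1.1, E.A.proj (E.hBundle.out e).1.1.2),
    (E.hBundle.out e).1.2.trans (E.A.r_out_proj _).symm⟩

theorem eq_of_rel (d : E.sigmaAction.Space × Circle) (χ : E.Dual) (z : Circle) (σ : S)
    (h : χ.base = E.gpd.r σ) (hrel : E.hBundle.setoid.r d (⟨(χ, σ), h⟩, z)) :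
    d.1.1.1 = χ ∧ E.A.proj d.1.1.2 = E.A.proj σ := by
  obtain ⟨⟨⟨ψ, τ⟩, k⟩, w⟩ := d
  obtain ⟨h1, h2, h3, -⟩ := hrel
  change ψ = χ at h1
  change E.sact ψ τ = E.sact χ σ at h2
  change ψ.base = E.gpd.r τ at k
  subst h1
  have hs : E.gpd.s τ = E.gpd.s σ := by rw [← E.base_sact k, h2, E.base_sact h]
  have hm : E.sigmaAction.groupoid.mul ⟨(ψ, τ), k⟩ (E.sigmaAction.groupoid.inv ⟨(ψ, σ), h⟩) =
      ⟨(ψ, E.gpd.mul τ (E.gpd.inv σ)),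
        k.trans (E.gpd.r_mul _ _ (hs.trans (E.gpd.r_inv σ).symm)).symm⟩ :=
    dif_pos (hs.trans (E.gpd.r_inv σ).symm)
  change (E.sigmaAction.groupoid.mul ⟨(ψ, τ), k⟩
    (E.sigmaAction.groupoid.inv ⟨(ψ, σ), h⟩)).1.2 ∈ E.A.carrier at h3
  rw [hm] at h3
  exact ⟨rfl, E.A.proj_eq ⟨k.symm.trans h, hs, h3⟩⟩

theorem jMap_cls (χ : E.Dual) (z : Circle) (σ : S) (h : χ.base = E.gpd.r σ) :
    E.jMap (E.cls χ z σ h) = ⟨(χ, E.A.proj σ), h.trans (E.A.r_out_proj _).symm⟩ := by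
  have hrel := E.eq_of_rel _ χ z σ h (E.hBundle.out_proj (⟨(χ, σ), h⟩, z))
  exact Subtype.ext (Prod.ext hrel.1 hrel.2)

/-- A (not necessarily continuous) section of `jMap`. -/
def jLift (q : E.quotAction.Space) : E.SigmaHat := E.cls q.1.1 1 (E.A.out q.1.2) q.2

theorem jMap_jLift (q : E.quotAction.Space) : E.jMap (E.jLift q) = q :=
  (E.jMap_cls _ _ _ q.2).trans (Subtype.ext (Prod.ext rfl (E.A.proj_out _)))

variable (α : E.quot.HaarSystem)

/-- The measures `δ_χ × α^{p(χ)}` of the Haar system of the transformation groupoid. -/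
def transMeas (χ : E.Dual) : Measure E.quotAction.Space :=
  ((Measure.dirac χ).prod (α.meas χ.base)).comap Subtype.val

/-- The section algebra of the `𝕋`-groupoid `Σ̂`: the functions `f ∈ C_c(Σ̂)` with
`f(z e) = z f(e)`. Integrands depend only on the image of the variable in the transformation
groupoid, so they may be evaluated at any preimage. -/
def twistAlgebra : SectionAlgebra (E.SigmaHat → ℂ) where
  carrier := {f | Continuous f ∧ HasCompactSupport f ∧
    ∀ (z : Circle) (e : E.SigmaHat),
      f (E.sigmaHat.mul (E.incl (E.sigmaHat.r e) z) e) = (z : ℂ) * f e}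
  conv f g e := ∫ q, f (E.jLift q) * g (E.sigmaHat.mul (E.sigmaHat.inv (E.jLift q)) e)
    ∂(E.transMeas α (E.sigmaHat.r e))
  invol f e := star (f (E.sigmaHat.inv e))
  iNorm f := max (⨆ χ, ∫⁻ q, ‖f (E.jLift q)‖ₑ ∂(E.transMeas α χ))
    (⨆ χ, ∫⁻ q, ‖f (E.jLift (E.transGroupoid.inv q))‖ₑ ∂(E.transMeas α χ))
  unitNorm f := ⨆ χ, ‖f (E.sigmaHat.one χ)‖ₑ

/-! ### The Gelfand-transformed twisted dynamical system and its section algebra -/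

/-- The fibre `C₀(Â(x))`. -/
abbrev EFiber (x : X) : Type u := C₀(E.DualFiber x, ℂ)

/-- The total space of the C*-bundle with fibres `C₀(Â(x))`. -/
structure EHat where
  base : X
  val : E.EFiber base

/-- The topology of the C*-bundle whose `C₀`-sections are the functions `h ∈ C₀(Â)`, that is,
`x ↦ h|_{Â(x)}`: a basis is given by the tubes `{(x, k) : x ∈ U, ‖k - h|_{Â(x)}‖ < ε}`. -/
instance : TopologicalSpace E.EHat :=
  TopologicalSpace.generateFrom
    {W | ∃ (h : C₀(E.Dual, ℂ)) (U : Set X) (ε : ℝ), IsOpen U ∧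
      W = {k : E.EHat | k.base ∈ U ∧
        ∃ δ < ε, ∀ χ : E.DualFiber k.base, ‖k.val χ - h ⟨k.base, χ⟩‖ ≤ δ}}

/-- The isomorphism `ϑ̂_σ : C₀(Â(s(σ))) → C₀(Â(r(σ)))`, `ϑ̂_σ(h)(χ) = h(χ · σ)`. -/
def theta (σ : S) {x y : X} (hs : E.gpd.s σ = x) (hr : E.gpd.r σ = y) (h : E.EFiber x) :
    E.EFiber y :=
  h.comp (E.dualHomeo σ hs hr).toCocompactMap

/-- Functions `f : Σ → Ê` with `f(σ) ∈ C₀(Â(r(σ)))`. -/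
abbrev PreSection : Type u := (σ : S) → E.EFiber (E.gpd.r σ)

variable {E} in
/-- The value `f(σ)(χ)` for `χ ∈ Â(r(σ))`. -/
def PreSection.at (f : E.PreSection) (σ : S) (χ : E.Dual) (h : χ.base = E.gpd.r σ) : ℂ :=
  f σ (h ▸ χ.char)

open Classical in
/-- The integrand `f(τ) ϑ̂_τ(g(τ⁻¹σ))` of the convolution, in the fibre over `r(σ)`. -/
def convIntegrand (f g : E.PreSection) (σ τ : S) : E.EFiber (E.gpd.r σ) :=
  if h : E.gpd.r τ = E.gpd.r σ then
    (h ▸ f τ) * E.theta τ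
      (show E.gpd.s τ = E.gpd.r (E.gpd.mul (E.gpd.inv τ) σ) by
        rw [E.gpd.r_mul _ _ ((E.gpd.s_inv τ).trans h), E.gpd.r_inv]) h
      (g (E.gpd.mul (E.gpd.inv τ) σ))
  else 0

/-- The section algebra of the Fell bundle of the twisted system `(𝒢, Σ, Ê, ϑ̂, κ̂)`: continuous
`f : Σ → Ê` with `f(σ) ∈ C₀(Â(r(σ)))` and `f(aσ) = f(σ) κ̂(a)^*`, that is,
`f(aσ)(χ) = χ(a) f(σ)(χ)`, whose support has compact image in `𝒢`. Integrands depend only on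
classes in `𝒢`, so they may be evaluated at any representative. -/
def crossedAlgebra : SectionAlgebra E.PreSection where
  carrier := {f | Continuous (fun σ => (⟨E.gpd.r σ, f σ⟩ : E.EHat)) ∧
    (∀ (a : S) (_ : a ∈ E.A.carrier) (σ : S) (hs : E.gpd.s a = E.gpd.r σ) (χ : E.Dual)
      (hχ : χ.base = E.gpd.r σ),
      f.at (E.gpd.mul a σ) χ (by rw [E.gpd.r_mul _ _ hs, hχ, ← hs, E.A.isotropy _ ‹_›]) =
        (χ.eval a : ℂ) * f.at σ χ hχ) ∧
    ∃ K : Set E.A.Quot, IsCompact K ∧ ∀ σ, f σ ≠ 0 → E.A.proj σ ∈ K}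
  conv f g σ := ∫ γ, E.convIntegrand f g σ (E.A.out γ) ∂(α.meas (E.gpd.r σ))
  invol f σ := E.theta σ (E.gpd.r_inv σ).symm rfl (star (f (E.gpd.inv σ)))
  iNorm f := max (⨆ x, ∫⁻ γ, ‖f (E.A.out γ)‖ₑ ∂(α.meas x))
    (⨆ x, ∫⁻ γ, ‖f (E.A.out (E.quot.inv γ))‖ₑ ∂(α.meas x))
  unitNorm f := ⨆ x, ‖f (E.gpd.one x)‖ₑ

end AbelianExtension

end

noncomputable section

open Filter

set_option linter.unusedSectionVars false

/-! ### Extension of compactly supported functions -/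

/-- A function on a locally compact space that is continuous on a closed set, and vanishes there
off a compact set, agrees on the closed set with a compactly supported continuous function. -/
theorem exists_compactlySupported_eqOn {Y : Type*} [TopologicalSpace Y] [T2Space Y]
    [LocallyCompactSpace Y] [NormalSpace Y] {C K : Set Y} (hC : IsClosed C)
    (hK : IsCompact K) {k : Y → ℂ} (hk : ContinuousOn k C) (hz : ∀ y ∈ C, y ∉ K → k y = 0) :
    ∃ H : C_c(Y, ℂ), ∀ y ∈ C, H y = k y := by
  obtain ⟨g, hg⟩ := ContinuousMap.exists_extension' (hC.isClosedEmbedding_subtypeVal)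
    (⟨C.domRestrict k, continuousOn_iff_continuous_domRestrict.1 hk⟩ : C(C, ℂ))
  obtain ⟨c, hc1, -, hcs, -⟩ := exists_continuous_one_zero_of_isCompact hK isClosed_empty
    (Set.disjoint_empty K)
  refine ⟨⟨⟨fun y => (c y : ℂ) * g y, by fun_prop⟩, ?_⟩, fun y hy => ?_⟩
  · refine hcs.mono fun y hy => ?_
    contrapose! hy
    simp only [Function.mem_support, not_not] at hy ⊢
    simp [hy]
  · have h1 : g y = k y := congrFun hg ⟨y, hy⟩
    change (c y : ℂ) * g y = k y
    rw [h1]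
    by_cases hyK : y ∈ K
    · rw [hc1 hyK]; simp
    · rw [hz y hy hyK, mul_zero]

/-- Continuity on a set descends along an open surjection. -/
theorem ContinuousOn.of_comp_isOpenQuotientMap {P Q Z : Type*} [TopologicalSpace P]
    [TopologicalSpace Q] [TopologicalSpace Z] {π : P → Q} (hπ : IsOpenQuotientMap π) {C : Set Q}
    {h : Q → Z} (hc : ContinuousOn (h ∘ π) (π ⁻¹' C)) : ContinuousOn h C := by
  intro q hq
  obtain ⟨p, rfl⟩ := hπ.surjective q
  have h1 : Tendsto (h ∘ π) (𝓝[π ⁻¹' C] p) (𝓝 (h (π p))) := hc p hq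
  have h2 : 𝓝[C] (π p) = map π (𝓝[π ⁻¹' C] p) := by
    rw [nhdsWithin, nhdsWithin, ← hπ.map_nhds_eq, ← Filter.comap_principal, Filter.push_pull]
  change Tendsto h (𝓝[C] (π p)) _
  rw [h2]
  exact h1

namespace GroupoidStr.HaarSystem

variable {Y X : Type u} [TopologicalSpace Y] [T2Space Y] [LocallyCompactSpace Y]
  [SecondCountableTopology Y] [MeasurableSpace Y] [BorelSpace Y] [TopologicalSpace X]
  {G : GroupoidStr Y X} (lam : G.HaarSystem)

instance (x : X) : IsFiniteMeasureOnCompacts (lam.meas x) := lam.finite_compact x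

instance (x : X) : SigmaFinite (lam.meas x) :=
  haveI := isLocallyFiniteMeasure_of_isFiniteMeasureOnCompacts (μ := lam.meas x)
  inferInstance

theorem ae_r_eq (x : X) : ∀ᵐ a ∂lam.meas x, G.r a = x := lam.null_compl x

theorem integrable_compactlySupported (x : X) (f : C_c(Y, ℂ)) : Integrable f (lam.meas x) :=
  f.continuous.integrable_of_hasCompactSupport f.hasCompactSupport

variable [T2Space X]

/-- A function that is continuous on a fibre of the range map and vanishes there off a compact
set is integrable. -/
theorem integrable_of_continuousOn (hr : Continuous G.r) {x : X} {K : Set Y} (hK : IsCompact K)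
    {k : Y → ℂ} (hk : ContinuousOn k {y | G.r y = x}) (hz : ∀ y, G.r y = x → y ∉ K → k y = 0) :
    Integrable k (lam.meas x) := by
  obtain ⟨H, hH⟩ := exists_compactlySupported_eqOn (isClosed_eq hr continuous_const) hK hk hz
  refine (lam.integrable_compactlySupported x H).congr ?_
  filter_upwards [lam.ae_r_eq x] with y hy using hH y hy

/-- Compact sets have uniformly bounded measure. -/
theorem exists_measure_le (hr : Continuous G.r) {K : Set Y} (hK : IsCompact K) :
    ∃ C : ℝ, 0 ≤ C ∧ ∀ x, lam.meas x K ≤ ENNReal.ofReal C := by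
  obtain ⟨c, hc1, -, hcs, hc01⟩ := exists_continuous_one_zero_of_isCompact hK isClosed_empty
    (Set.disjoint_empty K)
  let f : C_c(Y, ℂ) := ⟨⟨fun y => (c y : ℂ), by fun_prop⟩, by
    refine hcs.mono fun y hy => ?_
    contrapose! hy
    simp only [Function.mem_support, not_not] at hy ⊢
    simp [hy]⟩
  obtain ⟨B, hB⟩ := ((hK.image hr).image (lam.continuous_integral f).norm).bddAbove
  refine ⟨max B 0, le_max_right _ _, fun x => ?_⟩
  by_cases hx : x ∈ G.r '' K
  · have h1 : ‖∫ a, f a ∂lam.meas x‖ ≤ B := hB ⟨x, hx, rfl⟩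
    have h2 : ∫ a, f a ∂lam.meas x = ((∫ a, c a ∂lam.meas x : ℝ) : ℂ) := integral_ofReal
    have hci : Integrable c (lam.meas x) := c.continuous.integrable_of_hasCompactSupport hcs
    have h3 : ENNReal.ofReal (∫ a, c a ∂lam.meas x) = ∫⁻ a, ENNReal.ofReal (c a) ∂lam.meas x :=
      ofReal_integral_eq_lintegral_ofReal hci (ae_of_all _ fun a => (hc01 a).1)
    calc lam.meas x K = ∫⁻ a in K, 1 ∂lam.meas x := by simp
      _ ≤ ∫⁻ a in K, ENNReal.ofReal (c a) ∂lam.meas x := by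
        refine setLIntegral_mono_ae' hK.measurableSet (ae_of_all _ fun a ha => ?_)
        rw [hc1 ha]; simp
      _ ≤ ∫⁻ a, ENNReal.ofReal (c a) ∂lam.meas x := setLIntegral_le_lintegral _ _
      _ ≤ ENNReal.ofReal (max B 0) := by
        rw [← h3]
        refine ENNReal.ofReal_le_ofReal (le_trans ?_ (le_max_left _ _))
        rw [h2, Complex.norm_real] at h1
        exact (le_abs_self _).trans h1
  · have : lam.meas x K = 0 := by
      refine measure_mono_null (fun a ha hax => hx ⟨a, ha, hax⟩) (lam.null_compl x)
    rw [this]; exact zero_le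

theorem isOpenMap_r (lam : G.HaarSystem) : IsOpenMap G.r := by
  rw [isOpenMap_iff_nhds_le]
  intro a U hU
  obtain ⟨V, hVU, hVo, haV⟩ := mem_nhds_iff.1 (mem_map.1 hU)
  obtain ⟨c, hc1, hcc, hcs, hc01⟩ := exists_continuousMap_one_of_isCompact_subset_isOpen
    (isCompact_singleton (x := a)) hVo (by simpa using haV)
  let f : C_c(Y, ℂ) := ⟨⟨fun y => (c y : ℂ), by fun_prop⟩, by
    refine HasCompactSupport.mono (f := c) hcc fun y hy => ?_
    contrapose! hy
    simp only [Function.mem_support, not_not] at hy ⊢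
    simp [hy]⟩
  have hinteg : ∀ x, ∫ b, f b ∂lam.meas x = ((∫ b, c b ∂lam.meas x : ℝ) : ℂ) :=
    fun x => integral_ofReal
  have hpos : ∫ b, f b ∂lam.meas (G.r a) ≠ 0 := by
    rw [hinteg]
    have hci : Integrable c (lam.meas (G.r a)) := c.continuous.integrable_of_hasCompactSupport hcc
    have : 0 < ∫ b, c b ∂lam.meas (G.r a) := by
      rw [integral_pos_iff_support_of_nonneg (fun b => (hc01 b).1) hci]
      refine lam.pos_of_isOpen _ _ c.continuous.isOpen_support ⟨a, ?_, rfl⟩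
      have := hc1 (Set.mem_singleton a)
      simp [this]
    exact_mod_cast this.ne'
  have hev := (lam.continuous_integral f).continuousAt.eventually_ne hpos
  refine mem_of_superset hev fun x hx => ?_
  by_contra hxU
  refine hx (integral_eq_zero_of_ae ?_)
  filter_upwards [lam.ae_r_eq x] with b hb
  by_contra hfb
  have : b ∈ tsupport c := subset_tsupport _ fun h => hfb (by simp [f, h])
  exact hxU (hb ▸ hVU (hcs this))

/-- A bound for the integral of a function supported in a compact set. -/
theorem lintegral_le_of_bound {x : X} {K : Set Y} {g : Y → ℝ≥0∞} {B : ℝ≥0∞}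
    (hK : MeasurableSet K) (hB : ∀ y, G.r y = x → g y ≤ B)
    (hz : ∀ y, G.r y = x → y ∉ K → g y = 0) :
    ∫⁻ y, g y ∂lam.meas x ≤ B * lam.meas x K := by
  calc ∫⁻ y, g y ∂lam.meas x ≤ ∫⁻ y, K.indicator (fun _ => B) y ∂lam.meas x := by
        refine lintegral_mono_ae ?_
        filter_upwards [lam.ae_r_eq x] with y hy
        by_cases hyK : y ∈ K
        · rw [Set.indicator_of_mem hyK]; exact hB y hy
        · rw [hz y hy hyK]; exact zero_le
    _ = B * lam.meas x K := by rw [lintegral_indicator hK, setLIntegral_const]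

theorem norm_integral_le_of_bound {Z : Type*} [NormedAddCommGroup Z] [NormedSpace ℝ Z]
    {x : X} {K : Set Y} {g : Y → Z} {B C : ℝ}
    (hK : MeasurableSet K) (hB0 : 0 ≤ B) (hC : 0 ≤ C) (hm : lam.meas x K ≤ ENNReal.ofReal C)
    (hB : ∀ y, G.r y = x → ‖g y‖ ≤ B) (hz : ∀ y, G.r y = x → y ∉ K → g y = 0) :
    ‖∫ y, g y ∂lam.meas x‖ ≤ B * C := by
  have h := lam.lintegral_le_of_bound (g := fun y => ‖g y‖ₑ) (B := ENNReal.ofReal B) hK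
    (fun y hy => by rw [← ofReal_norm]; exact ENNReal.ofReal_le_ofReal (hB y hy))
    (fun y hy hyK => by simp [hz y hy hyK])
  have h2 := (enorm_integral_le_lintegral_enorm g).trans
    (h.trans (mul_le_mul_right hm _))
  rw [← ENNReal.ofReal_mul hB0, ← ofReal_norm] at h2
  exact (ENNReal.ofReal_le_ofReal_iff (by positivity)).1 h2

/-- Convergence of integrals over moving fibres, for integrands that converge continuously. -/
theorem tendsto_integral (hr : Continuous G.r) {ι : Type*} {l : Filter ι} {p : ι → X} {x : X}
    (hp : Tendsto p l (𝓝 x)) {K : Set Y} (hK : IsCompact K) {k : ι → Y → ℂ} {k₀ : Y → ℂ}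
    (hk : ∀ᶠ i in l, ContinuousOn (k i) {y | G.r y = p i})
    (hz : ∀ᶠ i in l, ∀ y, G.r y = p i → y ∉ K → k i y = 0)
    (hk₀ : ContinuousOn k₀ {y | G.r y = x}) (hz₀ : ∀ y, G.r y = x → y ∉ K → k₀ y = 0)
    (hlim : ∀ y, G.r y = x → Tendsto (fun q : ι × Y => k q.1 q.2)
      ((l ×ˢ 𝓝 y) ⊓ 𝓟 {q | G.r q.2 = p q.1}) (𝓝 (k₀ y))) :
    Tendsto (fun i => ∫ y, k i y ∂lam.meas (p i)) l (𝓝 (∫ y, k₀ y ∂lam.meas x)) := by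
  obtain ⟨H, hH⟩ := exists_compactlySupported_eqOn (isClosed_eq hr continuous_const) hK hk₀ hz₀
  have hHx : ∫ y, k₀ y ∂lam.meas x = ∫ y, H y ∂lam.meas x := by
    refine integral_congr_ae ?_
    filter_upwards [lam.ae_r_eq x] with y hy using (hH y hy).symm
  rw [hHx]
  have hHlim : Tendsto (fun i => ∫ y, H y ∂lam.meas (p i)) l (𝓝 (∫ y, H y ∂lam.meas x)) :=
    ((lam.continuous_integral H).tendsto x).comp hp
  set K' : Set Y := K ∪ tsupport H with hK'def
  have hK' : IsCompact K' := hK.union H.hasCompactSupport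
  obtain ⟨C, hC0, hC⟩ := lam.exists_measure_le hr hK'
  suffices hd : Tendsto (fun i => (∫ y, k i y ∂lam.meas (p i)) - ∫ y, H y ∂lam.meas (p i)) l
      (𝓝 0) by
    have := hd.add hHlim
    simpa using this
  rw [Metric.tendsto_nhds]
  intro ε hε
  set δ : ℝ := ε / (2 * (C + 1)) with hδ
  have hδ0 : 0 < δ := by positivity
  have hunif : ∀ᶠ i in l, ∀ y ∈ K', G.r y = p i → ‖k i y - H y‖ ≤ δ := by
    have hmem : {q : ι × Y | G.r q.2 = p q.1 → ‖k q.1 q.2 - H q.2‖ ≤ δ} ∈ l ×ˢ 𝓝ˢ K' := by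
      refine hK'.mem_prod_nhdsSet_of_forall fun y _ => ?_
      by_cases hy : G.r y = x
      · have h1 : Tendsto (fun q : ι × Y => k q.1 q.2 - H q.2)
            ((l ×ˢ 𝓝 y) ⊓ 𝓟 {q | G.r q.2 = p q.1}) (𝓝 (k₀ y - H y)) :=
          (hlim y hy).sub (((H.continuous.tendsto y).comp tendsto_snd).mono_left inf_le_left)
        rw [hH y hy, sub_self] at h1
        have h2 := h1 (Metric.closedBall_mem_nhds 0 hδ0)
        rw [mem_map, mem_inf_principal] at h2
        filter_upwards [h2] with q hq hq'
        simpa using hq hq'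
      · obtain ⟨U, V, hU, hV, hyU, hxV, hUV⟩ := t2_separation hy
        have h1 : ∀ᶠ q : ι × Y in l ×ˢ 𝓝 y, p q.1 ∈ V :=
          tendsto_fst.eventually (hp.eventually (hV.mem_nhds hxV))
        have h2 : ∀ᶠ q : ι × Y in l ×ˢ 𝓝 y, G.r q.2 ∈ U :=
          tendsto_snd.eventually (hr.continuousAt.eventually (hU.mem_nhds hyU))
        filter_upwards [h1, h2] with q hq1 hq2 hq3
        exact absurd hq1 (fun h => Set.disjoint_left.1 hUV (hq3 ▸ hq2) h)
    have h3 := (eventually_prod_iff).1 hmem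
    obtain ⟨pa, hpa, pb, hpb, h4⟩ := h3
    filter_upwards [hpa] with i hi y hyK hyr
    exact h4 hi (subset_of_mem_nhdsSet hpb hyK) hyr
  filter_upwards [hunif, hk, hz] with i hi hki hzi
  have hi1 := lam.integrable_of_continuousOn hr hK hki hzi
  rw [dist_zero_right, ← integral_sub hi1 (lam.integrable_compactlySupported _ H)]
  have hz' : ∀ y, G.r y = p i → y ∉ K' → k i y - H y = 0 := fun y hy hyK => by
    rw [hzi y hy fun h => hyK (Or.inl h), image_eq_zero_of_notMem_tsupport fun h => hyK (Or.inr h),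
      sub_zero]
  have := lam.norm_integral_le_of_bound hK'.measurableSet hδ0.le hC0 (hC (p i))
    (g := fun y => k i y - H y)
    (fun y hy => by
      by_cases hyK : y ∈ K'
      · exact hi y hyK hy
      · rw [hz' y hy hyK, norm_zero]; exact hδ0.le) hz'
  refine this.trans_lt ?_
  rw [hδ, div_mul_eq_mul_div, div_lt_iff₀ (by positivity)]
  nlinarith

/-- Continuity of integrals over moving fibres. -/
theorem continuousOn_integral (hr : Continuous G.r) {P : Type*} [TopologicalSpace P] {W : Set P}
    {p : P → X} (hp : ContinuousOn p W) {K : Set Y} (hK : IsCompact K) {k : P → Y → ℂ}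
    (hk : ContinuousOn (fun q : P × Y => k q.1 q.2) {q | q.1 ∈ W ∧ G.r q.2 = p q.1})
    (hz : ∀ w ∈ W, ∀ y, G.r y = p w → y ∉ K → k w y = 0) :
    ContinuousOn (fun w => ∫ y, k w y ∂lam.meas (p w)) W := by
  intro w hw
  have hc : ∀ w ∈ W, ContinuousOn (k w) {y | G.r y = p w} := fun w hw =>
    hk.comp (f := fun y => (w, y)) (by fun_prop) fun y hy => ⟨hw, hy⟩
  refine lam.tendsto_integral hr (hp w hw) hK
    (eventually_nhdsWithin_of_forall hc) (eventually_nhdsWithin_of_forall hz) (hc w hw) (hz w hw)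
    fun y hy => ?_
  refine (hk (w, y) ⟨hw, hy⟩).mono_left ?_
  rw [nhdsWithin, nhdsWithin, nhds_prod_eq]
  rw [show {q : P × Y | q.1 ∈ W ∧ G.r q.2 = p q.1} = (Prod.fst ⁻¹' W) ∩ {q | G.r q.2 = p q.1}
    from rfl, ← inf_principal, ← inf_assoc]
  refine inf_le_inf_right _ (le_inf (Filter.prod_mono inf_le_left le_rfl) ?_)
  rw [le_principal_iff]
  exact tendsto_fst.eventually (mem_inf_of_right (mem_principal_self W))

/-- Left invariance, for functions that are continuous on a fibre. -/
theorem integral_mul_left (hr : Continuous G.r) (a : Y) {K : Set Y} (hK : IsCompact K)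
    {k : Y → ℂ} (hk : ContinuousOn k {y | G.r y = G.r a})
    (hz : ∀ y, G.r y = G.r a → y ∉ K → k y = 0) :
    ∫ b, k (G.mul a b) ∂lam.meas (G.s a) = ∫ b, k b ∂lam.meas (G.r a) := by
  obtain ⟨H, hH⟩ := exists_compactlySupported_eqOn (isClosed_eq hr continuous_const) hK hk hz
  have h1 : ∫ b, k b ∂lam.meas (G.r a) = ∫ b, H b ∂lam.meas (G.r a) := by
    refine integral_congr_ae ?_
    filter_upwards [lam.ae_r_eq (G.r a)] with y hy using (hH y hy).symm
  rw [h1, ← lam.left_inv H a]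
  refine integral_congr_ae ?_
  filter_upwards [lam.ae_r_eq (G.s a)] with b hb
  exact (hH _ (G.r_mul _ _ hb.symm)).symm

end GroupoidStr.HaarSystem

namespace AbelianExtension

variable {S X : Type u} [TopologicalSpace S] [T2Space S] [LocallyCompactSpace S]
  [SecondCountableTopology S] [MeasurableSpace S] [BorelSpace S] [TopologicalSpace X]
  (E : AbelianExtension S X)

/-! ### The unit space and the quotient groupoid -/

theorem isEmbedding_one : IsEmbedding E.gpd.one :=
  Function.LeftInverse.isEmbedding (f := E.gpd.r) E.gpd.r_one E.isTop.continuous_r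
    E.isTop.continuous_one

theorem t2Space_base (E : AbelianExtension S X) : T2Space X := E.isEmbedding_one.t2Space

theorem secondCountableTopology_base (E : AbelianExtension S X) : SecondCountableTopology X :=
  E.isEmbedding_one.secondCountableTopology

instance : LocallyCompactSpace E.A.carrier :=
  E.isClosed_A.isClosedEmbedding_subtypeVal.locallyCompactSpace

theorem continuous_r_carrier : Continuous E.A.toGroupoid.r :=
  E.isTop.continuous_r.comp continuous_subtype_val

theorem isOpenMap_r_carrier : IsOpenMap E.A.toGroupoid.r :=
  have := E.t2Space_base
  E.β.isOpenMap_r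

/-- Continuity of the product, in a form that composes. -/
theorem tendsto_mul {ι : Type*} {l : Filter ι} {f g : ι → S} {a b : S}
    (hf : Tendsto f l (𝓝 a)) (hg : Tendsto g l (𝓝 b)) (hab : E.gpd.s a = E.gpd.r b)
    (h : ∀ᶠ i in l, E.gpd.s (f i) = E.gpd.r (g i)) :
    Tendsto (fun i => E.gpd.mul (f i) (g i)) l (𝓝 (E.gpd.mul a b)) := by
  have h1 := E.isTop.continuousOn_mul (a, b) hab
  refine Tendsto.comp (f := fun i => (f i, g i)) h1 (tendsto_nhdsWithin_iff.2 ⟨?_, h⟩)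
  exact hf.prodMk_nhds hg

theorem continuousOn_mul' {P : Type*} [TopologicalSpace P] {W : Set P} {f g : P → S}
    (hf : ContinuousOn f W) (hg : ContinuousOn g W) (h : ∀ w ∈ W, E.gpd.s (f w) = E.gpd.r (g w)) :
    ContinuousOn (fun w => E.gpd.mul (f w) (g w)) W := fun w hw =>
  E.tendsto_mul (hf w hw) (hg w hw) (h w hw) (eventually_nhdsWithin_of_forall h)

theorem continuousOn_inv' {P : Type*} [TopologicalSpace P] {W : Set P} {f : P → S}
    (hf : ContinuousOn f W) : ContinuousOn (fun w => E.gpd.inv (f w)) W :=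
  E.isTop.continuous_inv.comp_continuousOn hf

theorem mul_rel_left {a σ : S} (ha : a ∈ E.A.carrier) (h : E.gpd.s a = E.gpd.r σ) :
    E.A.setoid.r (E.gpd.mul a σ) σ := by
  refine ⟨?_, E.gpd.s_mul _ _ h, ?_⟩
  · rw [E.gpd.r_mul _ _ h, ← h, E.A.isotropy _ ha]
  · rw [E.gpd.mul_inv_cancel_right _ _ h]; exact ha

theorem proj_mul_left {a σ : S} (ha : a ∈ E.A.carrier) (h : E.gpd.s a = E.gpd.r σ) :
    E.A.proj (E.gpd.mul a σ) = E.A.proj σ :=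
  E.A.proj_eq (E.mul_rel_left ha h)

theorem rel_of_proj_eq {σ τ : S} (h : E.A.proj σ = E.A.proj τ) : E.A.setoid.r σ τ :=
  Quotient.exact h

theorem exists_mul_of_rel {σ τ : S} (h : E.A.setoid.r σ τ) :
    ∃ a ∈ E.A.carrier, E.gpd.s a = E.gpd.r τ ∧ E.gpd.r a = E.gpd.r τ ∧ σ = E.gpd.mul a τ := by
  obtain ⟨h1, h2, h3⟩ := h
  have hc : E.gpd.s σ = E.gpd.r (E.gpd.inv τ) := h2.trans (E.gpd.r_inv _).symm
  refine ⟨_, h3, ?_, ?_, (E.gpd.inv_mul_cancel_right _ _ h2).symm⟩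
  · rw [E.gpd.s_mul _ _ hc, E.gpd.s_inv]
  · rw [E.gpd.r_mul _ _ hc, h1]

theorem r_of_proj_eq {σ τ : S} (h : E.A.proj σ = E.A.proj τ) : E.gpd.r σ = E.gpd.r τ :=
  (E.rel_of_proj_eq h).1

theorem s_of_proj_eq {σ τ : S} (h : E.A.proj σ = E.A.proj τ) : E.gpd.s σ = E.gpd.s τ :=
  (E.rel_of_proj_eq h).2.1

theorem quot_r_proj (σ : S) : E.quot.r (E.A.proj σ) = E.gpd.r σ := E.A.r_out_proj σ

theorem quot_s_proj (σ : S) : E.quot.s (E.A.proj σ) = E.gpd.s σ := E.A.s_out_proj σ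

theorem quot_mul_proj {σ τ : S} (h : E.gpd.s σ = E.gpd.r τ) :
    E.quot.mul (E.A.proj σ) (E.A.proj τ) = E.A.proj (E.gpd.mul σ τ) :=
  E.A.proj_eq (E.A.mul_rel (E.A.out_proj σ) (E.A.out_proj τ)
    (by rw [E.A.s_out_proj, E.A.r_out_proj, h]))

theorem quot_inv_proj (σ : S) : E.quot.inv (E.A.proj σ) = E.A.proj (E.gpd.inv σ) :=
  E.A.proj_eq (E.A.inv_rel (E.A.out_proj σ))

theorem isOpenQuotientMap_proj : IsOpenQuotientMap E.A.proj := by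
  refine ⟨Quotient.mk_surjective, continuous_quotient_mk', fun U hU => ?_⟩
  refine isOpen_coinduced.2 ?_
  change IsOpen (E.A.proj ⁻¹' (E.A.proj '' U))
  rw [isOpen_iff_mem_nhds]
  rintro b ⟨u, huU, hub⟩
  obtain ⟨a, ha, has, har, rfl⟩ := E.exists_mul_of_rel (E.rel_of_proj_eq hub.symm)
  have hinv : E.gpd.mul (E.gpd.inv a) (E.gpd.mul a u) = u := E.gpd.inv_mul_cancel_left _ _ has
  have hrab : E.gpd.r (E.gpd.mul a u) = E.gpd.r a := E.gpd.r_mul _ _ has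
  have hcont : Tendsto (fun q : E.A.carrier × S => E.gpd.mul (E.gpd.inv q.1) q.2)
      ((𝓝 ⟨a, ha⟩ ×ˢ 𝓝 (E.gpd.mul a u)) ⊓ 𝓟 {q | E.gpd.r q.1 = E.gpd.r q.2}) (𝓝 u) := by
    have h0 := E.tendsto_mul (l := (𝓝 (⟨a, ha⟩ : E.A.carrier) ×ˢ 𝓝 (E.gpd.mul a u)) ⊓
        𝓟 {q | E.gpd.r q.1 = E.gpd.r q.2})
      (f := fun q => E.gpd.inv q.1) (g := fun q => q.2) (a := E.gpd.inv a) (b := E.gpd.mul a u)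
      (((E.isTop.continuous_inv.comp continuous_subtype_val).tendsto (⟨a, ha⟩ : E.A.carrier)).comp
        (tendsto_fst.mono_left inf_le_left)) (tendsto_snd.mono_left inf_le_left)
      (by rw [E.gpd.s_inv, hrab])
      (by
        refine mem_inf_of_right ?_
        intro q hq
        exact (E.gpd.s_inv _).trans hq)
    rwa [hinv] at h0
  have h1 := hcont (hU.mem_nhds huU)
  rw [mem_map, mem_inf_principal] at h1
  obtain ⟨pa, hpa, pb, hpb, h2⟩ := eventually_prod_iff.1 h1
  have h3 := E.isOpenMap_r_carrier.image_mem_nhds hpa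
  have h4 : E.gpd.r ⁻¹' (E.A.toGroupoid.r '' {x | pa x}) ∈ 𝓝 (E.gpd.mul a u) :=
    E.isTop.continuous_r.continuousAt.preimage_mem_nhds (by rw [hrab]; exact h3)
  filter_upwards [hpb, h4] with b' hb' ⟨a', ha', hra'⟩
  have hra'' : E.gpd.r a'.1 = E.gpd.r b' := hra'
  refine ⟨_, h2 ha' hb' hra', ?_⟩
  exact E.proj_mul_left (E.A.inv_mem _ a'.2) ((E.gpd.s_inv _).trans hra'')

theorem continuous_proj : Continuous E.A.proj := E.isOpenQuotientMap_proj.continuous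

instance : T2Space E.A.Quot := by
  have := E.t2Space_base
  rw [t2Space_iff_of_isOpenQuotientMap E.isOpenQuotientMap_proj]
  have hr := E.isTop.continuous_r
  have hs := E.isTop.continuous_s
  have hC : IsClosed {q : S × S | E.gpd.r q.1 = E.gpd.r q.2 ∧ E.gpd.s q.1 = E.gpd.s q.2} :=
    (isClosed_eq (by fun_prop) (by fun_prop)).inter (isClosed_eq (by fun_prop) (by fun_prop))
  have hm : ContinuousOn (fun q : S × S => E.gpd.mul q.1 (E.gpd.inv q.2))
      {q : S × S | E.gpd.r q.1 = E.gpd.r q.2 ∧ E.gpd.s q.1 = E.gpd.s q.2} :=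
    E.continuousOn_mul' continuousOn_fst (E.continuousOn_inv' continuousOn_snd)
      fun q hq => hq.2.trans (E.gpd.r_inv _).symm
  convert hm.preimage_isClosed_of_isClosed hC E.isClosed_A using 1
  ext ⟨a, b⟩
  constructor
  · intro h
    obtain ⟨h1, h2, h3⟩ := E.rel_of_proj_eq h
    exact ⟨⟨h1, h2⟩, h3⟩
  · rintro ⟨⟨h1, h2⟩, h3⟩
    exact E.A.proj_eq ⟨h1, h2, h3⟩

instance : LocallyCompactSpace E.A.Quot := E.isOpenQuotientMap_proj.locallyCompactSpace

instance : SecondCountableTopology E.A.Quot :=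
  E.isOpenQuotientMap_proj.isQuotientMap.secondCountableTopology E.isOpenQuotientMap_proj.isOpenMap

theorem continuous_quot_r : Continuous E.quot.r := by
  rw [← E.isOpenQuotientMap_proj.continuous_comp_iff]
  exact E.isTop.continuous_r.congr fun σ => (E.quot_r_proj σ).symm

theorem continuous_quot_inv : Continuous E.quot.inv := by
  rw [← E.isOpenQuotientMap_proj.continuous_comp_iff]
  exact (E.continuous_proj.comp E.isTop.continuous_inv).congr fun σ => (E.quot_inv_proj σ).symm

/-- Compact sets lift along open quotient maps from locally compact spaces. -/
theorem _root_.IsOpenQuotientMap.exists_isCompact_image_superset {P Q : Type*}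
    [TopologicalSpace P] [LocallyCompactSpace P] [TopologicalSpace Q] {π : P → Q}
    (hπ : IsOpenQuotientMap π) {K : Set Q} (hK : IsCompact K) :
    ∃ K' : Set P, IsCompact K' ∧ K ⊆ π '' K' := by
  have h : ∀ p : P, ∃ C : Set P, IsCompact C ∧ C ∈ 𝓝 p := fun p => exists_compact_mem_nhds p
  choose C hC hCp using h
  obtain ⟨t, ht⟩ := hK.elim_finite_subcover (fun p : P => π '' interior (C p))
    (fun p => hπ.isOpenMap _ isOpen_interior) (fun q _ => by
      obtain ⟨p, rfl⟩ := hπ.surjective q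
      exact Set.mem_iUnion.2 ⟨p, p, mem_interior_iff_mem_nhds.2 (hCp p), rfl⟩)
  refine ⟨⋃ p ∈ t, C p, t.finite_toSet.isCompact_biUnion fun p _ => hC p, ht.trans ?_⟩
  refine Set.iUnion₂_subset fun p hp => Set.image_mono ?_
  exact interior_subset.trans (Set.subset_biUnion_of_mem (u := fun p => C p) hp)

theorem exists_isCompact_lift {K : Set E.A.Quot} (hK : IsCompact K) :
    ∃ K' : Set S, IsCompact K' ∧ K ⊆ E.A.proj '' K' :=
  E.isOpenQuotientMap_proj.exists_isCompact_image_superset hK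

/-- Products of compact sets of the quotient groupoid lie in compact sets. -/
theorem exists_isCompact_mul {K L : Set E.A.Quot} (hK : IsCompact K) (hL : IsCompact L) :
    ∃ M : Set E.A.Quot, IsCompact M ∧ ∀ σ τ : S, E.gpd.s σ = E.gpd.r τ → E.A.proj σ ∈ K →
      E.A.proj τ ∈ L → E.A.proj (E.gpd.mul σ τ) ∈ M := by
  have := E.t2Space_base
  obtain ⟨K', hK', hKK'⟩ := E.exists_isCompact_lift hK
  obtain ⟨L', hL', hLL'⟩ := E.exists_isCompact_lift hL
  have hcl : IsClosed {q : S × S | E.gpd.s q.1 = E.gpd.r q.2} :=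
    isClosed_eq (E.isTop.continuous_s.comp continuous_fst) (E.isTop.continuous_r.comp continuous_snd)
  have hc := ((hK'.prod hL').inter_right hcl).image_of_continuousOn
    (E.isTop.continuousOn_mul.mono Set.inter_subset_right)
  refine ⟨_, hc.image E.continuous_proj, fun σ τ h hσ hτ => ?_⟩
  obtain ⟨σ', hσ', hσσ'⟩ := hKK' hσ
  obtain ⟨τ', hτ', hττ'⟩ := hLL' hτ
  have h' : E.gpd.s σ' = E.gpd.r τ' := by
    rw [E.s_of_proj_eq hσσ', E.r_of_proj_eq hττ', h]
  refine ⟨_, ⟨(σ', τ'), ⟨⟨hσ', hτ'⟩, h'⟩, rfl⟩, ?_⟩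
  exact E.A.proj_eq (E.A.mul_rel (E.rel_of_proj_eq hσσ') (E.rel_of_proj_eq hττ') h')

/-- Inverses of a compact set of the quotient groupoid form a compact set. -/
theorem exists_isCompact_inv {K : Set E.A.Quot} (hK : IsCompact K) :
    ∃ M : Set E.A.Quot, IsCompact M ∧ ∀ σ : S, E.A.proj σ ∈ K → E.A.proj (E.gpd.inv σ) ∈ M :=
  ⟨_, hK.image E.continuous_quot_inv, fun σ hσ => ⟨_, hσ, E.quot_inv_proj σ⟩⟩

/-- A function of representatives that depends only on classes is continuous on classes. -/
theorem continuousOn_out {P Z : Type*} [TopologicalSpace P] [TopologicalSpace Z] {W : Set P}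
    {p : P → X} {h : P → S → Z}
    (hinv : ∀ w ∈ W, ∀ σ, E.gpd.r σ = p w → h w (E.A.out (E.A.proj σ)) = h w σ)
    (hc : ContinuousOn (fun q : P × S => h q.1 q.2) {q | q.1 ∈ W ∧ E.gpd.r q.2 = p q.1}) :
    ContinuousOn (fun q : P × E.A.Quot => h q.1 (E.A.out q.2))
      {q | q.1 ∈ W ∧ E.quot.r q.2 = p q.1} := by
  refine ContinuousOn.of_comp_isOpenQuotientMap
    (IsOpenQuotientMap.id.prodMap E.isOpenQuotientMap_proj) ?_
  refine (hc.congr ?_).mono ?_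
  · rintro ⟨w, σ⟩ ⟨hw, hσ⟩
    exact hinv w hw σ hσ
  · rintro ⟨w, σ⟩ ⟨hw, hσ⟩
    exact ⟨hw, (E.quot_r_proj σ).symm.trans hσ⟩

end AbelianExtension

/-- Continuity of the product of a topological groupoid, in a form that composes. -/
theorem GroupoidStr.IsTopological.tendsto_mul {S X : Type u} [TopologicalSpace S]
    [TopologicalSpace X] {G : GroupoidStr S X} (hG : G.IsTopological) {ι : Type*} {l : Filter ι}
    {f g : ι → S} {a b : S} (hf : Tendsto f l (𝓝 a)) (hg : Tendsto g l (𝓝 b))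
    (hab : G.s a = G.r b) (h : ∀ᶠ i in l, G.s (f i) = G.r (g i)) :
    Tendsto (fun i => G.mul (f i) (g i)) l (𝓝 (G.mul a b)) := by
  refine Tendsto.comp (f := fun i => (f i, g i)) (hG.continuousOn_mul (a, b) hab)
    (tendsto_nhdsWithin_iff.2 ⟨?_, h⟩)
  exact hf.prodMk_nhds hg

theorem continuous_circle_coe : Continuous ((↑) : Circle → ℂ) := continuous_induced_dom

namespace AbelianExtension

variable {S X : Type u} [TopologicalSpace S] [T2Space S] [LocallyCompactSpace S]
  [SecondCountableTopology S] [MeasurableSpace S] [BorelSpace S] [TopologicalSpace X]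
  (E : AbelianExtension S X)

/-! ### The topology of the dual bundle -/

theorem isTopological_carrier : E.A.toGroupoid.IsTopological where
  continuous_r := E.continuous_r_carrier
  continuous_s := E.isTop.continuous_s.comp continuous_subtype_val
  continuous_one := E.isTop.continuous_one.subtype_mk _
  continuous_inv := (E.isTop.continuous_inv.comp continuous_subtype_val).subtype_mk _
  continuousOn_mul := by
    rw [IsInducing.subtypeVal.continuousOn_iff]
    refine ContinuousOn.congr (f := fun p : E.A.carrier × E.A.carrier => E.gpd.mul p.1 p.2)
      (E.continuousOn_mul' (by fun_prop) (by fun_prop) fun p hp => hp) fun p hp => ?_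
    exact congrArg Subtype.val (dif_pos (show E.gpd.s p.1 = E.gpd.r p.2 from hp))

theorem carrier_mul {a b : E.A.carrier} (h : E.gpd.s a = E.gpd.r b) :
    ((E.A.toGroupoid.mul a b : E.A.carrier) : S) = E.gpd.mul a b :=
  congrArg Subtype.val (dif_pos h)

/-- The Gelfand transform `χ ↦ ∫ f(a) conj(χ(a)) dβ(a)`. -/
def hat (f : C_c(E.A.carrier, ℂ)) (χ : E.Dual) : ℂ :=
  ∫ a, f a * star (χ.eval (a : S) : ℂ) ∂(E.β.meas χ.base)

theorem isInducing_hat : IsInducing (fun (χ : E.Dual) f => E.hat f χ) := ⟨rfl⟩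

theorem continuous_hat (f : C_c(E.A.carrier, ℂ)) : Continuous (E.hat f) :=
  (continuous_apply f).comp E.isInducing_hat.continuous

theorem continuousOn_eval (χ : E.Dual) :
    ContinuousOn (fun a : E.A.carrier => χ.eval (a : S)) {a | E.A.toGroupoid.r a = χ.base} := by
  rw [continuousOn_iff_continuous_domRestrict]
  have h : Continuous fun a : {a : E.A.carrier | E.A.toGroupoid.r a = χ.base} =>
      (⟨a.1.1, a.1.2, a.2⟩ : E.A.Fiber χ.base) :=
    Continuous.subtype_mk (continuous_subtype_val.comp continuous_subtype_val) _
  exact (χ.char.continuous_toFun.comp h).congr fun a => (Dual.eval_of E a.1.2 a.2).symm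

theorem continuousOn_mul_eval (χ : E.Dual) {f : E.A.carrier → ℂ} (hf : Continuous f) :
    ContinuousOn (fun a : E.A.carrier => f a * star (χ.eval (a : S) : ℂ))
      {a | E.A.toGroupoid.r a = χ.base} :=
  hf.continuousOn.mul (continuous_star.comp_continuousOn
    (continuous_circle_coe.comp_continuousOn (E.continuousOn_eval χ)))

theorem integrable_hat (f : C_c(E.A.carrier, ℂ)) (χ : E.Dual) :
    Integrable (fun a : E.A.carrier => f a * star (χ.eval (a : S) : ℂ)) (E.β.meas χ.base) := by
  have := E.t2Space_base
  refine E.β.integrable_of_continuousOn E.continuous_r_carrier f.hasCompactSupport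
    (E.continuousOn_mul_eval χ f.continuous) fun a _ ha => ?_
  rw [image_eq_zero_of_notMem_tsupport ha, zero_mul]

theorem norm_eval (χ : E.Dual) (a : S) : ‖(χ.eval a : ℂ)‖ = 1 := Circle.norm_coe _

theorem exists_norm_hat_le (f : C_c(E.A.carrier, ℂ)) : ∃ C : ℝ, ∀ χ, ‖E.hat f χ‖ ≤ C := by
  have := E.t2Space_base
  obtain ⟨C, hC0, hC⟩ := E.β.exists_measure_le E.continuous_r_carrier f.hasCompactSupport
  obtain ⟨B, hB⟩ := f.continuous.bounded_above_of_compact_support f.hasCompactSupport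
  have hB0 : 0 ≤ max B 0 := le_max_right _ _
  refine ⟨max B 0 * C, fun χ => ?_⟩
  refine E.β.norm_integral_le_of_bound (IsCompact.measurableSet f.hasCompactSupport) hB0 hC0
    (hC _) (fun a _ => ?_) fun a _ ha => ?_
  · rw [norm_mul, norm_star, E.norm_eval, mul_one]
    exact (hB a).trans (le_max_left _ _)
  · rw [image_eq_zero_of_notMem_tsupport ha, zero_mul]

theorem exists_hat_ne_zero (χ : E.Dual) {V : Set E.A.carrier} (hV : IsOpen V)
    (h1 : E.A.toGroupoid.one χ.base ∈ V) :
    ∃ f : C_c(E.A.carrier, ℂ), Function.support f ⊆ V ∧ E.hat f χ ≠ 0 := by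
  have := E.t2Space_base
  obtain ⟨c, hc1, hcc, hcs, hc01⟩ := exists_continuousMap_one_of_isCompact_subset_isOpen
    (isCompact_singleton (x := E.A.toGroupoid.one χ.base)) hV (by simpa using h1)
  obtain ⟨H, hH⟩ := exists_compactlySupported_eqOn (K := tsupport c)
    (k := fun a => (c a : ℂ) * (χ.eval (a : S) : ℂ))
    (isClosed_eq E.continuous_r_carrier (continuous_const (y := χ.base))) hcc
    ((Complex.continuous_ofReal.comp c.continuous).continuousOn.mul
      (continuous_circle_coe.comp_continuousOn (E.continuousOn_eval χ)))
    fun a _ ha => by rw [image_eq_zero_of_notMem_tsupport ha]; simp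
  let f : C_c(E.A.carrier, ℂ) := ⟨⟨fun a => (c a : ℂ) * H a, by fun_prop⟩,
    H.hasCompactSupport.mono (Function.support_mul_subset_right _ _)⟩
  refine ⟨f, ?_, ?_⟩
  · intro a ha
    refine hcs (subset_tsupport _ fun h => ha ?_)
    change (c a : ℂ) * H a = 0
    simp [h]
  · have h2 : E.hat f χ = ((∫ a, c a * c a ∂E.β.meas χ.base : ℝ) : ℂ) := by
      rw [← integral_complex_ofReal]
      refine integral_congr_ae ?_
      filter_upwards [E.β.ae_r_eq χ.base] with a ha
      change (c a : ℂ) * H a * _ = _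
      rw [hH a ha]
      have h3 : (χ.eval (a : S) : ℂ) * star (χ.eval (a : S) : ℂ) = 1 := by
        rw [Complex.star_def, Complex.mul_conj, Circle.normSq_coe, Complex.ofReal_one]
      push_cast
      linear_combination (c a : ℂ) * (c a : ℂ) * h3
    rw [h2]
    have hcc' : HasCompactSupport fun a => c a * c a := by
      refine HasCompactSupport.mono (f := c) hcc fun a ha h => ?_
      simp [h] at ha
    have hci : Integrable (fun a => c a * c a) (E.β.meas χ.base) :=
      (c.continuous.mul c.continuous).integrable_of_hasCompactSupport hcc'
    have : 0 < ∫ a, c a * c a ∂E.β.meas χ.base := by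
      rw [integral_pos_iff_support_of_nonneg (fun a => mul_self_nonneg _) hci]
      refine E.β.pos_of_isOpen _ _ (c.continuous.mul c.continuous).isOpen_support
        ⟨E.A.toGroupoid.one χ.base, ?_, E.A.toGroupoid.r_one _⟩
      have h4 : c (E.A.toGroupoid.one χ.base) = 1 := hc1 (Set.mem_singleton _)
      simp [h4]
    exact_mod_cast this.ne'

theorem exists_mem_of_hat_ne_zero {f : C_c(E.A.carrier, ℂ)} {χ : E.Dual} (h : E.hat f χ ≠ 0) :
    ∃ a ∈ Function.support f, E.A.toGroupoid.r a = χ.base := by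
  by_contra hcon
  push Not at hcon
  refine h (integral_eq_zero_of_ae ?_)
  filter_upwards [E.β.ae_r_eq χ.base] with a ha
  by_contra hne
  exact hcon a (fun h0 => hne (by simp [h0])) ha

theorem continuous_base : Continuous (Dual.base : E.Dual → X) := by
  rw [continuous_iff_continuousAt]
  intro χ U hU
  obtain ⟨V, hVU, hVo, hxV⟩ := mem_nhds_iff.1 hU
  obtain ⟨f, hf, hne⟩ := E.exists_hat_ne_zero χ (hVo.preimage E.continuous_r_carrier)
    (by rw [Set.mem_preimage, E.A.toGroupoid.r_one]; exact hxV)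
  refine mem_map.2 (mem_of_superset ((E.continuous_hat f).continuousAt.eventually_ne hne) fun ψ hψ => ?_)
  obtain ⟨a, ha, hr⟩ := E.exists_mem_of_hat_ne_zero hψ
  have := hf ha
  rw [Set.mem_preimage, hr] at this
  exact hVU this

theorem eval_mul_hat (f : C_c(E.A.carrier, ℂ)) {χ : E.Dual} {a : E.A.carrier}
    (h : E.A.toGroupoid.r a = χ.base) :
    (χ.eval (a : S) : ℂ) * E.hat f χ =
      ∫ b, f (E.A.toGroupoid.mul a b) * star (χ.eval (b : S) : ℂ) ∂(E.β.meas χ.base) := by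
  have := E.t2Space_base
  have hs : E.A.toGroupoid.s a = χ.base := (E.A.isotropy _ a.2).trans h
  have h1 := E.β.integral_mul_left E.continuous_r_carrier a f.hasCompactSupport
    (k := fun b => f b * star (χ.eval (b : S) : ℂ))
    (by rw [h]; exact E.continuousOn_mul_eval χ f.continuous)
    (fun y _ hy => by rw [image_eq_zero_of_notMem_tsupport hy, zero_mul])
  rw [h, hs] at h1
  rw [hat, ← h1, ← integral_const_mul]
  refine integral_congr_ae ?_
  filter_upwards [E.β.ae_r_eq χ.base] with b hb
  have hab : E.gpd.s a = E.gpd.r b := hs.trans hb.symm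
  rw [E.carrier_mul hab, Dual.eval_mul E a.2 b.2 h hb]
  have h3 : (χ.eval (a : S) : ℂ) * star (χ.eval (a : S) : ℂ) = 1 := by
    rw [Complex.star_def, Complex.mul_conj, Circle.normSq_coe, Complex.ofReal_one]
  rw [Circle.coe_mul, star_mul']
  linear_combination (f (E.A.toGroupoid.mul a b) * star (χ.eval (b : S) : ℂ)) * h3

/-- Translates of a Gelfand transform are locally uniformly close to Gelfand transforms. -/
theorem exists_hat_approx (f : C_c(E.A.carrier, ℂ)) (a₀ : E.A.carrier) :
    ∃ F : C_c(E.A.carrier, ℂ), ∀ ε > 0, ∀ᶠ a in 𝓝 a₀, ∀ χ : E.Dual,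
      E.A.toGroupoid.r a = χ.base → ‖(χ.eval (a : S) : ℂ) * E.hat f χ - E.hat F χ‖ ≤ ε := by
  have := E.t2Space_base
  have hT := E.isTopological_carrier
  set M := E.A.toGroupoid with hM
  have hiso : ∀ a : E.A.carrier, M.s a = M.r a := fun a => E.A.isotropy _ a.2
  obtain ⟨K₀, hK₀, hK₀n⟩ := exists_compact_mem_nhds a₀
  have hcl : IsClosed {q : E.A.carrier × E.A.carrier | M.r q.1 = M.r q.2} :=
    isClosed_eq (hT.continuous_r.comp continuous_fst) (hT.continuous_r.comp continuous_snd)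
  have hKc : IsCompact ((fun q : E.A.carrier × E.A.carrier => M.mul (M.inv q.1) q.2) ''
      ((K₀ ×ˢ tsupport f) ∩ {q | M.r q.1 = M.r q.2})) := by
    refine ((hK₀.prod f.hasCompactSupport).inter_right hcl).image_of_continuousOn ?_
    intro q hq
    refine hT.tendsto_mul
      ((hT.continuous_inv.continuousAt.comp continuous_fst.continuousAt).tendsto.mono_left
        nhdsWithin_le_nhds)
      (continuous_snd.continuousAt.tendsto.mono_left nhdsWithin_le_nhds)
      ((M.s_inv _).trans hq.2) (eventually_nhdsWithin_of_forall fun q hq => ?_)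
    exact (M.s_inv _).trans hq.2
  set K := (fun q : E.A.carrier × E.A.carrier => M.mul (M.inv q.1) q.2) ''
      ((K₀ ×ˢ tsupport f) ∩ {q | M.r q.1 = M.r q.2}) with hKdef
  have hzero : ∀ a ∈ K₀, ∀ b, M.r b = M.r a → b ∉ K → f (M.mul a b) = 0 := by
    intro a ha b hb hbK
    by_contra hne
    refine hbK ⟨(a, M.mul a b), ⟨⟨ha, subset_tsupport _ hne⟩, ?_⟩, ?_⟩
    · exact (M.r_mul _ _ ((hiso a).trans hb.symm)).symm
    · exact M.inv_mul_cancel_left _ _ ((hiso a).trans hb.symm)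
  have hmulc : ∀ a b, M.r b = M.r a → Tendsto (fun q : E.A.carrier × E.A.carrier => M.mul q.1 q.2)
      ((𝓝 a ×ˢ 𝓝 b) ⊓ 𝓟 {q | M.r q.2 = M.r q.1}) (𝓝 (M.mul a b)) := fun a b hab =>
    hT.tendsto_mul (tendsto_fst.mono_left inf_le_left) (tendsto_snd.mono_left inf_le_left)
      ((hiso a).trans hab.symm)
      (mem_inf_of_right fun q hq => (hiso q.1).trans (Eq.symm hq))
  have hfa : ∀ a, ContinuousOn (fun b => f (M.mul a b)) {b | M.r b = M.r a} := by
    intro a b hb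
    refine (f.continuous.tendsto _).comp (hT.tendsto_mul tendsto_const_nhds
      (continuousAt_id.tendsto.mono_left nhdsWithin_le_nhds) ((hiso a).trans (Eq.symm hb))
      (eventually_nhdsWithin_of_forall fun q hq => (hiso a).trans (Eq.symm hq)))
  obtain ⟨F, hF⟩ := exists_compactlySupported_eqOn
    (isClosed_eq hT.continuous_r (continuous_const (y := M.r a₀))) hKc (hfa a₀)
    (fun b hb hbK => hzero a₀ (mem_of_mem_nhds hK₀n) b hb hbK)
  refine ⟨F, fun ε hε => ?_⟩
  have hlim := E.β.tendsto_integral (l := 𝓝 a₀) (p := M.r) (x := M.r a₀) hT.continuous_r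
    (hT.continuous_r.tendsto a₀) (K := K ∪ tsupport F) (hKc.union F.hasCompactSupport)
    (k := fun a b => ((‖f (M.mul a b) - F b‖ : ℝ) : ℂ)) (k₀ := fun _ => 0)
    (Eventually.of_forall fun a => Complex.continuous_ofReal.comp_continuousOn
      ((hfa a).sub F.continuous.continuousOn).norm)
    (by
      filter_upwards [hK₀n] with a ha b hb hbK
      rw [hzero a ha b hb fun h => hbK (Or.inl h),
        image_eq_zero_of_notMem_tsupport fun h => hbK (Or.inr h)]
      simp)
    continuousOn_const (fun _ _ _ => rfl)
    (fun b hb => by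
      have h1 : Tendsto (fun q : E.A.carrier × E.A.carrier => f (M.mul q.1 q.2) - F q.2)
          ((𝓝 a₀ ×ˢ 𝓝 b) ⊓ 𝓟 {q | M.r q.2 = M.r q.1}) (𝓝 (f (M.mul a₀ b) - F b)) :=
        ((f.continuous.tendsto _).comp (hmulc a₀ b hb)).sub
          ((F.continuous.tendsto b).comp (tendsto_snd.mono_left inf_le_left))
      rw [hF b hb, sub_self] at h1
      have h2 := (Complex.continuous_ofReal.tendsto _).comp h1.norm
      rwa [norm_zero, Complex.ofReal_zero] at h2)
  simp only [integral_zero] at hlim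
  have hev := hlim (Metric.closedBall_mem_nhds 0 hε)
  filter_upwards [hev, hK₀n] with a ha haK χ hχ
  rw [E.eval_mul_hat f hχ, hat, ← integral_sub]
  · have h1 : ‖∫ b, (f (M.mul a b) * star (χ.eval (b : S) : ℂ) - F b * star (χ.eval (b : S) : ℂ))
        ∂E.β.meas χ.base‖ ≤ ∫ b, ‖f (M.mul a b) - F b‖ ∂E.β.meas χ.base := by
      refine (norm_integral_le_integral_norm _).trans (le_of_eq ?_)
      refine integral_congr_ae (Eventually.of_forall fun b => ?_)
      change ‖_ - _‖ = _
      rw [← sub_mul, norm_mul, norm_star, E.norm_eval, mul_one]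
    refine h1.trans ?_
    have h2 : ‖∫ b, ((‖f (M.mul a b) - F b‖ : ℝ) : ℂ) ∂E.β.meas (M.r a)‖ ≤ ε := by
      simpa using ha
    rw [integral_complex_ofReal, Complex.norm_real, hχ] at h2
    exact (le_abs_self _).trans h2
  · refine E.β.integrable_of_continuousOn hT.continuous_r hKc ?_ fun b hb hbK => ?_
    · exact (hχ ▸ hfa a).mul (continuous_star.comp_continuousOn
        (continuous_circle_coe.comp_continuousOn (E.continuousOn_eval χ)))
    · rw [hzero a haK b (hb.trans hχ.symm) hbK, zero_mul]
  · exact E.integrable_hat F χ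

theorem tendsto_eval_aux {l : Filter E.Dual} {a₀ : E.A.carrier} {f F : C_c(E.A.carrier, ℂ)}
    (hF : ∀ ε > 0, ∀ᶠ a in 𝓝 a₀, ∀ χ : E.Dual,
      E.A.toGroupoid.r a = χ.base → ‖(χ.eval (a : S) : ℂ) * E.hat f χ - E.hat F χ‖ ≤ ε)
    {v w : ℂ} (hw : w ≠ 0) (hfl : Tendsto (E.hat f) l (𝓝 w)) (hFl : Tendsto (E.hat F) l (𝓝 v)) :
    Tendsto (fun q : E.Dual × E.A.carrier => (q.1.eval (q.2 : S) : ℂ))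
      ((l ×ˢ 𝓝 a₀) ⊓ 𝓟 {q | E.A.toGroupoid.r q.2 = q.1.base}) (𝓝 (v / w)) := by
  set N := (l ×ˢ 𝓝 a₀) ⊓ 𝓟 {q : E.Dual × E.A.carrier | E.A.toGroupoid.r q.2 = q.1.base} with hN
  have hf' : Tendsto (fun q : E.Dual × E.A.carrier => E.hat f q.1) N (𝓝 w) :=
    hfl.comp (tendsto_fst.mono_left inf_le_left)
  have hF' : Tendsto (fun q : E.Dual × E.A.carrier => E.hat F q.1) N (𝓝 v) :=
    hFl.comp (tendsto_fst.mono_left inf_le_left)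
  have hd : Tendsto (fun q : E.Dual × E.A.carrier =>
      (q.1.eval (q.2 : S) : ℂ) * E.hat f q.1 - E.hat F q.1) N (𝓝 0) := by
    rw [Metric.tendsto_nhds]
    intro ε hε
    have h1 : ∀ᶠ q in N, E.A.toGroupoid.r q.2 = q.1.base := mem_inf_of_right (mem_principal_self _)
    have h2 : ∀ᶠ q : E.Dual × E.A.carrier in N, ∀ χ : E.Dual, E.A.toGroupoid.r q.2 = χ.base →
        ‖(χ.eval (q.2 : S) : ℂ) * E.hat f χ - E.hat F χ‖ ≤ ε / 2 :=
      (tendsto_snd.mono_left inf_le_left).eventually (hF (ε / 2) (by positivity))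
    filter_upwards [h1, h2] with q hq1 hq2
    rw [dist_zero_right]
    exact (hq2 q.1 hq1).trans_lt (by linarith)
  have h3 := (hd.add hF').div hf' hw
  rw [zero_add] at h3
  refine h3.congr' ?_
  filter_upwards [hf'.eventually_ne hw] with q hq
  simp [hq]

theorem tendsto_eval_carrier (χ : E.Dual) {a : E.A.carrier} (h : E.A.toGroupoid.r a = χ.base) :
    Tendsto (fun q : E.Dual × E.A.carrier => (q.1.eval (q.2 : S) : ℂ))
      ((𝓝 χ ×ˢ 𝓝 a) ⊓ 𝓟 {q | E.A.toGroupoid.r q.2 = q.1.base}) (𝓝 (χ.eval (a : S) : ℂ)) := by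
  obtain ⟨f, -, hf⟩ := E.exists_hat_ne_zero χ isOpen_univ trivial
  obtain ⟨F, hF⟩ := E.exists_hat_approx f a
  have h1 := E.tendsto_eval_aux hF hf ((E.continuous_hat f).tendsto χ)
    ((E.continuous_hat F).tendsto χ)
  have h2 : E.hat F χ = (χ.eval (a : S) : ℂ) * E.hat f χ := by
    have h3 : ‖(χ.eval (a : S) : ℂ) * E.hat f χ - E.hat F χ‖ ≤ 0 :=
      le_of_forall_pos_le_add fun ε hε => by
        rw [zero_add]
        exact (hF ε hε).self_of_nhds χ h
    exact (sub_eq_zero.1 (norm_le_zero_iff.1 h3)).symm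
  rwa [h2, mul_div_cancel_right₀ _ hf] at h1

/-- The pairing of characters and group elements is jointly continuous. -/
theorem tendsto_eval {ι : Type*} {l : Filter ι} {u : ι → E.Dual} {b : ι → S} {χ : E.Dual} {a : S}
    (hu : Tendsto u l (𝓝 χ)) (hb : Tendsto b l (𝓝 a)) (ha : a ∈ E.A.carrier)
    (hr : E.gpd.r a = χ.base)
    (h : ∀ᶠ i in l, b i ∈ E.A.carrier ∧ E.gpd.r (b i) = (u i).base) :
    Tendsto (fun i => ((u i).eval (b i) : ℂ)) l (𝓝 (χ.eval a : ℂ)) := by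
  classical
  let b' : ι → E.A.carrier := fun i => if h : b i ∈ E.A.carrier then ⟨b i, h⟩ else ⟨a, ha⟩
  have hb' : ∀ᶠ i in l, (b' i : S) = b i := by
    filter_upwards [h] with i hi
    simp only [b', dif_pos hi.1]
  have hb'l : Tendsto b' l (𝓝 ⟨a, ha⟩) := by
    rw [tendsto_subtype_rng]
    exact hb.congr' (hb'.mono fun i hi => hi.symm)
  have h1 : Tendsto (fun i => (u i, b' i)) l
      ((𝓝 χ ×ˢ 𝓝 ⟨a, ha⟩) ⊓ 𝓟 {q | E.A.toGroupoid.r q.2 = q.1.base}) := by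
    refine tendsto_inf.2 ⟨hu.prodMk hb'l, tendsto_principal.2 ?_⟩
    filter_upwards [h, hb'] with i hi hi'
    change E.gpd.r (b' i : S) = _
    rw [hi', hi.2]
  refine ((E.tendsto_eval_carrier χ (a := ⟨a, ha⟩) hr).comp h1).congr' ?_
  filter_upwards [hb'] with i hi
  simp only [Function.comp, hi]

/-- Convergence in the dual bundle follows from convergence of base points and continuous
convergence of characters. -/
theorem tendsto_dual_of_eval {ι : Type*} {l : Filter ι} {u : ι → E.Dual} {χ : E.Dual}
    (hb : Tendsto (fun i => (u i).base) l (𝓝 χ.base))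
    (he : ∀ a : E.A.carrier, E.A.toGroupoid.r a = χ.base →
      Tendsto (fun q : ι × E.A.carrier => ((u q.1).eval (q.2 : S) : ℂ))
        ((l ×ˢ 𝓝 a) ⊓ 𝓟 {q | E.A.toGroupoid.r q.2 = (u q.1).base}) (𝓝 (χ.eval (a : S) : ℂ))) :
    Tendsto u l (𝓝 χ) := by
  have := E.t2Space_base
  rw [E.isInducing_hat.tendsto_nhds_iff, tendsto_pi_nhds]
  intro f
  refine E.β.tendsto_integral E.continuous_r_carrier hb f.hasCompactSupport
    (k := fun i a => f a * star ((u i).eval (a : S) : ℂ))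
    (Eventually.of_forall fun i => E.continuousOn_mul_eval (u i) f.continuous)
    (Eventually.of_forall fun i y _ hy => by
      rw [image_eq_zero_of_notMem_tsupport hy, zero_mul])
    (E.continuousOn_mul_eval χ f.continuous)
    (fun y _ hy => by rw [image_eq_zero_of_notMem_tsupport hy, zero_mul]) fun a ha => ?_
  exact ((f.continuous.tendsto a).comp (tendsto_snd.mono_left inf_le_left)).mul
    ((continuous_star.tendsto _).comp (he a ha))

instance : T2Space E.Dual := by
  have := E.t2Space_base
  refine T2Space.of_injective_continuous (f := fun (χ : E.Dual) f => E.hat f χ) ?_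
    E.isInducing_hat.continuous
  intro χ ψ h
  have hh : ∀ f, E.hat f χ = E.hat f ψ := fun f => congrFun h f
  have hb : χ.base = ψ.base := by
    by_contra hne
    obtain ⟨U, V, hU, hV, hxU, hyV, hUV⟩ := t2_separation hne
    obtain ⟨f, hf, hf0⟩ := E.exists_hat_ne_zero χ (hU.preimage E.continuous_r_carrier)
      (by rw [Set.mem_preimage, E.A.toGroupoid.r_one]; exact hxU)
    rw [hh] at hf0
    obtain ⟨a, ha, har⟩ := E.exists_mem_of_hat_ne_zero hf0
    have := hf ha
    rw [Set.mem_preimage, har] at this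
    exact Set.disjoint_left.1 hUV this hyV
  refine Dual.ext' E hb fun a ha har => ?_
  obtain ⟨f, -, hf⟩ := E.exists_hat_ne_zero χ isOpen_univ trivial
  obtain ⟨F, hF⟩ := E.exists_hat_approx f ⟨a, ha⟩
  have h2 : ∀ φ : E.Dual, E.gpd.r a = φ.base → E.hat F φ = (φ.eval a : ℂ) * E.hat f φ := by
    intro φ hφ
    have h3 : ‖(φ.eval a : ℂ) * E.hat f φ - E.hat F φ‖ ≤ 0 :=
      le_of_forall_pos_le_add fun ε hε => by
        rw [zero_add]
        exact (hF ε hε).self_of_nhds φ hφ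
    exact (sub_eq_zero.1 (norm_le_zero_iff.1 h3)).symm
  have h4 := h2 χ har
  rw [hh F, h2 ψ (har.trans hb), ← hh f] at h4
  exact Subtype.ext (mul_right_cancel₀ hf h4).symm

end AbelianExtension

namespace AbelianExtension

variable {S X : Type u} [TopologicalSpace S] [T2Space S] [LocallyCompactSpace S]
  [SecondCountableTopology S] [MeasurableSpace S] [BorelSpace S] [TopologicalSpace X]
  (E : AbelianExtension S X)

/-- Gelfand transforms vanish at infinity. -/
theorem isCompact_le_norm_hat (f : C_c(E.A.carrier, ℂ)) {ε : ℝ} (hε : 0 < ε) :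
    IsCompact {χ : E.Dual | ε ≤ ‖E.hat f χ‖} := by
  have := E.t2Space_base
  have hT := E.isTopological_carrier
  have hclosed : IsClosed {χ : E.Dual | ε ≤ ‖E.hat f χ‖} :=
    isClosed_le continuous_const (E.continuous_hat f).norm
  rw [isCompact_iff_ultrafilter_le_nhds]
  intro U hU
  set M := E.A.toGroupoid with hM
  have hiso : ∀ a : E.A.carrier, M.s a = M.r a := fun a => E.A.isotropy _ a.2
  have hUmem : {χ : E.Dual | ε ≤ ‖E.hat f χ‖} ∈ U := le_principal_iff.1 hU
  obtain ⟨x, -, hx⟩ := (IsCompact.image (s := tsupport f) f.hasCompactSupport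
    hT.continuous_r).ultrafilter_le_nhds (U.map Dual.base) (by
      rw [le_principal_iff, Ultrafilter.coe_map, mem_map]
      filter_upwards [hUmem] with χ hχ
      obtain ⟨a, ha, hr⟩ := E.exists_mem_of_hat_ne_zero
        (norm_pos_iff.1 (hε.trans_le hχ))
      exact ⟨a, subset_tsupport _ ha, hr⟩)
  have hbase : Tendsto (Dual.base : E.Dual → X) U (𝓝 x) := hx
  have hv : ∀ g, ∃ v, Tendsto (E.hat g) U (𝓝 v) := fun g => by
    obtain ⟨C, hC⟩ := E.exists_norm_hat_le g
    obtain ⟨v, -, hv⟩ := (isCompact_closedBall (0 : ℂ) C).ultrafilter_le_nhds (U.map (E.hat g)) (by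
      rw [le_principal_iff, Ultrafilter.coe_map, mem_map]
      exact Eventually.of_forall fun χ => by simpa using hC χ)
    exact ⟨v, hv⟩
  choose v hv using hv
  have hw : v f ≠ 0 := by
    have h1 : ε ≤ ‖v f‖ := ge_of_tendsto (hv f).norm hUmem
    exact norm_pos_iff.1 (hε.trans_le h1)
  choose F hF using fun a => E.exists_hat_approx f a
  set N : E.A.carrier → Filter (E.Dual × E.A.carrier) := fun a =>
    ((U : Filter E.Dual) ×ˢ 𝓝 a) ⊓ 𝓟 {q | M.r q.2 = q.1.base} with hN
  have hlim : ∀ a, Tendsto (fun q : E.Dual × E.A.carrier => (q.1.eval (q.2 : S) : ℂ)) (N a)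
      (𝓝 (v (F a) / v f)) := fun a => E.tendsto_eval_aux (hF a) hw (hv f) (hv (F a))
  have hopen : ∀ a, M.r a = x → ∀ W ∈ 𝓝 a, ∀ᶠ χ in (U : Filter E.Dual), ∃ b ∈ W, M.r b = χ.base :=
    fun a ha W hW => by
      have h1 := E.isOpenMap_r_carrier.image_mem_nhds hW
      rw [show E.A.toGroupoid.r a = x from ha] at h1
      filter_upwards [hbase h1] with χ hχ
      exact hχ
  have hNe : ∀ a, M.r a = x → (N a).NeBot := fun a ha => by
    rw [hN, inf_principal_neBot_iff]
    intro V hV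
    obtain ⟨V₁, hV₁, W, hW, hVW⟩ := mem_prod_iff.1 hV
    obtain ⟨χ, hχ1, b, hb, hbr⟩ :=
      (U.eventually_mem_set.2 hV₁ |>.and (hopen a ha W hW)).exists
    exact ⟨(χ, b), hVW ⟨hχ1, hb⟩, hbr⟩
  have hnorm : ∀ a, M.r a = x → ‖v (F a) / v f‖ = 1 := fun a ha => by
    have := hNe a ha
    refine tendsto_nhds_unique (hlim a).norm ?_
    simp only [E.norm_eval]
    exact tendsto_const_nhds
  have hmul : ∀ a b c : E.A.carrier, M.r a = x → M.r b = x → M.mul a b = c →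
      v (F c) / v f = (v (F a) / v f) * (v (F b) / v f) := by
    intro a b c ha hb hc
    have hc' : M.r c = x := by rw [← hc, M.r_mul _ _ ((hiso a).trans (ha.trans hb.symm)), ha]
    set N₂ : Filter (E.Dual × E.A.carrier × E.A.carrier) :=
      ((U : Filter E.Dual) ×ˢ (𝓝 a ×ˢ 𝓝 b)) ⊓
        𝓟 {q | M.r q.2.1 = q.1.base ∧ M.r q.2.2 = q.1.base} with hN₂
    have hN₂ne : N₂.NeBot := by
      rw [hN₂, inf_principal_neBot_iff]
      intro V hV
      obtain ⟨V₁, hV₁, W, hW, hVW⟩ := mem_prod_iff.1 hV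
      obtain ⟨W₁, hW₁, W₂, hW₂, hWW⟩ := mem_prod_iff.1 hW
      obtain ⟨χ, hχ1, ⟨a', ha', har'⟩, b', hb', hbr'⟩ :=
        (U.eventually_mem_set.2 hV₁ |>.and ((hopen a ha W₁ hW₁).and (hopen b hb W₂ hW₂))).exists
      exact ⟨(χ, a', b'), hVW ⟨hχ1, hWW ⟨ha', hb'⟩⟩, har', hbr'⟩
    have hmem : ∀ᶠ q in N₂, M.r q.2.1 = q.1.base ∧ M.r q.2.2 = q.1.base :=
      mem_inf_of_right (mem_principal_self _)
    have t0 : Tendsto Prod.fst N₂ (U : Filter E.Dual) := tendsto_fst.mono_left inf_le_left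
    have t1 : Tendsto (fun q : E.Dual × E.A.carrier × E.A.carrier => q.2.1) N₂ (𝓝 a) :=
      (tendsto_fst.comp tendsto_snd).mono_left inf_le_left
    have t2 : Tendsto (fun q : E.Dual × E.A.carrier × E.A.carrier => q.2.2) N₂ (𝓝 b) :=
      (tendsto_snd.comp tendsto_snd).mono_left inf_le_left
    have l1 := (hlim a).comp (tendsto_inf.2 ⟨t0.prodMk t1,
      tendsto_principal.2 (hmem.mono fun q hq => hq.1)⟩)
    have l2 := (hlim b).comp (tendsto_inf.2 ⟨t0.prodMk t2,
      tendsto_principal.2 (hmem.mono fun q hq => hq.2)⟩)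
    have hcomp : ∀ q : E.Dual × E.A.carrier × E.A.carrier,
        (M.r q.2.1 = q.1.base ∧ M.r q.2.2 = q.1.base) → M.s q.2.1 = M.r q.2.2 :=
      fun q hq => (hiso _).trans (hq.1.trans hq.2.symm)
    have t3 : Tendsto (fun q : E.Dual × E.A.carrier × E.A.carrier => M.mul q.2.1 q.2.2) N₂
        (𝓝 c) := by
      rw [← hc]
      exact hT.tendsto_mul t1 t2 ((hiso a).trans (ha.trans hb.symm)) (hmem.mono hcomp)
    have l3 := (hlim c).comp (tendsto_inf.2 ⟨t0.prodMk t3, tendsto_principal.2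
      (hmem.mono fun q hq => (M.r_mul _ _ (hcomp q hq)).trans hq.1)⟩)
    refine tendsto_nhds_unique l3 ((l1.mul l2).congr' ?_)
    filter_upwards [hmem] with q hq
    simp only [Function.comp]
    rw [E.carrier_mul (hcomp q hq), Dual.eval_mul E q.2.1.2 q.2.2.2 hq.1 hq.2, Circle.coe_mul]
  have hcont : ContinuousOn (fun a => v (F a) / v f) {a | M.r a = x} := by
    intro a ha
    change Tendsto _ _ _
    rw [(Metric.nhds_basis_closedBall (x := v (F a) / v f)).tendsto_right_iff]
    intro δ hδ
    have h1 := hlim a (Metric.closedBall_mem_nhds _ hδ)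
    rw [mem_map, hN, mem_inf_principal] at h1
    obtain ⟨V₁, hV₁, W, hW, hVW⟩ := mem_prod_iff.1 h1
    obtain ⟨W', hW'W, hW'o, haW'⟩ := mem_nhds_iff.1 hW
    refine eventually_nhdsWithin_iff.2 ?_
    filter_upwards [hW'o.mem_nhds haW'] with b hb hbr
    have := hNe b hbr
    refine Metric.isClosed_closedBall.mem_of_tendsto (hlim b) ?_
    have h2 : ∀ᶠ q : E.Dual × E.A.carrier in N b, q.1 ∈ V₁ :=
      (tendsto_fst.mono_left inf_le_left).eventually hV₁
    have h3 : ∀ᶠ q : E.Dual × E.A.carrier in N b, q.2 ∈ W' :=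
      (tendsto_snd.mono_left inf_le_left).eventually (hW'o.mem_nhds hb)
    have h4 : ∀ᶠ q : E.Dual × E.A.carrier in N b, M.r q.2 = q.1.base :=
      mem_inf_of_right (mem_principal_self _)
    filter_upwards [h2, h3, h4] with q hq2 hq3 hq4
    exact hVW (show q ∈ V₁ ×ˢ W from ⟨hq2, hW'W hq3⟩) hq4
  let χ₀ : E.DualFiber x :=
    { toFun := fun a => ⟨v (F ⟨a.1, a.2.1⟩) / v f, 
        mem_sphere_zero_iff_norm.2 (hnorm ⟨a.1, a.2.1⟩ a.2.2)⟩
      map_one' := by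
        refine Subtype.ext ?_
        have h1 := hmul (M.one x) (M.one x) (M.one x) (M.r_one x) (M.r_one x) (by
          have := M.mul_one (M.one x)
          rwa [M.s_one] at this)
        have h2 : v (F (M.one x)) / v f ≠ 0 := by
          rw [← norm_pos_iff, hnorm _ (M.r_one x)]; exact one_pos
        exact (mul_left_cancel₀ h2 ((mul_one _).trans h1)).symm
      map_mul' := fun a b => by
        refine Subtype.ext ?_
        refine hmul ⟨a.1, a.2.1⟩ ⟨b.1, b.2.1⟩ _ a.2.2 b.2.2 ?_
        exact Subtype.ext (E.carrier_mul (a := ⟨a.1, a.2.1⟩) (b := ⟨b.1, b.2.1⟩)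
          (GroupoidStr.NormalBundle.Fiber.comp E.A a b))
      continuous_toFun := by
        refine Continuous.subtype_mk ?_ _
        have h1 : Continuous fun a : E.A.Fiber x => (⟨a.1, a.2.1⟩ : E.A.carrier) :=
          Continuous.subtype_mk continuous_subtype_val _
        exact hcont.comp_continuous h1 fun a => a.2.2 }
  have hU₀ : (U : Filter E.Dual) ≤ 𝓝 ⟨x, χ₀⟩ := by
    refine E.tendsto_dual_of_eval (u := id) hbase fun a ha => ?_
    have h1 : (((⟨x, χ₀⟩ : E.Dual).eval (a : S) : Circle) : ℂ) = v (F a) / v f := by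
      rw [Dual.eval_of E a.2 ha]; rfl
    rw [h1]
    exact hlim a
  exact ⟨⟨x, χ₀⟩, hclosed.mem_of_tendsto (f := id) hU₀ hUmem, hU₀⟩

instance : LocallyCompactSpace E.Dual := by
  have : WeaklyLocallyCompactSpace E.Dual := ⟨fun χ => by
    obtain ⟨f, -, hf⟩ := E.exists_hat_ne_zero χ isOpen_univ trivial
    refine ⟨_, E.isCompact_le_norm_hat f (half_pos (norm_pos_iff.2 hf)), ?_⟩
    have h := (E.continuous_hat f).norm.continuousAt.eventually
      (lt_mem_nhds (half_lt_self (norm_pos_iff.2 hf)))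
    exact h.mono fun ψ hψ => le_of_lt hψ⟩
  infer_instance

/-- The character underlying a point of the dual bundle over `x`. -/
def Dual.charAt {E : AbelianExtension S X} (χ : E.Dual) {x : X} (h : χ.base = x) :
    E.DualFiber x := h ▸ χ.char

theorem mk_charAt (χ : E.Dual) {x : X} (h : χ.base = x) : (⟨x, χ.charAt h⟩ : E.Dual) = χ := by
  subst h; rfl

theorem charAt_apply (χ : E.Dual) {x : X} (h : χ.base = x) (a : E.A.Fiber x) :
    χ.charAt h a = χ.eval a.1 := by
  subst h
  exact (Dual.eval_of E a.2.1 a.2.2).symm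

instance (x : X) : LocallyCompactSpace (E.A.Fiber x) := by
  have := E.t2Space_base
  have h : IsClosed {a : S | a ∈ E.A.carrier ∧ E.gpd.r a = x} :=
    E.isClosed_A.inter (isClosed_eq E.isTop.continuous_r continuous_const)
  exact h.isClosedEmbedding_subtypeVal.locallyCompactSpace

theorem continuous_dual_mk (x : X) : Continuous fun c : E.DualFiber x => (⟨x, c⟩ : E.Dual) := by
  rw [continuous_iff_continuousAt]
  intro c
  refine E.tendsto_dual_of_eval tendsto_const_nhds fun a ha => ?_
  have hev : Continuous fun q : E.DualFiber x × E.A.Fiber x => ((q.1 q.2 : Circle) : ℂ) :=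
    continuous_circle_coe.comp (continuous_fst.eval continuous_snd)
  have h1 : Tendsto (fun q : E.DualFiber x × E.A.carrier => ((⟨x, q.1⟩ : E.Dual).eval q.2 : ℂ))
      (𝓝[{q | E.A.toGroupoid.r q.2 = x}] (c, a)) (𝓝 ((⟨x, c⟩ : E.Dual).eval (a : S) : ℂ)) := by
    have h2 : ContinuousOn
        (fun q : E.DualFiber x × E.A.carrier => ((⟨x, q.1⟩ : E.Dual).eval q.2 : ℂ))
        {q | E.A.toGroupoid.r q.2 = x} := by
      rw [continuousOn_iff_continuous_domRestrict]
      have h3 : Continuous fun q : {q : E.DualFiber x × E.A.carrier | E.A.toGroupoid.r q.2 = x} =>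
          (q.1.1, (⟨q.1.2.1, q.1.2.2, q.2⟩ : E.A.Fiber x)) :=
        (continuous_fst.comp continuous_subtype_val).prodMk (Continuous.subtype_mk
          (continuous_subtype_val.comp (continuous_snd.comp continuous_subtype_val)) _)
      refine (hev.comp h3).congr fun q => ?_
      change _ = (((⟨x, q.1.1⟩ : E.Dual).eval (q.1.2 : S) : Circle) : ℂ)
      rw [Dual.eval_of E (χ := ⟨x, q.1.1⟩) q.1.2.2 q.2]
      rfl
    exact h2 (c, a) ha
  rwa [nhdsWithin, nhds_prod_eq] at h1

/-- The fibres of the dual bundle are closed subspaces. -/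
theorem isClosedEmbedding_dual_mk (x : X) :
    IsClosedEmbedding fun c : E.DualFiber x => (⟨x, c⟩ : E.Dual) := by
  have := E.t2Space_base
  let Z := {χ : E.Dual // χ.base = x}
  have hZ : IsClosed {χ : E.Dual | χ.base = x} := isClosed_eq E.continuous_base continuous_const
  let j : E.DualFiber x → Z := fun c => ⟨⟨x, c⟩, rfl⟩
  let g : Z → E.DualFiber x := fun χ => χ.1.charAt χ.2
  have hg : Continuous g := by
    refine ContinuousMonoidHom.continuous_of_continuous_uncurry g ?_
    refine continuous_induced_rng.2 ?_
    rw [continuous_iff_continuousAt]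
    rintro ⟨χ, a⟩
    have h1 : ∀ q : Z × E.A.Fiber x, ((g q.1 q.2 : Circle) : ℂ) = (q.1.1.eval q.2.1 : ℂ) :=
      fun q => by rw [E.charAt_apply]
    have h2 : Tendsto (fun q : Z × E.A.Fiber x => (q.1.1.eval q.2.1 : ℂ)) (𝓝 (χ, a))
        (𝓝 (χ.1.eval a.1 : ℂ)) :=
      E.tendsto_eval
        ((continuous_subtype_val.comp continuous_fst).tendsto (χ, a))
        ((continuous_subtype_val.comp continuous_snd).tendsto (χ, a)) a.2.1 (a.2.2.trans χ.2.symm)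
        (Eventually.of_forall fun q => ⟨q.2.2.1, q.2.2.2.trans q.1.2.symm⟩)
    rw [← h1 (χ, a)] at h2
    exact h2.congr fun q => (h1 q).symm
  have hj : IsEmbedding j := Function.LeftInverse.isEmbedding (f := g) (fun c => rfl) hg
    ((E.continuous_dual_mk x).subtype_mk _)
  have hjr : IsClosed (Set.range j) := by
    have : Set.range j = Set.univ := Set.eq_univ_of_forall fun χ =>
      ⟨χ.1.charAt χ.2, Subtype.ext (E.mk_charAt χ.1 χ.2)⟩
    rw [this]; exact isClosed_univ
  exact hZ.isClosedEmbedding_subtypeVal.comp ⟨hj, hjr⟩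

/-- The action of the groupoid on the dual bundle is continuous. -/
theorem tendsto_sact {ι : Type*} {l : Filter ι} {u : ι → E.Dual} {t : ι → S} {χ : E.Dual} {τ : S}
    (hu : Tendsto u l (𝓝 χ)) (ht : Tendsto t l (𝓝 τ)) (h : χ.base = E.gpd.r τ)
    (hev : ∀ᶠ i in l, (u i).base = E.gpd.r (t i)) :
    Tendsto (fun i => E.sact (u i) (t i)) l (𝓝 (E.sact χ τ)) := by
  refine E.tendsto_dual_of_eval ?_ fun a ha => ?_
  · rw [E.base_sact h]
    refine ((E.isTop.continuous_s.tendsto τ).comp ht).congr' ?_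
    filter_upwards [hev] with i hi
    rw [E.base_sact hi]; rfl
  · set N := (l ×ˢ 𝓝 a) ⊓ 𝓟 {q : ι × E.A.carrier | E.A.toGroupoid.r q.2 =
      (E.sact (u q.1) (t q.1)).base} with hN
    have t0 : Tendsto (fun q : ι × E.A.carrier => q.1) N l := tendsto_fst.mono_left inf_le_left
    have t1 : Tendsto (fun q : ι × E.A.carrier => (q.2 : S)) N (𝓝 (a : S)) :=
      (continuous_subtype_val.tendsto a).comp (tendsto_snd.mono_left inf_le_left)
    have hr : E.gpd.r (a : S) = E.gpd.s τ := Eq.trans ha (E.base_sact h)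
    have e0 : ∀ᶠ q in N, (u q.1).base = E.gpd.r (t q.1) := t0.eventually hev
    have e1 : ∀ᶠ q in N, E.gpd.r (q.2 : S) = E.gpd.s (t q.1) := by
      have e2 : ∀ᶠ q in N, E.A.toGroupoid.r q.2 = (E.sact (u q.1) (t q.1)).base :=
        mem_inf_of_right (mem_principal_self _)
      filter_upwards [e0, e2] with q h0 h2
      rw [E.base_sact h0] at h2
      exact h2
    have t2 : Tendsto (fun q : ι × E.A.carrier => E.gpd.mul (t q.1) q.2) N
        (𝓝 (E.gpd.mul τ a)) :=
      E.tendsto_mul (ht.comp t0) t1 hr.symm (e1.mono fun q hq => hq.symm)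
    have hc : ∀ (σ : S) (b : E.A.carrier), E.gpd.r (b : S) = E.gpd.s σ →
        E.gpd.s (E.gpd.mul σ b) = E.gpd.r (E.gpd.inv σ) := fun σ b hb => by
      rw [E.gpd.s_mul _ _ hb.symm, E.gpd.r_inv, E.A.isotropy _ b.2, hb]
    have t3 : Tendsto (fun q : ι × E.A.carrier =>
        E.gpd.mul (E.gpd.mul (t q.1) q.2) (E.gpd.inv (t q.1))) N
        (𝓝 (E.gpd.mul (E.gpd.mul τ a) (E.gpd.inv τ))) :=
      E.tendsto_mul t2 ((E.isTop.continuous_inv.tendsto τ).comp (ht.comp t0)) (hc τ a hr)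
        (e1.mono fun q hq => hc _ _ hq)
    rw [E.eval_sact h a.2 hr]
    refine (E.tendsto_eval (hu.comp t0) t3 (E.A.conj_mem _ _ a.2 hr.symm)
      ((E.r_conj a.2 hr.symm).trans h.symm) ?_).congr' ?_
    · filter_upwards [e0, e1] with q h0 h1
      exact ⟨E.A.conj_mem _ _ q.2.2 h1.symm, (E.r_conj q.2.2 h1.symm).trans h0.symm⟩
    · filter_upwards [e0, e1] with q h0 h1
      rw [E.eval_sact h0 q.2.2 h1]; rfl

theorem continuousOn_sact {P : Type*} [TopologicalSpace P] {W : Set P} {u : P → E.Dual}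
    {t : P → S} (hu : ContinuousOn u W) (ht : ContinuousOn t W)
    (h : ∀ w ∈ W, (u w).base = E.gpd.r (t w)) :
    ContinuousOn (fun w => E.sact (u w) (t w)) W := fun w hw =>
  E.tendsto_sact (hu w hw) (ht w hw) (h w hw) (eventually_nhdsWithin_of_forall h)

end AbelianExtension

namespace AbelianExtension

variable {S X : Type u} [TopologicalSpace S] [T2Space S] [LocallyCompactSpace S]
  [SecondCountableTopology S] [MeasurableSpace S] [BorelSpace S] [TopologicalSpace X]
  (E : AbelianExtension S X)

/-! ### Sections as functions of a character and an arrow -/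

/-- A section of the Fell bundle, as a function of a character and an arrow: continuous,
equivariant, supported over a compact subset of the quotient groupoid and vanishing at infinity. -/
structure IsSection (φ : E.Dual → S → ℂ) : Prop where
  continuousOn : ContinuousOn (fun q : E.Dual × S => φ q.1 q.2) {q | q.1.base = E.gpd.r q.2}
  equivariant : ∀ a ∈ E.A.carrier, ∀ χ σ, E.gpd.s a = E.gpd.r σ → Dual.base χ = E.gpd.r σ →
    φ χ (E.gpd.mul a σ) = (χ.eval a : ℂ) * φ χ σ
  exists_support : ∃ K : Set E.A.Quot, IsCompact K ∧
    ∀ χ σ, Dual.base χ = E.gpd.r σ → φ χ σ ≠ 0 → E.A.proj σ ∈ K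
  vanishing : ∀ ε > 0, ∃ L : Set E.Dual, IsCompact L ∧
    ∀ χ σ, Dual.base χ = E.gpd.r σ → ε ≤ ‖φ χ σ‖ → χ ∈ L
  eq_zero : ∀ χ σ, Dual.base χ ≠ E.gpd.r σ → φ χ σ = 0

/-- A section with compact support. -/
structure IsCSection (φ : E.Dual → S → ℂ) : Prop extends E.IsSection φ where
  exists_support_dual : ∃ L : Set E.Dual, IsCompact L ∧
    ∀ χ σ, Dual.base χ = E.gpd.r σ → φ χ σ ≠ 0 → χ ∈ L

/-- The translate `ψ(χ · τ, τ⁻¹σ)`. -/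
def tr (ψ : E.Dual → S → ℂ) (χ : E.Dual) (τ σ : S) : ℂ :=
  ψ (E.sact χ τ) (E.gpd.mul (E.gpd.inv τ) σ)

theorem r_inv_mul {τ σ : S} (h : E.gpd.r τ = E.gpd.r σ) :
    E.gpd.r (E.gpd.mul (E.gpd.inv τ) σ) = E.gpd.s τ := by
  rw [E.gpd.r_mul _ _ ((E.gpd.s_inv τ).trans h), E.gpd.r_inv]

theorem s_inv_mul {τ σ : S} (h : E.gpd.r τ = E.gpd.r σ) :
    E.gpd.s (E.gpd.mul (E.gpd.inv τ) σ) = E.gpd.s σ :=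
  E.gpd.s_mul _ _ ((E.gpd.s_inv τ).trans h)

theorem base_sact_inv_mul {χ : E.Dual} {τ σ : S} (hτ : χ.base = E.gpd.r τ)
    (hσ : χ.base = E.gpd.r σ) : (E.sact χ τ).base = E.gpd.r (E.gpd.mul (E.gpd.inv τ) σ) := by
  rw [E.base_sact hτ, E.r_inv_mul (hτ.symm.trans hσ)]

theorem base_sact_inv {χ : E.Dual} {τ : S} (hτ : χ.base = E.gpd.r τ) :
    (E.sact χ τ).base = E.gpd.r (E.gpd.inv τ) := by
  rw [E.base_sact hτ, E.gpd.r_inv]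

theorem sact_sact_inv {χ : E.Dual} {τ : S} (hτ : χ.base = E.gpd.r τ) :
    E.sact (E.sact χ τ) (E.gpd.inv τ) = χ := by
  rw [← E.sact_mul hτ (E.gpd.r_inv τ).symm, E.gpd.mul_inv,
    E.sact_of_mem (E.A.one_mem _) (by rw [E.gpd.r_one, hτ])]

theorem inv_mul_one {τ : S} {x : X} (h : E.gpd.r τ = x) :
    E.gpd.mul (E.gpd.inv τ) (E.gpd.one x) = E.gpd.inv τ := by
  rw [← h, ← E.gpd.s_inv, E.gpd.mul_one]

theorem tr_one (ψ : E.Dual → S → ℂ) {χ : E.Dual} {τ : S} (h : χ.base = E.gpd.r τ) :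
    E.tr ψ χ τ (E.gpd.one χ.base) = ψ (E.sact χ τ) (E.gpd.inv τ) := by
  rw [tr, E.inv_mul_one h.symm]

theorem exists_out_proj (σ : S) : ∃ a ∈ E.A.carrier, E.gpd.s a = E.gpd.r σ ∧
    E.gpd.r a = E.gpd.r σ ∧ E.A.out (E.A.proj σ) = E.gpd.mul a σ :=
  E.exists_mul_of_rel (E.A.out_proj σ)

theorem star_coe_circle (z : Circle) : star (z : ℂ) = ((z⁻¹ : Circle) : ℂ) :=
  (Circle.coe_inv_eq_conj z).symm

namespace IsSection

variable {E} {φ ψ : E.Dual → S → ℂ}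

theorem continuousOn_comp (hφ : E.IsSection φ) {P : Type*} [TopologicalSpace P] {W : Set P}
    {u : P → E.Dual} {t : P → S} (hu : ContinuousOn u W) (ht : ContinuousOn t W)
    (h : ∀ w ∈ W, (u w).base = E.gpd.r (t w)) : ContinuousOn (fun w => φ (u w) (t w)) W :=
  hφ.continuousOn.comp (f := fun w => (u w, t w)) (hu.prodMk ht) h

theorem norm_mul_left (hφ : E.IsSection φ) {a : S} (ha : a ∈ E.A.carrier) {χ : E.Dual} {σ : S}
    (h : E.gpd.s a = E.gpd.r σ) (hχ : χ.base = E.gpd.r σ) :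
    ‖φ χ (E.gpd.mul a σ)‖ = ‖φ χ σ‖ := by
  rw [hφ.equivariant a ha χ σ h hχ, norm_mul, E.norm_eval, one_mul]

theorem norm_congr (hφ : E.IsSection φ) {χ : E.Dual} {σ τ : S} (h : E.A.proj σ = E.A.proj τ)
    (hχ : χ.base = E.gpd.r τ) : ‖φ χ σ‖ = ‖φ χ τ‖ := by
  obtain ⟨a, ha, hs, -, rfl⟩ := E.exists_mul_of_rel (E.rel_of_proj_eq h)
  exact hφ.norm_mul_left ha hs hχ

theorem exists_bound (hφ : E.IsSection φ) : ∃ B : ℝ, 0 ≤ B ∧ ∀ χ σ, ‖φ χ σ‖ ≤ B := by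
  have := E.t2Space_base
  obtain ⟨K, hK, hKφ⟩ := hφ.exists_support
  obtain ⟨L, hL, hLφ⟩ := hφ.vanishing 1 one_pos
  obtain ⟨K', hK', hKK'⟩ := E.exists_isCompact_lift hK
  have hcl : IsClosed {q : E.Dual × S | q.1.base = E.gpd.r q.2} :=
    isClosed_eq (E.continuous_base.comp continuous_fst) (E.isTop.continuous_r.comp continuous_snd)
  have hc := ((hL.prod hK').inter_right hcl).image_of_continuousOn
    (hφ.continuousOn.norm.mono Set.inter_subset_right)
  obtain ⟨B, hB⟩ := hc.bddAbove
  refine ⟨max B 1, le_max_of_le_right zero_le_one, fun χ σ => ?_⟩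
  by_cases h : χ.base = E.gpd.r σ
  · by_cases h1 : 1 ≤ ‖φ χ σ‖
    · have hne : φ χ σ ≠ 0 := norm_pos_iff.1 (one_pos.trans_le h1)
      obtain ⟨τ, hτ, hτσ⟩ := hKK' (hKφ χ σ h hne)
      have hχτ : χ.base = E.gpd.r τ := h.trans (E.r_of_proj_eq hτσ).symm
      rw [← hφ.norm_congr hτσ h]
      exact le_max_of_le_left (hB ⟨(χ, τ), ⟨⟨hLφ χ σ h h1, hτ⟩, hχτ⟩, rfl⟩)
    · exact le_max_of_le_right (not_le.1 h1).le
  · rw [hφ.eq_zero χ σ h, norm_zero]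
    exact le_max_of_le_right zero_le_one

theorem tr_mul_right (hψ : E.IsSection ψ) {χ : E.Dual} {a τ σ : S} (ha : a ∈ E.A.carrier)
    (hs : E.gpd.s a = E.gpd.r σ) (hτ : χ.base = E.gpd.r τ) (hσ : χ.base = E.gpd.r σ) :
    E.tr ψ χ τ (E.gpd.mul a σ) = (χ.eval a : ℂ) * E.tr ψ χ τ σ := by
  have hra : E.gpd.r a = E.gpd.r τ := by rw [← E.A.isotropy a ha, hs, ← hσ, hτ]
  have h1 : E.gpd.s (E.gpd.inv τ) = E.gpd.r a := (E.gpd.s_inv τ).trans hra.symm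
  have hb := E.A.conj_mem (E.gpd.inv τ) a ha h1
  have hsb : E.gpd.s (E.gpd.mul (E.gpd.inv τ) a) = E.gpd.r τ := by
    rw [E.gpd.s_mul _ _ h1, E.A.isotropy a ha, hra]
  rw [E.gpd.inv_inv] at hb
  have hσ' : E.gpd.s τ = E.gpd.r (E.gpd.mul (E.gpd.inv τ) σ) :=
    (E.r_inv_mul (hτ.symm.trans hσ)).symm
  have hrw : E.gpd.mul (E.gpd.inv τ) (E.gpd.mul a σ) =
      E.gpd.mul (E.gpd.mul (E.gpd.mul (E.gpd.inv τ) a) τ) (E.gpd.mul (E.gpd.inv τ) σ) := by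
    rw [E.gpd.assoc _ τ _ hsb hσ', E.gpd.mul_inv_cancel_left _ _ (hτ.symm.trans hσ),
      E.gpd.assoc _ _ _ h1 hs]
  have hsm : E.gpd.s (E.gpd.mul (E.gpd.mul (E.gpd.inv τ) a) τ) = E.gpd.s τ :=
    E.gpd.s_mul _ _ hsb
  have hrb : E.gpd.r (E.gpd.mul (E.gpd.mul (E.gpd.inv τ) a) τ) = E.gpd.s τ := by
    rw [← E.A.isotropy _ hb, hsm]
  rw [tr, hrw, hψ.equivariant _ hb _ _ (hsm.trans hσ') (E.base_sact_inv_mul hτ hσ),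
    E.eval_sact hτ hb hrb]
  have hconj : E.gpd.mul (E.gpd.mul τ (E.gpd.mul (E.gpd.mul (E.gpd.inv τ) a) τ)) (E.gpd.inv τ)
      = a := by
    rw [E.gpd.assoc _ _ _ h1 (hsb ▸ (E.gpd.s_mul _ _ h1).symm), E.gpd.mul_inv_cancel_left,
      E.gpd.mul_inv_cancel_right]
    · rw [E.A.isotropy a ha, hra]
    · rw [E.gpd.r_mul _ _ (by rw [E.A.isotropy a ha, hra]), hra]
  rw [hconj, tr]

theorem tr_mul_left (hψ : E.IsSection ψ) {χ : E.Dual} {a τ σ : S} (ha : a ∈ E.A.carrier)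
    (hs : E.gpd.s a = E.gpd.r τ) (hτ : χ.base = E.gpd.r τ) (hσ : χ.base = E.gpd.r σ) :
    E.tr ψ χ (E.gpd.mul a τ) σ = star (χ.eval a : ℂ) * E.tr ψ χ τ σ := by
  have hra : E.gpd.r a = χ.base := by rw [← E.A.isotropy a ha, hs, hτ]
  have h1 : E.gpd.s (E.gpd.inv τ) = E.gpd.r (E.gpd.inv a) := by
    rw [E.gpd.s_inv, E.gpd.r_inv, hs]
  have h2 : E.gpd.s (E.gpd.inv a) = E.gpd.r σ := by rw [E.gpd.s_inv, hra, hσ]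
  have h3 : E.tr ψ χ (E.gpd.mul a τ) σ = E.tr ψ χ τ (E.gpd.mul (E.gpd.inv a) σ) := by
    rw [tr, tr, E.sact_rel hτ (E.mul_rel_left ha hs), E.gpd.mul_inv_rev _ _ hs,
      E.gpd.assoc _ _ _ h1 h2]
  rw [h3, hψ.tr_mul_right (E.A.inv_mem a ha) h2 hτ hσ, Dual.eval_inv E ha hra, star_coe_circle]

theorem tr_out (hψ : E.IsSection ψ) {χ : E.Dual} {τ σ : S} (hτ : χ.base = E.gpd.r τ)
    (hσ : χ.base = E.gpd.r σ) :
    ‖E.tr ψ χ (E.A.out (E.A.proj τ)) σ‖ = ‖E.tr ψ χ τ σ‖ := by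
  obtain ⟨a, ha, hs, -, h⟩ := E.exists_out_proj τ
  rw [h, hψ.tr_mul_left ha hs hτ hσ, norm_mul, norm_star, E.norm_eval, one_mul]

theorem mul_tr_out (hφ : E.IsSection φ) (hψ : E.IsSection ψ) {χ : E.Dual} {τ σ : S}
    (hτ : χ.base = E.gpd.r τ) (hσ : χ.base = E.gpd.r σ) :
    φ χ (E.A.out (E.A.proj τ)) * E.tr ψ χ (E.A.out (E.A.proj τ)) σ = φ χ τ * E.tr ψ χ τ σ := by
  obtain ⟨a, ha, hs, -, h⟩ := E.exists_out_proj τ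
  rw [h, hψ.tr_mul_left ha hs hτ hσ, hφ.equivariant a ha χ τ hs hτ]
  have h3 : (χ.eval a : ℂ) * star (χ.eval a : ℂ) = 1 := by
    rw [Complex.star_def, Complex.mul_conj, Circle.normSq_coe, Complex.ofReal_one]
  linear_combination (φ χ τ * E.tr ψ χ τ σ) * h3

theorem continuousOn_tr (hψ : E.IsSection ψ) {P : Type*} [TopologicalSpace P] {W : Set P}
    {u : P → E.Dual} {t v : P → S} (hu : ContinuousOn u W) (ht : ContinuousOn t W)
    (hv : ContinuousOn v W) (h : ∀ w ∈ W, (u w).base = E.gpd.r (t w))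
    (h' : ∀ w ∈ W, (u w).base = E.gpd.r (v w)) :
    ContinuousOn (fun w => E.tr ψ (u w) (t w) (v w)) W :=
  hψ.continuousOn_comp (E.continuousOn_sact hu ht h)
    (E.continuousOn_mul' (E.continuousOn_inv' ht) hv
      fun w hw => (E.gpd.s_inv _).trans ((h w hw).symm.trans (h' w hw)))
    fun w hw => E.base_sact_inv_mul (h w hw) (h' w hw)

theorem zero : E.IsSection (0 : E.Dual → S → ℂ) where
  continuousOn := continuousOn_const
  equivariant := by simp
  exists_support := ⟨∅, isCompact_empty, by simp⟩
  vanishing := fun ε hε => ⟨∅, isCompact_empty, fun χ σ _ h => absurd h (by simpa using hε)⟩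
  eq_zero := by simp

theorem add (hφ : E.IsSection φ) (hψ : E.IsSection ψ) : E.IsSection (φ + ψ) where
  continuousOn := hφ.continuousOn.add hψ.continuousOn
  equivariant a ha χ σ hs hχ := by
    simp only [Pi.add_apply, hφ.equivariant a ha χ σ hs hχ, hψ.equivariant a ha χ σ hs hχ, mul_add]
  exists_support := by
    obtain ⟨K, hK, hK'⟩ := hφ.exists_support
    obtain ⟨L, hL, hL'⟩ := hψ.exists_support
    refine ⟨K ∪ L, hK.union hL, fun χ σ hχ h => ?_⟩
    by_cases h1 : φ χ σ = 0
    · refine Or.inr (hL' χ σ hχ fun h2 => h ?_)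
      simp [h1, h2]
    · exact Or.inl (hK' χ σ hχ h1)
  vanishing ε hε := by
    obtain ⟨K, hK, hK'⟩ := hφ.vanishing (ε / 2) (by positivity)
    obtain ⟨L, hL, hL'⟩ := hψ.vanishing (ε / 2) (by positivity)
    refine ⟨K ∪ L, hK.union hL, fun χ σ hχ h => ?_⟩
    by_contra hc
    rw [Set.mem_union, not_or] at hc
    have h1 : ‖φ χ σ‖ < ε / 2 := not_le.1 fun h => hc.1 (hK' χ σ hχ h)
    have h2 : ‖ψ χ σ‖ < ε / 2 := not_le.1 fun h => hc.2 (hL' χ σ hχ h)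
    have h3 : ‖φ χ σ + ψ χ σ‖ ≤ _ := norm_add_le _ _
    have h4 : ε ≤ ‖φ χ σ + ψ χ σ‖ := h
    linarith
  eq_zero χ σ h := by simp [hφ.eq_zero χ σ h, hψ.eq_zero χ σ h]

/-- Multiplication by a bounded continuous function on the dual bundle. -/
theorem mulDual (hφ : E.IsSection φ) {θ : E.Dual → ℂ} (hθ : Continuous θ) {B : ℝ}
    (hB : ∀ χ, ‖θ χ‖ ≤ B) : E.IsSection (fun χ σ => θ χ * φ χ σ) where
  continuousOn := (hθ.comp continuous_fst).continuousOn.mul hφ.continuousOn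
  equivariant a ha χ σ hs hχ := by
    rw [hφ.equivariant a ha χ σ hs hχ]; ring
  exists_support := by
    obtain ⟨K, hK, hK'⟩ := hφ.exists_support
    exact ⟨K, hK, fun χ σ hχ h => hK' χ σ hχ (right_ne_zero_of_mul h)⟩
  vanishing ε hε := by
    obtain ⟨L, hL, hL'⟩ := hφ.vanishing (ε / (|B| + 1)) (by positivity)
    refine ⟨L, hL, fun χ σ hχ h => hL' χ σ hχ ?_⟩
    rw [div_le_iff₀ (by positivity)]
    rw [norm_mul] at h
    have h1 : ‖θ χ‖ ≤ |B| + 1 := (hB χ).trans ((le_abs_self B).trans (by linarith))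
    nlinarith [norm_nonneg (φ χ σ)]
  eq_zero χ σ h := by rw [hφ.eq_zero χ σ h, mul_zero]

theorem smul (hφ : E.IsSection φ) (c : ℂ) : E.IsSection (c • φ) :=
  hφ.mulDual (θ := fun _ => c) continuous_const fun _ => le_rfl

end IsSection

namespace IsCSection

variable {E} {φ ψ : E.Dual → S → ℂ}

theorem mk' (hc : ContinuousOn (fun q : E.Dual × S => φ q.1 q.2) {q | q.1.base = E.gpd.r q.2})
    (he : ∀ a ∈ E.A.carrier, ∀ χ σ, E.gpd.s a = E.gpd.r σ → Dual.base χ = E.gpd.r σ →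
      φ χ (E.gpd.mul a σ) = (χ.eval a : ℂ) * φ χ σ)
    (hK : ∃ K : Set E.A.Quot, IsCompact K ∧
      ∀ χ σ, Dual.base χ = E.gpd.r σ → φ χ σ ≠ 0 → E.A.proj σ ∈ K)
    (hL : ∃ L : Set E.Dual, IsCompact L ∧
      ∀ χ σ, Dual.base χ = E.gpd.r σ → φ χ σ ≠ 0 → χ ∈ L)
    (hz : ∀ χ σ, Dual.base χ ≠ E.gpd.r σ → φ χ σ = 0) : E.IsCSection φ where
  continuousOn := hc
  equivariant := he
  exists_support := hK
  vanishing ε hε := by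
    obtain ⟨L, hL, hL'⟩ := hL
    exact ⟨L, hL, fun χ σ hχ h => hL' χ σ hχ (norm_pos_iff.1 (hε.trans_le h))⟩
  eq_zero := hz
  exists_support_dual := hL

theorem zero : E.IsCSection (0 : E.Dual → S → ℂ) :=
  ⟨IsSection.zero, ∅, isCompact_empty, by simp⟩

theorem add (hφ : E.IsCSection φ) (hψ : E.IsCSection ψ) : E.IsCSection (φ + ψ) := by
  refine ⟨hφ.toIsSection.add hψ.toIsSection, ?_⟩
  obtain ⟨K, hK, hK'⟩ := hφ.exists_support_dual
  obtain ⟨L, hL, hL'⟩ := hψ.exists_support_dual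
  refine ⟨K ∪ L, hK.union hL, fun χ σ hχ h => ?_⟩
  by_cases h1 : φ χ σ = 0
  · refine Or.inr (hL' χ σ hχ fun h2 => h ?_)
    simp [h1, h2]
  · exact Or.inl (hK' χ σ hχ h1)

/-- Multiplication by a continuous function on the dual bundle. -/
theorem mulDual (hφ : E.IsCSection φ) {θ : E.Dual → ℂ} (hθ : Continuous θ) :
    E.IsCSection (fun χ σ => θ χ * φ χ σ) := by
  obtain ⟨K, hK, hK'⟩ := hφ.exists_support
  obtain ⟨L, hL, hL'⟩ := hφ.exists_support_dual
  refine mk' ((hθ.comp continuous_fst).continuousOn.mul hφ.continuousOn)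
    (fun a ha χ σ hs hχ => ?_) ⟨K, hK, fun χ σ hχ h => hK' χ σ hχ (right_ne_zero_of_mul h)⟩
    ⟨L, hL, fun χ σ hχ h => hL' χ σ hχ (right_ne_zero_of_mul h)⟩
    fun χ σ h => by rw [hφ.eq_zero χ σ h, mul_zero]
  rw [hφ.equivariant a ha χ σ hs hχ]; ring

theorem smul (hφ : E.IsCSection φ) (c : ℂ) : E.IsCSection (c • φ) :=
  hφ.mulDual (θ := fun _ => c) continuous_const

theorem sub (hφ : E.IsCSection φ) (hψ : E.IsCSection ψ) : E.IsCSection (φ - ψ) := by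
  have := hφ.add (hψ.smul (-1))
  rwa [neg_one_smul, ← sub_eq_add_neg] at this

theorem sum {ι : Type*} {f : ι → E.Dual → S → ℂ} {s : Finset ι}
    (hf : ∀ i ∈ s, E.IsCSection (f i)) : E.IsCSection (∑ i ∈ s, f i) := by
  classical
  induction s using Finset.induction_on with
  | empty => simpa using zero
  | insert i s hi ih =>
    rw [Finset.sum_insert hi]
    exact (hf i (Finset.mem_insert_self _ _)).add
      (ih fun j hj => hf j (Finset.mem_insert_of_mem hj))

end IsCSection

/-- A section times a compactly supported function on the dual bundle is compactly supported. -/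
theorem IsSection.mulDual_compact {E : AbelianExtension S X} {φ : E.Dual → S → ℂ}
    (hφ : E.IsSection φ) {θ : E.Dual → ℂ} (hθ : Continuous θ) (hθc : HasCompactSupport θ) :
    E.IsCSection (fun χ σ => θ χ * φ χ σ) := by
  obtain ⟨B, hB⟩ := hθ.bounded_above_of_compact_support hθc
  exact ⟨hφ.mulDual hθ hB, tsupport θ, hθc, fun χ σ _ h =>
    subset_tsupport _ (left_ne_zero_of_mul h)⟩

variable (α : E.quot.HaarSystem)

open Classical in
/-- The convolution of sections. -/
def mconv (φ ψ : E.Dual → S → ℂ) (χ : E.Dual) (σ : S) : ℂ :=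
  if χ.base = E.gpd.r σ then
    ∫ γ, φ χ (E.A.out γ) * E.tr ψ χ (E.A.out γ) σ ∂(α.meas χ.base) else 0

open Classical in
/-- The involution of sections. -/
def minv (φ : E.Dual → S → ℂ) (χ : E.Dual) (σ : S) : ℂ :=
  if χ.base = E.gpd.r σ then star (φ (E.sact χ σ) (E.gpd.inv σ)) else 0

theorem mconv_of {φ ψ : E.Dual → S → ℂ} {χ : E.Dual} {σ : S} (h : χ.base = E.gpd.r σ) :
    E.mconv α φ ψ χ σ = ∫ γ, φ χ (E.A.out γ) * E.tr ψ χ (E.A.out γ) σ ∂(α.meas χ.base) :=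
  if_pos h

theorem minv_of {φ : E.Dual → S → ℂ} {χ : E.Dual} {σ : S} (h : χ.base = E.gpd.r σ) :
    E.minv φ χ σ = star (φ (E.sact χ σ) (E.gpd.inv σ)) := if_pos h

namespace IsSection

variable {E} {φ ψ : E.Dual → S → ℂ}

theorem continuousOn_conv_integrand (hφ : E.IsSection φ) (hψ : E.IsSection ψ) :
    ContinuousOn (fun q : (E.Dual × S) × E.A.Quot =>
        φ q.1.1 (E.A.out q.2) * E.tr ψ q.1.1 (E.A.out q.2) q.1.2)
      {q | q.1 ∈ {q : E.Dual × S | q.1.base = E.gpd.r q.2} ∧ E.quot.r q.2 = q.1.1.base} := by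
  refine E.continuousOn_out (P := E.Dual × S) (W := {q : E.Dual × S | q.1.base = E.gpd.r q.2})
    (p := fun q => q.1.base)
    (h := fun q τ => φ q.1 τ * E.tr ψ q.1 τ q.2)
    (fun w hw τ hτ => hφ.mul_tr_out hψ hτ.symm hw) ?_
  exact (hφ.continuousOn_comp (by fun_prop) (by fun_prop) fun w hw => hw.2.symm).mul
    (hψ.continuousOn_tr (by fun_prop) (by fun_prop) (by fun_prop) (fun w hw => hw.2.symm)
      fun w hw => hw.1)

theorem continuousOn_conv_fiber (hφ : E.IsSection φ) (hψ : E.IsSection ψ) {χ : E.Dual} {σ : S}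
    (h : χ.base = E.gpd.r σ) : ContinuousOn
      (fun γ : E.A.Quot => φ χ (E.A.out γ) * E.tr ψ χ (E.A.out γ) σ)
      {γ | E.quot.r γ = χ.base} :=
  (hφ.continuousOn_conv_integrand hψ).comp (f := fun γ => ((χ, σ), γ)) (by fun_prop)
    fun _ hγ => ⟨h, hγ⟩

theorem integrable_conv (hφ : E.IsSection φ) (hψ : E.IsSection ψ) {χ : E.Dual} {σ : S}
    (h : χ.base = E.gpd.r σ) :
    Integrable (fun γ => φ χ (E.A.out γ) * E.tr ψ χ (E.A.out γ) σ) (α.meas χ.base) := by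
  have := E.t2Space_base
  obtain ⟨K, hK, hKφ⟩ := hφ.exists_support
  refine α.integrable_of_continuousOn E.continuous_quot_r hK
    (hφ.continuousOn_conv_fiber hψ h) fun γ hγ hγK => ?_
  have : φ χ (E.A.out γ) = 0 := by
    by_contra hne
    exact hγK (by simpa [E.A.proj_out] using hKφ χ _ hγ.symm hne)
  rw [this, zero_mul]

theorem exists_of_mconv_ne_zero {χ : E.Dual} {σ : S} (h : E.mconv α φ ψ χ σ ≠ 0) :
    χ.base = E.gpd.r σ ∧ ∃ τ, χ.base = E.gpd.r τ ∧ φ χ τ ≠ 0 ∧ E.tr ψ χ τ σ ≠ 0 := by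
  have hb : χ.base = E.gpd.r σ := by
    by_contra hne
    exact h (if_neg hne)
  refine ⟨hb, ?_⟩
  by_contra hcon
  push Not at hcon
  refine h ?_
  rw [E.mconv_of α hb]
  refine integral_eq_zero_of_ae ?_
  filter_upwards [α.ae_r_eq χ.base] with γ hγ
  by_cases h1 : φ χ (E.A.out γ) = 0
  · simp [h1]
  · simp [hcon _ hγ.symm h1]

theorem mconv_support {K L : Set E.A.Quot} (hK : IsCompact K) (hL : IsCompact L) :
    ∃ M : Set E.A.Quot, IsCompact M ∧ ∀ φ ψ : E.Dual → S → ℂ,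
      (∀ χ σ, Dual.base χ = E.gpd.r σ → φ χ σ ≠ 0 → E.A.proj σ ∈ K) →
      (∀ χ σ, Dual.base χ = E.gpd.r σ → ψ χ σ ≠ 0 → E.A.proj σ ∈ L) →
      ∀ χ σ, E.mconv α φ ψ χ σ ≠ 0 → E.A.proj σ ∈ M := by
  obtain ⟨M, hM, hMM⟩ := E.exists_isCompact_mul hK hL
  refine ⟨M, hM, fun φ ψ hφ hψ χ σ h => ?_⟩
  obtain ⟨hb, τ, hτ, h1, h2⟩ := exists_of_mconv_ne_zero α h
  have h3 := hMM τ (E.gpd.mul (E.gpd.inv τ) σ) (E.r_inv_mul (hτ.symm.trans hb)).symm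
    (hφ χ τ hτ h1) (hψ _ _ (E.base_sact_inv_mul hτ hb) h2)
  rwa [E.gpd.mul_inv_cancel_left _ _ (hτ.symm.trans hb)] at h3

theorem conv (hφ : E.IsSection φ) (hψ : E.IsSection ψ) : E.IsSection (E.mconv α φ ψ) := by
  have := E.t2Space_base
  obtain ⟨K, hK, hKφ⟩ := hφ.exists_support
  obtain ⟨L, hL, hLψ⟩ := hψ.exists_support
  obtain ⟨B, hB0, hB⟩ := hψ.exists_bound
  obtain ⟨C, hC0, hC⟩ := α.exists_measure_le E.continuous_quot_r hK
  have hz : ∀ χ γ, E.quot.r γ = χ.base → γ ∉ K → φ χ (E.A.out γ) = 0 := fun χ γ hγ hγK => by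
    by_contra hne
    exact hγK (by simpa [E.A.proj_out] using hKφ χ _ hγ.symm hne)
  constructor
  · refine ContinuousOn.congr ?_ fun q hq => E.mconv_of α hq
    exact α.continuousOn_integral E.continuous_quot_r (p := fun q : E.Dual × S => q.1.base)
      (E.continuous_base.comp continuous_fst).continuousOn hK
      (k := fun q γ => φ q.1 (E.A.out γ) * E.tr ψ q.1 (E.A.out γ) q.2)
      (hφ.continuousOn_conv_integrand hψ) fun w _ γ hγ hγK => by rw [hz _ γ hγ hγK, zero_mul]
  · intro a ha χ σ hs hχ
    have h1 : χ.base = E.gpd.r (E.gpd.mul a σ) := by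
      rw [E.gpd.r_mul _ _ hs, ← E.A.isotropy a ha, hs, hχ]
    rw [E.mconv_of α h1, E.mconv_of α hχ, ← integral_const_mul]
    refine integral_congr_ae ?_
    filter_upwards [α.ae_r_eq χ.base] with γ hγ
    rw [hψ.tr_mul_right ha hs (Eq.symm hγ) hχ]
    ring
  · obtain ⟨M, hM, hMM⟩ := mconv_support (E := E) α hK hL
    exact ⟨M, hM, fun χ σ _ h => hMM φ ψ hKφ hLψ χ σ h⟩
  · intro ε hε
    obtain ⟨D, hD, hDφ⟩ := hφ.vanishing (ε / (2 * (B * C + 1))) (by positivity)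
    refine ⟨D, hD, fun χ σ hχ h => ?_⟩
    by_contra hχD
    have hsmall : ∀ τ, χ.base = E.gpd.r τ → ‖φ χ τ‖ ≤ ε / (2 * (B * C + 1)) := fun τ hτ =>
      (not_le.1 fun h => hχD (hDφ χ τ hτ h)).le
    rw [E.mconv_of α hχ] at h
    have h1 := α.norm_integral_le_of_bound (x := χ.base) hK.measurableSet
      (g := fun γ => φ χ (E.A.out γ) * E.tr ψ χ (E.A.out γ) σ)
      (B := ε / (2 * (B * C + 1)) * B) (by positivity) hC0 (hC _) (fun γ hγ => by
        rw [norm_mul]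
        exact mul_le_mul (hsmall _ (Eq.symm hγ)) (hB _ _) (norm_nonneg _) (by positivity))
      fun γ hγ hγK => by rw [hz _ γ hγ hγK, zero_mul]
    have h2 : ε / (2 * (B * C + 1)) * B * C < ε := by
      rw [div_mul_eq_mul_div, div_mul_eq_mul_div, div_lt_iff₀ (by positivity)]
      nlinarith [mul_nonneg hB0 hC0]
    exact absurd (h.trans h1) (not_le.2 h2)
  · intro χ σ h
    exact if_neg h

theorem inv (hφ : E.IsSection φ) : E.IsSection (E.minv φ) := by
  have := E.t2Space_base
  obtain ⟨K, hK, hKφ⟩ := hφ.exists_support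
  constructor
  · refine ContinuousOn.congr ?_ fun q hq => E.minv_of hq
    exact continuous_star.comp_continuousOn (hφ.continuousOn_comp
      (E.continuousOn_sact (by fun_prop) (by fun_prop) fun w hw => hw)
      (E.continuousOn_inv' (by fun_prop)) fun w hw => E.base_sact_inv hw)
  · intro a ha χ σ hs hχ
    have h1 : χ.base = E.gpd.r (E.gpd.mul a σ) := by
      rw [E.gpd.r_mul _ _ hs, ← E.A.isotropy a ha, hs, hχ]
    rw [E.minv_of h1, E.minv_of hχ, ← E.tr_one φ h1, ← E.tr_one φ hχ,
      hφ.tr_mul_left ha hs hχ (E.gpd.r_one _).symm, star_mul', star_star]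
  · obtain ⟨M, hM, hMM⟩ := E.exists_isCompact_inv hK
    refine ⟨M, hM, fun χ σ hχ h => ?_⟩
    rw [E.minv_of hχ, star_ne_zero] at h
    have := hMM _ (hKφ _ _ (E.base_sact_inv hχ) h)
    rwa [E.gpd.inv_inv] at this
  · intro ε hε
    obtain ⟨L, hL, hLφ⟩ := hφ.vanishing ε hε
    obtain ⟨K', hK', hKK'⟩ := E.exists_isCompact_lift hK
    have hcl : IsClosed {q : E.Dual × S | q.1.base = E.gpd.r q.2} :=
      isClosed_eq (E.continuous_base.comp continuous_fst)
        (E.isTop.continuous_r.comp continuous_snd)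
    refine ⟨_, ((hL.prod hK').inter_right hcl).image_of_continuousOn
      (E.continuousOn_sact (W := _ ∩ _) (by fun_prop) (by fun_prop) fun w hw => hw.2),
      fun χ σ hχ h => ?_⟩
    rw [E.minv_of hχ, norm_star] at h
    have hne := norm_pos_iff.1 (hε.trans_le h)
    obtain ⟨τ, hτ, hτσ⟩ := hKK' (hKφ _ _ (E.base_sact_inv hχ) hne)
    have hr : (E.sact χ σ).base = E.gpd.r τ :=
      (E.base_sact_inv hχ).trans (E.r_of_proj_eq hτσ).symm
    refine ⟨(E.sact χ σ, τ), ⟨⟨hLφ _ _ (E.base_sact_inv hχ) h, hτ⟩, hr⟩, ?_⟩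
    change E.sact (E.sact χ σ) τ = χ
    rw [E.sact_rel (E.base_sact_inv hχ) (E.rel_of_proj_eq hτσ), E.sact_sact_inv hχ]
  · intro χ σ h
    exact if_neg h

end IsSection

namespace IsCSection

variable {E} {φ ψ : E.Dual → S → ℂ}

/-- The convolution of a compactly supported section with a section. -/
theorem conv_left (hφ : E.IsCSection φ) (hψ : E.IsSection ψ) : E.IsCSection (E.mconv α φ ψ) := by
  refine ⟨hφ.toIsSection.conv α hψ, ?_⟩
  obtain ⟨L, hL, hLφ⟩ := hφ.exists_support_dual
  refine ⟨L, hL, fun χ σ _ h => ?_⟩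
  obtain ⟨-, τ, hτ, h1, -⟩ := IsSection.exists_of_mconv_ne_zero α h
  exact hLφ χ τ hτ h1

theorem conv (hφ : E.IsCSection φ) (hψ : E.IsCSection ψ) : E.IsCSection (E.mconv α φ ψ) :=
  hφ.conv_left α hψ.toIsSection

/-- The translates of the characters in the support of a compactly supported section. -/
theorem exists_isCompact_sact (hφ : E.IsCSection φ) : ∃ L : Set E.Dual, IsCompact L ∧
    ∀ χ σ, Dual.base χ = E.gpd.r σ → φ χ σ ≠ 0 → E.sact χ σ ∈ L := by
  have := E.t2Space_base
  obtain ⟨K, hK, hKφ⟩ := hφ.exists_support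
  obtain ⟨L, hL, hLφ⟩ := hφ.exists_support_dual
  obtain ⟨K', hK', hKK'⟩ := E.exists_isCompact_lift hK
  have hcl : IsClosed {q : E.Dual × S | q.1.base = E.gpd.r q.2} :=
    isClosed_eq (E.continuous_base.comp continuous_fst)
      (E.isTop.continuous_r.comp continuous_snd)
  refine ⟨_, ((hL.prod hK').inter_right hcl).image_of_continuousOn
    (E.continuousOn_sact (W := _ ∩ _) (by fun_prop) (by fun_prop) fun w hw => hw.2),
    fun χ σ hχ h => ?_⟩
  obtain ⟨τ, hτ, hτσ⟩ := hKK' (hKφ _ _ hχ h)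
  exact ⟨(χ, τ), ⟨⟨hLφ χ σ hχ h, hτ⟩, hχ.trans (E.r_of_proj_eq hτσ).symm⟩,
    E.sact_rel hχ (E.rel_of_proj_eq hτσ)⟩

theorem inv (hφ : E.IsCSection φ) : E.IsCSection (E.minv φ) := by
  refine ⟨hφ.toIsSection.inv, ?_⟩
  obtain ⟨L, hL, hLφ⟩ := hφ.exists_isCompact_sact
  refine ⟨L, hL, fun χ σ hχ h => ?_⟩
  rw [E.minv_of hχ, star_ne_zero] at h
  have := hLφ _ _ (E.base_sact_inv hχ) h
  rwa [E.sact_sact_inv hχ] at this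

end IsCSection

end AbelianExtension

namespace AbelianExtension

variable {S X : Type u} [TopologicalSpace S] [T2Space S] [LocallyCompactSpace S]
  [SecondCountableTopology S] [MeasurableSpace S] [BorelSpace S] [TopologicalSpace X]
  (E : AbelianExtension S X)

/-! ### The section algebra of the `𝕋`-groupoid -/

theorem rel_cls_iff {χ : E.Dual} {z w : Circle} {σ τ : S} (hσ : χ.base = E.gpd.r σ)
    (hτ : χ.base = E.gpd.r τ) (hs : E.gpd.s σ = E.gpd.s τ) :
    E.hBundle.setoid.r (⟨(χ, σ), hσ⟩, z) (⟨(χ, τ), hτ⟩, w) ↔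
      E.sact χ σ = E.sact χ τ ∧ E.gpd.mul σ (E.gpd.inv τ) ∈ E.A.carrier ∧
        z * w⁻¹ = (χ.eval (E.gpd.mul σ (E.gpd.inv τ)))⁻¹ := by
  have hm : E.sigmaAction.groupoid.mul ⟨(χ, σ), hσ⟩ (E.sigmaAction.groupoid.inv ⟨(χ, τ), hτ⟩) =
      ⟨(χ, E.gpd.mul σ (E.gpd.inv τ)),
        hσ.trans (E.gpd.r_mul _ _ (hs.trans (E.gpd.r_inv τ).symm)).symm⟩ :=
    dif_pos (hs.trans (E.gpd.r_inv τ).symm)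
  constructor
  · rintro ⟨-, h2, h3⟩
    change (E.sigmaAction.groupoid.mul ⟨(χ, σ), hσ⟩ (E.sigmaAction.groupoid.inv ⟨(χ, τ), hτ⟩),
      z * w⁻¹) ∈ E.hBundle.carrier at h3
    rw [hm] at h3
    exact ⟨h2, h3⟩
  · rintro ⟨h2, h3⟩
    refine ⟨rfl, h2, ?_⟩
    change (E.sigmaAction.groupoid.mul ⟨(χ, σ), hσ⟩ (E.sigmaAction.groupoid.inv ⟨(χ, τ), hτ⟩),
      z * w⁻¹) ∈ E.hBundle.carrier
    rw [hm]
    exact h3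

theorem cls_mul_left {χ : E.Dual} {z : Circle} {a σ : S} (ha : a ∈ E.A.carrier)
    (hs : E.gpd.s a = E.gpd.r σ) (h : χ.base = E.gpd.r (E.gpd.mul a σ)) (hσ : χ.base = E.gpd.r σ) :
    E.cls χ z (E.gpd.mul a σ) h = E.cls χ (χ.eval a * z) σ hσ := by
  refine E.hBundle.proj_eq ((E.rel_cls_iff h hσ (E.gpd.s_mul _ _ hs)).2 ⟨?_, ?_, ?_⟩)
  · exact E.sact_rel hσ (E.mul_rel_left ha hs)
  · rwa [E.gpd.mul_inv_cancel_right _ _ hs]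
  · rw [E.gpd.mul_inv_cancel_right _ _ hs, mul_inv_rev, ← mul_assoc, mul_inv_cancel, one_mul]

/-- Every element of the `𝕋`-groupoid is a class. -/
theorem exists_cls (e : E.SigmaHat) : ∃ χ z σ, ∃ h : Dual.base χ = E.gpd.r σ,
    e = E.cls χ z σ h :=
  ⟨(E.hBundle.out e).1.1.1, (E.hBundle.out e).2, (E.hBundle.out e).1.1.2, (E.hBundle.out e).1.2,
    (E.hBundle.proj_out e).symm⟩

theorem sigmaHat_r_cls {χ : E.Dual} {z : Circle} {σ : S} (h : χ.base = E.gpd.r σ) :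
    E.sigmaHat.r (E.cls χ z σ h) = χ :=
  E.hBundle.r_out_proj (⟨(χ, σ), h⟩, z)

theorem sigmaHat_mul_cls {χ ψ : E.Dual} {z w : Circle} {σ τ : S} (h : χ.base = E.gpd.r σ)
    (k : ψ.base = E.gpd.r τ) (hψ : E.sact χ σ = ψ) (hm : χ.base = E.gpd.r (E.gpd.mul σ τ)) :
    E.sigmaHat.mul (E.cls χ z σ h) (E.cls ψ w τ k) = E.cls χ (z * w) (E.gpd.mul σ τ) hm := by
  have hs : E.gpd.s σ = E.gpd.r τ := by rw [← k, ← hψ, E.base_sact h]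
  have hmul : E.sigmaAction.groupoid.mul ⟨(χ, σ), h⟩ ⟨(ψ, τ), k⟩ = ⟨(χ, E.gpd.mul σ τ), hm⟩ :=
    dif_pos hs
  have h1 := E.hBundle.proj_eq (E.hBundle.mul_rel (E.hBundle.out_proj (⟨(χ, σ), h⟩, z))
    (E.hBundle.out_proj (⟨(ψ, τ), k⟩, w))
    (by rw [E.hBundle.s_out_proj, E.hBundle.r_out_proj]; exact hψ))
  refine h1.trans ?_
  change E.hBundle.proj (E.sigmaAction.groupoid.mul ⟨(χ, σ), h⟩ ⟨(ψ, τ), k⟩, z * w) = _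
  rw [hmul]
  rfl

theorem sigmaHat_inv_cls {χ : E.Dual} {z : Circle} {σ : S} (h : χ.base = E.gpd.r σ) :
    E.sigmaHat.inv (E.cls χ z σ h) =
      E.cls (E.sact χ σ) z⁻¹ (E.gpd.inv σ) (E.base_sact_inv h) :=
  E.hBundle.proj_eq (E.hBundle.inv_rel (E.hBundle.out_proj (⟨(χ, σ), h⟩, z)))

theorem sigmaHat_one (χ : E.Dual) :
    E.sigmaHat.one χ = E.cls χ 1 (E.gpd.one χ.base) (E.gpd.r_one _).symm := rfl

theorem incl_mul_cls {χ : E.Dual} {z w : Circle} {σ : S} (h : χ.base = E.gpd.r σ) :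
    E.sigmaHat.mul (E.incl χ z) (E.cls χ w σ h) = E.cls χ (z * w) σ h := by
  have hm : E.gpd.mul (E.gpd.one χ.base) σ = σ := by rw [h, E.gpd.one_mul]
  have h1 := E.sigmaHat_mul_cls (z := z) (w := w) (E.gpd.r_one χ.base).symm h
    (E.sact_of_mem (E.A.one_mem _) (E.gpd.r_one _).symm) (by rw [hm]; exact h)
  refine h1.trans ?_
  congr 1

theorem continuous_jMap : Continuous E.jMap := by
  refine continuous_coinduced_dom.2 ?_
  have h : ∀ d : E.sigmaAction.Space × Circle,
      E.jMap (E.hBundle.proj d) =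
        ⟨(d.1.1.1, E.A.proj d.1.1.2), d.1.2.trans (E.A.r_out_proj _).symm⟩ :=
    fun d => E.jMap_cls d.1.1.1 d.2 d.1.1.2 d.1.2
  refine Continuous.congr ?_ fun d => (h d).symm
  refine Continuous.subtype_mk ?_ _
  exact (by fun_prop : Continuous fun d : E.sigmaAction.Space × Circle => d.1.1.1).prodMk
    (E.continuous_proj.comp (by fun_prop))

variable {E} in
open Classical in
/-- A function on the `𝕋`-groupoid as a function of a character and an arrow. -/
def untwist (f : E.SigmaHat → ℂ) (χ : E.Dual) (σ : S) : ℂ :=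
  if h : χ.base = E.gpd.r σ then f (E.cls χ 1 σ h) else 0

theorem untwist_of (f : E.SigmaHat → ℂ) {χ : E.Dual} {σ : S} (h : χ.base = E.gpd.r σ) :
    untwist f χ σ = f (E.cls χ 1 σ h) := dif_pos h

/-- The function on the `𝕋`-groupoid defined by a section. -/
def twist (φ : E.Dual → S → ℂ) (e : E.SigmaHat) : ℂ :=
  ((E.hBundle.out e).2 : ℂ) * φ (E.hBundle.out e).1.1.1 (E.hBundle.out e).1.1.2

theorem twist_cls {φ : E.Dual → S → ℂ} (hφ : E.IsSection φ) {χ : E.Dual} {z : Circle} {σ : S}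
    (h : χ.base = E.gpd.r σ) : E.twist φ (E.cls χ z σ h) = (z : ℂ) * φ χ σ := by
  rw [twist]
  have hrel := E.hBundle.out_proj (⟨(χ, σ), h⟩, z)
  change E.hBundle.setoid.r (E.hBundle.out (E.cls χ z σ h)) _ at hrel
  generalize E.hBundle.out (E.cls χ z σ h) = d at hrel ⊢
  obtain ⟨⟨⟨ψ, τ⟩, k⟩, w⟩ := d
  change ψ.base = E.gpd.r τ at k
  obtain rfl : ψ = χ := hrel.1
  have hs : E.gpd.s τ = E.gpd.s σ := by
    rw [← E.base_sact k, show E.sact ψ τ = E.sact ψ σ from hrel.2.1, E.base_sact h]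
  obtain ⟨-, h3, h4⟩ := (E.rel_cls_iff k h hs).1 hrel
  set a := E.gpd.mul τ (E.gpd.inv σ) with ha
  have hτ : τ = E.gpd.mul a σ := (E.gpd.inv_mul_cancel_right _ _ hs).symm
  have hsa : E.gpd.s a = E.gpd.r σ := by
    rw [ha, E.gpd.s_mul _ _ (hs.trans (E.gpd.r_inv _).symm), E.gpd.s_inv]
  change (w : ℂ) * φ ψ τ = z * φ ψ σ
  have hw : w * ψ.eval a = z := by
    have h5 : w = (ψ.eval a)⁻¹ * z := by rw [← h4, inv_mul_cancel_right]
    rw [h5, mul_comm, mul_inv_cancel_left]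
  rw [hτ, hφ.equivariant a h3 ψ σ hsa h, ← hw, Circle.coe_mul, mul_assoc]

theorem untwist_twist {φ : E.Dual → S → ℂ} (hφ : E.IsSection φ) : untwist (E.twist φ) = φ := by
  funext χ σ
  by_cases h : χ.base = E.gpd.r σ
  · rw [E.untwist_of _ h, E.twist_cls hφ, Circle.coe_one, one_mul]
  · rw [untwist, dif_neg h, hφ.eq_zero χ σ h]

variable (α : E.quot.HaarSystem)

theorem twistAlgebra_apply_cls {f : E.SigmaHat → ℂ} (hf : f ∈ (E.twistAlgebra α).carrier)
    {χ : E.Dual} {z : Circle} {σ : S} (h : χ.base = E.gpd.r σ) :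
    f (E.cls χ z σ h) = (z : ℂ) * f (E.cls χ 1 σ h) := by
  have h1 := hf.2.2 z (E.cls χ 1 σ h)
  rw [E.sigmaHat_r_cls, E.incl_mul_cls, mul_one] at h1
  exact h1

theorem twist_untwist {f : E.SigmaHat → ℂ} (hf : f ∈ (E.twistAlgebra α).carrier)
    (hφ : E.IsSection (untwist f)) : E.twist (untwist f) = f := by
  funext e
  obtain ⟨χ, z, σ, h, rfl⟩ := E.exists_cls e
  rw [E.twist_cls hφ, E.untwist_of _ h, ← E.twistAlgebra_apply_cls α hf]

/-- Functions in the section algebra of the `𝕋`-groupoid are compactly supported sections. -/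
theorem isCSection_untwist {f : E.SigmaHat → ℂ} (hf : f ∈ (E.twistAlgebra α).carrier) :
    E.IsCSection (untwist f) := by
  have hKc := hf.2.1.isCompact.image E.continuous_jMap
  have hmem : ∀ χ σ (h : Dual.base χ = E.gpd.r σ), untwist f χ σ ≠ 0 →
      (⟨(χ, E.A.proj σ), h.trans (E.A.r_out_proj _).symm⟩ : E.quotAction.Space) ∈
        E.jMap '' tsupport f := fun χ σ h hne => by
    rw [E.untwist_of _ h] at hne
    exact ⟨_, subset_tsupport _ hne, E.jMap_cls χ 1 σ h⟩
  refine IsCSection.mk' ?_ ?_ ⟨_, hKc.image (f := fun q => q.1.2) (by fun_prop), ?_⟩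
    ⟨_, hKc.image (f := fun q => q.1.1) (by fun_prop), ?_⟩ ?_
  · rw [continuousOn_iff_continuous_domRestrict]
    have h1 : Continuous fun q : E.sigmaAction.Space => f (E.hBundle.proj (q, 1)) :=
      hf.1.comp (Continuous.comp (continuous_coinduced_rng)
        (continuous_id.prodMk continuous_const))
    exact h1.congr fun q => (E.untwist_of f q.2).symm
  · intro a ha χ σ hs hχ
    have h1 : χ.base = E.gpd.r (E.gpd.mul a σ) := by
      rw [E.gpd.r_mul _ _ hs, ← E.A.isotropy a ha, hs, hχ]
    rw [E.untwist_of _ h1, E.untwist_of _ hχ, E.cls_mul_left ha hs h1 hχ, mul_one,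
      E.twistAlgebra_apply_cls α hf]
  · intro χ σ hχ hne
    exact ⟨_, hmem χ σ hχ hne, rfl⟩
  · intro χ σ hχ hne
    exact ⟨_, hmem χ σ hχ hne, rfl⟩
  · intro χ σ h
    exact dif_neg h

/-- Compactly supported sections define functions in the section algebra of the `𝕋`-groupoid. -/
theorem twist_mem {φ : E.Dual → S → ℂ} (hφ : E.IsCSection φ) :
    E.twist φ ∈ (E.twistAlgebra α).carrier := by
  have := E.t2Space_base
  have hφ' := hφ.toIsSection
  refine ⟨?_, ?_, fun z e => ?_⟩
  · refine continuous_coinduced_dom.2 ?_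
    have h1 : Continuous fun d : E.sigmaAction.Space × Circle =>
        (d.2 : ℂ) * φ d.1.1.1 d.1.1.2 := by
      refine (continuous_circle_coe.comp continuous_snd).mul ?_
      exact (continuousOn_iff_continuous_domRestrict.1 hφ.continuousOn).comp continuous_fst
    exact h1.congr fun d => (E.twist_cls hφ' (z := d.2) d.1.2).symm
  · obtain ⟨K, hK, hKφ⟩ := hφ.exists_support
    obtain ⟨L, hL, hLφ⟩ := hφ.exists_support_dual
    obtain ⟨K', hK', hKK'⟩ := E.exists_isCompact_lift hK
    have hcl : IsClosed {q : E.Dual × S | q.1.base = E.gpd.r q.2} :=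
      isClosed_eq (E.continuous_base.comp continuous_fst)
        (E.isTop.continuous_r.comp continuous_snd)
    have hD : IsCompact ((Subtype.val : E.sigmaAction.Space → E.Dual × S) ⁻¹' (L ×ˢ K')) :=
      hcl.isClosedEmbedding_subtypeVal.isCompact_preimage (hL.prod hK')
    have hI : IsCompact (E.hBundle.proj ''
        (((Subtype.val : E.sigmaAction.Space → E.Dual × S) ⁻¹' (L ×ˢ K')) ×ˢ
          (Set.univ : Set Circle))) :=
      (hD.prod isCompact_univ).image continuous_coinduced_rng
    have hJ : IsClosed (E.jMap ⁻¹' (Subtype.val ⁻¹' (L ×ˢ K))) :=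
      ((hL.isClosed.prod hK.isClosed).preimage continuous_subtype_val).preimage E.continuous_jMap
    have hsub : E.jMap ⁻¹' (Subtype.val ⁻¹' (L ×ˢ K)) ⊆ E.hBundle.proj ''
        (((Subtype.val : E.sigmaAction.Space → E.Dual × S) ⁻¹' (L ×ˢ K')) ×ˢ
          (Set.univ : Set Circle)) := by
      intro e he
      obtain ⟨χ, z, σ, h, rfl⟩ := E.exists_cls e
      rw [Set.mem_preimage, E.jMap_cls] at he
      obtain ⟨τ, hτ, hτσ⟩ := hKK' he.2
      obtain ⟨a, ha, hs, -, h2⟩ := E.exists_mul_of_rel (E.rel_of_proj_eq hτσ.symm)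
      subst h2
      have hτ' : χ.base = E.gpd.r τ := h.trans (E.r_of_proj_eq hτσ).symm
      refine ⟨(⟨(χ, τ), hτ'⟩, χ.eval a * z), ⟨⟨he.1, hτ⟩, trivial⟩, ?_⟩
      exact (E.cls_mul_left ha hs h hτ').symm
    refine IsCompact.of_isClosed_subset (hI.of_isClosed_subset hJ hsub) (isClosed_tsupport _)
      (closure_minimal ?_ hJ)
    intro e he
    obtain ⟨χ, z, σ, h, rfl⟩ := E.exists_cls e
    rw [Function.mem_support, E.twist_cls hφ'] at he
    rw [Set.mem_preimage, E.jMap_cls]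
    exact ⟨hLφ χ σ h (right_ne_zero_of_mul he), hKφ χ σ h (right_ne_zero_of_mul he)⟩
  · obtain ⟨χ, w, σ, h, rfl⟩ := E.exists_cls e
    rw [E.sigmaHat_r_cls, E.incl_mul_cls, E.twist_cls hφ', E.twist_cls hφ', Circle.coe_mul,
      mul_assoc]

/-- Integrals over the transformation groupoid. -/
theorem integral_transMeas (χ : E.Dual) (g : E.quotAction.Space → ℂ) (g' : E.A.Quot → ℂ)
    (h : ∀ γ (hγ : χ.base = E.quot.r γ), g ⟨(χ, γ), hγ⟩ = g' γ) :
    ∫ q, g q ∂(E.transMeas α χ) = ∫ γ, g' γ ∂(α.meas χ.base) := by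
  classical
  have := E.t2Space_base
  have := E.secondCountableTopology_base
  let B : MeasurableSpace X := borel X
  have : BorelSpace X := ⟨rfl⟩
  have hms : MeasurableSet {q : E.Dual × E.A.Quot | E.quotAction.p q.1 = E.quot.r q.2} :=
    measurableSet_eq_fun (E.continuous_base.measurable.comp measurable_fst)
      (E.continuous_quot_r.measurable.comp measurable_snd)
  let G : E.Dual × E.A.Quot → ℂ := fun q =>
    if h : E.quotAction.p q.1 = E.quot.r q.2 then g ⟨q, h⟩ else 0
  have h1 : ∫ q, g q ∂(E.transMeas α χ) =
      ∫ q in {q : E.Dual × E.A.Quot | E.quotAction.p q.1 = E.quot.r q.2}, G q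
        ∂((Measure.dirac χ).prod (α.meas χ.base)) := by
    rw [← integral_subtype_comap hms]
    refine integral_congr_ae (Eventually.of_forall fun q => ?_)
    have hq : G q.1 = g ⟨q.1, q.2⟩ := dif_pos q.2
    exact hq.symm
  have h2 : ∀ q ∉ {q : E.Dual × E.A.Quot | E.quotAction.p q.1 = E.quot.r q.2}, G q = 0 :=
    fun q hq => dif_neg hq
  have hemb : MeasurableEmbedding (Prod.mk χ : E.A.Quot → E.Dual × E.A.Quot) :=
    MeasurableEmbedding.id.prodMk_left χ
  rw [h1, setIntegral_eq_integral_of_forall_compl_eq_zero h2, Measure.dirac_prod,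
    hemb.integral_map]
  refine integral_congr_ae ?_
  filter_upwards [α.ae_r_eq χ.base] with γ hγ
  have hγ' : E.quotAction.p (χ, γ).1 = E.quot.r (χ, γ).2 := Eq.symm hγ
  change dite _ _ _ = _
  rw [dif_pos hγ']
  exact h γ hγ'

theorem lintegral_transMeas (χ : E.Dual) (g : E.quotAction.Space → ℝ≥0∞) (g' : E.A.Quot → ℝ≥0∞)
    (h : ∀ γ (hγ : χ.base = E.quot.r γ), g ⟨(χ, γ), hγ⟩ = g' γ) :
    ∫⁻ q, g q ∂(E.transMeas α χ) = ∫⁻ γ, g' γ ∂(α.meas χ.base) := by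
  classical
  have := E.t2Space_base
  have := E.secondCountableTopology_base
  let B : MeasurableSpace X := borel X
  have : BorelSpace X := ⟨rfl⟩
  have hms : MeasurableSet {q : E.Dual × E.A.Quot | E.quotAction.p q.1 = E.quot.r q.2} :=
    measurableSet_eq_fun (E.continuous_base.measurable.comp measurable_fst)
      (E.continuous_quot_r.measurable.comp measurable_snd)
  let G : E.Dual × E.A.Quot → ℝ≥0∞ := fun q =>
    if h : E.quotAction.p q.1 = E.quot.r q.2 then g ⟨q, h⟩ else 0
  have h1 : ∫⁻ q, g q ∂(E.transMeas α χ) =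
      ∫⁻ q in {q : E.Dual × E.A.Quot | E.quotAction.p q.1 = E.quot.r q.2}, G q
        ∂((Measure.dirac χ).prod (α.meas χ.base)) := by
    rw [← lintegral_subtype_comap hms]
    refine lintegral_congr fun q => ?_
    have hq : G q.1 = g ⟨q.1, q.2⟩ := dif_pos q.2
    exact hq.symm
  have h2 : {q : E.Dual × E.A.Quot | E.quotAction.p q.1 = E.quot.r q.2}.indicator G = G := by
    rw [Set.indicator_eq_self]
    intro q hq
    by_contra hne
    exact hq (dif_neg hne)
  have hemb : MeasurableEmbedding (Prod.mk χ : E.A.Quot → E.Dual × E.A.Quot) :=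
    MeasurableEmbedding.id.prodMk_left χ
  rw [h1, ← lintegral_indicator hms, h2, Measure.dirac_prod,
    hemb.lintegral_map]
  refine lintegral_congr_ae ?_
  filter_upwards [α.ae_r_eq χ.base] with γ hγ
  have hγ' : E.quotAction.p (χ, γ).1 = E.quot.r (χ, γ).2 := Eq.symm hγ
  change dite _ _ _ = _
  rw [dif_pos hγ']
  exact h γ hγ'

theorem twist_conv_cls (f : E.SigmaHat → ℂ) {g : E.SigmaHat → ℂ}
    (hg : g ∈ (E.twistAlgebra α).carrier) {χ : E.Dual} {z : Circle} {σ : S}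
    (h : χ.base = E.gpd.r σ) :
    (E.twistAlgebra α).conv f g (E.cls χ z σ h) =
      (z : ℂ) * E.mconv α (untwist f) (untwist g) χ σ := by
  change ∫ q, f (E.jLift q) * g (E.sigmaHat.mul (E.sigmaHat.inv (E.jLift q)) (E.cls χ z σ h))
    ∂(E.transMeas α (E.sigmaHat.r (E.cls χ z σ h))) = _
  rw [E.sigmaHat_r_cls, E.mconv_of α h, ← integral_const_mul]
  refine E.integral_transMeas α χ _ _ fun γ hγ => ?_
  have hτ : χ.base = E.gpd.r (E.A.out γ) := hγ
  have hm := E.base_sact_inv_mul hτ h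
  have h1 : E.sigmaHat.mul (E.sigmaHat.inv (E.jLift ⟨(χ, γ), hγ⟩)) (E.cls χ z σ h) =
      E.cls (E.sact χ (E.A.out γ)) z (E.gpd.mul (E.gpd.inv (E.A.out γ)) σ) hm := by
    change E.sigmaHat.mul (E.sigmaHat.inv (E.cls χ 1 (E.A.out γ) hτ)) (E.cls χ z σ h) = _
    rw [E.sigmaHat_inv_cls, E.sigmaHat_mul_cls _ _ (E.sact_sact_inv hτ) hm]
    congr 1
    rw [inv_one, one_mul]
  rw [h1, E.twistAlgebra_apply_cls α hg, tr, E.untwist_of _ hτ, E.untwist_of _ hm]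
  change f (E.cls χ 1 (E.A.out γ) hτ) * _ = _
  ring

theorem untwist_conv (f : E.SigmaHat → ℂ) {g : E.SigmaHat → ℂ}
    (hg : g ∈ (E.twistAlgebra α).carrier) :
    untwist ((E.twistAlgebra α).conv f g) = E.mconv α (untwist f) (untwist g) := by
  funext χ σ
  by_cases h : χ.base = E.gpd.r σ
  · rw [E.untwist_of _ h, E.twist_conv_cls α f hg h, Circle.coe_one, one_mul]
  · rw [untwist, dif_neg h, mconv, if_neg h]

theorem twist_conv {f g : E.SigmaHat → ℂ} (hf : f ∈ (E.twistAlgebra α).carrier)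
    (hg : g ∈ (E.twistAlgebra α).carrier) :
    (E.twistAlgebra α).conv f g = E.twist (E.mconv α (untwist f) (untwist g)) := by
  have hc := (E.isCSection_untwist α hf).conv α (E.isCSection_untwist α hg)
  funext e
  obtain ⟨χ, z, σ, h, rfl⟩ := E.exists_cls e
  rw [E.twist_conv_cls α f hg h, E.twist_cls hc.toIsSection]

theorem untwist_invol (f : E.SigmaHat → ℂ) :
    untwist ((E.twistAlgebra α).invol f) = E.minv (untwist f) := by
  funext χ σ
  by_cases h : χ.base = E.gpd.r σ
  · rw [E.untwist_of _ h, E.minv_of h, E.untwist_of _ (E.base_sact_inv h)]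
    change star (f (E.sigmaHat.inv (E.cls χ 1 σ h))) = _
    rw [E.sigmaHat_inv_cls, inv_one]
  · rw [untwist, dif_neg h, minv, if_neg h]

theorem twist_invol {f : E.SigmaHat → ℂ} (hf : f ∈ (E.twistAlgebra α).carrier) :
    (E.twistAlgebra α).invol f = E.twist (E.minv (untwist f)) := by
  have hc := (E.isCSection_untwist α hf).inv
  funext e
  obtain ⟨χ, z, σ, h, rfl⟩ := E.exists_cls e
  rw [E.twist_cls hc.toIsSection, E.minv_of h, E.untwist_of _ (E.base_sact_inv h)]
  change star (f (E.sigmaHat.inv (E.cls χ z σ h))) = _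
  rw [E.sigmaHat_inv_cls, E.twistAlgebra_apply_cls α hf, star_mul', star_coe_circle, inv_inv]

theorem untwist_add (f g : E.SigmaHat → ℂ) : untwist (f + g) = untwist f + untwist g := by
  funext χ σ
  by_cases h : χ.base = E.gpd.r σ
  · simp only [Pi.add_apply, E.untwist_of _ h]
  · simp only [Pi.add_apply, untwist, dif_neg h, add_zero]

theorem untwist_smul (c : ℂ) (f : E.SigmaHat → ℂ) : untwist (c • f) = c • untwist f := by
  funext χ σ
  by_cases h : χ.base = E.gpd.r σ
  · simp only [Pi.smul_apply, E.untwist_of _ h]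
  · simp only [Pi.smul_apply, untwist, dif_neg h, smul_zero]

end AbelianExtension

namespace ZeroAtInftyContinuousMap

variable {Y : Type*} [TopologicalSpace Y]

theorem norm_apply_le (f : C₀(Y, ℂ)) (y : Y) : ‖f y‖ ≤ ‖f‖ := f.toBCF.norm_coe_le_norm y

theorem norm_le_of_forall {f : C₀(Y, ℂ)} {B : ℝ} (hB : 0 ≤ B) (h : ∀ y, ‖f y‖ ≤ B) : ‖f‖ ≤ B :=
  (BoundedContinuousFunction.norm_le (f := f.toBCF) hB).2 h

theorem exists_isCompact_le_norm (f : C₀(Y, ℂ)) {ε : ℝ} (hε : 0 < ε) :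
    ∃ L : Set Y, IsCompact L ∧ ∀ y, ε ≤ ‖f y‖ → y ∈ L := by
  obtain ⟨L, hL, h⟩ := mem_cocompact.1 ((zero_at_infty f).eventually (Metric.ball_mem_nhds 0 hε))
  refine ⟨L, hL, fun y hy => ?_⟩
  by_contra hyL
  have := h hyL
  simp only [Set.mem_ofPred_eq, dist_zero_right] at this
  exact absurd hy (not_le.2 this)

/-- A function that is small off compact sets vanishes at infinity. -/
def ofVanishing (f : Y → ℂ) (hf : Continuous f)
    (h : ∀ ε > 0, ∃ L : Set Y, IsCompact L ∧ ∀ y, ε ≤ ‖f y‖ → y ∈ L) : C₀(Y, ℂ) where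
  toFun := f
  continuous_toFun := hf
  zero_at_infty' := by
    rw [Metric.tendsto_nhds]
    intro ε hε
    obtain ⟨L, hL, hLf⟩ := h ε hε
    refine mem_cocompact.2 ⟨L, hL, fun y hy => ?_⟩
    rw [Set.mem_ofPred_eq, dist_zero_right]
    exact not_le.1 fun hle => hy (hLf y hle)

/-- Evaluation at a point. -/
def evalCLM (y : Y) : C₀(Y, ℂ) →L[ℂ] ℂ :=
  LinearMap.mkContinuous
    { toFun := fun f => f y, map_add' := fun _ _ => rfl, map_smul' := fun _ _ => rfl } 1
    fun f => by rw [one_mul]; exact f.norm_apply_le y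

/-- A jointly continuous, uniformly vanishing family of functions is continuous in norm. -/
theorem continuousOn_of_joint {Q : Type*} [TopologicalSpace Q] {W : Set Q} {v : Q → C₀(Y, ℂ)}
    (hc : ContinuousOn (fun q : Q × Y => v q.1 q.2) {q | q.1 ∈ W})
    (hv : ∀ ε > 0, ∃ L : Set Y, IsCompact L ∧ ∀ q ∈ W, ∀ y, ε ≤ ‖v q y‖ → y ∈ L) :
    ContinuousOn v W := by
  intro q₀ hq₀
  rw [ContinuousWithinAt, Metric.tendsto_nhds]
  intro ε hε
  obtain ⟨L, hL, hLv⟩ := hv (ε / 4) (by positivity)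
  have h1 : ∀ᶠ q in 𝓝 q₀, ∀ y ∈ L, q ∈ W → ‖v q y - v q₀ y‖ < ε / 2 := by
    refine hL.eventually_forall_of_forall_eventually fun y _ => ?_
    have h2 : Tendsto (fun q : Q × Y => v q.1 q.2 - v q₀ q.2) (𝓝[{q | q.1 ∈ W}] (q₀, y))
        (𝓝 (v q₀ y - v q₀ y)) :=
      (hc (q₀, y) hq₀).tendsto.sub (((map_continuous (v q₀)).comp continuous_snd).tendsto' _ _ rfl
        |>.mono_left inf_le_left)
    rw [sub_self] at h2
    have h3 := h2.norm.eventually (gt_mem_nhds (show ‖(0 : ℂ)‖ < ε / 2 by simpa using hε))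
    exact eventually_nhdsWithin_iff.1 h3
  filter_upwards [eventually_nhdsWithin_of_eventually_nhds h1, self_mem_nhdsWithin] with q hq hqW
  rw [dist_eq_norm]
  refine (norm_le_of_forall (by positivity) fun y => ?_).trans_lt (half_lt_self hε)
  change ‖v q y - v q₀ y‖ ≤ ε / 2
  by_cases hy : y ∈ L
  · exact (hq y hy hqW).le
  · have h4 : ‖v q y‖ < ε / 4 := not_le.1 fun h => hy (hLv q hqW y h)
    have h5 : ‖v q₀ y‖ < ε / 4 := not_le.1 fun h => hy (hLv q₀ hq₀ y h)
    linarith [norm_sub_le (v q y) (v q₀ y)]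

/-- Functions vanishing at infinity extend from closed subspaces. -/
theorem exists_extension {Z : Type*} [TopologicalSpace Z] [T2Space Z] [LocallyCompactSpace Z]
    {j : Y → Z} (hj : IsClosedEmbedding j) (f : C₀(Y, ℂ)) : ∃ g : C₀(Z, ℂ), ∀ y, g (j y) = f y := by
  have : T2Space Y := hj.isEmbedding.t2Space
  have hJ : Continuous (OnePoint.map j) := OnePoint.continuous_map hj.continuous (by
    rw [coclosedCompact_eq_cocompact, coclosedCompact_eq_cocompact]
    exact hj.tendsto_cocompact)
  have hJ' : IsClosedEmbedding (OnePoint.map j) :=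
    hJ.isClosedEmbedding (Option.map_injective hj.injective)
  obtain ⟨g, hg⟩ := ContinuousMap.exists_extension' hJ'
    (OnePoint.continuousMapMk f.toContinuousMap 0 (by
      rw [coclosedCompact_eq_cocompact]; exact zero_at_infty f))
  have hg' : ∀ y, g (OnePoint.map j y) = OnePoint.continuousMapMk f.toContinuousMap 0 _ y :=
    fun y => congrFun hg y
  refine ⟨⟨⟨fun z => g z, g.continuous.comp OnePoint.continuous_coe⟩, ?_⟩, fun y => ?_⟩
  · have h1 : g OnePoint.infty = 0 := hg' OnePoint.infty
    have h2 := (g.continuous.tendsto OnePoint.infty).comp (OnePoint.tendsto_coe_infty (X := Z))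
    rwa [h1, coclosedCompact_eq_cocompact] at h2
  · exact hg' y

end ZeroAtInftyContinuousMap

namespace AbelianExtension

variable {S X : Type u} [TopologicalSpace S] [T2Space S] [LocallyCompactSpace S]
  [SecondCountableTopology S] [MeasurableSpace S] [BorelSpace S] [TopologicalSpace X]
  (E : AbelianExtension S X)

/-! ### The section algebra of the twisted system -/

variable {E} in
open Classical in
/-- A section of the bundle as a function of a character and an arrow. -/
def unc (F : E.PreSection) (χ : E.Dual) (σ : S) : ℂ :=
  if h : χ.base = E.gpd.r σ then F.at σ χ h else 0

theorem unc_of (F : E.PreSection) {χ : E.Dual} {σ : S} (h : χ.base = E.gpd.r σ) :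
    unc F χ σ = F.at σ χ h := dif_pos h

theorem unc_mk (F : E.PreSection) {σ : S} (c : E.DualFiber (E.gpd.r σ)) :
    unc F ⟨E.gpd.r σ, c⟩ σ = F σ c := E.unc_of F rfl

theorem unc_injective : Function.Injective (unc : E.PreSection → E.Dual → S → ℂ) := by
  intro F G h
  funext σ
  ext c
  rw [← E.unc_mk F, ← E.unc_mk G, h]

theorem unc_add (F G : E.PreSection) : unc (F + G) = unc F + unc G := by
  funext χ σ
  by_cases h : χ.base = E.gpd.r σ
  · simp only [Pi.add_apply, E.unc_of _ h]
    rfl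
  · simp only [Pi.add_apply, unc, dif_neg h, add_zero]

theorem unc_smul (c : ℂ) (F : E.PreSection) : unc (c • F) = c • unc F := by
  funext χ σ
  by_cases h : χ.base = E.gpd.r σ
  · simp only [Pi.smul_apply, E.unc_of _ h]
    rfl
  · simp only [Pi.smul_apply, unc, dif_neg h, smul_zero]

theorem unc_sub (F G : E.PreSection) : unc (F - G) = unc F - unc G := by
  rw [sub_eq_add_neg, ← neg_one_smul ℂ G, unc_add, unc_smul, neg_one_smul, ← sub_eq_add_neg]

theorem unc_zero : unc (0 : E.PreSection) = 0 := by
  rw [← zero_smul ℂ (0 : E.PreSection), unc_smul, zero_smul]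

theorem norm_unc_le (F : E.PreSection) (χ : E.Dual) (σ : S) : ‖unc F χ σ‖ ≤ ‖F σ‖ := by
  by_cases h : χ.base = E.gpd.r σ
  · rw [E.unc_of _ h]
    exact (F σ).norm_apply_le _
  · rw [unc, dif_neg h, norm_zero]
    exact norm_nonneg _

theorem norm_le_of_unc {F : E.PreSection} {σ : S} {B : ℝ} (hB : 0 ≤ B)
    (h : ∀ χ, Dual.base χ = E.gpd.r σ → ‖unc F χ σ‖ ≤ B) : ‖F σ‖ ≤ B :=
  ZeroAtInftyContinuousMap.norm_le_of_forall hB fun c => by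
    rw [← E.unc_mk F]; exact h _ rfl

/-- The section of the bundle defined by a function of a character and an arrow. -/
def ofSection (φ : E.Dual → S → ℂ) (hφ : E.IsSection φ) : E.PreSection := fun σ =>
  ZeroAtInftyContinuousMap.ofVanishing (fun c => φ ⟨E.gpd.r σ, c⟩ σ)
    (hφ.continuousOn.comp_continuous (f := fun c => ((⟨E.gpd.r σ, c⟩ : E.Dual), σ))
      ((E.continuous_dual_mk _).prodMk continuous_const) fun _ => rfl)
    fun ε hε => by
      obtain ⟨L, hL, hLφ⟩ := hφ.vanishing ε hε
      exact ⟨_, (E.isClosedEmbedding_dual_mk (E.gpd.r σ)).isCompact_preimage hL,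
        fun c hc => hLφ _ _ rfl hc⟩

theorem unc_ofSection {φ : E.Dual → S → ℂ} (hφ : E.IsSection φ) :
    unc (E.ofSection φ hφ) = φ := by
  funext χ σ
  by_cases h : χ.base = E.gpd.r σ
  · obtain ⟨x, c⟩ := χ
    obtain rfl : x = E.gpd.r σ := h
    rw [E.unc_mk]
    rfl
  · rw [unc, dif_neg h, hφ.eq_zero χ σ h]

variable (α : E.quot.HaarSystem)

/-- Near any arrow a continuous section is uniformly close to a function on the dual bundle. -/
theorem exists_tube {F : E.PreSection} (hF : F ∈ (E.crossedAlgebra α).carrier) (σ₀ : S) {ε : ℝ}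
    (hε : 0 < ε) : ∃ h : C₀(E.Dual, ℂ), (∀ χ, Dual.base χ = E.gpd.r σ₀ → unc F χ σ₀ = h χ) ∧
      ∀ᶠ σ in 𝓝 σ₀, ∀ χ, Dual.base χ = E.gpd.r σ → ‖unc F χ σ - h χ‖ ≤ ε := by
  obtain ⟨h, hh⟩ := ZeroAtInftyContinuousMap.exists_extension
    (E.isClosedEmbedding_dual_mk (E.gpd.r σ₀)) (F σ₀)
  refine ⟨h, fun χ hχ => ?_, ?_⟩
  · obtain ⟨x, c⟩ := χ
    obtain rfl : x = E.gpd.r σ₀ := hχ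
    rw [E.unc_mk, hh]
  · have hopen : IsOpen {k : E.EHat | k.base ∈ Set.univ ∧
        ∃ δ < ε, ∀ χ : E.DualFiber k.base, ‖k.val χ - h ⟨k.base, χ⟩‖ ≤ δ} :=
      TopologicalSpace.isOpen_generateFrom_of_mem ⟨h, Set.univ, ε, isOpen_univ, rfl⟩
    have hmem := hF.1.continuousAt (x := σ₀) |>.eventually (hopen.mem_nhds
      ⟨trivial, 0, hε, fun χ => by rw [hh, sub_self, norm_zero]⟩)
    filter_upwards [hmem] with σ hσ χ hχ
    obtain ⟨-, δ, hδ, hle⟩ := hσ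
    obtain ⟨x, c⟩ := χ
    obtain rfl : x = E.gpd.r σ := hχ
    rw [E.unc_mk]
    exact (hle c).trans hδ.le

theorem isSection_unc {F : E.PreSection} (hF : F ∈ (E.crossedAlgebra α).carrier) :
    E.IsSection (unc F) := by
  have heq : ∀ a ∈ E.A.carrier, ∀ χ σ, E.gpd.s a = E.gpd.r σ → Dual.base χ = E.gpd.r σ →
      unc F χ (E.gpd.mul a σ) = (χ.eval a : ℂ) * unc F χ σ := by
    intro a ha χ σ hs hχ
    have h1 : χ.base = E.gpd.r (E.gpd.mul a σ) := by
      rw [E.gpd.r_mul _ _ hs, ← E.A.isotropy a ha, hs, hχ]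
    rw [E.unc_of _ h1, E.unc_of _ hχ]
    exact hF.2.1 a ha σ hs χ hχ
  obtain ⟨K, hK, hKF⟩ := hF.2.2
  have hsupp : ∀ χ σ, Dual.base χ = E.gpd.r σ → unc F χ σ ≠ 0 → E.A.proj σ ∈ K :=
    fun χ σ _ h => hKF σ fun h0 => h (norm_le_zero_iff.1 (by
      simpa [h0] using E.norm_unc_le F χ σ))
  refine ⟨?_, heq, ⟨K, hK, hsupp⟩, ?_, fun χ σ h => dif_neg h⟩
  · rintro ⟨χ₀, σ₀⟩ h₀
    change χ₀.base = E.gpd.r σ₀ at h₀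
    rw [ContinuousWithinAt, Metric.tendsto_nhds]
    intro ε hε
    obtain ⟨h, hh, hev⟩ := E.exists_tube α hF σ₀ (half_pos hε)
    have h1 := Metric.tendsto_nhds.1 ((map_continuous h).tendsto χ₀) (ε / 2) (half_pos hε)
    have h2 : ∀ᶠ q : E.Dual × S in 𝓝[{q | q.1.base = E.gpd.r q.2}] (χ₀, σ₀),
        dist (h q.1) (h χ₀) < ε / 2 :=
      (continuous_fst.tendsto' (χ₀, σ₀) χ₀ rfl |>.mono_left inf_le_left).eventually h1
    have h3 : ∀ᶠ q : E.Dual × S in 𝓝[{q | q.1.base = E.gpd.r q.2}] (χ₀, σ₀),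
        ∀ χ, Dual.base χ = E.gpd.r q.2 → ‖unc F χ q.2 - h χ‖ ≤ ε / 2 :=
      (continuous_snd.tendsto' (χ₀, σ₀) σ₀ rfl |>.mono_left inf_le_left).eventually hev
    filter_upwards [h2, h3, self_mem_nhdsWithin] with q hq2 hq3 hq
    rw [hh χ₀ h₀]
    have := hq3 q.1 hq
    rw [← dist_eq_norm] at this
    linarith [dist_triangle (unc F q.1 q.2) (h q.1) (h χ₀)]
  · intro ε hε
    obtain ⟨K', hK', hKK'⟩ := E.exists_isCompact_lift hK
    have hloc : ∃ L : Set E.Dual, IsCompact L ∧ ∀ σ ∈ K', ∀ χ, Dual.base χ = E.gpd.r σ →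
        ε ≤ ‖unc F χ σ‖ → χ ∈ L := by
      refine hK'.induction_on (p := fun s => ∃ L : Set E.Dual, IsCompact L ∧ ∀ σ ∈ s, ∀ χ,
        Dual.base χ = E.gpd.r σ → ε ≤ ‖unc F χ σ‖ → χ ∈ L) ⟨∅, isCompact_empty, by simp⟩
        (fun s t hst ⟨L, hL, h⟩ => ⟨L, hL, fun σ hσ => h σ (hst hσ)⟩)
        (fun s t ⟨L, hL, h⟩ ⟨M, hM, h'⟩ => ⟨L ∪ M, hL.union hM, fun σ hσ χ hχ hle => ?_⟩)
        fun σ₀ _ => ?_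
      · rcases hσ with hσ | hσ
        · exact Or.inl (h σ hσ χ hχ hle)
        · exact Or.inr (h' σ hσ χ hχ hle)
      · obtain ⟨h, -, hev⟩ := E.exists_tube α hF σ₀ (half_pos hε)
        obtain ⟨L, hL, hLh⟩ := h.exists_isCompact_le_norm (half_pos hε)
        refine ⟨_, mem_nhdsWithin_of_mem_nhds hev, L, hL, fun σ hσ χ hχ hle => hLh χ ?_⟩
        have := hσ χ hχ
        linarith [norm_sub_norm_le (unc F χ σ) (h χ)]
    obtain ⟨L, hL, hLF⟩ := hloc
    refine ⟨L, hL, fun χ σ hχ hle => ?_⟩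
    have hne := norm_pos_iff.1 (hε.trans_le hle)
    obtain ⟨τ, hτ, hτσ⟩ := hKK' (hsupp χ σ hχ hne)
    obtain ⟨a, ha, hs, -, rfl⟩ := E.exists_mul_of_rel (E.rel_of_proj_eq hτσ.symm)
    have hχτ : χ.base = E.gpd.r τ := hχ.trans (E.r_of_proj_eq hτσ).symm
    rw [heq a ha χ τ hs hχτ, norm_mul, E.norm_eval, one_mul] at hle
    exact hLF τ hτ χ hχτ hle

theorem ofSection_mem {φ : E.Dual → S → ℂ} (hφ : E.IsSection φ) :
    E.ofSection φ hφ ∈ (E.crossedAlgebra α).carrier := by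
  have := E.t2Space_base
  refine ⟨?_, ?_, ?_⟩
  · refine continuous_generateFrom_iff.2 ?_
    rintro _ ⟨h, U, ε, hU, rfl⟩
    rw [isOpen_iff_mem_nhds]
    rintro σ₀ ⟨hσU, δ, hδ, hle⟩
    have hle' : ∀ χ, Dual.base χ = E.gpd.r σ₀ → ‖φ χ σ₀ - h χ‖ ≤ δ := by
      rintro ⟨x, c⟩ hx
      obtain rfl : x = E.gpd.r σ₀ := hx
      exact hle c
    have hδ0 : 0 ≤ δ := (norm_nonneg _).trans (hle 1)
    obtain ⟨δ', hδ', hε⟩ := exists_between hδ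
    have hδ'0 : 0 < δ' := hδ0.trans_lt hδ'
    obtain ⟨L₁, hL₁, hL₁φ⟩ := hφ.vanishing (δ' / 2) (half_pos hδ'0)
    obtain ⟨L₂, hL₂, hL₂h⟩ := h.exists_isCompact_le_norm (half_pos hδ'0)
    have hev : ∀ᶠ σ in 𝓝 σ₀, ∀ χ ∈ L₁ ∪ L₂, χ.base = E.gpd.r σ → ‖φ χ σ - h χ‖ < δ' := by
      refine (hL₁.union hL₂).eventually_forall_of_forall_eventually fun χ₀ _ => ?_
      by_cases h₀ : χ₀.base = E.gpd.r σ₀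
      · have h1 : Tendsto (fun q : E.Dual × S => φ q.1 q.2 - h q.1)
            (𝓝[{q | q.1.base = E.gpd.r q.2}] (χ₀, σ₀)) (𝓝 (φ χ₀ σ₀ - h χ₀)) :=
          (hφ.continuousOn (χ₀, σ₀) h₀).tendsto.sub
            (((map_continuous h).comp continuous_fst).tendsto' _ _ rfl |>.mono_left inf_le_left)
        have h2 := eventually_nhdsWithin_iff.1
          (h1.norm.eventually (gt_mem_nhds ((hle' χ₀ h₀).trans_lt hδ')))
        exact (continuous_swap.tendsto (σ₀, χ₀)).eventually h2
      · have h1 : IsOpen {q : S × E.Dual | q.2.base ≠ E.gpd.r q.1} :=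
          isOpen_ne_fun (E.continuous_base.comp continuous_snd)
            (E.isTop.continuous_r.comp continuous_fst)
        filter_upwards [h1.mem_nhds (show (σ₀, χ₀) ∈ _ from h₀)] with q hq hq'
        exact absurd hq' hq
    filter_upwards [hev, (hU.preimage E.isTop.continuous_r).mem_nhds hσU] with σ hσ hσU
    refine ⟨hσU, δ', hε, fun c => ?_⟩
    change ‖φ ⟨E.gpd.r σ, c⟩ σ - h ⟨E.gpd.r σ, c⟩‖ ≤ δ'
    by_cases hc : (⟨E.gpd.r σ, c⟩ : E.Dual) ∈ L₁ ∪ L₂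
    · exact (hσ _ hc rfl).le
    · rw [Set.mem_union, not_or] at hc
      have h1 := not_le.1 fun h => hc.1 (hL₁φ _ σ rfl h)
      have h2 := not_le.1 fun h => hc.2 (hL₂h _ h)
      linarith [norm_sub_le (φ ⟨E.gpd.r σ, c⟩ σ) (h ⟨E.gpd.r σ, c⟩)]
  · intro a ha σ hs χ hχ
    have h1 : χ.base = E.gpd.r (E.gpd.mul a σ) := by
      rw [E.gpd.r_mul _ _ hs, ← E.A.isotropy a ha, hs, hχ]
    rw [← E.unc_of _ h1, ← E.unc_of _ hχ, E.unc_ofSection, hφ.equivariant a ha χ σ hs hχ]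
  · obtain ⟨K, hK, hKφ⟩ := hφ.exists_support
    refine ⟨K, hK, fun σ hne => ?_⟩
    by_contra hσ
    refine hne (ZeroAtInftyContinuousMap.ext fun c => ?_)
    by_contra h
    exact hσ (hKφ ⟨E.gpd.r σ, c⟩ σ rfl h)

theorem mem_crossedAlgebra_iff (F : E.PreSection) :
    F ∈ (E.crossedAlgebra α).carrier ↔ E.IsSection (unc F) := by
  refine ⟨E.isSection_unc α, fun h => ?_⟩
  rw [← E.unc_injective (E.unc_ofSection h)]
  exact E.ofSection_mem α h

theorem cast_apply {x y : X} (h : x = y) (f : E.EFiber x) (c : E.DualFiber y) :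
    (h ▸ f : E.EFiber y) c = f (h ▸ c) := by
  subst h; rfl

theorem mk_dualHomeo {σ : S} {x y : X} (hs : E.gpd.s σ = x) (hr : E.gpd.r σ = y)
    (c : E.DualFiber y) : (⟨x, E.dualHomeo σ hs hr c⟩ : E.Dual) = E.sact ⟨y, c⟩ σ := by
  subst hs hr
  rw [sact, dif_pos rfl]

theorem convIntegrand_apply (F G : E.PreSection) {σ τ : S} (h : E.gpd.r τ = E.gpd.r σ)
    (c : E.DualFiber (E.gpd.r σ)) :
    E.convIntegrand F G σ τ c =
      unc F ⟨E.gpd.r σ, c⟩ τ * E.tr (unc G) ⟨E.gpd.r σ, c⟩ τ σ := by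
  rw [convIntegrand, dif_pos h, ZeroAtInftyContinuousMap.mul_apply]
  congr 1
  · rw [E.cast_apply h, E.unc_of F h.symm]
    rfl
  · rw [tr, ← E.mk_dualHomeo (E.r_inv_mul h).symm h, E.unc_mk]
    rfl

theorem integrable_convIntegrand {F G : E.PreSection} (hF : E.IsSection (unc F))
    (hG : E.IsSection (unc G)) (σ : S) :
    Integrable (fun γ => E.convIntegrand F G σ (E.A.out γ)) (α.meas (E.gpd.r σ)) := by
  have := E.t2Space_base
  obtain ⟨K, hK, hKF⟩ := hF.exists_support
  obtain ⟨B, hB0, hB⟩ := hF.exists_bound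
  obtain ⟨C, hC0, hC⟩ := hG.exists_bound
  obtain ⟨M, -, hM⟩ := α.exists_measure_le E.continuous_quot_r hK
  have hcl : IsClosed {γ | E.quot.r γ = E.gpd.r σ} := isClosed_eq E.continuous_quot_r continuous_const
  have hcont : ContinuousOn (fun γ => E.convIntegrand F G σ (E.A.out γ))
      {γ | E.quot.r γ = E.gpd.r σ} := by
    refine ZeroAtInftyContinuousMap.continuousOn_of_joint ?_ fun ε hε => ?_
    · have h1 := (hF.continuousOn_conv_integrand hG).comp
        (f := fun q : E.A.Quot × E.DualFiber (E.gpd.r σ) =>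
          (((⟨E.gpd.r σ, q.2⟩ : E.Dual), σ), q.1)) (s := {q | q.1 ∈ {γ | E.quot.r γ = E.gpd.r σ}})
        (((((E.continuous_dual_mk _).comp continuous_snd).prodMk continuous_const).prodMk
          continuous_fst).continuousOn) fun q hq => ⟨rfl, hq⟩
      exact h1.congr fun q hq => E.convIntegrand_apply F G hq q.2
    · obtain ⟨L, hL, hLF⟩ := hF.vanishing (ε / (C + 1)) (by positivity)
      refine ⟨_, (E.isClosedEmbedding_dual_mk (E.gpd.r σ)).isCompact_preimage hL,
        fun γ hγ c hc => hLF _ (E.A.out γ) (Eq.symm hγ) ?_⟩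
      rw [E.convIntegrand_apply F G hγ, norm_mul] at hc
      rw [div_le_iff₀ (by positivity)]
      refine hc.trans (mul_le_mul_of_nonneg_left ((hC _ _).trans (by linarith)) (norm_nonneg _))
  have hres : (α.meas (E.gpd.r σ)).restrict {γ | E.quot.r γ = E.gpd.r σ} = α.meas (E.gpd.r σ) :=
    Measure.restrict_eq_self_of_ae_mem (α.ae_r_eq _)
  have hmeas := hcont.aestronglyMeasurable (μ := α.meas (E.gpd.r σ)) hcl.measurableSet
  rw [hres] at hmeas
  refine ⟨hmeas, ?_⟩
  rw [hasFiniteIntegral_iff_enorm]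
  refine (α.lintegral_le_of_bound (B := ENNReal.ofReal (B * C)) hK.measurableSet (fun γ hγ => ?_)
    fun γ hγ hγK => ?_).trans_lt (ENNReal.mul_lt_top ENNReal.ofReal_lt_top
      ((hM _).trans_lt ENNReal.ofReal_lt_top))
  · rw [← ofReal_norm]
    refine ENNReal.ofReal_le_ofReal (ZeroAtInftyContinuousMap.norm_le_of_forall (by positivity)
      fun c => ?_)
    rw [E.convIntegrand_apply F G hγ, norm_mul]
    exact mul_le_mul (hB _ _) (hC _ _) (norm_nonneg _) hB0
  · have : E.convIntegrand F G σ (E.A.out γ) = 0 := by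
      ext c
      rw [E.convIntegrand_apply F G hγ]
      have h0 : unc F ⟨E.gpd.r σ, c⟩ (E.A.out γ) = 0 := by
        by_contra hne
        exact hγK (by simpa [E.A.proj_out] using hKF ⟨E.gpd.r σ, c⟩ (E.A.out γ) (Eq.symm hγ) hne)
      rw [h0, zero_mul, ZeroAtInftyContinuousMap.zero_apply]
    rw [this]
    exact enorm_zero (E := E.EFiber (E.gpd.r σ))

theorem unc_conv {F G : E.PreSection} (hF : E.IsSection (unc F)) (hG : E.IsSection (unc G)) :
    unc ((E.crossedAlgebra α).conv F G) = E.mconv α (unc F) (unc G) := by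
  funext χ σ
  by_cases h : χ.base = E.gpd.r σ
  · obtain ⟨x, c⟩ := χ
    obtain rfl : x = E.gpd.r σ := h
    rw [E.unc_mk, E.mconv_of α rfl]
    change ZeroAtInftyContinuousMap.evalCLM c
      (∫ γ, E.convIntegrand F G σ (E.A.out γ) ∂(α.meas (E.gpd.r σ))) = _
    rw [← ContinuousLinearMap.integral_comp_comm _ (E.integrable_convIntegrand α hF hG σ)]
    refine integral_congr_ae ?_
    filter_upwards [α.ae_r_eq (E.gpd.r σ)] with γ hγ
    exact E.convIntegrand_apply F G hγ c
  · rw [unc, dif_neg h, mconv, if_neg h]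

theorem unc_invol (F : E.PreSection) :
    unc ((E.crossedAlgebra α).invol F) = E.minv (unc F) := by
  funext χ σ
  by_cases h : χ.base = E.gpd.r σ
  · obtain ⟨x, c⟩ := χ
    obtain rfl : x = E.gpd.r σ := h
    rw [E.unc_mk, E.minv_of rfl, ← E.mk_dualHomeo (E.gpd.r_inv σ).symm rfl, E.unc_mk]
    rfl
  · rw [unc, dif_neg h, minv, if_neg h]

end AbelianExtension

theorem exists_tendsto_of_norm_sub {V : Type*} [NormedAddCommGroup V] [CompleteSpace V]
    {D : Set (ℕ → V)} (hD : D.Nonempty) (h : ∀ u ∈ D, ∀ v ∈ D,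
      Tendsto (fun p : ℕ × ℕ => ‖u p.1 - v p.2‖) (atTop ×ˢ atTop) (𝓝 0)) :
    ∃ t, ∀ u ∈ D, Tendsto u atTop (𝓝 t) := by
  obtain ⟨u, hu⟩ := hD
  have hcs : CauchySeq u := by
    rw [cauchySeq_iff_tendsto_dist_atTop_0, ← prod_atTop_atTop_eq]
    simpa only [dist_eq_norm] using h u hu u hu
  obtain ⟨t, ht⟩ := cauchySeq_tendsto_of_complete hcs
  refine ⟨t, fun v hv => ?_⟩
  have h0 : Tendsto (fun n => ‖u n - v n‖) atTop (𝓝 0) :=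
    (h u hu v hv).comp (tendsto_id.prodMk tendsto_id)
  have h2 := ht.sub (tendsto_zero_iff_norm_tendsto_zero.2 h0)
  rw [sub_zero] at h2
  exact h2.congr fun n => sub_sub_cancel _ _

namespace NonUnitalStarSubalgebra

variable {P Q : Type*} [NonUnitalCStarAlgebra P] [NonUnitalCStarAlgebra Q] {Ψ : P →⋆ₙₐ[ℂ] Q}

/-- An isometric homomorphism maps the closed subalgebra generated by a set onto the one generated
by any set in which the image is dense. -/
theorem map_topologicalClosure_adjoin (hΨ : Isometry Ψ) {s : Set P} {t : Set Q}
    (hst : ∀ a ∈ s, Ψ a ∈ t) (hts : ∀ b ∈ t, ∀ ε > 0, ∃ a ∈ s, ‖b - Ψ a‖ < ε) :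
    (NonUnitalStarAlgebra.adjoin ℂ s).topologicalClosure.map Ψ =
      (NonUnitalStarAlgebra.adjoin ℂ t).topologicalClosure := by
  have hclosed : IsClosed
      ((NonUnitalStarAlgebra.adjoin ℂ s).topologicalClosure.map Ψ : Set Q) := by
    rw [NonUnitalStarSubalgebra.coe_map]
    exact hΨ.isClosedEmbedding.isClosedMap _
      (NonUnitalStarSubalgebra.isClosed_topologicalClosure _)
  refine le_antisymm ?_ ?_
  · rintro _ ⟨a, ha, rfl⟩
    have h1 : NonUnitalStarAlgebra.adjoin ℂ s ≤
        (NonUnitalStarAlgebra.adjoin ℂ t).topologicalClosure.comap Ψ :=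
      NonUnitalStarAlgebra.adjoin_le fun a ha => NonUnitalStarSubalgebra.le_topologicalClosure _
        (NonUnitalStarAlgebra.subset_adjoin ℂ _ (hst a ha))
    have h2 : IsClosed
        ((NonUnitalStarAlgebra.adjoin ℂ t).topologicalClosure.comap Ψ : Set P) :=
      (NonUnitalStarSubalgebra.isClosed_topologicalClosure _).preimage hΨ.continuous
    exact NonUnitalStarSubalgebra.topologicalClosure_minimal _ h1 h2 ha
  · refine NonUnitalStarSubalgebra.topologicalClosure_minimal _
      (NonUnitalStarAlgebra.adjoin_le fun b hb => ?_) hclosed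
    refine hclosed.closure_subset (Metric.mem_closure_iff.2 fun ε hε => ?_)
    obtain ⟨a, ha, hab⟩ := hts b hb ε hε
    exact ⟨Ψ a, ⟨a, NonUnitalStarSubalgebra.le_topologicalClosure _
      (NonUnitalStarAlgebra.subset_adjoin ℂ _ ha), rfl⟩, by rwa [dist_eq_norm]⟩

theorem exists_equiv_of_map_eq (hΨ : Function.Injective Ψ) {U : NonUnitalStarSubalgebra ℂ P}
    {V : NonUnitalStarSubalgebra ℂ Q} (h : U.map Ψ = V) :
    ∃ Φ : U ≃⋆ₐ[ℂ] V, ∀ a, (Φ a : Q) = Ψ a := by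
  let Θ : U →⋆ₙₐ[ℂ] V :=
    NonUnitalStarAlgHom.codRestrict (Ψ.comp (NonUnitalStarSubalgebraClass.subtype U)) V
      fun a => h ▸ ⟨a, a.2, rfl⟩
  have hΘ : Function.Bijective Θ := by
    constructor
    · intro a b hab
      exact Subtype.ext (hΨ (congrArg Subtype.val hab))
    · rintro ⟨b, hb⟩
      rw [← h] at hb
      obtain ⟨a, ha, rfl⟩ := hb
      exact ⟨⟨a, ha⟩, rfl⟩
  exact ⟨StarAlgEquiv.ofBijective Θ hΘ, fun a => rfl⟩

end NonUnitalStarSubalgebra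

namespace SectionAlgebra

variable {F F' : Type u} [AddCommGroup F] [Module ℂ F] [AddCommGroup F'] [Module ℂ F']
  {A : SectionAlgebra F} {B : SectionAlgebra F'} {nA : F → ℝ≥0∞} {nB : F' → ℝ≥0∞}
  {T : A.carrier → B.carrier}

/-- The pull-back of a representation along a homomorphism of section algebras. -/
def Rep.restrict (hT : A.IsStarHom B T) (L : B.Rep nB)
    (h : ∀ f, ‖L.toFun (T f)‖ ≤ (nA f).toReal) : A.Rep nA where
  H := L.H
  toFun f := L.toFun (T f)
  map_add f g k hk := L.map_add _ _ _ (hT.map_add f g k hk)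
  map_smul c f k hk := L.map_smul c _ _ (hT.map_smul c f k hk)
  map_conv f g k hk := L.map_conv _ _ _ (hT.map_conv f g k hk)
  map_invol f k hk := L.map_invol _ _ (hT.map_invol f k hk)
  norm_le := h

/-- The homomorphism of the algebras of bounded families induced by a map of representations. -/
def ambientHom (hT : A.IsStarHom B T)
    (hres : ∀ (L : B.Rep nB) f, ‖L.toFun (T f)‖ ≤ (nA f).toReal) :
    A.Ambient nA →⋆ₙₐ[ℂ] B.Ambient nB where
  toFun a := ⟨fun L => a (L.restrict hT (hres L)), memℓp_infty ⟨‖a‖, by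
    rintro _ ⟨L, rfl⟩
    exact lp.norm_apply_le_norm ENNReal.top_ne_zero a _⟩⟩
  map_smul' _ _ := rfl
  map_zero' := rfl
  map_add' _ _ := rfl
  map_mul' _ _ := rfl
  map_star' _ := rfl

theorem norm_ambientHom (hT : A.IsStarHom B T)
    (hres : ∀ (L : B.Rep nB) f, ‖L.toFun (T f)‖ ≤ (nA f).toReal)
    (hsurj : ∀ M : A.Rep nA, ∃ L : B.Rep nB, L.restrict hT (hres L) = M) (a : A.Ambient nA) :
    ‖ambientHom hT hres a‖ = ‖a‖ := by
  refine le_antisymm (lp.norm_le_of_forall_le (norm_nonneg _) fun L =>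
    lp.norm_apply_le_norm ENNReal.top_ne_zero a (L.restrict hT (hres L)))
    (lp.norm_le_of_forall_le (norm_nonneg _) fun M => ?_)
  obtain ⟨L, rfl⟩ := hsurj M
  exact lp.norm_apply_le_norm ENNReal.top_ne_zero (ambientHom hT hres a) L

theorem map_sub (L : B.Rep nB) {f g h : B.carrier} (hh : (h : F') = f - g) :
    L.toFun h = L.toFun f - L.toFun g := by
  rw [eq_sub_iff_add_eq]
  exact (L.map_add h g f (by rw [hh, sub_add_cancel])).symm

theorem norm_sub_le (L : B.Rep nB) {f g h : B.carrier} (hh : (h : F') = f - g) :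
    ‖L.toFun f - L.toFun g‖ ≤ (nB h).toReal := by
  rw [← map_sub L hh]
  exact L.norm_le h

theorem norm_univRep_sub_le {f g h : B.carrier} (hh : (h : F') = f - g) :
    ‖B.univRep nB f - B.univRep nB g‖ ≤ (nB h).toReal :=
  lp.norm_le_of_forall_le ENNReal.toReal_nonneg fun L => norm_sub_le L hh

theorem IsWellDefined.sub_mem (hB : B.IsWellDefined) {f g : F'} (hf : f ∈ B.carrier)
    (hg : g ∈ B.carrier) : f - g ∈ B.carrier := by
  have := hB.add_mem f hf _ (hB.smul_mem (-1) g hg)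
  rwa [neg_one_smul, ← sub_eq_add_neg] at this

/-- A homomorphism of section algebras with dense range, along which representations restrict and
extend, induces an isomorphism of the completions. -/
theorem exists_completion_equiv (hB : B.IsWellDefined) (hT : A.IsStarHom B T)
    (hres : ∀ (L : B.Rep nB) f, ‖L.toFun (T f)‖ ≤ (nA f).toReal)
    (hext : ∀ M : A.Rep nA, ∃ L : B.Rep nB, L.restrict hT (hres L) = M)
    (hdense : ∀ g ∈ B.carrier, ∀ ε : ℝ≥0∞, 0 < ε → ∃ f, nB (g - (T f).1) < ε) :
    ∃ Φ : A.Completion nA ≃⋆ₐ[ℂ] B.Completion nB,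
      ∀ f, Φ (A.toCompletion nA f) = B.toCompletion nB (T f) := by
  have hiso : Isometry (ambientHom (nA := nA) (nB := nB) hT hres) :=
    AddMonoidHomClass.isometry_of_norm _ (norm_ambientHom hT hres hext)
  have hmap : (A.envelope nA).map (ambientHom (nA := nA) (nB := nB) hT hres) = B.envelope nB := by
    refine NonUnitalStarSubalgebra.map_topologicalClosure_adjoin hiso ?_ ?_
    · rintro _ ⟨f, rfl⟩
      exact ⟨T f, rfl⟩
    · rintro _ ⟨g, rfl⟩ ε hε
      obtain ⟨f, hf⟩ := hdense g g.2 (ENNReal.ofReal ε) (ENNReal.ofReal_pos.2 hε)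
      refine ⟨A.univRep nA f, ⟨f, rfl⟩, ?_⟩
      change ‖B.univRep nB g - B.univRep nB (T f)‖ < ε
      refine (norm_univRep_sub_le (h := ⟨(g : F') - T f, hB.sub_mem g.2 (T f).2⟩) rfl).trans_lt ?_
      exact (ENNReal.lt_ofReal_iff_toReal_lt hf.ne_top).1 hf
  obtain ⟨Φ, hΦ⟩ := NonUnitalStarSubalgebra.exists_equiv_of_map_eq hiso.injective hmap
  exact ⟨Φ, fun f => Subtype.ext (hΦ _)⟩

/-- Representations extend along a homomorphism of section algebras, if sections of the target are
limits of sequences of sections of the source in a sense `C` that is compatible with the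
operations. -/
theorem Rep.exists_extension (hA : A.IsWellDefined) (hT : A.IsStarHom B T)
    (hres : ∀ (L : B.Rep nB) f, ‖L.toFun (T f)‖ ≤ (nA f).toReal)
    {C : (ℕ → A.carrier) → B.carrier → Prop}
    (hex : ∀ g, ∃ u, C u g ∧ ∀ n, (nA (u n)).toReal ≤ (nB g).toReal)
    (hcauchy : ∀ u v g, C u g → C v g →
      Tendsto (fun p : ℕ × ℕ => (nA ((u p.1 : F) - v p.2)).toReal) (atTop ×ˢ atTop) (𝓝 0))
    (hadd : ∀ u v (w : ℕ → A.carrier) (f g h : B.carrier), C u f → C v g →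
      (∀ n, (w n : F) = u n + v n) → (h : F') = f + g → C w h)
    (hsmul : ∀ (c : ℂ) u (w : ℕ → A.carrier) (f h : B.carrier), C u f →
      (∀ n, (w n : F) = c • (u n : F)) → (h : F') = c • (f : F') → C w h)
    (hconv : ∀ u v (w : ℕ → A.carrier) (f g h : B.carrier), C u f → C v g →
      (∀ n, (w n : F) = A.conv (u n) (v n)) → (h : F') = B.conv f g → C w h)
    (hinvol : ∀ u (w : ℕ → A.carrier) (f h : B.carrier), C u f →
      (∀ n, (w n : F) = A.invol (u n)) → (h : F') = B.invol f → C w h)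
    (hconst : ∀ f, C (fun _ => f) (T f)) (M : A.Rep nA) :
    ∃ L : B.Rep nB, L.restrict hT (hres L) = M := by
  have hdist : ∀ u v g, C u g → C v g → Tendsto
      (fun p : ℕ × ℕ => ‖M.toFun (u p.1) - M.toFun (v p.2)‖) (atTop ×ˢ atTop) (𝓝 0) :=
    fun u v g hu hv => squeeze_zero (fun _ => norm_nonneg _)
      (fun p => norm_sub_le M (h := ⟨(u p.1 : F) - v p.2, hA.sub_mem (u p.1).2 (v p.2).2⟩) rfl)
      (hcauchy u v g hu hv)
  have hlim : ∀ g, ∃ t, ∀ v, C v g → Tendsto (fun n => M.toFun (v n)) atTop (𝓝 t) := by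
    intro g
    obtain ⟨t, ht⟩ := exists_tendsto_of_norm_sub (D := {w | ∃ u, C u g ∧ w = fun n => M.toFun (u n)})
      (let ⟨u, hu, _⟩ := hex g; ⟨_, u, hu, rfl⟩)
      (by rintro _ ⟨u, hu, rfl⟩ _ ⟨v, hv, rfl⟩; exact hdist u v g hu hv)
    exact ⟨t, fun v hv => ht _ ⟨v, hv, rfl⟩⟩
  choose t ht using hlim
  have hex' : ∀ g, ∃ u, C u g := fun g => (hex g).imp fun _ h => h.1
  have htT : (fun f => t (T f)) = M.toFun := funext fun f =>
    tendsto_nhds_unique (ht _ _ (hconst f)) tendsto_const_nhds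
  refine ⟨⟨M.H, t, ?_, ?_, ?_, ?_, ?_⟩, ?_⟩
  · intro f g h hh
    obtain ⟨u, hu⟩ := hex' f
    obtain ⟨v, hv⟩ := hex' g
    have hw := ht h _ (hadd u v (fun n => ⟨(u n : F) + v n, hA.add_mem _ (u n).2 _ (v n).2⟩) f g h
      hu hv (fun _ => rfl) hh)
    refine tendsto_nhds_unique hw (((ht f u hu).add (ht g v hv)).congr fun n => ?_)
    exact (M.map_add _ _ _ rfl).symm
  · intro c f h hh
    obtain ⟨u, hu⟩ := hex' f
    have hw := ht h _ (hsmul c u (fun n => ⟨c • (u n : F), hA.smul_mem c _ (u n).2⟩) f h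
      hu (fun _ => rfl) hh)
    refine tendsto_nhds_unique hw (((ht f u hu).const_smul c).congr fun n => ?_)
    exact (M.map_smul _ _ _ rfl).symm
  · intro f g h hh
    obtain ⟨u, hu⟩ := hex' f
    obtain ⟨v, hv⟩ := hex' g
    have hw := ht h _ (hconv u v (fun n => ⟨A.conv (u n) (v n), hA.conv_mem _ (u n).2 _ (v n).2⟩)
      f g h hu hv (fun _ => rfl) hh)
    refine tendsto_nhds_unique hw (((ht f u hu).mul (ht g v hv)).congr fun n => ?_)
    exact (M.map_conv _ _ _ rfl).symm
  · intro f h hh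
    obtain ⟨u, hu⟩ := hex' f
    have hw := ht h _ (hinvol u (fun n => ⟨A.invol (u n), hA.invol_mem _ (u n).2⟩) f h
      hu (fun _ => rfl) hh)
    refine tendsto_nhds_unique hw ((ht f u hu).star.congr fun n => ?_)
    exact (M.map_invol _ _ rfl).symm
  · intro g
    obtain ⟨u, hu, hle⟩ := hex g
    exact le_of_tendsto (ht g u hu).norm
      (Eventually.of_forall fun n => (M.norm_le _).trans (hle n))
  · cases M
    simp only [Rep.restrict]
    congr 1

end SectionAlgebra

/-- The Schur test. -/
theorem MeasureTheory.lintegral_sq_le_of_schur {Y : Type*} [MeasurableSpace Y] {μ : Measure Y}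
    [SFinite μ] {k : Y → Y → ℝ≥0∞} {g : Y → ℝ≥0∞}
    (hk : AEMeasurable (Function.uncurry k) (μ.prod μ)) (hg : AEMeasurable g μ) {C D : ℝ≥0∞}
    (hC : ∀ᵐ x ∂μ, ∫⁻ y, k x y ∂μ ≤ C) (hD : ∀ᵐ y ∂μ, ∫⁻ x, k x y ∂μ ≤ D) :
    ∫⁻ x, (∫⁻ y, k x y * g y ∂μ) ^ 2 ∂μ ≤ C * D * ∫⁻ y, g y ^ 2 ∂μ := by
  have h1 : ∀ᵐ x ∂μ, (∫⁻ y, k x y * g y ∂μ) ^ 2 ≤ C * ∫⁻ y, k x y * g y ^ 2 ∂μ := by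
    filter_upwards [hC, hk.aestronglyMeasurable.prodMk_left] with x hx hkx'
    have hkx : AEMeasurable (k x) μ := hkx'.aemeasurable
    have h2 := ENNReal.lintegral_mul_le_Lp_mul_Lq μ Real.HolderConjugate.two_two
      (f := fun y => k x y ^ (1 / 2 : ℝ)) (g := fun y => k x y ^ (1 / 2 : ℝ) * g y)
      (hkx.pow_const _) ((hkx.pow_const _).mul hg)
    have h3 : ∀ y, k x y ^ (1 / 2 : ℝ) * k x y ^ (1 / 2 : ℝ) = k x y := fun y => by
      rw [← ENNReal.rpow_add_of_nonneg _ _ (by norm_num) (by norm_num)]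
      norm_num
    have h4 : ∀ a : ℝ≥0∞, a ^ (2 : ℝ) = a ^ 2 := fun a => by
      rw [← ENNReal.rpow_natCast]; norm_num
    have h5 : ∀ a : ℝ≥0∞, (a ^ (1 / 2 : ℝ)) ^ 2 = a := fun a => by
      rw [← h4, ← ENNReal.rpow_mul]; norm_num
    simp only [Pi.mul_apply, ← mul_assoc, h3, h4, mul_pow, h5] at h2
    calc (∫⁻ y, k x y * g y ∂μ) ^ 2
        ≤ ((∫⁻ y, k x y ∂μ) ^ (1 / 2 : ℝ) * (∫⁻ y, k x y * g y ^ 2 ∂μ) ^ (1 / 2 : ℝ)) ^ 2 := by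
          gcongr
      _ = (∫⁻ y, k x y ∂μ) * ∫⁻ y, k x y * g y ^ 2 ∂μ := by rw [mul_pow, h5, h5]
      _ ≤ C * ∫⁻ y, k x y * g y ^ 2 ∂μ := by gcongr
  have hkg : AEMeasurable (Function.uncurry fun x y => k x y * g y ^ 2) (μ.prod μ) :=
    hk.mul ((hg.comp_quasiMeasurePreserving Measure.quasiMeasurePreserving_snd).pow_const 2)
  calc ∫⁻ x, (∫⁻ y, k x y * g y ∂μ) ^ 2 ∂μ
      ≤ ∫⁻ x, C * ∫⁻ y, k x y * g y ^ 2 ∂μ ∂μ := lintegral_mono_ae h1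
    _ = C * ∫⁻ x, ∫⁻ y, k x y * g y ^ 2 ∂μ ∂μ := lintegral_const_mul'' _ hkg.lintegral_prod_right'
    _ = C * ∫⁻ y, ∫⁻ x, k x y * g y ^ 2 ∂μ ∂μ := by rw [lintegral_lintegral_swap hkg]
    _ ≤ C * ∫⁻ y, D * g y ^ 2 ∂μ := by
        refine mul_le_mul_right (lintegral_mono_ae ?_) _
        have hk' : AEMeasurable (Function.uncurry fun y x => k x y) (μ.prod μ) := hk.prod_swap
        filter_upwards [hD, hk'.aestronglyMeasurable.prodMk_left] with y hy hky
        have hky' : AEMeasurable (fun x => k x y) μ := hky.aemeasurable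
        rw [lintegral_mul_const'' _ hky']
        gcongr
    _ = C * D * ∫⁻ y, g y ^ 2 ∂μ := by
        rw [lintegral_const_mul'' _ (hg.pow_const 2), mul_assoc]

namespace AbelianExtension

variable {S X : Type u} [TopologicalSpace S] [T2Space S] [LocallyCompactSpace S]
  [SecondCountableTopology S] [MeasurableSpace S] [BorelSpace S] [TopologicalSpace X]
  (E : AbelianExtension S X)

/-! ### The norms of sections -/

theorem continuousOn_quot_mul : ContinuousOn (fun q : E.A.Quot × E.A.Quot => E.quot.mul q.1 q.2)
    {q | E.quot.s q.1 = E.quot.r q.2} := by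
  refine ContinuousOn.of_comp_isOpenQuotientMap
    (E.isOpenQuotientMap_proj.prodMap E.isOpenQuotientMap_proj) ?_
  have h : ∀ q ∈ Prod.map E.A.proj E.A.proj ⁻¹' {q | E.quot.s q.1 = E.quot.r q.2},
      E.gpd.s q.1 = E.gpd.r q.2 := fun q hq => by
    rw [← E.quot_s_proj, ← E.quot_r_proj]; exact hq
  refine ContinuousOn.congr (E.continuous_proj.comp_continuousOn
    (E.continuousOn_mul' (f := Prod.fst) (g := Prod.snd) continuousOn_fst continuousOn_snd h))
    fun q hq => ?_
  exact E.quot_mul_proj (h q hq)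

theorem continuousOn_quot_inv_mul (x : X) :
    ContinuousOn (fun q : E.A.Quot × E.A.Quot => E.quot.mul (E.quot.inv q.1) q.2)
      ({γ | E.quot.r γ = x} ×ˢ {γ | E.quot.r γ = x}) :=
  E.continuousOn_quot_mul.comp (f := fun q : E.A.Quot × E.A.Quot => (E.quot.inv q.1, q.2))
    ((E.continuous_quot_inv.comp continuous_fst).prodMk continuous_snd).continuousOn
    fun q hq => (E.quot.s_inv q.1).trans (hq.1.trans hq.2.symm)

theorem exists_isCompact_quot_mul {K L : Set E.A.Quot} (hK : IsCompact K) (hL : IsCompact L) :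
    ∃ M : Set E.A.Quot, IsCompact M ∧ ∀ γ ∈ K, ∀ δ ∈ L, E.quot.s γ = E.quot.r δ →
      E.quot.mul γ δ ∈ M := by
  obtain ⟨M, hM, h⟩ := E.exists_isCompact_mul hK hL
  exact ⟨M, hM, fun γ hγ δ hδ hs => h (E.A.out γ) (E.A.out δ) hs (by rwa [E.A.proj_out])
    (by rwa [E.A.proj_out])⟩

variable (α : E.quot.HaarSystem)

/-- Left invariance for non-negative functions. -/
theorem lintegral_quot_mul_left (γ : E.A.Quot) {K : Set E.A.Quot} (hK : IsCompact K)
    {k : E.A.Quot → ℝ} (hk0 : ∀ δ, 0 ≤ k δ) (hk : ContinuousOn k {δ | E.quot.r δ = E.quot.r γ})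
    (hz : ∀ δ, E.quot.r δ = E.quot.r γ → δ ∉ K → k δ = 0) :
    ∫⁻ δ, ENNReal.ofReal (k (E.quot.mul γ δ)) ∂α.meas (E.quot.s γ) =
      ∫⁻ δ, ENNReal.ofReal (k δ) ∂α.meas (E.quot.r γ) := by
  have := E.t2Space_base
  obtain ⟨M, hM, hMK⟩ := E.exists_isCompact_quot_mul (isCompact_singleton (x := E.quot.inv γ)) hK
  have hc : ContinuousOn (fun δ => (k δ : ℂ)) {δ | E.quot.r δ = E.quot.r γ} :=
    Complex.continuous_ofReal.comp_continuousOn hk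
  have hz' : ∀ δ, E.quot.r δ = E.quot.r γ → δ ∉ K → (k δ : ℂ) = 0 := fun δ h1 h2 => by
    rw [hz δ h1 h2, Complex.ofReal_zero]
  have hi := α.integrable_of_continuousOn E.continuous_quot_r hK hc hz'
  have hc' : ContinuousOn (fun δ => (k (E.quot.mul γ δ) : ℂ)) {δ | E.quot.r δ = E.quot.s γ} :=
    hc.comp (f := fun δ => E.quot.mul γ δ) (E.continuousOn_quot_mul.comp
      (f := fun δ => (γ, δ)) (by fun_prop) fun δ hδ => Eq.symm hδ) fun δ hδ =>
      E.quot.r_mul _ _ (Eq.symm hδ)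
  have hi' := α.integrable_of_continuousOn (x := E.quot.s γ) E.continuous_quot_r hM hc'
    fun δ hδ hδM => hz' _ (E.quot.r_mul _ _ (Eq.symm hδ)) fun h => hδM (by
      have := hMK _ rfl _ h (by rw [E.quot.s_inv, E.quot.r_mul _ _ (Eq.symm hδ)])
      rwa [E.quot.inv_mul_cancel_left _ _ (Eq.symm hδ)] at this)
  have h := α.integral_mul_left E.continuous_quot_r γ hK hc hz'
  rw [integral_complex_ofReal, integral_complex_ofReal, Complex.ofReal_inj] at h
  have hr : Integrable k (α.meas (E.quot.r γ)) := hi.re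
  have hr' : Integrable (fun δ => k (E.quot.mul γ δ)) (α.meas (E.quot.s γ)) := hi'.re
  rw [← ofReal_integral_eq_lintegral_ofReal hr' (Eventually.of_forall fun δ => hk0 _),
    ← ofReal_integral_eq_lintegral_ofReal hr (Eventually.of_forall fun δ => hk0 _)]
  exact congrArg _ h

theorem tr_sact (ψ : E.Dual → S → ℂ) {χ : E.Dual} {ρ τ σ : S} (hρ : χ.base = E.gpd.r ρ)
    (hτ : E.gpd.s ρ = E.gpd.r τ) (hσ : χ.base = E.gpd.r σ) :
    E.tr ψ (E.sact χ ρ) τ (E.gpd.mul (E.gpd.inv ρ) σ) = E.tr ψ χ (E.gpd.mul ρ τ) σ := by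
  rw [tr, tr, E.sact_mul hρ hτ, E.gpd.mul_inv_rev _ _ hτ, E.gpd.assoc]
  · rw [E.gpd.s_inv, E.gpd.r_inv, hτ]
  · rw [E.gpd.s_inv, ← hρ, hσ]

/-- The square of the norm of the fibre over `χ` of the Hilbert module of a section. -/
def sqNorm (φ : E.Dual → S → ℂ) (χ : E.Dual) : ℝ≥0∞ :=
  ∫⁻ γ, ‖φ (E.sact χ (E.A.out γ)) (E.gpd.inv (E.A.out γ))‖ₑ ^ 2 ∂α.meas χ.base

/-- The norm of a section in the Hilbert module. -/
def modNorm (φ : E.Dual → S → ℂ) : ℝ≥0∞ := (⨆ χ, E.sqNorm α φ χ) ^ (1 / 2 : ℝ)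

theorem modNorm_mono {φ ψ : E.Dual → S → ℂ} (h : ∀ χ σ, ‖φ χ σ‖ ≤ ‖ψ χ σ‖) :
    E.modNorm α φ ≤ E.modNorm α ψ := by
  refine ENNReal.rpow_le_rpow (iSup_mono fun χ => lintegral_mono fun γ => ?_) (by norm_num)
  exact pow_le_pow_left' (enorm_le_iff_norm_le.2 (h _ _)) 2

theorem enorm_mconv_minv_self {φ : E.Dual → S → ℂ} (hφ : E.IsSection φ) (χ : E.Dual) :
    ‖E.mconv α (E.minv φ) φ χ (E.gpd.one χ.base)‖ₑ = E.sqNorm α φ χ := by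
  have hone : χ.base = E.gpd.r (E.gpd.one χ.base) := (E.gpd.r_one _).symm
  have hi := hφ.inv.integrable_conv α hφ hone
  have hae : (fun γ => E.minv φ χ (E.A.out γ) * E.tr φ χ (E.A.out γ) (E.gpd.one χ.base))
      =ᵐ[α.meas χ.base] fun γ =>
        ((‖φ (E.sact χ (E.A.out γ)) (E.gpd.inv (E.A.out γ))‖ ^ 2 : ℝ) : ℂ) := by
    filter_upwards [α.ae_r_eq χ.base] with γ hγ
    rw [E.minv_of (Eq.symm hγ), E.tr_one φ (Eq.symm hγ), Complex.star_def, ← Complex.normSq_eq_conj_mul_self,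
      Complex.normSq_eq_norm_sq]
  have hr : Integrable
      (fun γ => ‖φ (E.sact χ (E.A.out γ)) (E.gpd.inv (E.A.out γ))‖ ^ 2) (α.meas χ.base) :=
    (hi.congr hae).re
  rw [E.mconv_of α hone, integral_congr_ae hae, integral_complex_ofReal, ← ofReal_norm,
    Complex.norm_real, Real.norm_of_nonneg (integral_nonneg fun _ => by positivity),
    ofReal_integral_eq_lintegral_ofReal hr (Eventually.of_forall fun _ => by positivity)]
  refine lintegral_congr fun γ => ?_
  rw [ENNReal.ofReal_pow (norm_nonneg _), ofReal_norm]

theorem IsSection.continuousOn_norm_tr_one {E : AbelianExtension S X} {ψ : E.Dual → S → ℂ}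
    (hψ : E.IsSection ψ) (χ : E.Dual) :
    ContinuousOn (fun γ => ‖E.tr ψ χ (E.A.out γ) (E.gpd.one χ.base)‖)
      {γ | E.quot.r γ = χ.base} := by
  have hone : χ.base = E.gpd.r (E.gpd.one χ.base) := (E.gpd.r_one _).symm
  have h := E.continuousOn_out (P := Unit) (W := Set.univ) (p := fun _ => χ.base)
    (h := fun _ σ => ‖E.tr ψ χ σ (E.gpd.one χ.base)‖)
    (fun _ _ σ hσ => hψ.tr_out (Eq.symm hσ) hone)
    (hψ.continuousOn_tr continuousOn_const continuousOn_snd continuousOn_const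
      (fun q hq => hq.2.symm) fun _ _ => hone).norm
  exact h.comp (f := fun γ => ((), γ)) (by fun_prop) fun γ hγ => ⟨trivial, hγ⟩

/-- Left convolution by sections with values bounded by `B` and support in a given compact set is
bounded by a multiple of `B` on the Hilbert module. -/
theorem exists_modNorm_mconv_le {K : Set E.A.Quot} (hK : IsCompact K) :
    ∃ C : ℝ≥0∞, C ≠ ∞ ∧ ∀ (φ ψ : E.Dual → S → ℂ) (B : ℝ), E.IsSection ψ →
      (∀ χ σ, Dual.base χ = E.gpd.r σ → φ χ σ ≠ 0 → E.A.proj σ ∈ K) →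
      (∀ χ σ, ‖φ χ σ‖ ≤ B) →
      E.modNorm α (E.mconv α φ ψ) ≤ C * ENNReal.ofReal B * E.modNorm α ψ := by
  have := E.t2Space_base
  obtain ⟨c, hc1, -, hcs, hc01⟩ := exists_continuous_one_zero_of_isCompact hK isClosed_empty
    (Set.disjoint_empty K)
  have hcs' : IsCompact (tsupport c) := hcs
  obtain ⟨C₁, -, hC₁⟩ := α.exists_measure_le E.continuous_quot_r hcs'
  obtain ⟨C₂, -, hC₂⟩ := α.exists_measure_le E.continuous_quot_r
    (hcs'.image E.continuous_quot_inv)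
  have hc0 : ∀ γ, 0 ≤ c γ := fun γ => (hc01 γ).1
  have hI₁ : ∀ x, ∫⁻ γ, ENNReal.ofReal (c γ) ∂α.meas x ≤ ENNReal.ofReal C₁ := fun x =>
    (α.lintegral_le_of_bound (B := 1) hcs'.measurableSet
      (fun γ _ => ENNReal.ofReal_le_one.2 (hc01 γ).2)
      fun γ _ hγ => by rw [image_eq_zero_of_notMem_tsupport hγ, ENNReal.ofReal_zero]).trans
    (by rw [one_mul]; exact hC₁ x)
  have hI₂ : ∀ x, ∫⁻ γ, ENNReal.ofReal (c (E.quot.inv γ)) ∂α.meas x ≤ ENNReal.ofReal C₂ :=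
    fun x => (α.lintegral_le_of_bound (B := 1) (hcs'.image E.continuous_quot_inv).measurableSet
      (fun γ _ => ENNReal.ofReal_le_one.2 (hc01 _).2)
      fun γ _ hγ => by
        rw [image_eq_zero_of_notMem_tsupport fun h => hγ ⟨_, h, E.quot.inv_inv γ⟩,
          ENNReal.ofReal_zero]).trans
    (by rw [one_mul]; exact hC₂ x)
  set C₀ := max (ENNReal.ofReal C₁) (ENNReal.ofReal C₂) with hC₀
  refine ⟨C₀, (max_lt ENNReal.ofReal_lt_top ENNReal.ofReal_lt_top).ne,
    fun φ ψ B hψ hφK hB => ?_⟩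
  suffices hsq : ∀ χ, E.sqNorm α (E.mconv α φ ψ) χ ≤
      (C₀ * ENNReal.ofReal B) ^ 2 * E.sqNorm α ψ χ by
    have h1 : (⨆ χ, E.sqNorm α (E.mconv α φ ψ) χ) ≤
        (C₀ * ENNReal.ofReal B) ^ 2 * ⨆ χ, E.sqNorm α ψ χ :=
      iSup_le fun χ => (hsq χ).trans (mul_le_mul_right (le_iSup (E.sqNorm α ψ) χ) _)
    refine (ENNReal.rpow_le_rpow h1 (by norm_num : (0 : ℝ) ≤ 1 / 2)).trans ?_
    rw [ENNReal.mul_rpow_of_nonneg _ _ (by norm_num), ← ENNReal.rpow_natCast, ← ENNReal.rpow_mul]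
    norm_num
    rfl
  intro χ
  set x := χ.base with hx
  have hone : x = E.gpd.r (E.gpd.one x) := (E.gpd.r_one _).symm
  have hB0 : 0 ≤ B := (norm_nonneg _).trans (hB χ (E.gpd.one x))
  set g : E.A.Quot → ℝ := fun γ => ‖E.tr ψ χ (E.A.out γ) (E.gpd.one x)‖ with hg
  have hgc : ContinuousOn g {γ | E.quot.r γ = x} := hψ.continuousOn_norm_tr_one χ
  set s : Set E.A.Quot := {γ | E.quot.r γ = x} with hs
  have hcl : IsClosed s := isClosed_eq E.continuous_quot_r continuous_const
  have hres : (α.meas x).restrict s = α.meas x :=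
    Measure.restrict_eq_self_of_ae_mem (α.ae_r_eq x)
  have hcmul : ContinuousOn (fun q : E.A.Quot × E.A.Quot => c (E.quot.mul (E.quot.inv q.1) q.2))
      (s ×ˢ s) := c.continuous.comp_continuousOn (E.continuousOn_quot_inv_mul x)
  have hkm : AEMeasurable (Function.uncurry fun ω τ =>
      ENNReal.ofReal (c (E.quot.mul (E.quot.inv ω) τ))) ((α.meas x).prod (α.meas x)) := by
    have h1 := hcmul.aemeasurable (μ := (α.meas x).prod (α.meas x))
      (hcl.measurableSet.prod hcl.measurableSet)
    rw [← Measure.prod_restrict, hres] at h1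
    exact h1.ennreal_ofReal
  have hgm : AEMeasurable (fun τ => ENNReal.ofReal (g τ)) (α.meas x) := by
    have h1 := hgc.aemeasurable (μ := α.meas x) hcl.measurableSet
    rw [hres] at h1
    exact h1.ennreal_ofReal
  have hsupp : ∀ ω, E.quot.r ω = x → ∃ M : Set E.A.Quot, IsCompact M ∧
      ∀ δ, E.quot.r δ = x → δ ∉ M → c (E.quot.mul (E.quot.inv ω) δ) = 0 := fun ω hω => by
    obtain ⟨M, hM, hMK⟩ := E.exists_isCompact_quot_mul (isCompact_singleton (x := ω)) hcs'
    refine ⟨M, hM, fun δ hδ hδM => image_eq_zero_of_notMem_tsupport fun h => hδM ?_⟩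
    have h1 := hMK ω rfl _ h (by
      rw [E.quot.r_mul _ _ ((E.quot.s_inv ω).trans (hω.trans hδ.symm)), E.quot.r_inv])
    rwa [E.quot.mul_inv_cancel_left _ _ (hω.trans hδ.symm)] at h1
  have hcω : ∀ ω, E.quot.r ω = x → ContinuousOn (fun δ => c (E.quot.mul (E.quot.inv ω) δ)) s :=
    fun ω hω => hcmul.comp (f := fun δ => (ω, δ)) (by fun_prop) fun δ hδ => ⟨hω, hδ⟩
  have hinteg₁ : ∀ᵐ ω ∂α.meas x,
      ∫⁻ τ, ENNReal.ofReal (c (E.quot.mul (E.quot.inv ω) τ)) ∂α.meas x ≤ C₀ := by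
    filter_upwards [α.ae_r_eq x] with ω hω
    obtain ⟨M, hM, hMz⟩ := hsupp ω hω
    have h1 := E.lintegral_quot_mul_left α ω hM
      (k := fun δ => c (E.quot.mul (E.quot.inv ω) δ)) (fun δ => hc0 _)
      (by rw [hω]; exact hcω ω hω) (by rw [hω]; exact hMz)
    rw [hω] at h1
    rw [← h1]
    refine le_trans (le_of_eq ?_) ((hI₁ (E.quot.s ω)).trans (le_max_left _ _))
    refine lintegral_congr_ae ?_
    filter_upwards [α.ae_r_eq (E.quot.s ω)] with τ hτ
    rw [E.quot.inv_mul_cancel_left _ _ hτ.symm]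
  have hinteg₂ : ∀ᵐ τ ∂α.meas x,
      ∫⁻ ω, ENNReal.ofReal (c (E.quot.mul (E.quot.inv ω) τ)) ∂α.meas x ≤ C₀ := by
    filter_upwards [α.ae_r_eq x] with τ hτ
    obtain ⟨M, hM, hMK⟩ := E.exists_isCompact_quot_mul (isCompact_singleton (x := τ))
      (hcs'.image E.continuous_quot_inv)
    have h1 := E.lintegral_quot_mul_left α τ hM
      (k := fun δ => c (E.quot.mul (E.quot.inv δ) τ)) (fun δ => hc0 _)
      (by rw [hτ]; exact hcmul.comp (f := fun δ => (δ, τ)) (by fun_prop) fun δ hδ => ⟨hδ, hτ⟩)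
      (fun δ hδ hδM => image_eq_zero_of_notMem_tsupport fun h => hδM (by
        have hsδ : E.quot.s (E.quot.inv δ) = E.quot.r τ := (E.quot.s_inv δ).trans hδ
        have h2 := hMK τ rfl _ ⟨_, h, rfl⟩ (by
          rw [E.quot.r_inv, E.quot.s_mul _ _ hsδ])
        rw [E.quot.mul_inv_rev _ _ hsδ, E.quot.inv_inv, E.quot.mul_inv_cancel_left _ _ hδ.symm]
          at h2
        exact h2))
    rw [hτ] at h1
    rw [← h1]
    refine le_trans (le_of_eq ?_) ((hI₂ (E.quot.s τ)).trans (le_max_right _ _))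
    refine lintegral_congr_ae ?_
    filter_upwards [α.ae_r_eq (E.quot.s τ)] with ω hω
    rw [E.quot.mul_inv_rev _ _ hω.symm, E.quot.inv_mul_cancel_right]
    rw [E.quot.s_inv, hω]
  have hpt : ∀ᵐ ω ∂α.meas x,
      ‖E.mconv α φ ψ (E.sact χ (E.A.out ω)) (E.gpd.inv (E.A.out ω))‖ₑ ≤ ENNReal.ofReal B *
        ∫⁻ τ, ENNReal.ofReal (c (E.quot.mul (E.quot.inv ω) τ)) * ENNReal.ofReal (g τ)
          ∂α.meas x := by
    filter_upwards [α.ae_r_eq x] with ω hω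
    have hρ : χ.base = E.gpd.r (E.A.out ω) := Eq.symm hω
    obtain ⟨M, hM, hMz⟩ := hsupp ω hω
    have h1 := E.lintegral_quot_mul_left α ω hM
      (k := fun δ => c (E.quot.mul (E.quot.inv ω) δ) * g δ)
      (fun δ => mul_nonneg (hc0 _) (norm_nonneg _))
      (by rw [hω]; exact (hcω ω hω).mul hgc)
      (by rw [hω]; exact fun δ h2 h3 => by rw [hMz δ h2 h3, zero_mul])
    rw [hω] at h1
    simp only [← ENNReal.ofReal_mul (hc0 _)]
    rw [← h1, ← lintegral_const_mul' _ _ ENNReal.ofReal_ne_top,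
      E.mconv_of α (E.base_sact_inv hρ), E.base_sact hρ]
    refine (enorm_integral_le_lintegral_enorm _).trans (lintegral_mono_ae ?_)
    filter_upwards [α.ae_r_eq (E.quot.s ω)] with τ hτ
    have hτ' : E.gpd.s (E.A.out ω) = E.gpd.r (E.A.out τ) := Eq.symm hτ
    rw [E.quot.inv_mul_cancel_left _ _ hτ.symm, ← ENNReal.ofReal_mul hB0, ← ofReal_norm]
    refine ENNReal.ofReal_le_ofReal ?_
    have h2 : g (E.quot.mul ω τ) = ‖E.tr ψ (E.sact χ (E.A.out ω)) (E.A.out τ)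
        (E.gpd.inv (E.A.out ω))‖ := by
      have h3 := E.tr_sact ψ hρ hτ' hone
      rw [E.inv_mul_one (hρ.symm.trans hx.symm)] at h3
      rw [h3, hg]
      exact hψ.tr_out (hρ.trans (E.gpd.r_mul _ _ hτ').symm) hone
    rw [h2, norm_mul, ← mul_assoc]
    refine mul_le_mul_of_nonneg_right ?_ (norm_nonneg _)
    by_cases hne : φ (E.sact χ (E.A.out ω)) (E.A.out τ) = 0
    · rw [hne, norm_zero]
      exact mul_nonneg hB0 (hc0 _)
    · have h3 := hφK _ _ ((E.base_sact hρ).trans hτ') hne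
      rw [E.A.proj_out] at h3
      rw [hc1 h3]
      simpa using hB _ _
  calc E.sqNorm α (E.mconv α φ ψ) χ
      ≤ ∫⁻ ω, (ENNReal.ofReal B) ^ 2 * (∫⁻ τ, ENNReal.ofReal (c (E.quot.mul (E.quot.inv ω) τ)) *
          ENNReal.ofReal (g τ) ∂α.meas x) ^ 2 ∂α.meas x := by
        refine lintegral_mono_ae ?_
        filter_upwards [hpt] with ω hω
        rw [← mul_pow]
        exact pow_le_pow_left' hω 2
    _ ≤ (ENNReal.ofReal B) ^ 2 * (C₀ * C₀ * ∫⁻ τ, ENNReal.ofReal (g τ) ^ 2 ∂α.meas x) := by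
        rw [lintegral_const_mul' _ _ (ENNReal.pow_ne_top ENNReal.ofReal_ne_top)]
        exact mul_le_mul_right (lintegral_sq_le_of_schur hkm hgm hinteg₁ hinteg₂) _
    _ = (C₀ * ENNReal.ofReal B) ^ 2 * E.sqNorm α ψ χ := by
        have h1 : ∫⁻ τ, ENNReal.ofReal (g τ) ^ 2 ∂α.meas x = E.sqNorm α ψ χ := by
          refine lintegral_congr_ae ?_
          filter_upwards [α.ae_r_eq x] with τ hτ
          rw [hg, ofReal_norm, E.tr_one ψ (Eq.symm hτ)]
        rw [h1]
        ring

end AbelianExtension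

namespace AbelianExtension

variable {S X : Type u} [TopologicalSpace S] [T2Space S] [LocallyCompactSpace S]
  [SecondCountableTopology S] [MeasurableSpace S] [BorelSpace S] [TopologicalSpace X]
  (E : AbelianExtension S X) (α : E.quot.HaarSystem)

/-- The norm of left convolution on a class of sections. -/
def leftNorm (P : (E.Dual → S → ℂ) → Prop) (φ : E.Dual → S → ℂ) : ℝ≥0∞ :=
  sInf {C | ∀ ψ, P ψ → E.modNorm α (E.mconv α φ ψ) ≤ C * E.modNorm α ψ}

theorem moduleNorm_twist {f : E.SigmaHat → ℂ} (hf : f ∈ (E.twistAlgebra α).carrier) :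
    (E.twistAlgebra α).moduleNorm f = E.modNorm α (untwist f) := by
  refine congrArg (fun t : ℝ≥0∞ => t ^ (1 / 2 : ℝ)) (iSup_congr fun χ => ?_)
  rw [E.sigmaHat_one, ← E.untwist_of ((E.twistAlgebra α).conv ((E.twistAlgebra α).invol f) f),
    E.untwist_conv α _ hf, E.untwist_invol,
    E.enorm_mconv_minv_self α (E.isCSection_untwist α hf).toIsSection]

theorem enorm_unc_le (F : E.PreSection) (χ : E.Dual) (σ : S) : ‖unc F χ σ‖ₑ ≤ ‖F σ‖ₑ :=
  enorm_le_iff_norm_le.2 (E.norm_unc_le F χ σ)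

theorem enorm_le_of_unc {F : E.PreSection} {σ : S} {B : ℝ≥0∞}
    (h : ∀ χ, Dual.base χ = E.gpd.r σ → ‖unc F χ σ‖ₑ ≤ B) : ‖F σ‖ₑ ≤ B := by
  by_cases hB : B = ∞
  · rw [hB]; exact le_top
  · rw [← ofReal_norm]
    refine ENNReal.ofReal_le_of_le_toReal (E.norm_le_of_unc ENNReal.toReal_nonneg fun χ hχ => ?_)
    have h1 := h χ hχ
    rw [← ofReal_norm] at h1
    exact (ENNReal.ofReal_le_iff_le_toReal hB).1 h1

theorem moduleNorm_crossed {F : E.PreSection} (hF : F ∈ (E.crossedAlgebra α).carrier) :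
    (E.crossedAlgebra α).moduleNorm F = E.modNorm α (unc F) := by
  have hs := E.isSection_unc α hF
  have hunc : unc ((E.crossedAlgebra α).conv ((E.crossedAlgebra α).invol F) F) =
      E.mconv α (E.minv (unc F)) (unc F) := by
    rw [E.unc_conv α (by rw [E.unc_invol]; exact hs.inv) hs, E.unc_invol]
  refine congrArg (fun t : ℝ≥0∞ => t ^ (1 / 2 : ℝ)) (le_antisymm ?_ ?_)
  · refine iSup_le fun x => E.enorm_le_of_unc fun χ hχ => ?_
    rw [E.gpd.r_one] at hχ
    rw [hunc, ← hχ, E.enorm_mconv_minv_self α hs]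
    exact le_iSup (E.sqNorm α (unc F)) χ
  · refine iSup_le fun χ => ?_
    rw [← E.enorm_mconv_minv_self α hs, ← hunc]
    exact (E.enorm_unc_le _ _ _).trans (le_iSup (fun x => ‖(E.crossedAlgebra α).conv
      ((E.crossedAlgebra α).invol F) F (E.gpd.one x)‖ₑ) χ.base)

theorem conv_mem_twist {f g : E.SigmaHat → ℂ} (hf : f ∈ (E.twistAlgebra α).carrier)
    (hg : g ∈ (E.twistAlgebra α).carrier) :
    (E.twistAlgebra α).conv f g ∈ (E.twistAlgebra α).carrier := by
  rw [E.twist_conv α hf hg]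
  exact E.twist_mem α ((E.isCSection_untwist α hf).conv α (E.isCSection_untwist α hg))

theorem conv_mem_crossed {F G : E.PreSection} (hF : F ∈ (E.crossedAlgebra α).carrier)
    (hG : G ∈ (E.crossedAlgebra α).carrier) :
    (E.crossedAlgebra α).conv F G ∈ (E.crossedAlgebra α).carrier := by
  have hF' := E.isSection_unc α hF
  have hG' := E.isSection_unc α hG
  rw [mem_crossedAlgebra_iff, E.unc_conv α hF' hG']
  exact hF'.conv α hG'

theorem redNorm_twist {f : E.SigmaHat → ℂ} (hf : f ∈ (E.twistAlgebra α).carrier) :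
    (E.twistAlgebra α).redNorm f = E.leftNorm α E.IsCSection (untwist f) := by
  refine congrArg sInf (Set.ext fun C => ⟨fun h ψ hψ => ?_, fun h g hg => ?_⟩)
  · have hg := E.twist_mem α hψ
    have := h _ hg
    rwa [E.moduleNorm_twist α hg, E.moduleNorm_twist α (E.conv_mem_twist α hf hg),
      E.untwist_conv α _ hg, E.untwist_twist hψ.toIsSection] at this
  · rw [E.moduleNorm_twist α hg, E.moduleNorm_twist α (E.conv_mem_twist α hf hg),
      E.untwist_conv α _ hg]
    exact h _ (E.isCSection_untwist α hg)

theorem redNorm_crossed {F : E.PreSection} (hF : F ∈ (E.crossedAlgebra α).carrier) :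
    (E.crossedAlgebra α).redNorm F = E.leftNorm α E.IsSection (unc F) := by
  have hF' := E.isSection_unc α hF
  refine congrArg sInf (Set.ext fun C => ⟨fun h ψ hψ => ?_, fun h G hG => ?_⟩)
  · have hG := E.ofSection_mem α hψ
    have := h _ hG
    rwa [E.moduleNorm_crossed α hG, E.moduleNorm_crossed α (E.conv_mem_crossed α hF hG),
      E.unc_conv α hF' (E.isSection_unc α hG), E.unc_ofSection] at this
  · rw [E.moduleNorm_crossed α hG, E.moduleNorm_crossed α (E.conv_mem_crossed α hF hG),
      E.unc_conv α hF' (E.isSection_unc α hG)]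
    exact h _ (E.isSection_unc α hG)

theorem leftNorm_le_of_forall {P : (E.Dual → S → ℂ) → Prop} {φ : E.Dual → S → ℂ} {C : ℝ≥0∞}
    (h : ∀ ψ, P ψ → E.modNorm α (E.mconv α φ ψ) ≤ C * E.modNorm α ψ) : E.leftNorm α P φ ≤ C :=
  sInf_le h

/-- A cut-off function of compact support that is one on a given compact set. -/
theorem exists_cutoff {L : Set E.Dual} (hL : IsCompact L) : ∃ θ : E.Dual → ℝ, Continuous θ ∧
    HasCompactSupport θ ∧ (∀ χ ∈ L, θ χ = 1) ∧ ∀ χ, 0 ≤ θ χ ∧ θ χ ≤ 1 := by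
  obtain ⟨c, hc1, -, hcs, hc01⟩ := exists_continuous_one_zero_of_isCompact hL isClosed_empty
    (Set.disjoint_empty L)
  exact ⟨c, c.continuous, hcs, fun χ hχ => hc1 hχ, hc01⟩

theorem IsSection.cutoff {E : AbelianExtension S X} {φ : E.Dual → S → ℂ} (hφ : E.IsSection φ)
    {θ : E.Dual → ℝ} (hθ : Continuous θ) (hθc : HasCompactSupport θ) :
    E.IsCSection (fun χ σ => (θ χ : ℂ) * φ χ σ) :=
  hφ.mulDual_compact (Complex.continuous_ofReal.comp hθ)
    (hθc.comp_left (g := fun t : ℝ => (t : ℂ)) Complex.ofReal_zero)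

theorem norm_cutoff_le {θ : E.Dual → ℝ} (h : ∀ χ, 0 ≤ θ χ ∧ θ χ ≤ 1) (φ : E.Dual → S → ℂ)
    (χ : E.Dual) (σ : S) : ‖(θ χ : ℂ) * φ χ σ‖ ≤ ‖φ χ σ‖ := by
  rw [norm_mul, Complex.norm_real, Real.norm_of_nonneg (h χ).1]
  exact mul_le_of_le_one_left (norm_nonneg _) (h χ).2

/-- For compactly supported sections the reduced norm may be tested on compactly supported
sections. -/
theorem leftNorm_eq {φ : E.Dual → S → ℂ} (hφ : E.IsCSection φ) :
    E.leftNorm α E.IsSection φ = E.leftNorm α E.IsCSection φ := by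
  refine le_antisymm (sInf_le_sInf fun C hC ψ hψ => ?_)
    (sInf_le_sInf fun C hC ψ hψ => hC ψ hψ.toIsSection)
  obtain ⟨L, hL, hLφ⟩ := hφ.exists_isCompact_sact
  obtain ⟨θ, hθ, hθc, hθ1, hθ01⟩ := E.exists_cutoff hL
  have h1 : E.mconv α φ ψ = E.mconv α φ (fun χ σ => (θ χ : ℂ) * ψ χ σ) := by
    funext χ σ
    by_cases hb : χ.base = E.gpd.r σ
    · rw [E.mconv_of α hb, E.mconv_of α hb]
      refine integral_congr_ae ?_
      filter_upwards [α.ae_r_eq χ.base] with γ hγ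
      by_cases h0 : φ χ (E.A.out γ) = 0
      · rw [h0, zero_mul, zero_mul]
      · rw [tr, tr, hθ1 _ (hLφ χ _ (Eq.symm hγ) h0), Complex.ofReal_one, one_mul]
    · rw [mconv, mconv, if_neg hb, if_neg hb]
  rw [h1]
  exact (hC _ (hψ.cutoff hθ hθc)).trans
    (mul_le_mul_right (E.modNorm_mono α (E.norm_cutoff_le hθ01 ψ)) _)

theorem mconv_mulDual_left (θ : E.Dual → ℂ) (φ ψ : E.Dual → S → ℂ) :
    E.mconv α (fun χ σ => θ χ * φ χ σ) ψ = fun χ σ => θ χ * E.mconv α φ ψ χ σ := by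
  funext χ σ
  by_cases hb : χ.base = E.gpd.r σ
  · rw [E.mconv_of α hb, E.mconv_of α hb, ← integral_const_mul]
    simp only [mul_assoc]
  · rw [mconv, mconv, if_neg hb, if_neg hb, mul_zero]

/-- Cutting off does not increase the reduced norm. -/
theorem leftNorm_cutoff_le {P : (E.Dual → S → ℂ) → Prop} {θ : E.Dual → ℝ}
    (h : ∀ χ, 0 ≤ θ χ ∧ θ χ ≤ 1) (φ : E.Dual → S → ℂ) :
    E.leftNorm α P (fun χ σ => (θ χ : ℂ) * φ χ σ) ≤ E.leftNorm α P φ := by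
  refine sInf_le_sInf fun C hC ψ hψ => ?_
  rw [E.mconv_mulDual_left α (fun χ => (θ χ : ℂ))]
  exact (E.modNorm_mono α (E.norm_cutoff_le h _)).trans (hC ψ hψ)

/-! ### The `I`-norms -/

/-- The first half of the `I`-norm. -/
def iNormR (φ : E.Dual → S → ℂ) : ℝ≥0∞ :=
  ⨆ χ : E.Dual, ∫⁻ γ, ‖φ χ (E.A.out γ)‖ₑ ∂α.meas χ.base

/-- The second half of the `I`-norm. -/
def iNormS (φ : E.Dual → S → ℂ) : ℝ≥0∞ :=
  ⨆ χ : E.Dual, ∫⁻ γ, ‖φ (E.sact χ (E.A.out γ)) (E.gpd.inv (E.A.out γ))‖ₑ ∂α.meas χ.base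

theorem proj_out_quot_inv (γ : E.A.Quot) :
    E.A.proj (E.A.out (E.quot.inv γ)) = E.A.proj (E.gpd.inv (E.A.out γ)) := E.A.proj_out _

theorem iNorm_twist {f : E.SigmaHat → ℂ} (hf : f ∈ (E.twistAlgebra α).carrier) :
    (E.twistAlgebra α).iNorm f = max (E.iNormR α (untwist f)) (E.iNormS α (untwist f)) := by
  have hs := (E.isCSection_untwist α hf).toIsSection
  refine congrArg₂ max (iSup_congr fun χ => ?_) (iSup_congr fun χ => ?_)
  · refine E.lintegral_transMeas α χ _ _ fun γ hγ => ?_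
    rw [E.untwist_of _ hγ]
    rfl
  · refine E.lintegral_transMeas α χ _ _ fun γ hγ => ?_
    have hb := E.base_sact_inv (χ := χ) (τ := E.A.out γ) hγ
    have hb' : (E.sact χ (E.A.out γ)).base = E.gpd.r (E.A.out (E.quot.inv γ)) :=
      hb.trans (E.r_of_proj_eq (E.proj_out_quot_inv γ)).symm
    have h1 := hs.norm_congr (χ := E.sact χ (E.A.out γ)) (E.proj_out_quot_inv γ) hb
    rw [← ofReal_norm, ← ofReal_norm, ← h1, E.untwist_of _ hb']
    rfl

/-- The `I`-norm is monotone along the inclusion of compactly supported sections. -/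
theorem iNorm_twist_le_crossed {f : E.SigmaHat → ℂ} (hf : f ∈ (E.twistAlgebra α).carrier)
    {F : E.PreSection} (h : ∀ χ σ, ‖untwist f χ σ‖ ≤ ‖unc F χ σ‖) :
    (E.twistAlgebra α).iNorm f ≤ (E.crossedAlgebra α).iNorm F := by
  have hs := (E.isCSection_untwist α hf).toIsSection
  have hle : ∀ χ σ, ‖untwist f χ σ‖ₑ ≤ ‖F σ‖ₑ := fun χ σ =>
    (enorm_le_iff_norm_le.2 (h χ σ)).trans (E.enorm_unc_le F χ σ)
  rw [E.iNorm_twist α hf]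
  refine max_le_max (iSup_le fun χ => ?_) (iSup_le fun χ => ?_)
  · exact (lintegral_mono fun γ => hle _ _).trans
      (le_iSup (fun x => ∫⁻ γ, ‖F (E.A.out γ)‖ₑ ∂α.meas x) χ.base)
  · refine le_trans (lintegral_mono_ae ?_)
      (le_iSup (fun x => ∫⁻ γ, ‖F (E.A.out (E.quot.inv γ))‖ₑ ∂α.meas x) χ.base)
    filter_upwards [α.ae_r_eq χ.base] with γ hγ
    have h1 := hs.norm_congr (χ := E.sact χ (E.A.out γ)) (E.proj_out_quot_inv γ)
      (E.base_sact_inv (Eq.symm hγ))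
    rw [← ofReal_norm, ← h1, ofReal_norm]
    exact hle _ _

/-- The `I`-norm of sections with values bounded by `B` and support in a given compact set is
bounded by a multiple of `B`. -/
theorem exists_iNorm_crossed_le {K : Set E.A.Quot} (hK : IsCompact K) :
    ∃ C : ℝ≥0∞, C ≠ ∞ ∧ ∀ (F : E.PreSection) (B : ℝ),
      (∀ χ σ, Dual.base χ = E.gpd.r σ → unc F χ σ ≠ 0 → E.A.proj σ ∈ K) →
      (∀ χ σ, ‖unc F χ σ‖ ≤ B) → (E.crossedAlgebra α).iNorm F ≤ C * ENNReal.ofReal B := by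
  have := E.t2Space_base
  obtain ⟨C₁, -, hC₁⟩ := α.exists_measure_le E.continuous_quot_r hK
  obtain ⟨C₂, -, hC₂⟩ := α.exists_measure_le E.continuous_quot_r
    (hK.image E.continuous_quot_inv)
  refine ⟨max (ENNReal.ofReal C₁) (ENNReal.ofReal C₂),
    (max_lt ENNReal.ofReal_lt_top ENNReal.ofReal_lt_top).ne, fun F B hFK hB => ?_⟩
  have hle : ∀ σ, ‖F σ‖ₑ ≤ ENNReal.ofReal B := fun σ => E.enorm_le_of_unc fun χ _ => by
    rw [← ofReal_norm]; exact ENNReal.ofReal_le_ofReal (hB χ σ)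
  have hz : ∀ σ, E.A.proj σ ∉ K → ‖F σ‖ₑ = 0 := fun σ hσ =>
    le_antisymm (E.enorm_le_of_unc fun χ hχ => by
      have : unc F χ σ = 0 := by
        by_contra hne
        exact hσ (hFK χ σ hχ hne)
      rw [this, enorm_zero]) zero_le
  refine max_le (iSup_le fun x => ?_) (iSup_le fun x => ?_)
  · refine (α.lintegral_le_of_bound hK.measurableSet (fun γ _ => hle _)
      fun γ _ hγ => hz _ (by rwa [E.A.proj_out])).trans ?_
    rw [mul_comm]
    exact mul_le_mul_left ((hC₁ x).trans (le_max_left _ _)) _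
  · refine (α.lintegral_le_of_bound (hK.image E.continuous_quot_inv).measurableSet
      (fun γ _ => hle _) fun γ _ hγ => hz _ (by
        rw [E.A.proj_out]
        exact fun h => hγ ⟨_, h, E.quot.inv_inv γ⟩)).trans ?_
    rw [mul_comm]
    exact mul_le_mul_left ((hC₂ x).trans (le_max_right _ _)) _

end AbelianExtension

/-- Averaging over the members of a fine partition of unity approximates the integral of a
product. -/
theorem MeasureTheory.norm_sum_average_sub_le {Y : Type*} [MeasurableSpace Y] {μ : Measure Y}
    {n : ℕ} {p : Fin n → Y → ℝ} {u v : Y → ℂ} {R : Set Y} {δ η B : ℝ} (hR : ∀ᵐ y ∂μ, y ∈ R)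
    (hp : ∀ i, Integrable (p i) μ) (hp01 : ∀ i y, 0 ≤ p i y ∧ p i y ≤ 1)
    (hu : Integrable u μ) (hv : Integrable v μ) (huv : Integrable (fun y => u y * v y) μ)
    (hη : 0 < η) (hδ : 0 ≤ δ) (hB : 0 ≤ B) (huB : ∀ y ∈ R, ‖u y‖ ≤ B) (hvB : ∀ y ∈ R, ‖v y‖ ≤ B)
    (hsum : ∀ y ∈ R, u y ≠ 0 → ∑ i, p i y = 1)
    (hosc : ∀ i, ∀ y ∈ R, ∀ z ∈ R, p i y ≠ 0 → p i z ≠ 0 → ‖v z - v y‖ ≤ δ) :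
    ‖∑ i, (((∫ y, p i y ∂μ) + η)⁻¹ : ℂ) * (∫ y, p i y * u y ∂μ) * (∫ y, p i y * v y ∂μ) -
      ∫ y, u y * v y ∂μ‖ ≤ δ * ∫ y, ‖u y‖ ∂μ + n * (B * B * η) := by
  have hpm : ∀ (i) {w : Y → ℂ}, Integrable w μ → Integrable (fun y => (p i y : ℂ) * w y) μ :=
    fun i w hw => hw.bdd_mul (c := 1)
      (Complex.continuous_ofReal.comp_aestronglyMeasurable (hp i).1)
      (Eventually.of_forall fun y => by
        rw [Complex.norm_real, Real.norm_of_nonneg (hp01 i y).1]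
        exact (hp01 i y).2)
  have hpn : ∀ i, Integrable (fun y => p i y * ‖u y‖) μ := fun i => by
    refine (hpm i hu).norm.congr (Eventually.of_forall fun y => ?_)
    simp only [norm_mul, Complex.norm_real, Real.norm_of_nonneg (hp01 i y).1]
  have hsplit : ∫ y, u y * v y ∂μ = ∑ i, ∫ y, p i y * (u y * v y) ∂μ := by
    rw [← integral_finsetSum _ fun i _ => hpm i huv]
    refine integral_congr_ae ?_
    filter_upwards [hR] with y hy
    by_cases h0 : u y = 0
    · simp [h0]
    · rw [← Finset.sum_mul, ← Complex.ofReal_sum, hsum y hy h0, Complex.ofReal_one, one_mul]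
  have hnorm : ∫ y, ‖u y‖ ∂μ = ∑ i, ∫ y, p i y * ‖u y‖ ∂μ := by
    rw [← integral_finsetSum _ fun i _ => hpn i]
    refine integral_congr_ae ?_
    filter_upwards [hR] with y hy
    by_cases h0 : u y = 0
    · simp [h0]
    · rw [← Finset.sum_mul, hsum y hy h0, one_mul]
  have hterm : ∀ i, ‖(((∫ y, p i y ∂μ) + η)⁻¹ : ℂ) * (∫ y, p i y * u y ∂μ) *
      (∫ y, p i y * v y ∂μ) - ∫ y, p i y * (u y * v y) ∂μ‖ ≤
      δ * ∫ y, p i y * ‖u y‖ ∂μ + B * B * η := by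
    intro i
    set m := ∫ y, p i y ∂μ with hm
    have hm0 : 0 ≤ m := integral_nonneg fun y => (hp01 i y).1
    have hmη : 0 < m + η := by linarith
    set V := ((m : ℂ) + η)⁻¹ * ∫ y, p i y * v y ∂μ with hV
    have hmc : ((m : ℂ) + η) ≠ 0 := by exact_mod_cast hmη.ne'
    have hpt : ∀ y ∈ R, p i y ≠ 0 → ‖V - v y‖ ≤ δ + B * η / (m + η) := by
      intro y hy hpy
      have h1 : V - v y = ((m : ℂ) + η)⁻¹ * ((∫ z, p i z * (v z - v y) ∂μ) - η * v y) := by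
        have h2 : ∫ z, (p i z : ℂ) * (v z - v y) ∂μ =
            (∫ z, p i z * v z ∂μ) - m * v y := by
          have h3 : Integrable (fun z => (p i z : ℂ) * v y) μ := (hp i).ofReal.mul_const _
          simp only [mul_sub]
          rw [integral_sub (hpm i hv) h3, integral_mul_const, integral_complex_ofReal]
        rw [h2, hV]
        field_simp
        ring
      have h3 : ‖∫ z, (p i z : ℂ) * (v z - v y) ∂μ‖ ≤ δ * m := by
        rw [hm, ← integral_const_mul]
        refine norm_integral_le_of_norm_le ((hp i).const_mul δ) ?_
        filter_upwards [hR] with z hz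
        rw [norm_mul, Complex.norm_real, Real.norm_of_nonneg (hp01 i z).1, mul_comm]
        by_cases hpz : p i z = 0
        · rw [hpz, mul_zero, mul_zero]
        · exact mul_le_mul_of_nonneg_right (hosc i y hy z hz hpy hpz) (hp01 i z).1
      have h4 : ‖((m : ℂ) + η)⁻¹‖ = (m + η)⁻¹ := by
        rw [norm_inv, ← Complex.ofReal_add, Complex.norm_real, Real.norm_of_nonneg hmη.le]
      have h5 : ‖(∫ z, (p i z : ℂ) * (v z - v y) ∂μ) - η * v y‖ ≤ δ * m + η * B := by
        refine (norm_sub_le _ _).trans (add_le_add h3 ?_)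
        rw [norm_mul, Complex.norm_real, Real.norm_of_nonneg hη.le]
        exact mul_le_mul_of_nonneg_left (hvB y hy) hη.le
      rw [h1, norm_mul, h4]
      calc (m + η)⁻¹ * ‖(∫ z, (p i z : ℂ) * (v z - v y) ∂μ) - η * v y‖
          ≤ (m + η)⁻¹ * (δ * m + η * B) := by gcongr
        _ = δ * (m / (m + η)) + B * η / (m + η) := by field_simp
        _ ≤ δ * 1 + B * η / (m + η) := by
            have : m / (m + η) ≤ 1 := (div_le_one hmη).2 (by linarith)
            gcongr
        _ = _ := by rw [mul_one]
    have heq : ((m : ℂ) + η)⁻¹ * (∫ y, p i y * u y ∂μ) * (∫ y, p i y * v y ∂μ) -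
        ∫ y, p i y * (u y * v y) ∂μ = ∫ y, (p i y : ℂ) * u y * (V - v y) ∂μ := by
      have h6 : ∀ y, (p i y : ℂ) * u y * (V - v y) =
          (p i y : ℂ) * u y * V - p i y * (u y * v y) := fun y => by ring
      simp only [h6]
      rw [integral_sub ((hpm i hu).mul_const V) (hpm i huv), integral_mul_const, hV]
      ring
    have hc : 0 ≤ B * η / (m + η) := by positivity
    rw [heq]
    have h7 : ‖∫ y, (p i y : ℂ) * u y * (V - v y) ∂μ‖ ≤
        ∫ y, (δ * (p i y * ‖u y‖) + B * η / (m + η) * B * p i y) ∂μ := by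
      refine norm_integral_le_of_norm_le (((hpn i).const_mul δ).add ((hp i).const_mul _)) ?_
      filter_upwards [hR] with y hy
      rw [norm_mul, norm_mul, Complex.norm_real, Real.norm_of_nonneg (hp01 i y).1]
      by_cases hpy : p i y = 0
      · simp [hpy]
      · have h8 := hpt y hy hpy
        have h9 := huB y hy
        calc p i y * ‖u y‖ * ‖V - v y‖ ≤ p i y * ‖u y‖ * (δ + B * η / (m + η)) :=
              mul_le_mul_of_nonneg_left h8 (mul_nonneg (hp01 i y).1 (norm_nonneg _))
          _ = δ * (p i y * ‖u y‖) + B * η / (m + η) * ‖u y‖ * p i y := by ring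
          _ ≤ _ := by
              gcongr
              exact (hp01 i y).1
    refine h7.trans ?_
    rw [integral_add ((hpn i).const_mul δ) ((hp i).const_mul _), integral_const_mul,
      integral_const_mul, ← hm]
    refine add_le_add le_rfl ?_
    have h10 : B * η / (m + η) * B * m = B * B * η * (m / (m + η)) := by ring
    rw [h10]
    exact mul_le_of_le_one_right (by positivity) ((div_le_one hmη).2 (by linarith))
  rw [hsplit, ← Finset.sum_sub_distrib, hnorm, Finset.mul_sum]
  refine (norm_sum_le _ _).trans ((Finset.sum_le_sum fun i _ => hterm i).trans ?_)
  rw [Finset.sum_add_distrib]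
  simp

namespace AbelianExtension

variable {S X : Type u} [TopologicalSpace S] [T2Space S] [LocallyCompactSpace S]
  [SecondCountableTopology S] [MeasurableSpace S] [BorelSpace S] [TopologicalSpace X]
  (E : AbelianExtension S X)

/-! ### Kernels -/

/-- A compactly supported continuous family of sections indexed by the classes over the base
point of the character. -/
structure IsKernel (k : E.Dual → E.A.Quot → S → ℂ) : Prop where
  continuousOn : ContinuousOn (fun q : (E.Dual × S) × E.A.Quot => k q.1.1 q.2 q.1.2)
    {q | q.1 ∈ {q : E.Dual × S | q.1.base = E.gpd.r q.2} ∧ E.quot.r q.2 = q.1.1.base}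
  equivariant : ∀ a ∈ E.A.carrier, ∀ χ γ σ, E.gpd.s a = E.gpd.r σ → Dual.base χ = E.gpd.r σ →
    E.quot.r γ = Dual.base χ → k χ γ (E.gpd.mul a σ) = (χ.eval a : ℂ) * k χ γ σ
  exists_support : ∃ (L : Set E.Dual) (K M : Set E.A.Quot), IsCompact L ∧ IsCompact K ∧
    IsCompact M ∧ ∀ χ γ σ, Dual.base χ = E.gpd.r σ → E.quot.r γ = Dual.base χ → k χ γ σ ≠ 0 →
      χ ∈ L ∧ γ ∈ K ∧ E.A.proj σ ∈ M

namespace IsKernel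

variable {E} {k : E.Dual → E.A.Quot → S → ℂ}

theorem continuousOn_fiber (hk : E.IsKernel k) {χ : E.Dual} {σ : S} (h : χ.base = E.gpd.r σ) :
    ContinuousOn (fun γ => k χ γ σ) {γ | E.quot.r γ = χ.base} :=
  hk.continuousOn.comp (f := fun γ => ((χ, σ), γ)) (by fun_prop) fun _ hγ => ⟨h, hγ⟩

theorem exists_bound (hk : E.IsKernel k) : ∃ B : ℝ, 0 ≤ B ∧ ∀ χ γ σ, Dual.base χ = E.gpd.r σ →
    E.quot.r γ = Dual.base χ → ‖k χ γ σ‖ ≤ B := by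
  have := E.t2Space_base
  obtain ⟨L, K, M, hL, hK, hM, hsupp⟩ := hk.exists_support
  obtain ⟨M', hM', hMM'⟩ := E.exists_isCompact_lift hM
  have hcl : IsClosed {q : (E.Dual × S) × E.A.Quot |
      q.1 ∈ {q : E.Dual × S | q.1.base = E.gpd.r q.2} ∧ E.quot.r q.2 = q.1.1.base} :=
    (isClosed_eq (E.continuous_base.comp (by fun_prop)) (E.isTop.continuous_r.comp
      (by fun_prop))).inter (isClosed_eq (E.continuous_quot_r.comp (by fun_prop))
        (E.continuous_base.comp (by fun_prop)))
  have hc := (((hL.prod hM').prod hK).inter_right hcl).image_of_continuousOn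
    (hk.continuousOn.norm.mono Set.inter_subset_right)
  obtain ⟨B, hB⟩ := hc.bddAbove
  refine ⟨max B 0, le_max_right _ _, fun χ γ σ hσ hγ => ?_⟩
  by_cases h0 : k χ γ σ = 0
  · rw [h0, norm_zero]; exact le_max_right _ _
  · obtain ⟨hχL, hγK, hσM⟩ := hsupp χ γ σ hσ hγ h0
    obtain ⟨τ, hτ, hτσ⟩ := hMM' hσM
    obtain ⟨a, ha, hs, -, rfl⟩ := E.exists_mul_of_rel (E.rel_of_proj_eq hτσ.symm)
    have hχτ : χ.base = E.gpd.r τ := hσ.trans (E.r_of_proj_eq hτσ).symm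
    rw [hk.equivariant a ha χ γ τ hs hχτ hγ, norm_mul, E.norm_eval, one_mul]
    exact le_max_of_le_left (hB ⟨((χ, τ), γ), ⟨⟨⟨hχL, hτ⟩, hγK⟩, hχτ, hγ⟩, rfl⟩)

/-- Kernels are uniformly continuous in the class variable. -/
theorem exists_nhds_osc (hk : E.IsKernel k) {δ : ℝ} (hδ : 0 < δ) (γ₀ : E.A.Quot) :
    ∃ V ∈ 𝓝 γ₀, ∀ γ ∈ V, ∀ γ' ∈ V, ∀ χ σ, Dual.base χ = E.gpd.r σ → E.quot.r γ = χ.base →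
      E.quot.r γ' = χ.base → ‖k χ γ σ - k χ γ' σ‖ ≤ δ := by
  have := E.t2Space_base
  obtain ⟨L, K, M, hL, hK, hM, hsupp⟩ := hk.exists_support
  obtain ⟨M', hM', hMM'⟩ := E.exists_isCompact_lift hM
  have hev : ∀ᶠ g : E.A.Quot × E.A.Quot in 𝓝 (γ₀, γ₀), ∀ q ∈ L ×ˢ M', q.1.base = E.gpd.r q.2 →
      E.quot.r g.1 = q.1.base → E.quot.r g.2 = q.1.base →
      ‖k q.1 g.1 q.2 - k q.1 g.2 q.2‖ < δ := by
    refine (hL.prod hM').eventually_forall_of_forall_eventually ?_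
    rintro ⟨χ₀, σ₀⟩ -
    by_cases h₀ : χ₀.base = E.gpd.r σ₀ ∧ E.quot.r γ₀ = χ₀.base
    · have h1 : Tendsto (fun q : (E.Dual × S) × E.A.Quot => k q.1.1 q.2 q.1.2)
          (𝓝[_] ((χ₀, σ₀), γ₀)) (𝓝 (k χ₀ γ₀ σ₀)) := hk.continuousOn ((χ₀, σ₀), γ₀) h₀
      have h2 := eventually_nhdsWithin_iff.1 (Metric.tendsto_nhds.1 h1 (δ / 2) (half_pos hδ))
      have h3 : Tendsto (fun z : (E.A.Quot × E.A.Quot) × (E.Dual × S) => (z.2, z.1.1))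
          (𝓝 ((γ₀, γ₀), (χ₀, σ₀))) (𝓝 ((χ₀, σ₀), γ₀)) := Continuous.tendsto' (by fun_prop) _ _ rfl
      have h4 : Tendsto (fun z : (E.A.Quot × E.A.Quot) × (E.Dual × S) => (z.2, z.1.2))
          (𝓝 ((γ₀, γ₀), (χ₀, σ₀))) (𝓝 ((χ₀, σ₀), γ₀)) := Continuous.tendsto' (by fun_prop) _ _ rfl
      filter_upwards [h3.eventually h2, h4.eventually h2] with z hz1 hz2 hσ hγ hγ'
      have h5 := hz1 ⟨hσ, hγ⟩
      have h6 := hz2 ⟨hσ, hγ'⟩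
      rw [← dist_eq_norm]
      linarith [dist_triangle_right (k z.2.1 z.1.1 z.2.2) (k z.2.1 z.1.2 z.2.2) (k χ₀ γ₀ σ₀)]
    · have hcl : IsClosed {z : (E.A.Quot × E.A.Quot) × (E.Dual × S) |
          z.2.1.base = E.gpd.r z.2.2 ∧ E.quot.r z.1.1 = z.2.1.base} :=
        (isClosed_eq (E.continuous_base.comp (by fun_prop)) (E.isTop.continuous_r.comp
          (by fun_prop))).inter (isClosed_eq (E.continuous_quot_r.comp (by fun_prop))
            (E.continuous_base.comp (by fun_prop)))
      filter_upwards [hcl.isOpen_compl.mem_nhds (x := ((γ₀, γ₀), (χ₀, σ₀))) h₀] with z hz hσ hγ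
      exact absurd ⟨hσ, hγ⟩ hz
  rw [nhds_prod_eq, eventually_prod_self_iff'] at hev
  obtain ⟨V, hV, hVk⟩ := hev
  refine ⟨V, hV, fun γ hγ γ' hγ' χ σ hσ hr hr' => ?_⟩
  by_cases h0 : χ ∈ L ∧ E.A.proj σ ∈ M
  · obtain ⟨τ, hτ, hτσ⟩ := hMM' h0.2
    obtain ⟨a, ha, hs, -, rfl⟩ := E.exists_mul_of_rel (E.rel_of_proj_eq hτσ.symm)
    have hχτ : χ.base = E.gpd.r τ := hσ.trans (E.r_of_proj_eq hτσ).symm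
    rw [hk.equivariant a ha χ γ τ hs hχτ hr, hk.equivariant a ha χ γ' τ hs hχτ hr', ← mul_sub,
      norm_mul, E.norm_eval, one_mul]
    exact (hVk γ hγ γ' hγ' (χ, τ) ⟨h0.1, hτ⟩ hχτ hr hr').le
  · have hz : ∀ γ, E.quot.r γ = χ.base → k χ γ σ = 0 := fun γ hγ => by
      by_contra hne
      obtain ⟨h1, -, h3⟩ := hsupp χ γ σ hσ hγ hne
      exact h0 ⟨h1, h3⟩
    rw [hz γ hr, hz γ' hr', sub_zero, norm_zero]
    exact hδ.le

end IsKernel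

end AbelianExtension

namespace AbelianExtension

variable {S X : Type u} [TopologicalSpace S] [T2Space S] [LocallyCompactSpace S]
  [SecondCountableTopology S] [MeasurableSpace S] [BorelSpace S] [TopologicalSpace X]
  (E : AbelianExtension S X) (α : E.quot.HaarSystem)

open Classical in
/-- The weighted average of a kernel against a function on the quotient groupoid. -/
def average (w : E.Dual → ℝ) (p : E.A.Quot → ℝ) (k : E.Dual → E.A.Quot → S → ℂ) (χ : E.Dual)
    (σ : S) : ℂ :=
  if χ.base = E.gpd.r σ then (w χ : ℂ) * ∫ γ, (p γ : ℂ) * k χ γ σ ∂α.meas χ.base else 0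

theorem average_of {w : E.Dual → ℝ} {p : E.A.Quot → ℝ} {k : E.Dual → E.A.Quot → S → ℂ}
    {χ : E.Dual} {σ : S} (h : χ.base = E.gpd.r σ) :
    E.average α w p k χ σ = (w χ : ℂ) * ∫ γ, (p γ : ℂ) * k χ γ σ ∂α.meas χ.base := if_pos h

/-- The integrand of the composition of the adjoint of a kernel with a kernel. -/
def kernelProd (k' k : E.Dual → E.A.Quot → S → ℂ) (χ : E.Dual) (τ σ : S) : ℂ :=
  ∫ γ, star (k' (E.sact χ τ) γ (E.gpd.inv τ)) * k (E.sact χ τ) γ (E.gpd.mul (E.gpd.inv τ) σ)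
    ∂α.meas (E.gpd.s τ)

namespace IsKernel

variable {E} {k : E.Dual → E.A.Quot → S → ℂ}

theorem isCSection_average (hk : E.IsKernel k) {w : E.Dual → ℝ} (hw : Continuous w)
    {p : E.A.Quot → ℝ} (hp : Continuous p) {M : Set E.A.Quot} (hM : IsCompact M)
    (hMk : ∀ χ γ σ, Dual.base χ = E.gpd.r σ → E.quot.r γ = Dual.base χ → k χ γ σ ≠ 0 →
      E.A.proj σ ∈ M) :
    E.IsCSection (E.average α w p k) ∧ ∀ χ σ, Dual.base χ = E.gpd.r σ →
      E.average α w p k χ σ ≠ 0 → E.A.proj σ ∈ M := by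
  have := E.t2Space_base
  obtain ⟨L, K, M₁, hL, hK, _, hsupp⟩ := hk.exists_support
  have hex : ∀ χ σ, Dual.base χ = E.gpd.r σ → E.average α w p k χ σ ≠ 0 →
      ∃ γ, E.quot.r γ = χ.base ∧ k χ γ σ ≠ 0 := by
    intro χ σ hσ hne
    by_contra hcon
    push Not at hcon
    refine hne ?_
    rw [E.average_of α hσ, integral_eq_zero_of_ae, mul_zero]
    filter_upwards [α.ae_r_eq χ.base] with γ hγ
    simp [hcon γ hγ]
  have hMM : ∀ χ σ, Dual.base χ = E.gpd.r σ → E.average α w p k χ σ ≠ 0 → E.A.proj σ ∈ M := by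
    intro χ σ hσ hne
    obtain ⟨γ, hγ, h0⟩ := hex χ σ hσ hne
    exact hMk χ γ σ hσ hγ h0
  refine ⟨IsCSection.mk' ?_ ?_ ⟨M, hM, hMM⟩ ⟨L, hL, fun χ σ hσ hne => ?_⟩ fun χ σ h => if_neg h,
    hMM⟩
  · refine ContinuousOn.congr ?_ fun q hq => E.average_of α hq
    refine ((Complex.continuous_ofReal.comp hw).comp continuous_fst).continuousOn.mul ?_
    refine α.continuousOn_integral E.continuous_quot_r (p := fun q : E.Dual × S => q.1.base)
      (E.continuous_base.comp continuous_fst).continuousOn hK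
      (k := fun q γ => (p γ : ℂ) * k q.1 γ q.2) ?_ fun q hq γ hγ hγK => ?_
    · exact ((Complex.continuous_ofReal.comp hp).comp continuous_snd).continuousOn.mul
        hk.continuousOn
    · have : k q.1 γ q.2 = 0 := by
        by_contra hne
        exact hγK (hsupp _ _ _ hq hγ hne).2.1
      rw [this, mul_zero]
  · intro a ha χ σ hs hχ
    have h1 : χ.base = E.gpd.r (E.gpd.mul a σ) := by
      rw [E.gpd.r_mul _ _ hs, ← E.A.isotropy a ha, hs, hχ]
    have h2 : ∫ γ, (p γ : ℂ) * k χ γ (E.gpd.mul a σ) ∂α.meas χ.base =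
        (χ.eval a : ℂ) * ∫ γ, (p γ : ℂ) * k χ γ σ ∂α.meas χ.base := by
      rw [← integral_const_mul]
      refine integral_congr_ae ?_
      filter_upwards [α.ae_r_eq χ.base] with γ hγ
      rw [hk.equivariant a ha χ γ σ hs hχ hγ]
      ring
    rw [E.average_of α h1, E.average_of α hχ, h2]
    ring
  · obtain ⟨γ, hγ, h0⟩ := hex χ σ hσ hne
    exact (hsupp χ γ σ hσ hγ h0).1

theorem integrable_fiber (hk : E.IsKernel k) {χ : E.Dual} {σ : S} (h : χ.base = E.gpd.r σ) :
    Integrable (fun γ => k χ γ σ) (α.meas χ.base) := by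
  have := E.t2Space_base
  obtain ⟨L, K, M₁, hL, hK, _, hsupp⟩ := hk.exists_support
  refine α.integrable_of_continuousOn E.continuous_quot_r hK (hk.continuousOn_fiber h)
    fun γ hγ hγK => ?_
  by_contra hne
  exact hγK (hsupp _ _ _ h hγ hne).2.1

theorem integrable_star_mul {k' : E.Dual → E.A.Quot → S → ℂ} (hk' : E.IsKernel k')
    (hk : E.IsKernel k) {χ : E.Dual} {σ τ : S} (h : χ.base = E.gpd.r σ) (h' : χ.base = E.gpd.r τ) :
    Integrable (fun γ => star (k' χ γ τ) * k χ γ σ) (α.meas χ.base) := by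
  have := E.t2Space_base
  obtain ⟨L, K, M₁, hL, hK, _, hsupp⟩ := hk.exists_support
  refine α.integrable_of_continuousOn E.continuous_quot_r hK
    ((continuous_star.comp_continuousOn (hk'.continuousOn_fiber h')).mul (hk.continuousOn_fiber h))
    fun γ hγ hγK => ?_
  have : k χ γ σ = 0 := by
    by_contra hne
    exact hγK (hsupp _ _ _ h hγ hne).2.1
  rw [this, mul_zero]

/-- Compositions of kernels are limits of sums of products of sections. -/
theorem exists_discretization {κ : Bool → E.Dual → E.A.Quot → S → ℂ} (hκ : ∀ j, E.IsKernel (κ j)) :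
    ∃ M : Set E.A.Quot, IsCompact M ∧ ∀ ε > 0, ∃ (n : ℕ) (a : Fin n → Bool → E.Dual → S → ℂ),
      (∀ i j, E.IsCSection (a i j)) ∧
      (∀ i j χ σ, Dual.base χ = E.gpd.r σ → a i j χ σ ≠ 0 → E.A.proj σ ∈ M) ∧
      ∀ j j' χ σ, Dual.base χ = E.gpd.r σ →
        Integrable (fun ω => E.kernelProd α (κ j) (κ j') χ (E.A.out ω) σ) (α.meas χ.base) →
        ‖∑ i, E.mconv α (E.minv (a i j)) (a i j') χ σ -
          ∫ ω, E.kernelProd α (κ j) (κ j') χ (E.A.out ω) σ ∂α.meas χ.base‖ ≤ ε := by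
  have := E.t2Space_base
  choose L K M hL hK hM hsupp using fun j => (hκ j).exists_support
  choose B hB0 hB using fun j => (hκ j).exists_bound
  set K₀ := K true ∪ K false with hK₀
  set M₀ := M true ∪ M false with hM₀
  set B₀ := max (B true) (B false) with hB₀
  have hK₀c : IsCompact K₀ := (hK _).union (hK _)
  have hM₀c : IsCompact M₀ := (hM _).union (hM _)
  have hKj : ∀ j, K j ⊆ K₀ := by
    rintro (_ | _)
    exacts [Set.subset_union_right, Set.subset_union_left]
  have hMj : ∀ j, M j ⊆ M₀ := by
    rintro (_ | _)
    exacts [Set.subset_union_right, Set.subset_union_left]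
  have hBj : ∀ j, B j ≤ B₀ := by
    rintro (_ | _)
    exacts [le_max_right _ _, le_max_left _ _]
  have hB₀0 : 0 ≤ B₀ := (hB0 true).trans (hBj true)
  obtain ⟨C, hC0, hC⟩ := α.exists_measure_le E.continuous_quot_r hK₀c
  have hMi : IsCompact (E.quot.inv '' M₀) := hM₀c.image E.continuous_quot_inv
  obtain ⟨D, hD0, hD⟩ := α.exists_measure_le E.continuous_quot_r hMi
  refine ⟨M₀, hM₀c, fun ε hε => ?_⟩
  set δ := ε / (2 * (B₀ * C * D + 1)) with hδ
  have hδ0 : 0 < δ := by positivity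
  have hosc : ∀ γ₀, ∃ V ∈ 𝓝 γ₀, ∀ j, ∀ γ ∈ V, ∀ γ' ∈ V, ∀ χ σ, Dual.base χ = E.gpd.r σ →
      E.quot.r γ = χ.base → E.quot.r γ' = χ.base → ‖κ j χ γ σ - κ j χ γ' σ‖ ≤ δ := by
    intro γ₀
    choose V hV hVk using fun j => (hκ j).exists_nhds_osc hδ0 γ₀
    refine ⟨V true ∩ V false, inter_mem (hV _) (hV _), ?_⟩
    rintro (_ | _) γ hγ γ' hγ'
    exacts [hVk false γ hγ.2 γ' hγ'.2, hVk true γ hγ.1 γ' hγ'.1]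
  choose V hV hVk using hosc
  obtain ⟨t, -, ht⟩ := hK₀c.elim_nhds_subcover (fun γ => interior (V γ))
    fun γ _ => interior_mem_nhds.2 (hV γ)
  obtain ⟨p, hpV, hp1, hp01, hpc⟩ := exists_continuous_sum_one_of_isOpen_isCompact
    (s := fun i : Fin t.card => interior (V (t.equivFin.symm i)))
    (fun i => isOpen_interior) hK₀c (by
      intro γ hγ
      obtain ⟨γ₀, hγ₀, h⟩ := Set.mem_iUnion₂.1 (ht hγ)
      exact Set.mem_iUnion.2 ⟨t.equivFin ⟨γ₀, hγ₀⟩, by simpa using h⟩)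
  set η := ε / (2 * (t.card * (B₀ * B₀) * D + 1)) with hη
  have hη0 : 0 < η := by positivity
  have hpi : ∀ x i, Integrable (p i) (α.meas x) := fun x i =>
    (p i).continuous.integrable_of_hasCompactSupport (hpc i)
  set m : Fin t.card → X → ℝ := fun i x => ∫ γ, p i γ ∂α.meas x with hm
  have hm0 : ∀ i x, 0 ≤ m i x := fun i x => integral_nonneg fun γ => (hp01 i γ).1
  have hmc : ∀ i, Continuous (m i) := fun i => by
    have h1 := α.continuous_integral ⟨⟨fun γ => (p i γ : ℂ), by fun_prop⟩,
      (hpc i).comp_left (g := fun t : ℝ => (t : ℂ)) Complex.ofReal_zero⟩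
    refine (Complex.continuous_re.comp h1).congr fun x => ?_
    change Complex.re (∫ γ, (p i γ : ℂ) ∂α.meas x) = _
    rw [integral_complex_ofReal, Complex.ofReal_re]
  set w : Fin t.card → E.Dual → ℝ := fun i χ => (√(m i χ.base + η))⁻¹ with hw
  have hwc : ∀ i, Continuous (w i) := fun i => by
    refine Continuous.inv₀ (Real.continuous_sqrt.comp
      (((hmc i).comp E.continuous_base).add continuous_const)) fun χ => ?_
    exact (Real.sqrt_pos.2 (by linarith [hm0 i χ.base])).ne'
  have hww : ∀ i χ, (w i χ : ℂ) * w i χ = ((m i χ.base : ℂ) + η)⁻¹ := fun i χ => by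
    have h1 : 0 ≤ m i χ.base + η := by linarith [hm0 i χ.base]
    rw [← Complex.ofReal_mul, hw, ← mul_inv, Real.mul_self_sqrt h1]
    push_cast
    rfl
  have hav : ∀ i j, _ := fun i j => (hκ j).isCSection_average α (hwc i) (p i).continuous hM₀c
    fun χ γ σ hσ hγ hne => hMj j (hsupp j χ γ σ hσ hγ hne).2.2
  refine ⟨t.card, fun i j => E.average α (w i) (p i) (κ j), fun i j => (hav i j).1,
    fun i j => (hav i j).2, fun j j' χ σ hσ hinteg => ?_⟩
  have hi : ∀ i ∈ Finset.univ, Integrable (fun ω => E.minv (E.average α (w i) (p i) (κ j)) χ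
      (E.A.out ω) * E.tr (E.average α (w i) (p i) (κ j')) χ (E.A.out ω) σ) (α.meas χ.base) :=
    fun i _ => (hav i j).1.toIsSection.inv.integrable_conv α (hav i j').1.toIsSection hσ
  simp only [E.mconv_of α hσ]
  rw [← integral_finsetSum _ hi, ← integral_sub (integrable_finsetSum _ hi) hinteg]
  have hbound : ∀ ω, E.quot.r ω = χ.base →
      ‖∑ i, E.minv (E.average α (w i) (p i) (κ j)) χ (E.A.out ω) *
        E.tr (E.average α (w i) (p i) (κ j')) χ (E.A.out ω) σ -
        E.kernelProd α (κ j) (κ j') χ (E.A.out ω) σ‖ ≤ δ * (B₀ * C) + t.card * (B₀ * B₀ * η) := by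
    intro ω hω
    have hτ : χ.base = E.gpd.r (E.A.out ω) := Eq.symm hω
    set τ := E.A.out ω with hτdef
    set χ' := E.sact χ τ with hχ'
    have hb : χ'.base = E.gpd.s τ := E.base_sact hτ
    have h1 : χ'.base = E.gpd.r (E.gpd.inv τ) := E.base_sact_inv hτ
    have h2 : χ'.base = E.gpd.r (E.gpd.mul (E.gpd.inv τ) σ) := E.base_sact_inv_mul hτ hσ
    have hu : Integrable (fun γ => star (κ j χ' γ (E.gpd.inv τ))) (α.meas χ'.base) := by
      have := (LinearIsometryEquiv.integrable_comp_iff Complex.conjLIE).2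
        ((hκ j).integrable_fiber α h1)
      exact this
    have hmain := norm_sum_average_sub_le (μ := α.meas χ'.base) (p := fun i => p i)
      (u := fun γ => star (κ j χ' γ (E.gpd.inv τ)))
      (v := fun γ => κ j' χ' γ (E.gpd.mul (E.gpd.inv τ) σ)) (R := {γ | E.quot.r γ = χ'.base})
      (α.ae_r_eq _) (hpi _) (fun i γ => hp01 i γ) hu ((hκ j').integrable_fiber α h2)
      ((hκ j).integrable_star_mul α (hκ j') h2 h1) hη0 hδ0.le hB₀0
      (fun γ hγ => by
        rw [norm_star]
        exact (hB j χ' γ _ h1 hγ).trans (hBj j))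
      (fun γ hγ => (hB j' χ' γ _ h2 hγ).trans (hBj j'))
      (fun γ hγ hne => by
        have := hp1 (hKj j (hsupp j χ' γ _ h1 hγ (star_ne_zero.1 hne)).2.1)
        simpa using this)
      (fun i γ hγ γ' hγ' hne hne' => hVk _ j' γ'
        (interior_subset (hpV i (subset_tsupport _ hne'))) γ
        (interior_subset (hpV i (subset_tsupport _ hne))) χ' _ h2 hγ' hγ)
    have hun : ∫ γ, ‖star (κ j χ' γ (E.gpd.inv τ))‖ ∂α.meas χ'.base ≤ B₀ * C := by
      have h3 := α.norm_integral_le_of_bound (x := χ'.base)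
        (g := fun γ => ‖star (κ j χ' γ (E.gpd.inv τ))‖) hK₀c.measurableSet hB₀0 hC0 (hC _)
        (fun γ hγ => by
          rw [norm_norm, norm_star]
          exact (hB j χ' γ _ h1 hγ).trans (hBj j))
        fun γ hγ hγK => by
          rw [norm_star, norm_eq_zero]
          by_contra hne
          exact hγK (hKj j (hsupp j χ' γ _ h1 hγ hne).2.1)
      exact (le_abs_self _).trans h3
    have hsum : ∑ i, E.minv (E.average α (w i) (p i) (κ j)) χ τ *
        E.tr (E.average α (w i) (p i) (κ j')) χ τ σ =
        ∑ i, (((∫ γ, p i γ ∂α.meas χ'.base : ℝ) : ℂ) + η)⁻¹ *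
          (∫ γ, p i γ * star (κ j χ' γ (E.gpd.inv τ)) ∂α.meas χ'.base) *
          ∫ γ, p i γ * κ j' χ' γ (E.gpd.mul (E.gpd.inv τ) σ) ∂α.meas χ'.base := by
      refine Finset.sum_congr rfl fun i _ => ?_
      rw [E.minv_of hτ, tr, E.average_of α h1, E.average_of α h2, star_mul']
      have h3 : star (∫ γ, (p i γ : ℂ) * κ j χ' γ (E.gpd.inv τ) ∂α.meas χ'.base) =
          ∫ γ, (p i γ : ℂ) * star (κ j χ' γ (E.gpd.inv τ)) ∂α.meas χ'.base := by
        rw [Complex.star_def, ← integral_conj]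
        simp only [map_mul, Complex.conj_ofReal]
      have h4 := hww i χ'
      simp only [hm] at h4
      rw [h3, Complex.star_def, Complex.conj_ofReal, ← h4]
      ring
    have hprod : E.kernelProd α (κ j) (κ j') χ τ σ = ∫ γ, star (κ j χ' γ (E.gpd.inv τ)) *
        κ j' χ' γ (E.gpd.mul (E.gpd.inv τ) σ) ∂α.meas χ'.base := by
      rw [kernelProd, ← hb]
    rw [hsum, hprod]
    exact hmain.trans (add_le_add (mul_le_mul_of_nonneg_left hun hδ0.le) le_rfl)
  have hzero : ∀ ω, E.quot.r ω = χ.base → ω ∉ E.quot.inv '' M₀ →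
      ∑ i, E.minv (E.average α (w i) (p i) (κ j)) χ (E.A.out ω) *
        E.tr (E.average α (w i) (p i) (κ j')) χ (E.A.out ω) σ -
        E.kernelProd α (κ j) (κ j') χ (E.A.out ω) σ = 0 := by
    intro ω hω hωM
    have hτ : χ.base = E.gpd.r (E.A.out ω) := Eq.symm hω
    have hinv : E.A.proj (E.gpd.inv (E.A.out ω)) ∉ M₀ := fun h => hωM ⟨_, h, by
      rw [← E.quot_inv_proj, E.A.proj_out, E.quot.inv_inv]⟩
    have h1 : (E.sact χ (E.A.out ω)).base = E.gpd.r (E.gpd.inv (E.A.out ω)) := E.base_sact_inv hτ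
    have h2 : ∀ i, E.minv (E.average α (w i) (p i) (κ j)) χ (E.A.out ω) = 0 := fun i => by
      rw [E.minv_of hτ, star_eq_zero]
      by_contra hne
      exact hinv ((hav i j).2 _ _ h1 hne)
    have h3 : E.kernelProd α (κ j) (κ j') χ (E.A.out ω) σ = 0 := by
      refine integral_eq_zero_of_ae ?_
      filter_upwards [α.ae_r_eq (E.gpd.s (E.A.out ω))] with γ hγ
      have h4 : κ j (E.sact χ (E.A.out ω)) γ (E.gpd.inv (E.A.out ω)) = 0 := by
        by_contra hne
        exact hinv (hMj j (hsupp j _ γ _ h1 (hγ.trans (E.base_sact hτ).symm) hne).2.2)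
      rw [h4, star_zero, zero_mul]
      rfl
    simp [h2, h3]
  refine (α.norm_integral_le_of_bound hMi.measurableSet (by positivity) hD0 (hD _) hbound
    hzero).trans ?_
  have h1 : δ * (B₀ * C) * D ≤ ε / 2 := by
    rw [hδ, div_mul_eq_mul_div, div_mul_eq_mul_div, div_le_iff₀ (by positivity)]
    nlinarith [mul_nonneg (mul_nonneg hB₀0 hC0) hD0]
  have h2 : t.card * (B₀ * B₀ * η) * D ≤ ε / 2 := by
    have h3 : (t.card : ℝ) * (B₀ * B₀ * η) * D = t.card * (B₀ * B₀) * D * η := by ring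
    rw [h3, hη, mul_div_assoc', div_le_iff₀ (by positivity)]
    have h4 : (0 : ℝ) ≤ t.card * (B₀ * B₀) * D := by positivity
    nlinarith
  linarith

end IsKernel

end AbelianExtension

/-- The factor `z / √‖z‖` of a complex number with the same modulus as `√‖z‖`. -/
def Complex.polarRoot (z : ℂ) : ℂ := z / (√‖z‖ : ℝ)

namespace Complex

theorem norm_polarRoot (z : ℂ) : ‖polarRoot z‖ = √‖z‖ := by
  rw [polarRoot, norm_div, norm_real, Real.norm_of_nonneg (Real.sqrt_nonneg _), Real.div_sqrt]

theorem polarRoot_eq_zero {z : ℂ} : polarRoot z = 0 ↔ z = 0 := by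
  rw [← norm_eq_zero, norm_polarRoot, Real.sqrt_eq_zero (norm_nonneg _), norm_eq_zero]

theorem sqrt_norm_mul_polarRoot (z : ℂ) : (√‖z‖ : ℝ) * polarRoot z = z := by
  by_cases hz : z = 0
  · simp [hz, polarRoot]
  · rw [polarRoot, mul_div_cancel₀]
    exact ofReal_ne_zero.2 (Real.sqrt_pos.2 (norm_pos_iff.2 hz)).ne'

theorem star_polarRoot_mul_self (z : ℂ) : star (polarRoot z) * polarRoot z = (‖z‖ : ℂ) := by
  rw [star_def, ← normSq_eq_conj_mul_self, normSq_eq_norm_sq, norm_polarRoot,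
    Real.sq_sqrt (norm_nonneg _)]

theorem polarRoot_mul (w z : ℂ) (hw : ‖w‖ = 1) : polarRoot (w * z) = w * polarRoot z := by
  rw [polarRoot, polarRoot, norm_mul, hw, one_mul, mul_div_assoc]

theorem continuous_polarRoot : Continuous polarRoot := by
  refine continuous_iff_continuousAt.2 fun z => ?_
  by_cases hz : z = 0
  · subst hz
    have h0 : polarRoot 0 = 0 := polarRoot_eq_zero.2 rfl
    rw [ContinuousAt, h0, tendsto_zero_iff_norm_tendsto_zero]
    simp only [norm_polarRoot]
    exact (Real.continuous_sqrt.comp continuous_norm).tendsto' _ _ (by simp)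
  · refine continuousAt_id.div (by fun_prop) ?_
    exact ofReal_ne_zero.2 (Real.sqrt_pos.2 (norm_pos_iff.2 hz)).ne'

end Complex

/-- A function on the square of a fibre that is continuous and compactly supported is
integrable. -/
theorem GroupoidStr.HaarSystem.integrable_prod_of_continuousOn {Y X : Type u}
    [TopologicalSpace Y] [T2Space Y] [LocallyCompactSpace Y] [SecondCountableTopology Y]
    [MeasurableSpace Y] [BorelSpace Y] [TopologicalSpace X] [T2Space X] {G : GroupoidStr Y X}
    (lam : G.HaarSystem) (hr : Continuous G.r) {x : X} {K : Set (Y × Y)} (hK : IsCompact K)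
    {k : Y × Y → ℂ} (hk : ContinuousOn k ({y | G.r y = x} ×ˢ {y | G.r y = x}))
    (hz : ∀ q ∈ {y | G.r y = x} ×ˢ {y | G.r y = x}, q ∉ K → k q = 0) :
    Integrable k ((lam.meas x).prod (lam.meas x)) := by
  set s : Set Y := {y | G.r y = x} with hs
  have hcl : IsClosed s := isClosed_eq hr continuous_const
  have hres : (lam.meas x).restrict s = lam.meas x :=
    Measure.restrict_eq_self_of_ae_mem (lam.ae_r_eq x)
  have h1 : IntegrableOn k (K ∩ s ×ˢ s) ((lam.meas x).prod (lam.meas x)) :=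
    (hk.mono Set.inter_subset_right).integrableOn_compact (hK.inter_right (hcl.prod hcl))
  have h2 : IntegrableOn k (s ×ˢ s) ((lam.meas x).prod (lam.meas x)) :=
    h1.of_forall_sdiff_eq_zero (hcl.prod hcl).measurableSet fun q hq =>
      hz q hq.1 fun h => hq.2 ⟨h, hq.1⟩
  rwa [IntegrableOn, ← Measure.prod_restrict, hres] at h2

namespace AbelianExtension

variable {S X : Type u} [TopologicalSpace S] [T2Space S] [LocallyCompactSpace S]
  [SecondCountableTopology S] [MeasurableSpace S] [BorelSpace S] [TopologicalSpace X]
  (E : AbelianExtension S X) (α : E.quot.HaarSystem)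

/-- The integral of the modulus of a section over the arrows ending at a character. -/
def mass (φ : E.Dual → S → ℂ) (χ : E.Dual) : ℝ := ∫ γ, ‖φ χ (E.A.out γ)‖ ∂α.meas χ.base

namespace IsSection

variable {E} {φ ψ : E.Dual → S → ℂ}

theorem continuousOn_norm_out (hφ : E.IsSection φ) :
    ContinuousOn (fun q : E.Dual × E.A.Quot => ‖φ q.1 (E.A.out q.2)‖)
      {q | q.1 ∈ Set.univ ∧ E.quot.r q.2 = q.1.base} :=
  E.continuousOn_out (h := fun χ σ => ‖φ χ σ‖)
    (fun _ _ _ hσ => hφ.norm_congr (E.A.proj_out _) (Eq.symm hσ))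
    (hφ.continuousOn_comp continuousOn_fst continuousOn_snd fun _ hq => hq.2.symm).norm

theorem integrable_norm_out (hφ : E.IsSection φ) (χ : E.Dual) :
    Integrable (fun γ => (‖φ χ (E.A.out γ)‖ : ℂ)) (α.meas χ.base) := by
  have := E.t2Space_base
  obtain ⟨K, hK, hKφ⟩ := hφ.exists_support
  refine α.integrable_of_continuousOn E.continuous_quot_r hK
    (Complex.continuous_ofReal.comp_continuousOn (hφ.continuousOn_norm_out.comp
      (f := fun γ => (χ, γ)) (by fun_prop) fun γ hγ => ⟨trivial, hγ⟩)) fun γ hγ hγK => ?_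
  rw [Complex.ofReal_eq_zero, norm_eq_zero]
  by_contra hne
  exact hγK (E.A.proj_out γ ▸ hKφ χ _ (Eq.symm hγ) hne)

theorem continuous_mass (hφ : E.IsSection φ) : Continuous (E.mass α φ) := by
  have := E.t2Space_base
  obtain ⟨K, hK, hKφ⟩ := hφ.exists_support
  have h := α.continuousOn_integral E.continuous_quot_r (W := Set.univ)
    (p := fun χ : E.Dual => χ.base) E.continuous_base.continuousOn hK
    (k := fun χ γ => (‖φ χ (E.A.out γ)‖ : ℂ))
    (Complex.continuous_ofReal.comp_continuousOn hφ.continuousOn_norm_out) (by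
      intro χ _ γ hγ hγK
      rw [Complex.ofReal_eq_zero, norm_eq_zero]
      by_contra hne
      exact hγK (E.A.proj_out γ ▸ hKφ χ _ (Eq.symm hγ) hne))
  refine (Complex.continuous_re.comp (continuousOn_univ.1 h)).congr fun χ => ?_
  change Complex.re (∫ γ, (‖φ χ (E.A.out γ)‖ : ℂ) ∂α.meas χ.base) = _
  rw [integral_complex_ofReal, Complex.ofReal_re]
  rfl

theorem ofReal_mass (hφ : E.IsSection φ) (χ : E.Dual) :
    ENNReal.ofReal (E.mass α φ χ) = ∫⁻ γ, ‖φ χ (E.A.out γ)‖ₑ ∂α.meas χ.base := by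
  have h : Integrable (fun γ => ‖φ χ (E.A.out γ)‖) (α.meas χ.base) :=
    (hφ.integrable_norm_out α χ).re
  rw [mass, ofReal_integral_eq_lintegral_ofReal h (Eventually.of_forall fun _ => norm_nonneg _)]
  exact lintegral_congr fun γ => ofReal_norm _

theorem norm_tr_out_right (hψ : E.IsSection ψ) {χ : E.Dual} {τ σ : S} (hτ : χ.base = E.gpd.r τ)
    (hσ : χ.base = E.gpd.r σ) :
    ‖E.tr ψ χ τ (E.A.out (E.A.proj σ))‖ = ‖E.tr ψ χ τ σ‖ := by
  obtain ⟨a, ha, hs, -, h⟩ := E.exists_out_proj σ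
  rw [h, hψ.tr_mul_right ha hs hτ hσ, norm_mul, E.norm_eval, one_mul]

end IsSection

theorem mass_sact (φ : E.Dual → S → ℂ) {χ : E.Dual} {τ : S} (hτ : χ.base = E.gpd.r τ) :
    E.mass α φ (E.sact χ τ) = ∫ γ, ‖φ (E.sact χ τ) (E.A.out γ)‖ ∂α.meas (E.gpd.s τ) := by
  rw [mass, E.base_sact hτ]

theorem tr_mulDual (θ : E.Dual → ℂ) (φ : E.Dual → S → ℂ) (χ : E.Dual) (τ σ : S) :
    E.tr (fun χ σ => θ χ * φ χ σ) χ τ σ = θ (E.sact χ τ) * E.tr φ χ τ σ := rfl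

theorem ofReal_mass_le_iNormR {φ : E.Dual → S → ℂ} (hφ : E.IsSection φ) (χ : E.Dual) :
    ENNReal.ofReal (E.mass α φ χ) ≤ E.iNormR α φ := by
  rw [hφ.ofReal_mass α χ]
  exact le_iSup (fun χ : E.Dual => ∫⁻ γ, ‖φ χ (E.A.out γ)‖ₑ ∂α.meas χ.base) χ

theorem ofReal_mass_minv_le_iNormS {φ : E.Dual → S → ℂ} (hφ : E.IsSection φ) (χ : E.Dual) :
    ENNReal.ofReal (E.mass α (E.minv φ) χ) ≤ E.iNormS α φ := by
  rw [hφ.inv.ofReal_mass α χ]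
  refine le_trans (le_of_eq ?_) (le_iSup (fun χ : E.Dual =>
    ∫⁻ γ, ‖φ (E.sact χ (E.A.out γ)) (E.gpd.inv (E.A.out γ))‖ₑ ∂α.meas χ.base) χ)
  refine lintegral_congr_ae ?_
  filter_upwards [α.ae_r_eq χ.base] with γ hγ
  rw [E.minv_of (Eq.symm hγ), ← ofReal_norm, norm_star, ofReal_norm]

/-! ### The two kernels of a factorized section -/

/-- The kernel `√‖f(χ, γ)‖ g(χ, σ)`. -/
def outerKernel (f g : E.Dual → S → ℂ) (χ : E.Dual) (γ : E.A.Quot) (σ : S) : ℂ :=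
  (√‖f χ (E.A.out γ)‖ : ℝ) * g χ σ

/-- The kernel `(f(χ, γ) / √‖f(χ, γ)‖) g(χ · γ, γ⁻¹σ)`. -/
def convKernel (f g : E.Dual → S → ℂ) (χ : E.Dual) (γ : E.A.Quot) (σ : S) : ℂ :=
  Complex.polarRoot (f χ (E.A.out γ)) * E.tr g χ (E.A.out γ) σ

section

variable {E} {f g : E.Dual → S → ℂ}

theorem IsCSection.isKernel_outerKernel (hf : E.IsCSection f) (hg : E.IsCSection g) :
    E.IsKernel (E.outerKernel f g) where
  continuousOn := by
    refine ContinuousOn.mul ?_ (hg.continuousOn_comp (by fun_prop) (by fun_prop) fun q hq => hq.1)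
    refine Complex.continuous_ofReal.comp_continuousOn (Real.continuous_sqrt.comp_continuousOn ?_)
    exact hf.continuousOn_norm_out.comp (f := fun q : (E.Dual × S) × E.A.Quot => (q.1.1, q.2))
      (by fun_prop) fun q hq => ⟨trivial, hq.2⟩
  equivariant a ha χ γ σ hs hχ _ := by
    rw [outerKernel, outerKernel, hg.equivariant a ha χ σ hs hχ]
    ring
  exists_support := by
    obtain ⟨K, hK, hKf⟩ := hf.exists_support
    obtain ⟨M, hM, hMg⟩ := hg.exists_support
    obtain ⟨L, hL, hLg⟩ := hg.exists_support_dual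
    refine ⟨L, K, M, hL, hK, hM, fun χ γ σ hσ hγ hne => ?_⟩
    have hg0 : g χ σ ≠ 0 := right_ne_zero_of_mul hne
    have hf0 : f χ (E.A.out γ) ≠ 0 := fun h => left_ne_zero_of_mul hne (by rw [h]; simp)
    exact ⟨hLg χ σ hσ hg0, E.A.proj_out γ ▸ hKf χ _ (Eq.symm hγ) hf0, hMg χ σ hσ hg0⟩

theorem IsCSection.polarRoot (hf : E.IsCSection f) :
    E.IsCSection (fun χ σ => Complex.polarRoot (f χ σ)) := by
  obtain ⟨K, hK, hKf⟩ := hf.exists_support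
  obtain ⟨L, hL, hLf⟩ := hf.exists_support_dual
  refine IsCSection.mk' (Complex.continuous_polarRoot.comp_continuousOn hf.continuousOn) ?_
    ⟨K, hK, fun χ σ hσ hne => hKf χ σ hσ fun h => hne (Complex.polarRoot_eq_zero.2 h)⟩
    ⟨L, hL, fun χ σ hσ hne => hLf χ σ hσ fun h => hne (Complex.polarRoot_eq_zero.2 h)⟩
    fun χ σ h => Complex.polarRoot_eq_zero.2 (hf.eq_zero χ σ h)
  intro a ha χ σ hs hχ
  rw [hf.equivariant a ha χ σ hs hχ, Complex.polarRoot_mul _ _ (E.norm_eval χ a)]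

theorem IsCSection.isKernel_convKernel (hf : E.IsCSection f) (hg : E.IsCSection g) :
    E.IsKernel (E.convKernel f g) where
  continuousOn := hf.polarRoot.continuousOn_conv_integrand hg.toIsSection
  equivariant a ha χ γ σ hs hχ hγ := by
    rw [convKernel, convKernel, hg.tr_mul_right ha hs (Eq.symm hγ) hχ]
    ring
  exists_support := by
    obtain ⟨K, hK, hKf⟩ := hf.exists_support
    obtain ⟨L, hL, hLf⟩ := hf.exists_support_dual
    obtain ⟨M, hM, hMg⟩ := hg.exists_support
    obtain ⟨N, hN, hNKM⟩ := E.exists_isCompact_mul hK hM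
    refine ⟨L, K, N, hL, hK, hN, fun χ γ σ hσ hγ hne => ?_⟩
    have hτ : χ.base = E.gpd.r (E.A.out γ) := Eq.symm hγ
    have hf0 : f χ (E.A.out γ) ≠ 0 := fun h =>
      left_ne_zero_of_mul hne (Complex.polarRoot_eq_zero.2 h)
    have hγK := hKf χ _ hτ hf0
    refine ⟨hLf χ _ hτ hf0, E.A.proj_out γ ▸ hγK, ?_⟩
    have h1 := hNKM (E.A.out γ) (E.gpd.mul (E.gpd.inv (E.A.out γ)) σ)
      (E.r_inv_mul (hτ.symm.trans hσ)).symm hγK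
      (hMg _ _ (E.base_sact_inv_mul hτ hσ) (right_ne_zero_of_mul hne))
    rwa [E.gpd.mul_inv_cancel_left _ _ (hτ.symm.trans hσ)] at h1

end

variable {f g : E.Dual → S → ℂ}

theorem kernelProd_outer_outer {χ : E.Dual} {τ σ : S} (hτ : χ.base = E.gpd.r τ) :
    E.kernelProd α (E.outerKernel f g) (E.outerKernel f g) χ τ σ =
      E.minv g χ τ * E.tr (fun χ σ => (E.mass α f χ : ℂ) * g χ σ) χ τ σ := by
  have h : ∀ γ, star (E.outerKernel f g (E.sact χ τ) γ (E.gpd.inv τ)) *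
      E.outerKernel f g (E.sact χ τ) γ (E.gpd.mul (E.gpd.inv τ) σ) =
      (‖f (E.sact χ τ) (E.A.out γ)‖ : ℂ) * (E.minv g χ τ * E.tr g χ τ σ) := fun γ => by
    rw [outerKernel, outerKernel, E.minv_of hτ, tr, star_mul', Complex.star_def,
      Complex.conj_ofReal]
    nth_rw 3 [← Real.mul_self_sqrt (norm_nonneg (f (E.sact χ τ) (E.A.out γ)))]
    push_cast
    ring
  rw [kernelProd]
  simp only [h]
  rw [integral_mul_const, integral_complex_ofReal, E.tr_mulDual, E.mass_sact α f hτ]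
  ring

theorem kernelProd_outer_conv {g' : E.Dual → S → ℂ} {χ : E.Dual} {τ σ : S}
    (hτ : χ.base = E.gpd.r τ) (hσ : χ.base = E.gpd.r σ) :
    E.kernelProd α (E.outerKernel f g') (E.convKernel f g) χ τ σ =
      E.minv g' χ τ * E.tr (E.mconv α f g) χ τ σ := by
  have h : ∀ γ, star (E.outerKernel f g' (E.sact χ τ) γ (E.gpd.inv τ)) *
      E.convKernel f g (E.sact χ τ) γ (E.gpd.mul (E.gpd.inv τ) σ) =
      E.minv g' χ τ * (f (E.sact χ τ) (E.A.out γ) *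
        E.tr g (E.sact χ τ) (E.A.out γ) (E.gpd.mul (E.gpd.inv τ) σ)) := fun γ => by
    rw [outerKernel, convKernel, E.minv_of hτ, star_mul', Complex.star_def, Complex.conj_ofReal]
    nth_rw 3 [← Complex.sqrt_norm_mul_polarRoot (f (E.sact χ τ) (E.A.out γ))]
    ring
  rw [kernelProd]
  simp only [h]
  rw [integral_const_mul, tr, E.mconv_of α (E.base_sact_inv_mul hτ hσ), E.base_sact hτ]

/-- The integrand of the double integral expressing the composition of the adjoint of the
convolution kernel with itself. -/
def doubleIntegrand (f g : E.Dual → S → ℂ) (χ : E.Dual) (σ τ ρ : S) : ℂ :=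
  (‖E.tr f χ τ ρ‖ : ℂ) * (E.minv g χ ρ * E.tr g χ ρ σ)

section

variable {E} {χ : E.Dual} {σ : S}

theorem doubleIntegrand_out (hf : E.IsSection f) (hg : E.IsSection g) (hσ : χ.base = E.gpd.r σ)
    {τ ρ : S} (hτ : χ.base = E.gpd.r τ) (hρ : χ.base = E.gpd.r ρ) :
    E.doubleIntegrand f g χ σ (E.A.out (E.A.proj τ)) (E.A.out (E.A.proj ρ)) =
      E.doubleIntegrand f g χ σ τ ρ := by
  have hτ' : χ.base = E.gpd.r (E.A.out (E.A.proj τ)) := by rw [E.A.r_out_proj, hτ]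
  rw [doubleIntegrand, doubleIntegrand, hf.norm_tr_out_right hτ' hρ, hf.tr_out hτ hρ,
    hg.inv.mul_tr_out hg hρ hσ]

theorem continuousOn_doubleIntegrand (hf : E.IsSection f) (hg : E.IsSection g)
    (hσ : χ.base = E.gpd.r σ) :
    ContinuousOn (fun q : E.A.Quot × E.A.Quot =>
        E.doubleIntegrand f g χ σ (E.A.out q.1) (E.A.out q.2))
      ({γ | E.quot.r γ = χ.base} ×ˢ {γ | E.quot.r γ = χ.base}) := by
  refine ContinuousOn.of_comp_isOpenQuotientMap
    (E.isOpenQuotientMap_proj.prodMap E.isOpenQuotientMap_proj) ?_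
  have h1 : ∀ q ∈ Prod.map E.A.proj E.A.proj ⁻¹'
      ({γ | E.quot.r γ = χ.base} ×ˢ {γ | E.quot.r γ = χ.base}),
      χ.base = E.gpd.r q.1 ∧ χ.base = E.gpd.r q.2 := fun q hq =>
    ⟨((E.quot_r_proj q.1).symm.trans hq.1).symm, ((E.quot_r_proj q.2).symm.trans hq.2).symm⟩
  refine ContinuousOn.congr (f := fun q : S × S => E.doubleIntegrand f g χ σ q.1 q.2) ?_
    fun q hq => doubleIntegrand_out hf hg hσ (h1 q hq).1 (h1 q hq).2
  refine ContinuousOn.mul ?_ (ContinuousOn.mul ?_ ?_)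
  · exact Complex.continuous_ofReal.comp_continuousOn (hf.continuousOn_tr continuousOn_const
      continuousOn_fst continuousOn_snd (fun q hq => (h1 q hq).1) fun q hq => (h1 q hq).2).norm
  · exact hg.inv.continuousOn_comp continuousOn_const continuousOn_snd fun q hq => (h1 q hq).2
  · exact hg.continuousOn_tr continuousOn_const continuousOn_snd continuousOn_const
      (fun q hq => (h1 q hq).2) fun _ _ => hσ

theorem exists_doubleIntegrand_support (hf : E.IsSection f) (hg : E.IsSection g)
    (χ : E.Dual) (σ : S) :
    ∃ K M : Set E.A.Quot, IsCompact K ∧ IsCompact M ∧ ∀ γ δ, E.quot.r γ = χ.base →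
      E.quot.r δ = χ.base → E.doubleIntegrand f g χ σ (E.A.out γ) (E.A.out δ) ≠ 0 →
      γ ∈ K ∧ δ ∈ M := by
  obtain ⟨K₁, hK₁, hKf⟩ := hf.exists_support
  obtain ⟨M, hM, hMg⟩ := hg.inv.exists_support
  obtain ⟨K₂, hK₂, hK₂inv⟩ := E.exists_isCompact_inv hK₁
  obtain ⟨K, hK, hKM⟩ := E.exists_isCompact_mul hM hK₂
  refine ⟨K, M, hK, hM, fun γ δ hγ hδ hne => ?_⟩
  have hτ : χ.base = E.gpd.r (E.A.out γ) := Eq.symm hγ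
  have hρ : χ.base = E.gpd.r (E.A.out δ) := Eq.symm hδ
  have h1 : E.tr f χ (E.A.out γ) (E.A.out δ) ≠ 0 := fun h =>
    left_ne_zero_of_mul hne (by rw [h]; simp)
  have h2 := hMg χ _ hρ (left_ne_zero_of_mul (right_ne_zero_of_mul hne))
  have h3 := hK₂inv _ (hKf _ _ (E.base_sact_inv_mul hτ hρ) h1)
  have h4 := hKM _ _ (by
    rw [E.gpd.r_inv, E.s_inv_mul (hτ.symm.trans hρ)]) h2 h3
  have h5 : E.gpd.s (E.gpd.inv (E.A.out γ)) = E.gpd.r (E.A.out δ) := by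
    rw [E.gpd.s_inv, ← hτ, hρ]
  rw [E.gpd.mul_inv_rev _ _ h5, E.gpd.inv_inv,
    E.gpd.mul_inv_cancel_left _ _ (hρ.symm.trans hτ), E.A.proj_out] at h4
  rw [E.A.proj_out] at h2
  exact ⟨h4, h2⟩

theorem kernelProd_conv_conv (hf : E.IsSection f) (hg : E.IsSection g) (hσ : χ.base = E.gpd.r σ)
    {ω : E.A.Quot} (hω : E.quot.r ω = χ.base) :
    E.kernelProd α (E.convKernel f g) (E.convKernel f g) χ (E.A.out ω) σ =
      ∫ δ, E.doubleIntegrand f g χ σ (E.A.out ω) (E.A.out δ) ∂α.meas χ.base := by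
  have := E.t2Space_base
  have hτ : χ.base = E.gpd.r (E.A.out ω) := Eq.symm hω
  have hone : χ.base = E.gpd.r (E.gpd.one χ.base) := (E.gpd.r_one _).symm
  obtain ⟨K, M, hK, hM, hKM⟩ := exists_doubleIntegrand_support hf hg χ σ
  have h := α.integral_mul_left E.continuous_quot_r ω hM
    (k := fun δ => E.doubleIntegrand f g χ σ (E.A.out ω) (E.A.out δ)) (by
      rw [hω]
      exact (continuousOn_doubleIntegrand hf hg hσ).comp (f := fun δ => (ω, δ)) (by fun_prop)
        fun δ hδ => ⟨hω, hδ⟩) (by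
      rw [hω]
      intro δ hδ hδM
      by_contra hne
      exact hδM (hKM ω δ hω hδ hne).2)
  rw [hω] at h
  rw [← h, kernelProd]
  refine integral_congr_ae ?_
  filter_upwards [α.ae_r_eq (E.quot.s ω)] with γ hγ
  have hτγ : E.gpd.s (E.A.out ω) = E.gpd.r (E.A.out γ) := Eq.symm hγ
  have hm : χ.base = E.gpd.r (E.gpd.mul (E.A.out ω) (E.A.out γ)) := by
    rw [E.gpd.r_mul _ _ hτγ, hτ]
  have h1 := doubleIntegrand_out hf hg hσ hτ hm
  rw [E.A.proj_out] at h1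
  change _ = E.doubleIntegrand f g χ σ (E.A.out ω)
    (E.A.out (E.A.proj (E.gpd.mul (E.A.out ω) (E.A.out γ))))
  have h2 := E.tr_sact g hτ hτγ hone
  rw [E.inv_mul_one hτ.symm] at h2
  have h3 : E.tr f χ (E.A.out ω) (E.gpd.mul (E.A.out ω) (E.A.out γ)) =
      f (E.sact χ (E.A.out ω)) (E.A.out γ) := by
    rw [tr, E.gpd.inv_mul_cancel_left _ _ hτγ]
  rw [h1, doubleIntegrand, E.minv_of hm, ← E.tr_one g hm, ← h2, ← E.tr_sact g hτ hτγ hσ,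
    convKernel, convKernel, star_mul', h3, ← Complex.star_polarRoot_mul_self]
  ring

theorem integral_doubleIntegrand (hf : E.IsSection f) (hg : E.IsSection g)
    (hσ : χ.base = E.gpd.r σ) {δ : E.A.Quot} (hδ : E.quot.r δ = χ.base) :
    ∫ ω, E.doubleIntegrand f g χ σ (E.A.out ω) (E.A.out δ) ∂α.meas χ.base =
      E.minv g χ (E.A.out δ) *
        E.tr (fun χ σ => (E.mass α (E.minv f) χ : ℂ) * g χ σ) χ (E.A.out δ) σ := by
  have := E.t2Space_base
  have hρ : χ.base = E.gpd.r (E.A.out δ) := Eq.symm hδ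
  obtain ⟨K, M, hK, hM, hKM⟩ := exists_doubleIntegrand_support hf hg χ σ
  have h := α.integral_mul_left E.continuous_quot_r δ hK
    (k := fun ω => E.doubleIntegrand f g χ σ (E.A.out ω) (E.A.out δ)) (by
      rw [hδ]
      exact (continuousOn_doubleIntegrand hf hg hσ).comp (f := fun ω => (ω, δ)) (by fun_prop)
        fun ω hω => ⟨hω, hδ⟩) (by
      rw [hδ]
      intro ω hω hωK
      by_contra hne
      exact hωK (hKM ω δ hω hδ hne).1)
  rw [hδ] at h
  rw [← h]
  have h1 : ∀ᵐ ω ∂α.meas (E.quot.s δ),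
      E.doubleIntegrand f g χ σ (E.A.out (E.quot.mul δ ω)) (E.A.out δ) =
        (‖E.minv f (E.sact χ (E.A.out δ)) (E.A.out ω)‖ : ℂ) *
          (E.minv g χ (E.A.out δ) * E.tr g χ (E.A.out δ) σ) := by
    filter_upwards [α.ae_r_eq (E.quot.s δ)] with ω hω
    have hδω : E.gpd.s (E.A.out δ) = E.gpd.r (E.A.out ω) := Eq.symm hω
    have hm : χ.base = E.gpd.r (E.gpd.mul (E.A.out δ) (E.A.out ω)) := by
      rw [E.gpd.r_mul _ _ hδω, hρ]
    have hb : (E.sact χ (E.A.out δ)).base = E.gpd.r (E.A.out ω) := (E.base_sact hρ).trans hδω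
    have h2 := doubleIntegrand_out hf hg hσ hm hρ
    rw [E.A.proj_out] at h2
    change E.doubleIntegrand f g χ σ
      (E.A.out (E.A.proj (E.gpd.mul (E.A.out δ) (E.A.out ω)))) (E.A.out δ) = _
    have h3 := E.tr_sact f hρ hδω hρ
    rw [E.gpd.inv_mul, ← E.base_sact hρ, E.tr_one f hb] at h3
    rw [h2, doubleIntegrand, ← h3, E.minv_of hb, norm_star]
  rw [integral_congr_ae h1, integral_mul_const, integral_complex_ofReal, E.tr_mulDual,
    E.mass_sact α _ hρ]
  change ((∫ γ, _ ∂α.meas (E.gpd.s (E.A.out δ)) : ℝ) : ℂ) * _ = _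
  ring

theorem integrable_doubleIntegrand (hf : E.IsSection f) (hg : E.IsSection g)
    (hσ : χ.base = E.gpd.r σ) :
    Integrable (fun q : E.A.Quot × E.A.Quot =>
        E.doubleIntegrand f g χ σ (E.A.out q.1) (E.A.out q.2))
      ((α.meas χ.base).prod (α.meas χ.base)) := by
  have := E.t2Space_base
  obtain ⟨K, M, hK, hM, hKM⟩ := exists_doubleIntegrand_support hf hg χ σ
  refine α.integrable_prod_of_continuousOn E.continuous_quot_r (hK.prod hM)
    (continuousOn_doubleIntegrand hf hg hσ) fun q hq hqK => ?_
  by_contra hne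
  exact hqK (hKM q.1 q.2 hq.1 hq.2 hne)

theorem integrable_kernelProd_conv_conv (hf : E.IsSection f) (hg : E.IsSection g)
    (hσ : χ.base = E.gpd.r σ) :
    Integrable (fun ω => E.kernelProd α (E.convKernel f g) (E.convKernel f g) χ (E.A.out ω) σ)
      (α.meas χ.base) := by
  refine (integrable_doubleIntegrand α hf hg hσ).integral_prod_left.congr ?_
  filter_upwards [α.ae_r_eq χ.base] with ω hω
  exact (kernelProd_conv_conv α hf hg hσ hω).symm

theorem integral_kernelProd_conv_conv (hf : E.IsSection f) (hg : E.IsSection g)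
    (hσ : χ.base = E.gpd.r σ) :
    ∫ ω, E.kernelProd α (E.convKernel f g) (E.convKernel f g) χ (E.A.out ω) σ ∂α.meas χ.base =
      E.mconv α (E.minv g) (fun χ σ => (E.mass α (E.minv f) χ : ℂ) * g χ σ) χ σ := by
  have h1 : ∀ᵐ ω ∂α.meas χ.base,
      E.kernelProd α (E.convKernel f g) (E.convKernel f g) χ (E.A.out ω) σ =
      ∫ δ, E.doubleIntegrand f g χ σ (E.A.out ω) (E.A.out δ) ∂α.meas χ.base := by
    filter_upwards [α.ae_r_eq χ.base] with ω hω using kernelProd_conv_conv α hf hg hσ hω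
  rw [integral_congr_ae h1, integral_integral_swap (integrable_doubleIntegrand α hf hg hσ),
    E.mconv_of α hσ]
  refine integral_congr_ae ?_
  filter_upwards [α.ae_r_eq χ.base] with δ hδ using integral_doubleIntegrand α hf hg hσ hδ

end

end AbelianExtension

open scoped InnerProductSpace in
/-- The Cauchy-Schwarz inequality for limits of sums of inner products. -/
theorem norm_sq_le_of_approx {H : Type*} [NormedAddCommGroup H] [InnerProductSpace ℂ H]
    {x y z : ℂ} (h : ∀ ε > 0, ∃ (n : ℕ) (v w : Fin n → H),
      ‖∑ i, ⟪v i, w i⟫_ℂ - x‖ ≤ ε ∧ ‖∑ i, ⟪v i, v i⟫_ℂ - y‖ ≤ ε ∧ ‖∑ i, ⟪w i, w i⟫_ℂ - z‖ ≤ ε) :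
    0 ≤ y.re ∧ 0 ≤ z.re ∧ ‖x‖ ^ 2 ≤ y.re * z.re := by
  have hsq : ∀ (n : ℕ) (v : Fin n → H), (∑ i, ⟪v i, v i⟫_ℂ).re = ∑ i, ‖v i‖ ^ 2 := fun n v => by
    rw [Complex.re_sum]
    exact Finset.sum_congr rfl fun i _ => by
      rw [inner_self_eq_norm_sq_to_K]
      norm_cast
  have key : ∀ ε > 0, ‖x‖ ≤ √(y.re + ε) * √(z.re + ε) + ε ∧ 0 ≤ y.re + ε ∧ 0 ≤ z.re + ε := by
    intro ε hε
    obtain ⟨n, v, w, h1, h2, h3⟩ := h ε hε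
    have h2' : ∑ i, ‖v i‖ ^ 2 ≤ y.re + ε := by
      have := (abs_le.1 ((Complex.abs_re_le_norm _).trans h2)).2
      rw [Complex.sub_re, hsq] at this
      linarith
    have h3' : ∑ i, ‖w i‖ ^ 2 ≤ z.re + ε := by
      have := (abs_le.1 ((Complex.abs_re_le_norm _).trans h3)).2
      rw [Complex.sub_re, hsq] at this
      linarith
    have h4 : ‖∑ i, ⟪v i, w i⟫_ℂ‖ ≤ √(∑ i, ‖v i‖ ^ 2) * √(∑ i, ‖w i‖ ^ 2) :=
      (norm_sum_le _ _).trans ((Finset.sum_le_sum fun i _ => norm_inner_le_norm _ _).trans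
        (Real.sum_mul_le_sqrt_mul_sqrt _ _ _))
    refine ⟨?_, le_trans (by positivity) h2', le_trans (by positivity) h3'⟩
    have h5 : ‖x‖ ≤ ‖∑ i, ⟪v i, w i⟫_ℂ‖ + ε := by
      have := norm_sub_norm_le x (∑ i, ⟪v i, w i⟫_ℂ)
      rw [norm_sub_rev] at this
      linarith
    refine h5.trans (add_le_add (h4.trans ?_) le_rfl)
    exact mul_le_mul (Real.sqrt_le_sqrt h2') (Real.sqrt_le_sqrt h3') (Real.sqrt_nonneg _)
      (Real.sqrt_nonneg _)
  have hy : 0 ≤ y.re := le_of_forall_pos_le_add fun ε hε => (key ε hε).2.1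
  have hz : 0 ≤ z.re := le_of_forall_pos_le_add fun ε hε => (key ε hε).2.2
  have hx : ‖x‖ ≤ √y.re * √z.re := by
    have hc : Continuous fun ε : ℝ => √(y.re + ε) * √(z.re + ε) + ε := by fun_prop
    have ht : Tendsto (fun ε : ℝ => √(y.re + ε) * √(z.re + ε) + ε) (𝓝[>] 0)
        (𝓝 (√y.re * √z.re)) := (hc.tendsto' 0 _ (by simp)).mono_left nhdsWithin_le_nhds
    exact ge_of_tendsto ht (eventually_nhdsWithin_of_forall fun ε hε => (key ε hε).1)
  refine ⟨hy, hz, ?_⟩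
  calc ‖x‖ ^ 2 ≤ (√y.re * √z.re) ^ 2 := by gcongr
    _ = y.re * z.re := by rw [mul_pow, Real.sq_sqrt hy, Real.sq_sqrt hz]

namespace AbelianExtension

variable {S X : Type u} [TopologicalSpace S] [T2Space S] [LocallyCompactSpace S]
  [SecondCountableTopology S] [MeasurableSpace S] [BorelSpace S] [TopologicalSpace X]
  {E : AbelianExtension S X} {α : E.quot.HaarSystem}
  (L : (E.crossedAlgebra α).Rep (E.crossedAlgebra α).iNorm)

open Classical in
/-- The operator by which a representation of the crossed algebra acts for a section. -/
def repOp (φ : E.Dual → S → ℂ) : L.H →L[ℂ] L.H :=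
  if h : E.IsSection φ then L.toFun ⟨E.ofSection φ h, E.ofSection_mem α h⟩ else 0

variable {φ ψ : E.Dual → S → ℂ}

theorem repOp_of (h : E.IsSection φ) :
    repOp L φ = L.toFun ⟨E.ofSection φ h, E.ofSection_mem α h⟩ := dif_pos h

theorem repOp_add (hφ : E.IsSection φ) (hψ : E.IsSection ψ) :
    repOp L (φ + ψ) = repOp L φ + repOp L ψ := by
  rw [repOp_of L hφ, repOp_of L hψ, repOp_of L (hφ.add hψ)]
  refine L.map_add _ _ _ (E.unc_injective ?_)
  rw [unc_add, unc_ofSection, unc_ofSection, unc_ofSection]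

theorem repOp_smul (hφ : E.IsSection φ) (c : ℂ) : repOp L (c • φ) = c • repOp L φ := by
  rw [repOp_of L hφ, repOp_of L (hφ.smul c)]
  refine L.map_smul _ _ _ (E.unc_injective ?_)
  rw [unc_smul, unc_ofSection, unc_ofSection]

theorem repOp_sub (hφ : E.IsSection φ) (hψ : E.IsSection ψ) :
    repOp L (φ - ψ) = repOp L φ - repOp L ψ := by
  have h : φ - ψ = φ + (-1 : ℂ) • ψ := by rw [neg_smul, one_smul, sub_eq_add_neg]
  rw [h, repOp_add L hφ (hψ.smul _), repOp_smul L hψ, neg_smul, one_smul, sub_eq_add_neg]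

theorem repOp_sum {n : ℕ} {f : Fin n → E.Dual → S → ℂ} (hf : ∀ i, E.IsCSection (f i))
    (s : Finset (Fin n)) : repOp L (∑ i ∈ s, f i) = ∑ i ∈ s, repOp L (f i) := by
  induction s using Finset.induction_on with
  | empty =>
    have h := repOp_smul L (IsSection.zero (E := E)) 0
    simpa using h
  | insert i s hi ih =>
    rw [Finset.sum_insert hi, Finset.sum_insert hi, repOp_add L (hf i).toIsSection
      (IsCSection.sum fun j _ => hf j).toIsSection, ih]

theorem repOp_conv (hφ : E.IsSection φ) (hψ : E.IsSection ψ) :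
    repOp L (E.mconv α φ ψ) = repOp L φ * repOp L ψ := by
  rw [repOp_of L hφ, repOp_of L hψ, repOp_of L (hφ.conv α hψ)]
  refine L.map_conv _ _ _ (E.unc_injective ?_)
  change unc (E.ofSection _ (hφ.conv α hψ)) = unc ((E.crossedAlgebra α).conv (E.ofSection φ hφ)
    (E.ofSection ψ hψ))
  rw [E.unc_conv α (by rwa [unc_ofSection]) (by rwa [unc_ofSection]), unc_ofSection,
    unc_ofSection, unc_ofSection]

theorem repOp_inv (hφ : E.IsSection φ) : repOp L (E.minv φ) = star (repOp L φ) := by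
  rw [repOp_of L hφ, repOp_of L hφ.inv]
  refine L.map_invol _ _ (E.unc_injective ?_)
  change unc (E.ofSection _ hφ.inv) = unc ((E.crossedAlgebra α).invol (E.ofSection φ hφ))
  rw [E.unc_invol α, unc_ofSection, unc_ofSection]

theorem exists_norm_repOp_le {K : Set E.A.Quot} (hK : IsCompact K) :
    ∃ C : ℝ, 0 ≤ C ∧ ∀ (φ : E.Dual → S → ℂ) (B : ℝ), 0 ≤ B → E.IsSection φ →
      (∀ χ σ, Dual.base χ = E.gpd.r σ → φ χ σ ≠ 0 → E.A.proj σ ∈ K) →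
      (∀ χ σ, Dual.base χ = E.gpd.r σ → ‖φ χ σ‖ ≤ B) → ‖repOp L φ‖ ≤ C * B := by
  obtain ⟨C, hC, h⟩ := E.exists_iNorm_crossed_le α hK
  refine ⟨C.toReal, ENNReal.toReal_nonneg, fun φ B hB hφ hφK hφB => ?_⟩
  have h1 := h (E.ofSection φ hφ) B (by rwa [unc_ofSection]) (by
    rw [unc_ofSection]
    intro χ σ
    by_cases hσ : χ.base = E.gpd.r σ
    · exact hφB χ σ hσ
    · rw [hφ.eq_zero χ σ hσ, norm_zero]
      exact hB)
  rw [repOp_of L hφ]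
  refine (L.norm_le _).trans ((ENNReal.toReal_mono
    (ENNReal.mul_ne_top hC ENNReal.ofReal_ne_top) h1).trans ?_)
  rw [ENNReal.toReal_mul, ENNReal.toReal_ofReal hB]

open scoped InnerProductSpace

theorem inner_repOp_minv_mconv (hφ : E.IsSection φ) (hψ : E.IsSection ψ) (ζ : L.H) :
    ⟪ζ, repOp L (E.mconv α (E.minv φ) ψ) ζ⟫_ℂ = ⟪repOp L φ ζ, repOp L ψ ζ⟫_ℂ := by
  rw [repOp_conv L hφ.inv hψ, repOp_inv L hφ, ContinuousLinearMap.star_eq_adjoint,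
    mul_apply_eq_comp, ContinuousLinearMap.adjoint_inner_right]

/-- The Cauchy-Schwarz inequality for a convolution with a factorized section. -/
theorem norm_inner_repOp_sq_le {f g g' : E.Dual → S → ℂ} (hf : E.IsCSection f)
    (hg : E.IsCSection g) (hg' : E.IsCSection g') (ζ : L.H) :
    0 ≤ (⟪repOp L g' ζ, repOp L (fun χ σ => (E.mass α f χ : ℂ) * g' χ σ) ζ⟫_ℂ).re ∧
    0 ≤ (⟪repOp L g ζ, repOp L (fun χ σ => (E.mass α (E.minv f) χ : ℂ) * g χ σ) ζ⟫_ℂ).re ∧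
    ‖⟪repOp L g' ζ, repOp L (E.mconv α f g) ζ⟫_ℂ‖ ^ 2 ≤
      (⟪repOp L g' ζ, repOp L (fun χ σ => (E.mass α f χ : ℂ) * g' χ σ) ζ⟫_ℂ).re *
      (⟪repOp L g ζ, repOp L (fun χ σ => (E.mass α (E.minv f) χ : ℂ) * g χ σ) ζ⟫_ℂ).re := by
  have hm : E.IsCSection (fun χ σ => (E.mass α f χ : ℂ) * g' χ σ) :=
    hg'.mulDual (Complex.continuous_ofReal.comp (hf.continuous_mass α))
  have hm' : E.IsCSection (fun χ σ => (E.mass α (E.minv f) χ : ℂ) * g χ σ) :=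
    hg.mulDual (Complex.continuous_ofReal.comp (hf.inv.continuous_mass α))
  set κ : Bool → E.Dual → E.A.Quot → S → ℂ := fun j =>
    if j then E.outerKernel f g' else E.convKernel f g with hκdef
  have hκ : ∀ j, E.IsKernel (κ j) := by
    rintro (_ | _)
    exacts [hf.isKernel_convKernel hg, hf.isKernel_outerKernel hg']
  obtain ⟨M, hM, hdisc⟩ := IsKernel.exists_discretization α hκ
  obtain ⟨M', hM', hMinv⟩ := E.exists_isCompact_inv hM
  obtain ⟨N, hN, hMN⟩ := IsSection.mconv_support α hM' hM
  have hcompare : ∀ (u v : E.Dual → S → ℂ) (hu : E.IsCSection u) (hv : E.IsCSection v),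
      ∃ C : ℝ, 0 ≤ C ∧ ∀ (n : ℕ) (a b : Fin n → E.Dual → S → ℂ) (ε : ℝ), 0 ≤ ε →
        (∀ i, E.IsCSection (a i)) → (∀ i, E.IsCSection (b i)) →
        (∀ i χ σ, Dual.base χ = E.gpd.r σ → a i χ σ ≠ 0 → E.A.proj σ ∈ M) →
        (∀ i χ σ, Dual.base χ = E.gpd.r σ → b i χ σ ≠ 0 → E.A.proj σ ∈ M) →
        (∀ χ σ, Dual.base χ = E.gpd.r σ →
          ‖∑ i, E.mconv α (E.minv (a i)) (b i) χ σ - E.mconv α (E.minv u) v χ σ‖ ≤ ε) →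
        ‖∑ i, ⟪repOp L (a i) ζ, repOp L (b i) ζ⟫_ℂ - ⟪repOp L u ζ, repOp L v ζ⟫_ℂ‖ ≤ C * ε := by
    intro u v hu hv
    have huv := hu.inv.conv α hv
    obtain ⟨N', hN', hN'uv⟩ := huv.exists_support
    obtain ⟨C, hC, hCL⟩ := exists_norm_repOp_le L (hN.union hN')
    refine ⟨C * ‖ζ‖ ^ 2, by positivity, fun n a b ε hε ha hb haM hbM hab => ?_⟩
    have hi : ∀ i, E.IsCSection (E.mconv α (E.minv (a i)) (b i)) := fun i =>
      (ha i).inv.conv α (hb i)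
    have hs : E.IsCSection (∑ i, E.mconv α (E.minv (a i)) (b i)) := IsCSection.sum fun i _ => hi i
    have h1 := hCL _ ε hε (hs.sub huv).toIsSection (by
      intro χ σ hσ hne
      by_contra hcon
      refine hne ?_
      have h2 : E.mconv α (E.minv u) v χ σ = 0 := by
        by_contra h
        exact hcon (Or.inr (hN'uv χ σ hσ h))
      have h3 : ∀ i, E.mconv α (E.minv (a i)) (b i) χ σ = 0 := fun i => by
        by_contra h
        refine hcon (Or.inl (hMN _ _ (fun χ' τ hτ hne' => ?_) (hbM i) χ σ h))
        rw [E.minv_of hτ] at hne'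
        have h4 := hMinv _ (haM i _ _ (E.base_sact_inv hτ) (star_ne_zero.1 hne'))
        rwa [E.gpd.inv_inv] at h4
      simp [h2, h3]) (fun χ σ hσ => by simpa using hab χ σ hσ)
    have h2 : ∑ i, ⟪repOp L (a i) ζ, repOp L (b i) ζ⟫_ℂ - ⟪repOp L u ζ, repOp L v ζ⟫_ℂ =
        ⟪ζ, repOp L (∑ i, E.mconv α (E.minv (a i)) (b i) - E.mconv α (E.minv u) v) ζ⟫_ℂ := by
      rw [repOp_sub L hs.toIsSection huv.toIsSection, repOp_sum L hi, sub_apply,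
        inner_sub_right, sum_apply, inner_sum]
      simp only [inner_repOp_minv_mconv L hu.toIsSection hv.toIsSection,
        inner_repOp_minv_mconv L (ha _).toIsSection (hb _).toIsSection]
    rw [h2]
    calc ‖⟪ζ, repOp L (∑ i, E.mconv α (E.minv (a i)) (b i) - E.mconv α (E.minv u) v) ζ⟫_ℂ‖
        ≤ ‖ζ‖ * (C * ε * ‖ζ‖) := (norm_inner_le_norm _ _).trans (mul_le_mul_of_nonneg_left
          (ContinuousLinearMap.le_of_opNorm_le _ h1 ζ) (norm_nonneg _))
      _ = C * ‖ζ‖ ^ 2 * ε := by ring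
  obtain ⟨C₁, hC₁, hcomp₁⟩ := hcompare g' _ hg' (hf.conv α hg)
  obtain ⟨C₂, hC₂, hcomp₂⟩ := hcompare g' _ hg' hm
  obtain ⟨C₃, hC₃, hcomp₃⟩ := hcompare g _ hg hm'
  refine norm_sq_le_of_approx (H := L.H) fun ε hε => ?_
  set η := ε / (C₁ + C₂ + C₃ + 1) with hη
  have hη0 : 0 < η := by positivity
  have hle : ∀ C, 0 ≤ C → C ≤ C₁ + C₂ + C₃ → C * η ≤ ε := fun C hC h => by
    rw [hη, mul_div_assoc', div_le_iff₀ (by positivity)]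
    nlinarith
  obtain ⟨n, a, ha, haM, hinteg⟩ := hdisc η hη0
  refine ⟨n, fun i => repOp L (a i true) ζ, fun i => repOp L (a i false) ζ, ?_, ?_, ?_⟩
  · refine (hcomp₁ n _ _ η hη0.le (fun i => ha i true) (fun i => ha i false) (fun i => haM i true)
      (fun i => haM i false) fun χ σ hσ => ?_).trans (hle _ hC₁ (by linarith))
    have h1 : ∀ᵐ ω ∂α.meas χ.base, E.minv g' χ (E.A.out ω) *
        E.tr (E.mconv α f g) χ (E.A.out ω) σ =
        E.kernelProd α (κ true) (κ false) χ (E.A.out ω) σ := by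
      filter_upwards [α.ae_r_eq χ.base] with ω hω
      exact (E.kernelProd_outer_conv α (Eq.symm hω) hσ).symm
    have h2 := hinteg true false χ σ hσ ((hg'.inv.toIsSection.integrable_conv α
      (hf.conv α hg).toIsSection hσ).congr h1)
    rwa [← integral_congr_ae h1, ← E.mconv_of α hσ] at h2
  · refine (hcomp₂ n _ _ η hη0.le (fun i => ha i true) (fun i => ha i true) (fun i => haM i true)
      (fun i => haM i true) fun χ σ hσ => ?_).trans (hle _ hC₂ (by linarith))
    have h1 : ∀ᵐ ω ∂α.meas χ.base, E.minv g' χ (E.A.out ω) *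
        E.tr (fun χ σ => (E.mass α f χ : ℂ) * g' χ σ) χ (E.A.out ω) σ =
        E.kernelProd α (κ true) (κ true) χ (E.A.out ω) σ := by
      filter_upwards [α.ae_r_eq χ.base] with ω hω
      exact (E.kernelProd_outer_outer α (Eq.symm hω)).symm
    have h2 := hinteg true true χ σ hσ ((hg'.inv.toIsSection.integrable_conv α
      hm.toIsSection hσ).congr h1)
    rwa [← integral_congr_ae h1, ← E.mconv_of α hσ] at h2
  · refine (hcomp₃ n _ _ η hη0.le (fun i => ha i false) (fun i => ha i false)
      (fun i => haM i false) (fun i => haM i false) fun χ σ hσ => ?_).trans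
      (hle _ hC₃ (by linarith))
    have h2 := hinteg false false χ σ hσ
      (integrable_kernelProd_conv_conv α hf.toIsSection hg.toIsSection hσ)
    have h3 := integral_kernelProd_conv_conv α hf.toIsSection hg.toIsSection hσ
    rw [← h3]
    exact h2

/-- Multiplication of a section by a function with values in `[0, s]` is bounded by `s`. -/
theorem re_inner_repOp_mulDual_le {g : E.Dual → S → ℂ} (hg : E.IsCSection g) {m : E.Dual → ℝ}
    (hm : Continuous m) {s : ℝ} (hs : ∀ χ, m χ ≤ s) (ζ : L.H) :
    (⟪repOp L g ζ, repOp L (fun χ σ => (m χ : ℂ) * g χ σ) ζ⟫_ℂ).re ≤ s * ‖repOp L g ζ‖ ^ 2 := by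
  have hθ : Continuous fun χ => ((√(s - m χ) : ℝ) : ℂ) := by fun_prop
  have hgθ := hg.mulDual hθ
  have hgm : E.IsCSection (fun χ σ => (m χ : ℂ) * g χ σ) := hg.mulDual (by fun_prop)
  have h1 : E.mconv α (E.minv fun χ σ => ((√(s - m χ) : ℝ) : ℂ) * g χ σ)
      (fun χ σ => ((√(s - m χ) : ℝ) : ℂ) * g χ σ) =
      E.mconv α (E.minv g) ((s : ℂ) • g - fun χ σ => (m χ : ℂ) * g χ σ) := by
    funext χ σ
    by_cases hσ : χ.base = E.gpd.r σ
    · rw [E.mconv_of α hσ, E.mconv_of α hσ]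
      refine integral_congr_ae ?_
      filter_upwards [α.ae_r_eq χ.base] with γ hγ
      have h2 : E.tr ((s : ℂ) • g - fun χ σ => (m χ : ℂ) * g χ σ) χ (E.A.out γ) σ =
          ((s - m (E.sact χ (E.A.out γ)) : ℝ) : ℂ) * E.tr g χ (E.A.out γ) σ := by
        push_cast
        exact (sub_mul _ _ _).symm
      rw [h2, E.tr_mulDual, E.minv_of (Eq.symm hγ), E.minv_of (Eq.symm hγ), star_mul',
        Complex.star_def, Complex.conj_ofReal,
        ← Real.mul_self_sqrt (sub_nonneg.2 (hs (E.sact χ (E.A.out γ))))]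
      push_cast
      rw [Real.mul_self_sqrt (sub_nonneg.2 (hs (E.sact χ (E.A.out γ))))]
      ring
    · rw [mconv, mconv, if_neg hσ, if_neg hσ]
  have h3 := inner_repOp_minv_mconv L hgθ.toIsSection hgθ.toIsSection ζ
  rw [h1, inner_repOp_minv_mconv L hg.toIsSection ((hg.smul _).sub hgm).toIsSection,
    repOp_sub L (hg.smul _).toIsSection hgm.toIsSection, repOp_smul L hg.toIsSection,
    sub_apply, inner_sub_right, smul_apply,
    inner_smul_right] at h3
  have h4 := congrArg Complex.re h3
  have h6 : ∀ v : L.H, (⟪v, v⟫_ℂ).re = ‖v‖ ^ 2 := inner_self_eq_norm_sq (𝕜 := ℂ)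
  rw [Complex.sub_re, Complex.re_ofReal_mul, h6, h6] at h4
  have h5 := sq_nonneg ‖repOp L (fun χ σ => ((√(s - m χ) : ℝ) : ℂ) * g χ σ) ζ‖
  linarith

/-- A representation of the crossed algebra is bounded on compactly supported sections by the
scalar `I`-norm. -/
theorem norm_repOp_le {f : E.Dual → S → ℂ} (hf : E.IsCSection f) {s : ℝ}
    (h : ∀ χ, E.mass α f χ ≤ s) (h' : ∀ χ, E.mass α (E.minv f) χ ≤ s) (hs : 0 ≤ s) :
    ‖repOp L f‖ ≤ s := by
  have key : ∀ (g : E.Dual → S → ℂ), E.IsCSection g → ∀ ζ : L.H,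
      ‖repOp L (E.mconv α f g) ζ‖ ≤ s * ‖repOp L g ζ‖ := by
    intro g hg ζ
    have hfg := hf.conv α hg
    obtain ⟨hy, hz, h1⟩ := norm_inner_repOp_sq_le L hf hg hfg ζ
    have h2 := re_inner_repOp_mulDual_le L hfg (hf.continuous_mass α) h ζ
    have h3 := re_inner_repOp_mulDual_le L hg (hf.inv.continuous_mass α) h' ζ
    have h4 : ‖⟪repOp L (E.mconv α f g) ζ, repOp L (E.mconv α f g) ζ⟫_ℂ‖ =
        ‖repOp L (E.mconv α f g) ζ‖ ^ 2 := by
      rw [inner_self_eq_norm_sq_to_K, norm_pow]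
      simp
    rw [h4] at h1
    have h5 := h1.trans (mul_le_mul h2 h3 hz (hy.trans h2))
    have hp := norm_nonneg (repOp L (E.mconv α f g) ζ)
    have hq := norm_nonneg (repOp L g ζ)
    by_contra! hlt
    have hp' := (mul_nonneg hs hq).trans_lt hlt
    have h6 : (s * ‖repOp L g ζ‖) ^ 2 < ‖repOp L (E.mconv α f g) ζ‖ ^ 2 := by gcongr
    have h7 := mul_lt_mul_of_pos_right h6 (pow_pos hp' 2)
    nlinarith
  have h1 : ‖repOp L f * star (repOp L f)‖ ≤ s * ‖star (repOp L f)‖ := by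
    refine ContinuousLinearMap.opNorm_le_bound _ (by positivity) fun ζ => ?_
    rw [← repOp_inv L hf.toIsSection, ← repOp_conv L hf.toIsSection hf.inv.toIsSection, mul_assoc]
    exact (key _ hf.inv ζ).trans (mul_le_mul_of_nonneg_left (ContinuousLinearMap.le_opNorm _ _) hs)
  rw [CStarRing.norm_self_mul_star, norm_star] at h1
  by_contra! hlt
  exact absurd h1 (not_le.2 (mul_lt_mul_of_pos_right hlt (hs.trans_lt hlt)))

end AbelianExtension

namespace AbelianExtension

variable {S X : Type u} [TopologicalSpace S] [T2Space S] [LocallyCompactSpace S]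
  [SecondCountableTopology S] [MeasurableSpace S] [BorelSpace S] [TopologicalSpace X]
  (E : AbelianExtension S X) (α : E.quot.HaarSystem)

/-! ### Uniform convergence with controlled supports -/

/-- The support of a section lies over a set of the quotient groupoid. -/
def SupportedIn (K : Set E.A.Quot) (φ : E.Dual → S → ℂ) : Prop :=
  ∀ χ σ, Dual.base χ = E.gpd.r σ → φ χ σ ≠ 0 → E.A.proj σ ∈ K

/-- Uniform convergence of sections with supports over a common compact set. -/
def SectionTendsto (φ : ℕ → E.Dual → S → ℂ) (ψ : E.Dual → S → ℂ) : Prop :=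
  (∃ K : Set E.A.Quot, IsCompact K ∧ (∀ n, E.SupportedIn K (φ n)) ∧ E.SupportedIn K ψ) ∧
    ∀ ε > 0, ∀ᶠ n in atTop, ∀ χ σ, ‖φ n χ σ - ψ χ σ‖ ≤ ε

variable {E}

theorem SupportedIn.mono {K M : Set E.A.Quot} {φ : E.Dual → S → ℂ} (h : E.SupportedIn K φ)
    (hKM : K ⊆ M) : E.SupportedIn M φ := fun χ σ hσ hne => hKM (h χ σ hσ hne)

theorem SupportedIn.add {K : Set E.A.Quot} {φ ψ : E.Dual → S → ℂ} (hφ : E.SupportedIn K φ)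
    (hψ : E.SupportedIn K ψ) : E.SupportedIn K (φ + ψ) := fun χ σ hσ hne => by
  by_cases h : φ χ σ = 0
  · refine hψ χ σ hσ fun h' => hne ?_
    rw [Pi.add_apply, Pi.add_apply, h, h', add_zero]
  · exact hφ χ σ hσ h

theorem SupportedIn.smul {K : Set E.A.Quot} {φ : E.Dual → S → ℂ} (hφ : E.SupportedIn K φ)
    (c : ℂ) : E.SupportedIn K (c • φ) := fun χ σ hσ hne =>
  hφ χ σ hσ (right_ne_zero_of_mul hne)

theorem SupportedIn.sub {K : Set E.A.Quot} {φ ψ : E.Dual → S → ℂ} (hφ : E.SupportedIn K φ)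
    (hψ : E.SupportedIn K ψ) : E.SupportedIn K (φ - ψ) := by
  have h : φ - ψ = φ + (-1 : ℂ) • ψ := by rw [neg_smul, one_smul, sub_eq_add_neg]
  rw [h]
  exact hφ.add (hψ.smul _)

theorem exists_supportedIn_minv {K : Set E.A.Quot} (hK : IsCompact K) :
    ∃ M : Set E.A.Quot, IsCompact M ∧ ∀ φ, E.SupportedIn K φ → E.SupportedIn M (E.minv φ) := by
  obtain ⟨M, hM, hMinv⟩ := E.exists_isCompact_inv hK
  refine ⟨M, hM, fun φ hφ χ σ hσ hne => ?_⟩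
  rw [E.minv_of hσ] at hne
  have h := hMinv _ (hφ _ _ (E.base_sact_inv hσ) (star_ne_zero.1 hne))
  rwa [E.gpd.inv_inv] at h

theorem exists_norm_mconv_sub_le {K : Set E.A.Quot} (hK : IsCompact K) :
    ∃ C : ℝ, 0 ≤ C ∧ ∀ (φ φ' ψ ψ' : E.Dual → S → ℂ) (B ε : ℝ), 0 ≤ B → 0 ≤ ε →
      E.IsSection φ → E.IsSection φ' → E.IsSection ψ → E.IsSection ψ' →
      E.SupportedIn K φ → E.SupportedIn K φ' → (∀ χ σ, ‖φ' χ σ‖ ≤ B) → (∀ χ σ, ‖ψ χ σ‖ ≤ B) →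
      (∀ χ σ, ‖φ χ σ - φ' χ σ‖ ≤ ε) → (∀ χ σ, ‖ψ χ σ - ψ' χ σ‖ ≤ ε) →
      ∀ χ σ, ‖E.mconv α φ ψ χ σ - E.mconv α φ' ψ' χ σ‖ ≤ 2 * (B * ε) * C := by
  have := E.t2Space_base
  obtain ⟨C, hC0, hC⟩ := α.exists_measure_le E.continuous_quot_r hK
  refine ⟨C, hC0, fun φ φ' ψ ψ' B ε hB hε hφ hφ' hψ hψ' hφK hφK' hφB hψB hφε hψε χ σ => ?_⟩
  by_cases hσ : χ.base = E.gpd.r σ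
  · rw [E.mconv_of α hσ, E.mconv_of α hσ,
      ← integral_sub (hφ.integrable_conv α hψ hσ) (hφ'.integrable_conv α hψ' hσ)]
    refine α.norm_integral_le_of_bound hK.measurableSet (by positivity) hC0 (hC _)
      (fun γ _ => ?_) fun γ hγ hγK => ?_
    · have h1 : φ χ (E.A.out γ) * E.tr ψ χ (E.A.out γ) σ -
          φ' χ (E.A.out γ) * E.tr ψ' χ (E.A.out γ) σ =
          (φ χ (E.A.out γ) - φ' χ (E.A.out γ)) * E.tr ψ χ (E.A.out γ) σ +
          φ' χ (E.A.out γ) * (E.tr ψ χ (E.A.out γ) σ - E.tr ψ' χ (E.A.out γ) σ) := by ring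
      rw [h1]
      refine (norm_add_le _ _).trans ?_
      rw [norm_mul, norm_mul]
      calc _ ≤ ε * B + B * ε := add_le_add
            (mul_le_mul (hφε _ _) (hψB _ _) (norm_nonneg _) hε)
            (mul_le_mul (hφB _ _) (hψε _ _) (norm_nonneg _) hB)
        _ = 2 * (B * ε) := by ring
    · have h0 : ∀ φ : E.Dual → S → ℂ, E.SupportedIn K φ → φ χ (E.A.out γ) = 0 := fun φ h => by
        by_contra hne
        exact hγK (E.A.proj_out γ ▸ h χ _ (Eq.symm hγ) hne)
      rw [h0 φ hφK, h0 φ' hφK', zero_mul, zero_mul, sub_zero]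
  · rw [mconv, mconv, if_neg hσ, if_neg hσ, sub_zero, norm_zero]
    positivity

namespace SectionTendsto

variable {φ φ' : ℕ → E.Dual → S → ℂ} {ψ ψ' : E.Dual → S → ℂ}

theorem const (hψ : E.IsSection ψ) : E.SectionTendsto (fun _ => ψ) ψ := by
  obtain ⟨K, hK, hKψ⟩ := hψ.exists_support
  refine ⟨⟨K, hK, fun _ => hKψ, hKψ⟩, fun ε hε => Eventually.of_forall fun n χ σ => ?_⟩
  rw [sub_self, norm_zero]
  exact hε.le

theorem add (h : E.SectionTendsto φ ψ) (h' : E.SectionTendsto φ' ψ') :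
    E.SectionTendsto (fun n => φ n + φ' n) (ψ + ψ') := by
  obtain ⟨⟨K, hK, h1, h2⟩, h3⟩ := h
  obtain ⟨⟨K', hK', h1', h2'⟩, h3'⟩ := h'
  refine ⟨⟨K ∪ K', hK.union hK', fun n => ((h1 n).mono Set.subset_union_left).add
    ((h1' n).mono Set.subset_union_right), (h2.mono Set.subset_union_left).add
    (h2'.mono Set.subset_union_right)⟩, fun ε hε => ?_⟩
  filter_upwards [h3 (ε / 2) (half_pos hε), h3' (ε / 2) (half_pos hε)] with n hn hn' χ σ
  have h4 : (φ n + φ' n) χ σ - (ψ + ψ') χ σ =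
      (φ n χ σ - ψ χ σ) + (φ' n χ σ - ψ' χ σ) := add_sub_add_comm _ _ _ _
  rw [h4]
  exact (norm_add_le _ _).trans ((add_le_add (hn χ σ) (hn' χ σ)).trans (add_halves ε).le)

theorem smul (h : E.SectionTendsto φ ψ) (c : ℂ) :
    E.SectionTendsto (fun n => c • φ n) (c • ψ) := by
  obtain ⟨⟨K, hK, h1, h2⟩, h3⟩ := h
  refine ⟨⟨K, hK, fun n => (h1 n).smul c, h2.smul c⟩, fun ε hε => ?_⟩
  filter_upwards [h3 (ε / (‖c‖ + 1)) (by positivity)] with n hn χ σ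
  have h4 : (c • φ n) χ σ - (c • ψ) χ σ = c * (φ n χ σ - ψ χ σ) := (mul_sub _ _ _).symm
  rw [h4, norm_mul]
  refine (mul_le_mul_of_nonneg_left (hn χ σ) (norm_nonneg c)).trans ?_
  rw [mul_div_assoc', div_le_iff₀ (by positivity)]
  nlinarith

theorem conv (h : E.SectionTendsto φ ψ) (h' : E.SectionTendsto φ' ψ')
    (hφ : ∀ n, E.IsSection (φ n)) (hψ : E.IsSection ψ) (hφ' : ∀ n, E.IsSection (φ' n))
    (hψ' : E.IsSection ψ') :
    E.SectionTendsto (fun n => E.mconv α (φ n) (φ' n)) (E.mconv α ψ ψ') := by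
  obtain ⟨⟨K, hK, h1, h2⟩, h3⟩ := h
  obtain ⟨⟨K', hK', h1', h2'⟩, h3'⟩ := h'
  obtain ⟨M, hM, hMK⟩ := IsSection.mconv_support α hK hK'
  refine ⟨⟨M, hM, fun n χ σ _ => hMK _ _ (h1 n) (h1' n) χ σ,
    fun χ σ _ => hMK _ _ h2 h2' χ σ⟩, fun ε hε => ?_⟩
  obtain ⟨C, hC0, hC⟩ := exists_norm_mconv_sub_le α hK
  obtain ⟨B₁, hB₁0, hB₁⟩ := hψ.exists_bound
  obtain ⟨B₂, hB₂0, hB₂⟩ := hψ'.exists_bound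
  set B := B₁ + B₂ + 1 with hB
  have hB0 : 0 ≤ B := by positivity
  have hη : 0 < ε / (2 * B * C + 1) := by positivity
  filter_upwards [h3 _ hη, h3' _ hη, h3' 1 one_pos] with n hn hn' hn1 χ σ
  refine (hC _ _ _ _ B _ hB0 hη.le (hφ n) hψ (hφ' n) hψ' (h1 n) h2
    (fun χ σ => (hB₁ χ σ).trans (by linarith)) (fun χ σ => ?_) hn hn' χ σ).trans ?_
  · have h4 := norm_sub_norm_le (φ' n χ σ) (ψ' χ σ)
    linarith [hn1 χ σ, hB₂ χ σ]
  · have h5 : 2 * (B * (ε / (2 * B * C + 1))) * C = 2 * B * C * ε / (2 * B * C + 1) := by ring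
    rw [h5, div_le_iff₀ (by positivity)]
    nlinarith

theorem inv (h : E.SectionTendsto φ ψ) :
    E.SectionTendsto (fun n => E.minv (φ n)) (E.minv ψ) := by
  obtain ⟨⟨K, hK, h1, h2⟩, h3⟩ := h
  obtain ⟨M, hM, hMinv⟩ := exists_supportedIn_minv hK
  refine ⟨⟨M, hM, fun n => hMinv _ (h1 n), hMinv _ h2⟩, fun ε hε => ?_⟩
  filter_upwards [h3 ε hε] with n hn χ σ
  by_cases hσ : χ.base = E.gpd.r σ
  · rw [E.minv_of hσ, E.minv_of hσ, ← star_sub, norm_star]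
    exact hn _ _
  · rw [minv, minv, if_neg hσ, if_neg hσ, sub_zero, norm_zero]
    exact hε.le

end SectionTendsto

/-- Compactly supported sections approximate sections uniformly. -/
theorem IsSection.exists_cutoff_tendsto {φ : E.Dual → S → ℂ} (hφ : E.IsSection φ) :
    ∃ θ : ℕ → E.Dual → ℝ, (∀ n, Continuous (θ n)) ∧ (∀ n, HasCompactSupport (θ n)) ∧
      (∀ n χ, 0 ≤ θ n χ ∧ θ n χ ≤ 1) ∧
      E.SectionTendsto (fun n χ σ => (θ n χ : ℂ) * φ χ σ) φ := by
  choose L hL hLφ using fun n : ℕ => hφ.vanishing (1 / ((n : ℝ) + 1)) (by positivity)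
  choose θ hθ hθc hθ1 hθ01 using fun n => E.exists_cutoff (hL n)
  obtain ⟨K, hK, hKφ⟩ := hφ.exists_support
  refine ⟨θ, hθ, hθc, hθ01, ⟨K, hK, fun n χ σ hσ hne =>
    hKφ χ σ hσ (right_ne_zero_of_mul hne), hKφ⟩, fun ε hε => ?_⟩
  obtain ⟨N, hN⟩ := exists_nat_one_div_lt hε
  filter_upwards [eventually_ge_atTop N] with n hn χ σ
  have h1 : ((θ n χ : ℂ) * φ χ σ - φ χ σ) = ((θ n χ - 1 : ℝ) : ℂ) * φ χ σ := by
    push_cast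
    ring
  rw [h1]
  by_cases hσ : χ.base = E.gpd.r σ
  · by_cases hχ : χ ∈ L n
    · rw [hθ1 n χ hχ, sub_self, Complex.ofReal_zero, zero_mul, norm_zero]
      exact hε.le
    · have h2 : ‖φ χ σ‖ ≤ ε := by
        have h3 : ‖φ χ σ‖ < 1 / ((n : ℝ) + 1) := not_le.1 fun h => hχ (hLφ n χ σ hσ h)
        exact h3.le.trans ((Nat.one_div_le_one_div hn).trans hN.le)
      rw [norm_mul, Complex.norm_real, Real.norm_eq_abs]
      refine (mul_le_mul (abs_le.2 ⟨?_, ?_⟩) h2 (norm_nonneg _) zero_le_one).trans (one_mul ε).le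
      · linarith [(hθ01 n χ).1]
      · linarith [(hθ01 n χ).2]
  · rw [hφ.eq_zero χ σ hσ, mul_zero, norm_zero]
    exact hε.le

/-! ### The two section algebras -/

theorem untwist_sub (f g : E.SigmaHat → ℂ) : untwist (f - g) = untwist f - untwist g := by
  have h : f - g = f + (-1 : ℂ) • g := by rw [neg_smul, one_smul, sub_eq_add_neg]
  rw [h, E.untwist_add, E.untwist_smul, neg_smul, one_smul, sub_eq_add_neg]

variable (E)

theorem exists_iNorm_twist_le {K : Set E.A.Quot} (hK : IsCompact K) :
    ∃ C : ℝ≥0∞, C ≠ ∞ ∧ ∀ f ∈ (E.twistAlgebra α).carrier, ∀ B : ℝ,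
      E.SupportedIn K (untwist f) → (∀ χ σ, ‖untwist f χ σ‖ ≤ B) →
      (E.twistAlgebra α).iNorm f ≤ C * ENNReal.ofReal B := by
  obtain ⟨C, hC, h⟩ := E.exists_iNorm_crossed_le α hK
  refine ⟨C, hC, fun f hf B hfK hfB => ?_⟩
  have hs := (E.isCSection_untwist α hf).toIsSection
  have hu := unc_ofSection E hs
  exact (E.iNorm_twist_le_crossed α hf (F := E.ofSection _ hs) fun χ σ => by rw [hu]).trans
    (h _ B (by rw [hu]; exact hfK) (by rwa [hu]))

theorem exists_redNorm_twist_le {K : Set E.A.Quot} (hK : IsCompact K) :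
    ∃ C : ℝ≥0∞, C ≠ ∞ ∧ ∀ f ∈ (E.twistAlgebra α).carrier, ∀ B : ℝ,
      E.SupportedIn K (untwist f) → (∀ χ σ, ‖untwist f χ σ‖ ≤ B) →
      (E.twistAlgebra α).redNorm f ≤ C * ENNReal.ofReal B := by
  obtain ⟨C, hC, h⟩ := E.exists_modNorm_mconv_le α hK
  refine ⟨C, hC, fun f hf B hfK hfB => ?_⟩
  rw [E.redNorm_twist α hf]
  exact E.leftNorm_le_of_forall α fun ψ hψ => h _ ψ B hψ.toIsSection hfK hfB

theorem exists_redNorm_crossed_le {K : Set E.A.Quot} (hK : IsCompact K) :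
    ∃ C : ℝ≥0∞, C ≠ ∞ ∧ ∀ F ∈ (E.crossedAlgebra α).carrier, ∀ B : ℝ,
      E.SupportedIn K (unc F) → (∀ χ σ, ‖unc F χ σ‖ ≤ B) →
      (E.crossedAlgebra α).redNorm F ≤ C * ENNReal.ofReal B := by
  obtain ⟨C, hC, h⟩ := E.exists_modNorm_mconv_le α hK
  refine ⟨C, hC, fun F hF B hFK hFB => ?_⟩
  rw [E.redNorm_crossed α hF]
  exact E.leftNorm_le_of_forall α fun ψ hψ => h _ ψ B hψ hFK hFB

theorem isWellDefined_twistAlgebra : (E.twistAlgebra α).IsWellDefined where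
  zero_mem := ⟨continuous_const, HasCompactSupport.zero, fun z e => (mul_zero _).symm⟩
  add_mem f hf g hg := ⟨hf.1.add hg.1, hf.2.1.add hg.2.1, fun z e => by
    rw [Pi.add_apply, Pi.add_apply, hf.2.2, hg.2.2, mul_add]⟩
  smul_mem c f hf := ⟨hf.1.const_smul c, hf.2.1.comp_left (g := fun t => c • t) (smul_zero c),
    fun z e => by rw [Pi.smul_apply, Pi.smul_apply, hf.2.2, mul_smul_comm]⟩
  conv_mem f hf g hg := E.conv_mem_twist α hf hg
  invol_mem f hf := by
    rw [E.twist_invol α hf]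
    exact E.twist_mem α (E.isCSection_untwist α hf).inv
  iNorm_ne_top f hf := by
    have hs := E.isCSection_untwist α hf
    obtain ⟨K, hK, hKf⟩ := hs.exists_support
    obtain ⟨B, -, hB⟩ := hs.exists_bound
    obtain ⟨C, hC, h⟩ := E.exists_iNorm_twist_le α hK
    exact ne_top_of_le_ne_top (ENNReal.mul_ne_top hC ENNReal.ofReal_ne_top) (h f hf B hKf hB)
  redNorm_ne_top f hf := by
    have hs := E.isCSection_untwist α hf
    obtain ⟨K, hK, hKf⟩ := hs.exists_support
    obtain ⟨B, -, hB⟩ := hs.exists_bound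
    obtain ⟨C, hC, h⟩ := E.exists_redNorm_twist_le α hK
    exact ne_top_of_le_ne_top (ENNReal.mul_ne_top hC ENNReal.ofReal_ne_top) (h f hf B hKf hB)

theorem isWellDefined_crossedAlgebra : (E.crossedAlgebra α).IsWellDefined where
  zero_mem := by
    rw [E.mem_crossedAlgebra_iff, E.unc_zero]
    exact IsSection.zero
  add_mem f hf g hg := by
    rw [E.mem_crossedAlgebra_iff, E.unc_add]
    exact (E.isSection_unc α hf).add (E.isSection_unc α hg)
  smul_mem c f hf := by
    rw [E.mem_crossedAlgebra_iff, E.unc_smul]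
    exact (E.isSection_unc α hf).smul c
  conv_mem f hf g hg := E.conv_mem_crossed α hf hg
  invol_mem f hf := by
    rw [E.mem_crossedAlgebra_iff, E.unc_invol]
    exact (E.isSection_unc α hf).inv
  iNorm_ne_top f hf := by
    have hs := E.isSection_unc α hf
    obtain ⟨K, hK, hKf⟩ := hs.exists_support
    obtain ⟨B, -, hB⟩ := hs.exists_bound
    obtain ⟨C, hC, h⟩ := E.exists_iNorm_crossed_le α hK
    exact ne_top_of_le_ne_top (ENNReal.mul_ne_top hC ENNReal.ofReal_ne_top) (h f B hKf hB)
  redNorm_ne_top f hf := by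
    have hs := E.isSection_unc α hf
    obtain ⟨K, hK, hKf⟩ := hs.exists_support
    obtain ⟨B, -, hB⟩ := hs.exists_bound
    obtain ⟨C, hC, h⟩ := E.exists_redNorm_crossed_le α hK
    exact ne_top_of_le_ne_top (ENNReal.mul_ne_top hC ENNReal.ofReal_ne_top) (h f hf B hKf hB)

/-- The inclusion `f ↦ F_f` of the section algebra of the twist into the crossed algebra. -/
def twistToCrossed (f : (E.twistAlgebra α).carrier) : (E.crossedAlgebra α).carrier :=
  ⟨E.ofSection (untwist f.1) (E.isCSection_untwist α f.2).toIsSection,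
    E.ofSection_mem α (E.isCSection_untwist α f.2).toIsSection⟩

theorem unc_twistToCrossed (f : (E.twistAlgebra α).carrier) :
    unc (E.twistToCrossed α f).1 = untwist f.1 :=
  E.unc_ofSection (E.isCSection_untwist α f.2).toIsSection

theorem isStarHom_twistToCrossed :
    (E.twistAlgebra α).IsStarHom (E.crossedAlgebra α) (E.twistToCrossed α) where
  map_add f g h hh := E.unc_injective (by
    rw [E.unc_add, E.unc_twistToCrossed, E.unc_twistToCrossed, E.unc_twistToCrossed, hh,
      E.untwist_add])
  map_smul c f h hh := E.unc_injective (by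
    rw [E.unc_smul, E.unc_twistToCrossed, E.unc_twistToCrossed, hh, E.untwist_smul])
  map_conv f g h hh := E.unc_injective (by
    rw [E.unc_conv α (E.isSection_unc α (E.twistToCrossed α f).2)
      (E.isSection_unc α (E.twistToCrossed α g).2), E.unc_twistToCrossed, E.unc_twistToCrossed,
      E.unc_twistToCrossed, hh, E.untwist_conv α _ g.2])
  map_invol f h hh := E.unc_injective (by
    rw [E.unc_invol, E.unc_twistToCrossed, E.unc_twistToCrossed, hh, E.untwist_invol])

theorem twistToCrossed_injective : Function.Injective (E.twistToCrossed α) := fun f g h => by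
  have h1 : untwist f.1 = untwist g.1 := by
    rw [← E.unc_twistToCrossed α, ← E.unc_twistToCrossed α, h]
  refine Subtype.ext ?_
  rw [← E.twist_untwist α f.2 (E.isCSection_untwist α f.2).toIsSection,
    ← E.twist_untwist α g.2 (E.isCSection_untwist α g.2).toIsSection, h1]

theorem redNorm_twistToCrossed (f : (E.twistAlgebra α).carrier) :
    (E.crossedAlgebra α).redNorm (E.twistToCrossed α f).1 = (E.twistAlgebra α).redNorm f.1 := by
  rw [E.redNorm_crossed α (E.twistToCrossed α f).2, E.redNorm_twist α f.2,
    E.unc_twistToCrossed, E.leftNorm_eq α (E.isCSection_untwist α f.2)]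

theorem norm_rep_twistToCrossed_le
    (L : (E.crossedAlgebra α).Rep (E.crossedAlgebra α).iNorm) (f : (E.twistAlgebra α).carrier) :
    ‖L.toFun (E.twistToCrossed α f)‖ ≤ ((E.twistAlgebra α).iNorm f).toReal := by
  have hs := E.isCSection_untwist α f.2
  have hfin := (E.isWellDefined_twistAlgebra α).iNorm_ne_top f f.2
  have h1 := repOp_of L hs.toIsSection
  change _ = L.toFun (E.twistToCrossed α f) at h1
  rw [← h1]
  refine norm_repOp_le L hs (fun χ => ?_) (fun χ => ?_) ENNReal.toReal_nonneg
  · rw [← ENNReal.ofReal_le_iff_le_toReal hfin, E.iNorm_twist α f.2]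
    exact (E.ofReal_mass_le_iNormR α hs.toIsSection χ).trans (le_max_left _ _)
  · rw [← ENNReal.ofReal_le_iff_le_toReal hfin, E.iNorm_twist α f.2]
    exact (E.ofReal_mass_minv_le_iNormS α hs.toIsSection χ).trans (le_max_right _ _)

/-- Sections of the crossed algebra are approximated by sections of the twist. -/
theorem exists_twist_tendsto (F : (E.crossedAlgebra α).carrier) :
    ∃ (θ : ℕ → E.Dual → ℝ) (u : ℕ → (E.twistAlgebra α).carrier),
      (∀ n χ, 0 ≤ θ n χ ∧ θ n χ ≤ 1) ∧
      (∀ n, untwist (u n).1 = fun χ σ => (θ n χ : ℂ) * unc F.1 χ σ) ∧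
      E.SectionTendsto (fun n => untwist (u n).1) (unc F.1) := by
  have hF := E.isSection_unc α F.2
  obtain ⟨θ, hθ, hθc, hθ01, h⟩ := hF.exists_cutoff_tendsto
  have hu : ∀ n, untwist (E.twist fun χ σ => (θ n χ : ℂ) * unc F.1 χ σ) =
      fun χ σ => (θ n χ : ℂ) * unc F.1 χ σ := fun n =>
    E.untwist_twist (hF.cutoff (hθ n) (hθc n)).toIsSection
  refine ⟨θ, fun n => ⟨_, E.twist_mem α (hF.cutoff (hθ n) (hθc n))⟩, hθ01, hu, ?_⟩
  simp only [hu]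
  exact h

/-- The range of the inclusion is dense for norms that control sections by their bounds and
supports. -/
theorem exists_sub_lt {n : E.PreSection → ℝ≥0∞}
    (hn : ∀ K : Set E.A.Quot, IsCompact K → ∃ C : ℝ≥0∞, C ≠ ∞ ∧
      ∀ F ∈ (E.crossedAlgebra α).carrier, ∀ B : ℝ, E.SupportedIn K (unc F) →
        (∀ χ σ, ‖unc F χ σ‖ ≤ B) → n F ≤ C * ENNReal.ofReal B)
    {F : E.PreSection} (hF : F ∈ (E.crossedAlgebra α).carrier) {ε : ℝ≥0∞} (hε : 0 < ε) :
    ∃ f, n (F - (E.twistToCrossed α f).1) < ε := by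
  obtain ⟨-, u, -, -, ⟨K, hK, huK, hFK⟩, hu⟩ := E.exists_twist_tendsto α ⟨F, hF⟩
  obtain ⟨C, hC, h⟩ := hn K hK
  have ht : Tendsto (fun δ : ℝ => C * ENNReal.ofReal δ) (𝓝[>] 0) (𝓝 0) := by
    have h1 := ENNReal.Tendsto.const_mul (a := C)
      (ENNReal.tendsto_ofReal (tendsto_id (α := ℝ) (x := 𝓝 0))) (Or.inr hC)
    simp only [id, ENNReal.ofReal_zero, mul_zero] at h1
    exact h1.mono_left nhdsWithin_le_nhds
  obtain ⟨δ, hδε, hδ⟩ := ((ht.eventually (gt_mem_nhds hε)).and self_mem_nhdsWithin).exists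
  obtain ⟨m, hm⟩ := (hu δ hδ).exists
  refine ⟨u m, (h _ ((E.isWellDefined_crossedAlgebra α).sub_mem hF (E.twistToCrossed α _).2) δ
    ?_ fun χ σ => ?_).trans_lt hδε⟩
  · rw [E.unc_sub, E.unc_twistToCrossed]
    exact hFK.sub (huK m)
  · rw [E.unc_sub, E.unc_twistToCrossed, Pi.sub_apply, Pi.sub_apply, norm_sub_rev]
    exact hm χ σ

/-- The inclusion extends to the completions for norms that control sections by their bounds and
supports. -/
theorem exists_completion_equiv_twistToCrossed {nA : (E.SigmaHat → ℂ) → ℝ≥0∞}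
    {nB : E.PreSection → ℝ≥0∞}
    (hA : ∀ K : Set E.A.Quot, IsCompact K → ∃ C : ℝ≥0∞, C ≠ ∞ ∧
      ∀ f ∈ (E.twistAlgebra α).carrier, ∀ B : ℝ, E.SupportedIn K (untwist f) →
        (∀ χ σ, ‖untwist f χ σ‖ ≤ B) → nA f ≤ C * ENNReal.ofReal B)
    (hB : ∀ K : Set E.A.Quot, IsCompact K → ∃ C : ℝ≥0∞, C ≠ ∞ ∧
      ∀ F ∈ (E.crossedAlgebra α).carrier, ∀ B : ℝ, E.SupportedIn K (unc F) →
        (∀ χ σ, ‖unc F χ σ‖ ≤ B) → nB F ≤ C * ENNReal.ofReal B)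
    (hBfin : ∀ F ∈ (E.crossedAlgebra α).carrier, nB F ≠ ∞)
    (hres : ∀ (L : (E.crossedAlgebra α).Rep nB) f,
      ‖L.toFun (E.twistToCrossed α f)‖ ≤ (nA f).toReal)
    (hcut : ∀ f ∈ (E.twistAlgebra α).carrier, ∀ F ∈ (E.crossedAlgebra α).carrier,
      ∀ θ : E.Dual → ℝ, (∀ χ, 0 ≤ θ χ ∧ θ χ ≤ 1) →
        (untwist f = fun χ σ => (θ χ : ℂ) * unc F χ σ) → nA f ≤ nB F) :
    ∃ Φ : (E.twistAlgebra α).Completion nA ≃⋆ₐ[ℂ] (E.crossedAlgebra α).Completion nB,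
      ∀ f, Φ ((E.twistAlgebra α).toCompletion nA f) =
        (E.crossedAlgebra α).toCompletion nB (E.twistToCrossed α f) := by
  have hT := E.isStarHom_twistToCrossed α
  refine SectionAlgebra.exists_completion_equiv (E.isWellDefined_crossedAlgebra α) hT hres ?_
    fun g hg ε hε => E.exists_sub_lt α hB hg hε
  have hsA : ∀ f : (E.twistAlgebra α).carrier, E.IsSection (untwist f.1) := fun f =>
    (E.isCSection_untwist α f.2).toIsSection
  have hsB : ∀ F : (E.crossedAlgebra α).carrier, E.IsSection (unc F.1) := fun F =>
    E.isSection_unc α F.2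
  refine SectionAlgebra.Rep.exists_extension (E.isWellDefined_twistAlgebra α) hT hres
    (C := fun u F => E.SectionTendsto (fun n => untwist (u n).1) (unc F.1)) ?_ ?_ ?_ ?_ ?_ ?_ ?_
  · intro F
    obtain ⟨θ, u, hθ, hu, h⟩ := E.exists_twist_tendsto α F
    exact ⟨u, h, fun n => ENNReal.toReal_mono (hBfin _ F.2) (hcut _ (u n).2 _ F.2 _ (hθ n) (hu n))⟩
  · rintro u v F ⟨⟨K, hK, huK, -⟩, hu⟩ ⟨⟨K', hK', hvK, -⟩, hv⟩
    obtain ⟨C, hC, h⟩ := hA _ (hK.union hK')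
    rw [Metric.tendsto_nhds]
    intro ε hε
    have hδ : 0 < ε / (2 * (C.toReal + 1)) := by positivity
    filter_upwards [(hu _ hδ).prod_mk (hv _ hδ)] with p hp
    have h1 := h _ ((E.isWellDefined_twistAlgebra α).sub_mem (u p.1).2 (v p.2).2)
      (2 * (ε / (2 * (C.toReal + 1)))) (by
        rw [untwist_sub]
        exact ((huK _).mono Set.subset_union_left).sub ((hvK _).mono Set.subset_union_right))
      (fun χ σ => by
        rw [untwist_sub, Pi.sub_apply, Pi.sub_apply, two_mul,
          ← sub_sub_sub_cancel_right _ _ (unc F.1 χ σ)]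
        exact (norm_sub_le _ _).trans (add_le_add (hp.1 χ σ) (hp.2 χ σ)))
    have h2 := ENNReal.toReal_mono (ENNReal.mul_ne_top hC ENNReal.ofReal_ne_top) h1
    rw [ENNReal.toReal_mul, ENNReal.toReal_ofReal (by positivity)] at h2
    rw [Real.dist_eq, sub_zero, abs_of_nonneg ENNReal.toReal_nonneg]
    refine h2.trans_lt ?_
    have h3 : C.toReal * (2 * (ε / (2 * (C.toReal + 1)))) = C.toReal * ε / (C.toReal + 1) := by
      field_simp
    rw [h3, div_lt_iff₀ (by positivity)]
    nlinarith
  · intro u v w F G H hu hv hw hH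
    simp only [hw, hH, E.untwist_add, E.unc_add]
    exact hu.add hv
  · intro c u w F H hu hw hH
    simp only [hw, hH, E.untwist_smul, E.unc_smul]
    exact hu.smul c
  · intro u v w F G H hu hv hw hH
    simp only [hw, hH, E.untwist_conv α _ (v _).2, E.unc_conv α (hsB F) (hsB G)]
    exact hu.conv α hv (fun n => hsA _) (hsB F) (fun n => hsA _) (hsB G)
  · intro u w F H hu hw hH
    simp only [hw, hH, E.untwist_invol, E.unc_invol]
    exact hu.inv
  · intro f
    rw [E.unc_twistToCrossed]
    exact SectionTendsto.const (hsA f)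

end AbelianExtension

end

theorem mainTheorem4 {S X : Type u} [TopologicalSpace S] [T2Space S] [LocallyCompactSpace S]
    [SecondCountableTopology S] [MeasurableSpace S] [BorelSpace S] [TopologicalSpace X]
    (E : AbelianExtension S X) (α : E.quot.HaarSystem) :
    (E.twistAlgebra α).IsWellDefined ∧ (E.crossedAlgebra α).IsWellDefined ∧
    ∃ T : (E.twistAlgebra α).carrier → (E.crossedAlgebra α).carrier,
      (∀ f (χ : E.Dual) (σ : S) (h : χ.base = E.gpd.r σ),
        (T f).1.at σ χ h = f.1 (E.cls χ 1 σ h)) ∧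
      Function.Injective T ∧
      (E.twistAlgebra α).IsStarHom (E.crossedAlgebra α) T ∧
      (∀ g ∈ (E.crossedAlgebra α).carrier, ∀ ε : ℝ≥0∞, 0 < ε →
        ∃ f, (E.crossedAlgebra α).iNorm (g - (T f).1) < ε) ∧
      (∀ f, (E.crossedAlgebra α).redNorm (T f).1 = (E.twistAlgebra α).redNorm f.1) ∧
      (∃ Φ : (E.twistAlgebra α).FullCStar ≃⋆ₐ[ℂ] (E.crossedAlgebra α).FullCStar,
        ∀ f, Φ ((E.twistAlgebra α).toCompletion _ f) = (E.crossedAlgebra α).toCompletion _ (T f)) ∧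
      (∃ Φ : (E.twistAlgebra α).RedCStar ≃⋆ₐ[ℂ] (E.crossedAlgebra α).RedCStar,
        ∀ f, Φ ((E.twistAlgebra α).toCompletion _ f) = (E.crossedAlgebra α).toCompletion _ (T f)) := by
  have hA := E.isWellDefined_twistAlgebra α
  have hB := E.isWellDefined_crossedAlgebra α
  have hI : ∀ K : Set E.A.Quot, IsCompact K → ∃ C : ℝ≥0∞, C ≠ ∞ ∧
      ∀ F ∈ (E.crossedAlgebra α).carrier, ∀ B : ℝ,
        E.SupportedIn K (AbelianExtension.unc F) →
        (∀ χ σ, ‖AbelianExtension.unc F χ σ‖ ≤ B) →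
        (E.crossedAlgebra α).iNorm F ≤ C * ENNReal.ofReal B := fun K hK => by
    obtain ⟨C, hC, h⟩ := E.exists_iNorm_crossed_le α hK
    exact ⟨C, hC, fun F _ B hFK hFB => h F B hFK hFB⟩
  refine ⟨hA, hB, E.twistToCrossed α, fun f χ σ h => ?_, E.twistToCrossed_injective α,
    E.isStarHom_twistToCrossed α, fun g hg ε hε => E.exists_sub_lt α hI hg hε,
    E.redNorm_twistToCrossed α, ?_, ?_⟩
  · rw [← E.unc_of _ h, E.unc_twistToCrossed, E.untwist_of _ h]
  · refine E.exists_completion_equiv_twistToCrossed α (fun K hK => E.exists_iNorm_twist_le α hK)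
      hI hB.iNorm_ne_top (E.norm_rep_twistToCrossed_le α) fun f hf F hF θ hθ hfF => ?_
    exact E.iNorm_twist_le_crossed α hf fun χ σ => by
      rw [hfF]
      exact E.norm_cutoff_le hθ _ χ σ
  · refine E.exists_completion_equiv_twistToCrossed α
      (fun K hK => E.exists_redNorm_twist_le α hK) (fun K hK => E.exists_redNorm_crossed_le α hK)
      hB.redNorm_ne_top (fun L f => ?_) fun f hf F hF θ hθ hfF => ?_
    · rw [← E.redNorm_twistToCrossed]
      exact L.norm_le _
    · rw [E.redNorm_twist α hf, ← E.leftNorm_eq α (E.isCSection_untwist α hf),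
        E.redNorm_crossed α hF, hfF]
      exact E.leftNorm_cutoff_le α hθ _
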